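/- **Setting.** Let $M=(M,\otimes,1)$ be a symmetric monoidal category with an initial object $0$ such that every functor $X\otimes-$ preserves $0$. *Multicyclically ordered sets.* A multicyclically ordered set $S$ is a finite set decomposed into $b\ge 1$ disjoint, possibly empty, totally cyclically ordered components; the number $b=b(S)$ is part of the data. Isomorphisms are bijections of the underlying sets together with a compatible bijection of the sets of components, preserving the cyclic orders. For $g\in\mathbb N$, the pair $(S,g)$ is *geometric* if $\frac12(g-b+1)\in\mathbb N=\{0,1,2,\dots\}$. If $\tau$ is an involution of the set underlying $S$, gluing each $x$ with $\tau x\ne x$ to $\tau x$ gives a multicyclically ordered set of the fixed points of $\tau$: to find the immediate successor of a fixed point $x$, pass from $x$ to its immediate successor in $S$; whenever a non-fixed element $y$ is reached, pass to the immediate successor of $\tau y$ in $S$; stop at the first fixed point reached. Every such cyclic walk that meets no fixed point gives one empty component, and the empty components of $S$ are kept. For $u\in S$, $v\in T$ let $S\,{}_u\!\sqcup_v T$ be the set so obtained from $S\sqcup T$ by gluing $u$ to $v$, and for $u\neq v$ in $S$ let $S_{uv}$ be the one obtained from $S$ by gluing $u$ to $v$. *Modules and operads.* A non-$\Sigma$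 modular module $P$ is a functor $(S,g)\mapsto P((S;g))\in M$ on the category of multicyclically ordered sets and isomorphisms times the discrete category $\mathbb N$. It is *geometric* if $P((S;g))\cong 0$ whenever $(S,g)$ is not geometric. The structure of a *non-$\Sigma$ modular operad* on $P$ consists of morphisms $${}_u\circ_v:P((S;g))\otimes P((T;h))\to P((S\,{}_u\!\sqcup_v T;g+h)),\qquad \xi_{uv}=\xi_{vu}:P((S;g))\to P((S_{uv};g+1))$$ for all $u\in S$, $v\in T$, respectively $u\ne v$ in $S$, that are natural in isomorphisms and satisfy, under the evident identifications of the multicyclically ordered sets involved and for distinct elements of the sets from which they are taken, $x\,{}_u\circ_v\,y=y\,{}_v\circ_u\,x$; $x\,{}_a\circ_b(y\,{}_c\circ_d\,z)=(x\,{}_a\circ_b\,y)\,{}_c\circ_d\,z$ (for $b\ne c$ both in the set of $y$); $\xi_{ab}\xi_{cd}=\xi_{cd}\xi_{ab}$; $\xi_{ab}(x\,{}_c\circ_d\,y)=\xi_{cd}(x\,{}_a\circ_b\,y)$ (for $a,c$ in the set of $x$ and $b,d$ in that of $y$); $\xi_{cd}(x)\,{}_a\circ_b\,y=\xi_{cd}(x\,{}_a\circ_b\,y)$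 (for $a,c,d$ in the set of $x$ and $b$ in that of $y$). (The elements $x,y,z$ are a shorthand for the corresponding equations between morphisms of $M$, with the symmetry of $M$ used where factors are exchanged.) *Graphs.* A non-$\Sigma$ modular graph $\Gamma$ consists of a finite set of flags, a partition of it into (possibly empty) blocks $\mathrm{Leg}(v)$ indexed by a finite set $\mathrm{Vert}(\Gamma)$, a multicyclic order on each $\mathrm{Leg}(v)$, a genus $g_v\in\mathbb N$ of each vertex, and an involution of the flags, whose fixed points are the legs and whose two-element orbits are the edges; $\Gamma$ is required to be connected and to have a vertex. The set $\mathrm{Leg}(\Gamma)$ of legs has the multicyclic order obtained from $\bigsqcup_v\mathrm{Leg}(v)$ by gluing along the involution, and $g(\Gamma)=b_1(\Gamma)+\sum_v g_v$. A morphism $\Gamma_0\to\Gamma_1$ is a contraction of a set of edges followed by an isomorphism; thus $\mathrm{Vert}(\Gamma_0)\to\mathrm{Vert}(\Gamma_1)$ is surjective and the preimage $f^{-1}(v)$ of each vertex $v$ of $\Gamma_1$ is a graph of genus $g_v$ with $\mathrm{Leg}(f^{-1}(v))\cong \mathrm{Leg}(v)$. Let $\Gamma(S;g)$ be the category of graphs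 $\Gamma$ of genus $g$ with an isomorphism $\mathrm{Leg}(\Gamma)\cong S$, and of the morphisms compatible with these isomorphisms. Its terminal object is the corolla $\star_{S,g}$, which has one vertex and no edges. For a graph $\Gamma$ put $P(\Gamma)=\bigotimes_{v\in\mathrm{Vert}(\Gamma)}P((\mathrm{Leg}(v);g_v))$ (an unordered tensor product), so that $P(\star_{S,g})\cong P((S;g))$. *Contractions.* A family of morphisms $\alpha_\Gamma:P(\Gamma)\to P((S;g))$, for all $(S,g)$ and $\Gamma\in\Gamma(S;g)$, is called the *family of contractions* of a non-$\Sigma$ modular operad structure on $P$ if it is compatible with isomorphisms of graphs and with relabelling of legs, if $\alpha_{\star_{S,g}}$ is the canonical isomorphism, if $\alpha_\Gamma$ is ${}_u\circ_v$, respectively $\xi_{uv}$, for the graph with two vertices (respectively one vertex) and the single edge $\{u,v\}$, and if, for a graph obtained by joining legs $u$ and $v$ of two graphs $\Gamma',\Gamma''$ (respectively of one graph $\Gamma'$), the contraction is ${}_u\circ_v\,(\alpha_{\Gamma'}\otimes\alpha_{\Gamma''})$ (respectively $\xi_{uv}\,\alpha_{\Gamma'}$). **Theorem.** Let $P$ be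 a geometric non-$\Sigma$ modular module. Every non-$\Sigma$ modular operad structure on $P$ has exactly one family of contractions. Conversely, let $\alpha_\Gamma:P(\Gamma)\to P((S;g))$ be any family of morphisms, for all $(S,g)$ and all $\Gamma\in\Gamma(S;g)$. Then $(\alpha_\Gamma)$ is the family of contractions of a non-$\Sigma$ modular operad structure on $P$ if and only if, for each geometric $(S,g)$, the correspondence $\Gamma\mapsto P(\Gamma)$ is the object part of a functor $\alpha:\Gamma(S;g)\to M$ that extends the given data: on isomorphisms of graphs it is the functoriality of $\Gamma\mapsto P(\Gamma)$ coming from the module $P$, on a morphism $f:\Gamma_0\to\Gamma_1$ it is $\bigotimes_{v\in\mathrm{Vert}(\Gamma_1)}\alpha_{f^{-1}(v)}$, and $\alpha(f)=\alpha_\Gamma$ (under $P(\star_{S,g})\cong P((S;g))$) for the unique morphism $f:\Gamma\to\star_{S,g}$. -/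

import Mathlib

open CategoryTheory MonoidalCategory Limits

universe v u

namespace NsMod

/-! ### Multicyclically ordered sets -/

/-- A multicyclically ordered finite set: a decomposition of a finite set `pt` into `b > 0` possibly
empty, totally cyclically ordered sets. The nonempty components together with their cyclic orders
are recorded by the permutation `succ` sending an element to its immediate successor in its
component: the nonempty components are the cycles of `succ` (fixed points included), each with the
cyclic order in which `succ` runs through it. The finite set `emp` is the set of (indices of) the
empty components. -/
structure MultCyc : Type 1 where
  pt : Type
  emp : Type
  [finite_pt : Finite pt]
  [finite_emp : Finite emp]
  succ : Equiv.Perm pt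
  nonempty : Nonempty (pt ⊕ emp)

namespace MultCyc

attribute [instance] MultCyc.finite_pt MultCyc.finite_emp

/-- The number `b` of components. -/
noncomputable def b (S : MultCyc) : ℕ :=
  Nat.card (Quotient (Equiv.Perm.SameCycle.setoid S.succ)) + Nat.card S.emp

/-- The arcs of `S`, when its components are drawn as circles with the elements of `S` marked on
them: an element `x` stands for the open arc that ends at `x` (and starts at the predecessor of
`x`), an empty component for the whole circle. -/
abbrev Arc (S : MultCyc) : Type := S.pt ⊕ S.emp

/-- Isomorphisms of multicyclically ordered sets: a bijection of the underlying sets that respects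
the cyclic orders of the components, together with a compatible bijection of the sets of
components. On nonempty components the latter is determined by the former. -/
@[ext]
structure Hom (S T : MultCyc) where
  pt : S.pt ≃ T.pt
  emp : S.emp ≃ T.emp
  map_succ : ∀ x, pt (S.succ x) = T.succ (pt x)

/-- The category of multicyclically ordered finite sets and their isomorphisms. -/
instance : Category MultCyc where
  Hom := Hom
  id S := ⟨Equiv.refl _, Equiv.refl _, fun _ => rfl⟩
  comp f g := ⟨f.pt.trans g.pt, f.emp.trans g.emp, fun x => by
    simp [f.map_succ, g.map_succ]⟩

/-- The map of arcs induced by an isomorphism. -/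
def arcMap {S T : MultCyc} (f : S ⟶ T) : S.Arc → T.Arc := Sum.map f.pt f.emp

/-- The disjoint union of two multicyclically ordered sets. -/
abbrev sum (S T : MultCyc) : MultCyc where
  pt := S.pt ⊕ T.pt
  emp := S.emp ⊕ T.emp
  succ := Equiv.sumCongr S.succ T.succ
  nonempty := S.nonempty.map (Sum.map Sum.inl Sum.inl)

end MultCyc

/-- `(S, g)` is geometric if `(g - b + 1) / 2` is a natural number. -/
def Geometric (S : MultCyc) (g : ℕ) : Prop := ∃ G : ℕ, g + 1 = S.b + 2 * G

/-! ### Gluing: merging, cutting, and the legs of a graph -/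

section FirstReturn

variable {α : Type} [Finite α] (φ : Equiv.Perm α) (p : α → Prop)

open Classical in
/-- The first element with property `p` in the sequence `x, φ x, φ (φ x), …`. -/
noncomputable def firstHit (x : α) (h : ∃ n : ℕ, p ((φ ^ n) x)) : {x // p x} :=
  ⟨(φ ^ Nat.find h) x, Nat.find_spec h⟩

theorem exists_return (x : {x // p x}) : ∃ n : ℕ, p ((φ ^ n) (φ x.1)) := by
  refine ⟨orderOf φ - 1, ?_⟩
  have h : 0 < orderOf φ := orderOf_pos φ
  rw [← Equiv.Perm.mul_apply, ← pow_succ, Nat.sub_add_cancel h, pow_orderOf_eq_one]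
  exact x.2

theorem firstReturn_injective :
    Function.Injective fun x : {x // p x} => firstHit φ p (φ x.1) (exists_return φ p x) := by
  classical
  have key : ∀ x y : {x // p x}, Nat.find (exists_return φ p x) ≤ Nat.find (exists_return φ p y) →
      (φ ^ Nat.find (exists_return φ p x)) (φ x.1) =
        (φ ^ Nat.find (exists_return φ p y)) (φ y.1) → x = y := by
    intro x y hle h
    obtain ⟨k, hk⟩ := Nat.exists_eq_add_of_le hle
    set m := Nat.find (exists_return φ p x)
    rw [hk, pow_add, Equiv.Perm.mul_apply] at h
    have h2 := (φ ^ m).injective h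
    rw [← Equiv.Perm.mul_apply, ← pow_succ, pow_succ', Equiv.Perm.mul_apply] at h2
    have h3 := φ.injective h2
    rcases k with _ | k
    · exact Subtype.ext (by simpa using h3)
    · exfalso
      have h4 : p ((φ ^ k) (φ y.1)) := by
        rw [← Equiv.Perm.mul_apply, ← pow_succ, ← h3]; exact x.2
      have := Nat.find_min' (exists_return φ p y) h4
      omega
  intro x y h
  have h' := congrArg Subtype.val h
  rcases le_total (Nat.find (exists_return φ p x)) (Nat.find (exists_return φ p y)) with hle | hle
  · exact key x y hle h'
  · exact (key y x hle h'.symm).symm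

/-- The first return map of `φ` to the set of elements with property `p`. -/
noncomputable def firstReturn : Equiv.Perm {x // p x} :=
  Equiv.ofBijective _ (Finite.injective_iff_bijective.1 (firstReturn_injective φ p))

end FirstReturn

/-- Let `S` be a multicyclically ordered set and `τ` an involution of its underlying set. Gluing
each `x` to `τ x` (when `x ≠ τ x`) gives the multicyclically ordered set `glue S τ` of unglued
elements. One walks along the boundary: from an unglued `x` to its immediate successor, and whenever
one arrives at a glued element `y`, one continues with the immediate successor of `τ y`, until an
unglued element is reached, which is the immediate successor of `x` in `glue S τ`. With
`φ = S.succ * τ`, the walks are the cycles of `φ`, and the components of `glue S τ` are these cycles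
(a cycle without unglued elements gives an empty component) and the empty components of `S`. -/
noncomputable abbrev glue (S : MultCyc) (τ : Equiv.Perm S.pt) : MultCyc where
  pt := {x // τ x = x}
  emp := S.emp ⊕ {c : Quotient (Equiv.Perm.SameCycle.setoid (S.succ * τ)) //
    ∀ x, Quotient.mk _ x = c → τ x ≠ x}
  succ := firstReturn (S.succ * τ) fun x => τ x = x
  nonempty := by
    obtain ⟨x | e⟩ := S.nonempty
    · by_cases h : ∃ y, Quotient.mk (Equiv.Perm.SameCycle.setoid (S.succ * τ)) y =
        Quotient.mk _ x ∧ τ y = y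
      · obtain ⟨y, -, hy⟩ := h
        exact ⟨Sum.inl ⟨y, hy⟩⟩
      · push Not at h
        exact ⟨Sum.inr (Sum.inr ⟨Quotient.mk _ x, h⟩)⟩
    · exact ⟨Sum.inr (Sum.inl e)⟩

/-- `Gluing S inv T` says how `T` is obtained from `S` by gluing `x` to `inv x` for all elements `x`
of `S` outside the range of `emb`. Here `emb` identifies the elements of `T` with the unglued
elements of `S`, and an arc of `S` lies on the arc `arc` of `T`. Gluing `x` to `inv x` joins the
arc that ends at `x` with the arc that starts at `inv x`, and the arcs of `T` are the classes of
arcs of `S` for the equivalence relation that these identifications generate. -/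
@[ext]
structure Gluing (S : MultCyc) (inv : S.pt → S.pt) (T : MultCyc) where
  emb : T.pt → S.pt
  hit : S.pt → T.Arc
  emp : S.emp → T.emp
  hit_emb : ∀ y, hit (emb y) = Sum.inl y
  hit_succ : ∀ y, hit (S.succ (emb y)) = Sum.inl (T.succ y)
  hit_inv : ∀ x, x ∉ Set.range emb → hit x = hit (S.succ (inv x))
  surj : Function.Surjective (Sum.elim hit (Sum.inr ∘ emp) : S.Arc → T.Arc)
  ker : ∀ a a' : S.Arc, (Sum.elim hit (Sum.inr ∘ emp) : S.Arc → T.Arc) a =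
      (Sum.elim hit (Sum.inr ∘ emp) : S.Arc → T.Arc) a' →
    Relation.EqvGen (fun a a' => ∃ x, x ∉ Set.range emb ∧ a = Sum.inl x ∧
      a' = Sum.inl (S.succ (inv x))) a a'

namespace Gluing

variable {S T U : MultCyc} {inv : S.pt → S.pt}

/-- The arc of `T` on which an arc of `S` lies. -/
def arc (G : Gluing S inv T) : S.Arc → T.Arc := Sum.elim G.hit (Sum.inr ∘ G.emp)

/-- Two arcs of `S` are adjacent if gluing `x` to `inv x` joins them for some glued `x`. -/
def Adj (G : Gluing S inv T) (a a' : S.Arc) : Prop :=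
  ∃ x, x ∉ Set.range G.emb ∧ a = Sum.inl x ∧ a' = Sum.inl (S.succ (inv x))

theorem arc_surjective (G : Gluing S inv T) : Function.Surjective G.arc := G.surj

theorem emb_injective (G : Gluing S inv T) : Function.Injective G.emb := fun y z h =>
  Sum.inl_injective (by rw [← G.hit_emb, ← G.hit_emb, h])

theorem arc_eq_iff (G : Gluing S inv T) (a a' : S.Arc) :
    G.arc a = G.arc a' ↔ Relation.EqvGen G.Adj a a' := by
  refine ⟨G.ker a a', fun h => ?_⟩
  induction h with
  | rel a a' h =>
    obtain ⟨x, hx, rfl, rfl⟩ := h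
    exact G.hit_inv x hx
  | refl => rfl
  | symm _ _ _ ih => exact ih.symm
  | trans _ _ _ _ _ ih ih' => exact ih.trans ih'

/-- The trivial gluing, where nothing is glued. -/
def refl (S : MultCyc) (inv : S.pt → S.pt) : Gluing S inv S where
  emb := id
  hit := Sum.inl
  emp := id
  hit_emb _ := rfl
  hit_succ _ := rfl
  hit_inv x hx := absurd ⟨x, rfl⟩ hx
  surj := by rintro (x | e); exacts [⟨Sum.inl x, rfl⟩, ⟨Sum.inr e, rfl⟩]
  ker a a' h := by
    have : a = a' := by rcases a with a | a <;> rcases a' with a' | a' <;> simp at h <;> rw [h]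
    subst this
    exact Relation.EqvGen.refl _

/-- Gluing in two steps. -/
def comp (G : Gluing S inv T) {inv' : T.pt → T.pt} (H : Gluing T inv' U)
    (h : ∀ y, y ∉ Set.range H.emb → inv (G.emb y) = G.emb (inv' y)) : Gluing S inv U where
  emb := G.emb ∘ H.emb
  hit x := H.arc (G.hit x)
  emp := H.emp ∘ G.emp
  hit_emb y := by simp [G.hit_emb, arc, H.hit_emb]
  hit_succ y := by simp [G.hit_succ, arc, H.hit_succ]
  hit_inv x hx := by
    by_cases hG : x ∈ Set.range G.emb
    · obtain ⟨y, rfl⟩ := hG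
      have hy : y ∉ Set.range H.emb := fun ⟨z, hz⟩ => hx ⟨z, by simp [hz]⟩
      rw [h y hy, G.hit_succ, G.hit_emb]
      exact H.hit_inv y hy
    · rw [G.hit_inv x hG]
  surj u := by
    obtain ⟨t, rfl⟩ := H.arc_surjective u
    obtain ⟨x | e, rfl⟩ := G.arc_surjective t
    exacts [⟨Sum.inl x, rfl⟩, ⟨Sum.inr e, rfl⟩]
  ker a a' haa' := by
    have e : ∀ a : S.Arc, (Sum.elim (fun x => H.arc (G.hit x)) (Sum.inr ∘ H.emp ∘ G.emp) :
        S.Arc → U.Arc) a = H.arc (G.arc a) := by rintro (x | x) <;> rfl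
    rw [e, e, H.arc_eq_iff] at haa'
    have key : ∀ t t' : T.Arc, Relation.EqvGen H.Adj t t' → ∀ a a', G.arc a = t → G.arc a' = t' →
        Relation.EqvGen (fun a a' : S.Arc => ∃ x, x ∉ Set.range (G.emb ∘ H.emb) ∧ a = Sum.inl x ∧
          a' = Sum.inl (S.succ (inv x))) a a' := by
      have base : ∀ a a', G.arc a = G.arc a' →
          Relation.EqvGen (fun a a' : S.Arc => ∃ x, x ∉ Set.range (G.emb ∘ H.emb) ∧ a = Sum.inl x ∧
            a' = Sum.inl (S.succ (inv x))) a a' := fun a a' h =>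
        Relation.EqvGen.mono (r := G.Adj) (fun _ _ ⟨x, hx, h1, h2⟩ =>
          ⟨x, fun ⟨z, hz⟩ => hx ⟨H.emb z, hz⟩, h1, h2⟩) _ _ ((G.arc_eq_iff a a').1 h)
      intro t t' htt'
      induction htt' with
      | rel t t' h' =>
        obtain ⟨y, hy, rfl, rfl⟩ := h'
        intro a a' ha ha'
        refine (base a (Sum.inl (G.emb y)) (by rw [ha]; exact (G.hit_emb y).symm)).trans _ _ _ ?_
        refine Relation.EqvGen.trans _ (Sum.inl (S.succ (inv (G.emb y)))) _
          (.rel _ _ ⟨_, fun ⟨z, hz⟩ => hy ⟨z, G.emb_injective hz⟩, rfl, rfl⟩) ?_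
        refine base _ _ ?_
        rw [ha', h y hy]
        exact G.hit_succ _
      | refl t =>
        intro a a' ha ha'
        exact base a a' (ha.trans ha'.symm)
      | symm _ _ _ ih => exact fun a a' ha ha' => (ih a' a ha' ha).symm
      | trans _ t' _ _ _ ih ih' =>
        intro a a' ha ha'
        obtain ⟨c, hc⟩ := G.arc_surjective t'
        exact (ih a c ha hc).trans _ _ _ (ih' c a' hc ha')
    exact key _ _ haa' a a' rfl rfl

theorem comp_arc (G : Gluing S inv T) {inv' : T.pt → T.pt} (H : Gluing T inv' U) (h) (a : S.Arc) :
    (G.comp H h).arc a = H.arc (G.arc a) := by rcases a with a | a <;> rfl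

/-- Transport of a gluing along an isomorphism. -/
def map (G : Gluing S inv T) (f : T ⟶ U) : Gluing S inv U where
  emb := G.emb ∘ f.pt.symm
  hit := MultCyc.arcMap f ∘ G.hit
  emp := f.emp ∘ G.emp
  hit_emb y := by simp [G.hit_emb, MultCyc.arcMap]
  hit_succ y := by simp [G.hit_succ, MultCyc.arcMap, f.map_succ]
  hit_inv x hx := congrArg (MultCyc.arcMap f) (G.hit_inv x (by simpa [f.pt.symm.surjective.range_comp] using hx))
  surj u := by
    have : Function.Surjective (MultCyc.arcMap f) :=
      Sum.map_surjective.2 ⟨f.pt.surjective, f.emp.surjective⟩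
    obtain ⟨t, rfl⟩ := this u
    obtain ⟨x | e, rfl⟩ := G.arc_surjective t
    exacts [⟨Sum.inl x, rfl⟩, ⟨Sum.inr e, rfl⟩]
  ker a a' haa' := by
    have : Function.Injective (MultCyc.arcMap f) :=
      Sum.map_injective.2 ⟨f.pt.injective, f.emp.injective⟩
    have e : ∀ a : S.Arc, (Sum.elim (MultCyc.arcMap f ∘ G.hit) (Sum.inr ∘ f.emp ∘ G.emp) :
        S.Arc → U.Arc) a = MultCyc.arcMap f (G.arc a) := by rintro (x | x) <;> rfl
    rw [e, e] at haa'
    have := (G.arc_eq_iff a a').1 (this haa')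
    rw [f.pt.symm.surjective.range_comp]
    exact this

theorem map_arc (G : Gluing S inv T) (f : T ⟶ U) (a : S.Arc) :
    (G.map f).arc a = MultCyc.arcMap f (G.arc a) := by rcases a with a | a <;> rfl

/-- The gluing of `glue S τ` from `S`. -/
noncomputable def canonical (S : MultCyc) (τ : Equiv.Perm S.pt) : Gluing S τ (glue S τ) := by
  classical
  let φ : Equiv.Perm S.pt := S.succ * τ
  have hφ : ∀ x, φ x = S.succ (τ x) := fun _ => rfl
  -- moving along the walk does not change what is hit first
  let hit : S.pt → (glue S τ).Arc := fun x =>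
    if h : ∃ n : ℕ, τ ((φ ^ n) x) = (φ ^ n) x then
      Sum.inl (firstHit φ (fun x => τ x = x) x h)
    else Sum.inr (Sum.inr ⟨Quotient.mk _ x, fun y hy hy' => h (by
      obtain ⟨n, hn⟩ := (Quotient.exact hy : φ.SameCycle y x).symm.exists_nat_pow_eq
      exact ⟨n, by rw [hn]; exact hy'⟩)⟩)
  have hit_pos : ∀ x (h : ∃ n : ℕ, τ ((φ ^ n) x) = (φ ^ n) x),
      hit x = Sum.inl (firstHit φ (fun x => τ x = x) x h) := fun x h => dif_pos h
  have hit_fix : ∀ x (h : τ x = x), hit x = Sum.inl ⟨x, h⟩ := by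
    intro x h
    have h0 : ∃ n : ℕ, τ ((φ ^ n) x) = (φ ^ n) x := ⟨0, h⟩
    rw [hit_pos x h0]
    have : Nat.find h0 = 0 := (Nat.find_eq_zero h0).2 h
    exact congrArg Sum.inl (Subtype.ext (show (φ ^ Nat.find h0) x = x by rw [this]; rfl))
  have hit_step : ∀ x, τ x ≠ x → hit x = hit (φ x) := by
    intro x hx
    by_cases h : ∃ n : ℕ, τ ((φ ^ n) x) = (φ ^ n) x
    · have h' : ∃ n : ℕ, τ ((φ ^ n) (φ x)) = (φ ^ n) (φ x) := by
        obtain ⟨_ | n, hn⟩ := h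
        · exact absurd hn hx
        · exact ⟨n, by rwa [pow_succ, Equiv.Perm.mul_apply] at hn⟩
      rw [hit_pos x h, hit_pos _ h']
      have e : Nat.find h = Nat.find h' + 1 := by
        refine (Nat.find_eq_iff h).2 ⟨?_, ?_⟩
        · rw [pow_succ, Equiv.Perm.mul_apply]; exact Nat.find_spec h'
        · rintro (_ | n) hn
          · exact hx
          · rw [pow_succ, Equiv.Perm.mul_apply]; exact Nat.find_min h' (by omega)
      exact congrArg Sum.inl (Subtype.ext (show (φ ^ Nat.find h) x = (φ ^ Nat.find h') (φ x) by
        rw [e, pow_succ, Equiv.Perm.mul_apply]))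
    · have h' : ¬ ∃ n : ℕ, τ ((φ ^ n) (φ x)) = (φ ^ n) (φ x) := by
        rintro ⟨n, hn⟩
        exact h ⟨n + 1, by rwa [pow_succ, Equiv.Perm.mul_apply]⟩
      simp only [hit, dif_neg h, dif_neg h']
      congr 3
      refine Quotient.sound (show φ.SameCycle x (φ x) from ⟨1, by simp⟩)
  have mem_range : ∀ x, x ∉ Set.range (Subtype.val : {x // τ x = x} → S.pt) ↔ τ x ≠ x := by
    simp
  have chain : ∀ (n : ℕ) x, (∀ m < n, τ ((φ ^ m) x) ≠ (φ ^ m) x) →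
      Relation.EqvGen (fun a a' : S.Arc => ∃ x, x ∉ Set.range (Subtype.val : {x // τ x = x} → S.pt) ∧
        a = Sum.inl x ∧ a' = Sum.inl (S.succ (τ x))) (Sum.inl x) (Sum.inl ((φ ^ n) x)) := by
    intro n x
    induction n with
    | zero => exact fun _ => .refl _
    | succ n ih =>
      intro h
      refine (ih fun m hm => h m (by omega)).trans _ _ _ (.rel _ _ ⟨(φ ^ n) x, ?_, rfl, ?_⟩)
      · exact (mem_range _).2 (h n (by omega))
      · rw [pow_succ', Equiv.Perm.mul_apply, hφ]
  exact
  { emb := Subtype.val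
    hit := hit
    emp := Sum.inl
    hit_emb := fun y => hit_fix y.1 y.2
    hit_succ := fun y => by
      have h := exists_return φ (fun x => τ x = x) y
      have e : S.succ y.1 = φ y.1 := by rw [hφ, y.2]
      rw [e]
      exact hit_pos _ h
    hit_inv := fun x hx => hit_step x ((mem_range x).1 hx)
    surj := by
      rintro (y | e | ⟨c, hc⟩)
      · exact ⟨Sum.inl y.1, hit_fix y.1 y.2⟩
      · exact ⟨Sum.inr e, rfl⟩
      · induction c using Quotient.inductionOn with | _ x => ?_
        refine ⟨Sum.inl x, dif_neg ?_⟩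
        rintro ⟨n, hn⟩
        exact hc _ (Quotient.sound (show φ.SameCycle _ x from ⟨-(n : ℤ), by simp⟩)) hn
    ker := by
      have pp : ∀ x y, hit x = hit y → Relation.EqvGen (fun a a' : S.Arc =>
          ∃ x, x ∉ Set.range (Subtype.val : {x // τ x = x} → S.pt) ∧
            a = Sum.inl x ∧ a' = Sum.inl (S.succ (τ x))) (Sum.inl x) (Sum.inl y) := by
        intro x y h
        by_cases hx : ∃ n : ℕ, τ ((φ ^ n) x) = (φ ^ n) x <;>
          by_cases hy : ∃ n : ℕ, τ ((φ ^ n) y) = (φ ^ n) y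
        · rw [hit_pos x hx, hit_pos y hy] at h
          have h' : (φ ^ Nat.find hx) x = (φ ^ Nat.find hy) y :=
            congrArg Subtype.val (Sum.inl_injective h)
          have c1 := chain (Nat.find hx) x fun m hm => Nat.find_min hx hm
          have c2 := chain (Nat.find hy) y fun m hm => Nat.find_min hy hm
          rw [h'] at c1
          exact c1.trans _ _ _ (c2.symm)
        · simp [hit, dif_pos hx, dif_neg hy] at h
        · simp [hit, dif_neg hx, dif_pos hy] at h
        · simp only [hit, dif_neg hx, dif_neg hy] at h
          have h' := Quotient.exact (congrArg Subtype.val (Sum.inr_injective (Sum.inr_injective h)))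
          obtain ⟨n, hn⟩ := (h' : φ.SameCycle x y).exists_nat_pow_eq
          rw [← hn]
          exact chain n x fun m _ hm => hx ⟨m, hm⟩
      rintro (x | e) (y | e') h
      · exact pp x y h
      · exfalso
        change hit x = Sum.inr (Sum.inl e') at h
        by_cases hx : ∃ n : ℕ, τ ((φ ^ n) x) = (φ ^ n) x
        · simp [hit, dif_pos hx] at h
        · simp only [hit, dif_neg hx] at h
          cases Sum.inr_injective h
      · exfalso
        change Sum.inr (Sum.inl e) = hit y at h
        by_cases hx : ∃ n : ℕ, τ ((φ ^ n) y) = (φ ^ n) y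
        · simp [hit, dif_pos hx] at h
        · simp only [hit, dif_neg hx] at h
          cases Sum.inr_injective h
      · have : e = e' := Sum.inl_injective (Sum.inr_injective h)
        subst this
        exact .refl _ }

theorem exists_emp {S T T' : MultCyc} {inv : S.pt → S.pt} (G : Gluing S inv T)
    (G' : Gluing S inv T') (h : Set.range G.emb = Set.range G'.emb) (e : T.emp) :
    ∃ e' : T'.emp, ∃ a, G.arc a = Sum.inr e ∧ G'.arc a = Sum.inr e' := by
  have hadj : G.Adj = G'.Adj := by unfold Adj; rw [h]
  obtain ⟨a, ha⟩ := G.arc_surjective (Sum.inr e)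
  rcases hy : G'.arc a with y | e'
  · exfalso
    have h1 : G'.arc a = G'.arc (Sum.inl (G'.emb y)) := by rw [hy]; exact (G'.hit_emb y).symm
    rw [G'.arc_eq_iff, ← hadj, ← G.arc_eq_iff, ha] at h1
    obtain ⟨z, hz⟩ : G'.emb y ∈ Set.range G.emb := h ▸ ⟨y, rfl⟩
    rw [← hz] at h1
    exact absurd (h1.trans (G.hit_emb z)) (by simp)
  · exact ⟨e', a, ha, hy⟩

/-- Two results of the same gluing are canonically isomorphic. -/
noncomputable def iso {S T T' : MultCyc} {inv : S.pt → S.pt} (G : Gluing S inv T)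
    (G' : Gluing S inv T') (h : Set.range G.emb = Set.range G'.emb) : T ⟶ T' :=
  have hadj : G.Adj = G'.Adj := by unfold Adj; rw [h]
  have harc : ∀ a a', G.arc a = G.arc a' ↔ G'.arc a = G'.arc a' := fun a a' => by
    rw [G.arc_eq_iff, G'.arc_eq_iff, hadj]
  let p : T.pt ≃ T'.pt := (Equiv.ofInjective _ G.emb_injective).trans
    ((Equiv.setCongr h).trans (Equiv.ofInjective _ G'.emb_injective).symm)
  have hp : ∀ y, G'.emb (p y) = G.emb y := fun y =>
    Equiv.apply_ofInjective_symm (f := _) G'.emb_injective _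
  { pt := p
    emp := Equiv.ofBijective (fun e => (exists_emp G G' h e).choose) (by
      constructor
      · intro e e' hee'
        obtain ⟨a, h1, h2⟩ := (exists_emp G G' h e).choose_spec
        obtain ⟨a', h1', h2'⟩ := (exists_emp G G' h e').choose_spec
        have := (harc a a').2 (by rw [h2, h2']; exact congrArg Sum.inr hee')
        rw [h1, h1'] at this
        exact Sum.inr_injective this
      · intro e'
        obtain ⟨e, a, h1, h2⟩ := exists_emp G' G h.symm e'
        refine ⟨e, ?_⟩
        obtain ⟨a', h1', h2'⟩ := (exists_emp G G' h e).choose_spec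
        have := (harc a a').1 (by rw [h2, h1'])
        rw [h1, h2'] at this
        exact (Sum.inr_injective this).symm)
    map_succ := fun y => by
      have h1 : G.arc (Sum.inl (S.succ (G.emb y))) = G.arc (Sum.inl (G.emb (T.succ y))) :=
        (G.hit_succ y).trans (G.hit_emb _).symm
      rw [harc, ← hp, ← hp] at h1
      exact (Sum.inl_injective ((G'.hit_succ _).symm.trans (h1.trans (G'.hit_emb _)))).symm }

theorem iso_arc {S T T' : MultCyc} {inv : S.pt → S.pt} (G : Gluing S inv T)
    (G' : Gluing S inv T') (h : Set.range G.emb = Set.range G'.emb) (a : S.Arc) :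
    MultCyc.arcMap (G.iso G' h) (G.arc a) = G'.arc a := by
  have hadj : G.Adj = G'.Adj := by unfold Adj; rw [h]
  have harc : ∀ a a', G.arc a = G.arc a' ↔ G'.arc a = G'.arc a' := fun a a' => by
    rw [G.arc_eq_iff, G'.arc_eq_iff, hadj]
  rcases hy : G.arc a with y | e
  · have hp : G'.emb ((G.iso G' h).pt y) = G.emb y :=
      Equiv.apply_ofInjective_symm (f := _) G'.emb_injective _
    have h1 : G.arc a = G.arc (Sum.inl (G.emb y)) := by rw [hy]; exact (G.hit_emb y).symm
    rw [harc, ← hp] at h1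
    exact (h1.trans (G'.hit_emb _)).symm
  · obtain ⟨a', h1', h2'⟩ := (exists_emp G G' h e).choose_spec
    have := (harc a a').1 (by rw [hy, h1'])
    rw [h2'] at this
    exact this.symm

end Gluing

/-! ### Non-Σ modular graphs -/

/-- A non-Σ modular graph: a connected graph given by a finite set `fl.pt` of flags (half-edges), an
involution `inv` of it and a partition of it into possibly empty blocks (the vertices; `ptV x` is
the vertex of the flag `x`), with a multicyclic order on the set of flags at each vertex and a genus
for each vertex. The multicyclic orders of all vertices are put together into `fl`, each component
of which is located at some vertex. Every vertex has at least one (possibly empty) component. -/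
structure Graph : Type 1 where
  fl : MultCyc
  Vert : Type
  [finite_vert : Finite Vert]
  ptV : fl.pt → Vert
  empV : fl.emp → Vert
  ptV_succ : ∀ x, ptV (fl.succ x) = ptV x
  surj : Function.Surjective (Sum.elim ptV empV)
  genus : Vert → ℕ
  inv : Equiv.Perm fl.pt
  inv_inv : ∀ x, inv (inv x) = x
  conn : ∀ v w, Relation.EqvGen (fun v w => ∃ x, ptV x = v ∧ ptV (inv x) = w) v w

namespace Graph

attribute [instance] Graph.finite_vert

/-- The vertex at which an arc is located. -/
def arcV (Γ : Graph) : Γ.fl.Arc → Γ.Vert := Sum.elim Γ.ptV Γ.empV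

/-- The multicyclically ordered set `Leg(v)` of flags at the vertex `v`. -/
abbrev legAt (Γ : Graph) (v : Γ.Vert) : MultCyc where
  pt := {x // Γ.ptV x = v}
  emp := {e // Γ.empV e = v}
  succ := Γ.fl.succ.subtypePerm fun x => by rw [Γ.ptV_succ]
  nonempty := by
    obtain ⟨x | e, h⟩ := Γ.surj v
    exacts [⟨Sum.inl ⟨x, h⟩⟩, ⟨Sum.inr ⟨e, h⟩⟩]

/-- The set of legs (flags fixed by the involution) with its induced multicyclic order, given by the
oriented edge cycles of the graph; an empty component at a vertex gives an empty component. -/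
noncomputable abbrev leg (Γ : Graph) : MultCyc := glue Γ.fl Γ.inv

/-- The number of edges, i.e. of two-element orbits of the involution. -/
noncomputable def numEdges (Γ : Graph) : ℕ := Nat.card {x // Γ.inv x ≠ x} / 2

/-- The genus of a graph: the first Betti number of the (connected) graph, which is the number of
edges minus the number of vertices plus one, plus the sum of the genera of the vertices. -/
noncomputable def totalGenus (Γ : Graph) : ℤ :=
  ((Γ.numEdges : ℤ) - Nat.card Γ.Vert + 1) + ∑ᶠ v, (Γ.genus v : ℤ)

/-- The data of a morphism of graphs, see `Graph.Hom`, without the condition on the genera. The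
flags of `Γ` outside the range of `gl.emb` form the edges that are contracted. -/
@[ext]
structure PreHom (Γ Δ : Graph) where
  gl : Gluing Γ.fl Γ.inv Δ.fl
  vert : Γ.Vert → Δ.Vert
  inv_emb : ∀ y, Γ.inv (gl.emb y) = gl.emb (Δ.inv y)
  mem_of_leg : ∀ x, Γ.inv x = x → x ∈ Set.range gl.emb
  arcV : ∀ a, Δ.arcV (gl.arc a) = vert (Γ.arcV a)
  conn : ∀ v w, vert v = vert w → Relation.EqvGen
    (fun v w => ∃ x, x ∉ Set.range gl.emb ∧ Γ.ptV x = v ∧ Γ.ptV (Γ.inv x) = w) v w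

namespace PreHom

variable {Γ Δ : Graph} (f : PreHom Γ Δ)

theorem inv_mem {x : Γ.fl.pt} : Γ.inv x ∈ Set.range f.gl.emb ↔ x ∈ Set.range f.gl.emb := by
  have h : ∀ x, x ∈ Set.range f.gl.emb → Γ.inv x ∈ Set.range f.gl.emb := by
    rintro _ ⟨y, rfl⟩
    exact ⟨_, (f.inv_emb y).symm⟩
  exact ⟨fun hx => Γ.inv_inv x ▸ h _ hx, h x⟩

theorem vert_inv {x : Γ.fl.pt} (hx : x ∉ Set.range f.gl.emb) :
    f.vert (Γ.ptV (Γ.inv x)) = f.vert (Γ.ptV x) := by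
  have h := congrArg Δ.arcV (f.gl.hit_inv x hx)
  have h1 := f.arcV (Sum.inl x)
  have h2 := f.arcV (Sum.inl (Γ.fl.succ (Γ.inv x)))
  have h3 : Γ.arcV (Sum.inl (Γ.fl.succ (Γ.inv x))) = Γ.ptV (Γ.inv x) := Γ.ptV_succ _
  rw [h3] at h2
  exact h2.symm.trans (h.symm.trans h1)

open Classical in
/-- The involution of the flags of `Γ` that keeps the contracted edges and cuts the others. -/
noncomputable def cutInv : Equiv.Perm Γ.fl.pt :=
  Function.Involutive.toPerm (fun x => if x ∈ Set.range f.gl.emb then x else Γ.inv x) fun x => by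
    by_cases h : x ∈ Set.range f.gl.emb
    · simp only [if_pos h]
    · simp only [if_neg h, f.inv_mem, Γ.inv_inv]

theorem cutInv_of_mem {x : Γ.fl.pt} (h : x ∈ Set.range f.gl.emb) : f.cutInv x = x := if_pos h

theorem cutInv_of_notMem {x : Γ.fl.pt} (h : x ∉ Set.range f.gl.emb) : f.cutInv x = Γ.inv x :=
  if_neg h

theorem cutInv_eq_iff {x : Γ.fl.pt} : f.cutInv x = x ↔ x ∈ Set.range f.gl.emb := by
  refine ⟨fun h => ?_, f.cutInv_of_mem⟩
  by_contra hx
  rw [f.cutInv_of_notMem hx] at h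
  exact hx (f.mem_of_leg x h)

theorem vert_cutInv (x : Γ.fl.pt) : f.vert (Γ.ptV (f.cutInv x)) = f.vert (Γ.ptV x) := by
  by_cases hx : x ∈ Set.range f.gl.emb
  · rw [f.cutInv_of_mem hx]
  · rw [f.cutInv_of_notMem hx, f.vert_inv hx]

/-- The preimage of the vertex `v`: the graph formed by the vertices of `Γ` over `v`, the flags at
these vertices, and the contracted edges between them. The other flags become legs. -/
noncomputable abbrev fiber (v : Δ.Vert) : Graph where
  fl :=
    { pt := {x // f.vert (Γ.ptV x) = v}
      emp := {e // f.vert (Γ.empV e) = v}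
      succ := Γ.fl.succ.subtypePerm fun x => by rw [Γ.ptV_succ]
      nonempty := by
        obtain ⟨a, ha⟩ := Δ.surj v
        obtain ⟨x | e, h⟩ := f.gl.arc_surjective a
        · exact ⟨Sum.inl ⟨x, by rw [← ha, ← h]; exact (f.arcV (Sum.inl x)).symm⟩⟩
        · exact ⟨Sum.inr ⟨e, by rw [← ha, ← h]; exact (f.arcV (Sum.inr e)).symm⟩⟩ }
  Vert := {w // f.vert w = v}
  ptV x := ⟨Γ.ptV x.1, x.2⟩
  empV e := ⟨Γ.empV e.1, e.2⟩
  ptV_succ x := Subtype.ext (Γ.ptV_succ x.1)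
  surj := by
    rintro ⟨w, hw⟩
    obtain ⟨x | e, h⟩ := Γ.surj w
    · have h : Γ.ptV x = w := h
      exact ⟨Sum.inl ⟨x, by rw [h, hw]⟩, Subtype.ext h⟩
    · have h : Γ.empV e = w := h
      exact ⟨Sum.inr ⟨e, by rw [h, hw]⟩, Subtype.ext h⟩
  genus w := Γ.genus w.1
  inv := f.cutInv.subtypePerm fun x => by rw [f.vert_cutInv]
  inv_inv x := Subtype.ext (by
    show f.cutInv (f.cutInv x.1) = x.1
    by_cases hx : x.1 ∈ Set.range f.gl.emb
    · rw [f.cutInv_of_mem hx, f.cutInv_of_mem hx]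
    · rw [f.cutInv_of_notMem hx, f.cutInv_of_notMem (fun h => hx (f.inv_mem.1 h)), Γ.inv_inv])
  conn := by
    have key : ∀ w w', Relation.EqvGen (fun v w => ∃ x, x ∉ Set.range f.gl.emb ∧ Γ.ptV x = v ∧
        Γ.ptV (Γ.inv x) = w) w w' → f.vert w = f.vert w' ∧ ∀ (hw : f.vert w = v)
        (hw' : f.vert w' = v), Relation.EqvGen
          (fun w w' : {w // f.vert w = v} => ∃ x : {x // f.vert (Γ.ptV x) = v},
            (⟨Γ.ptV x.1, x.2⟩ : {w // f.vert w = v}) = w ∧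
            (⟨Γ.ptV (f.cutInv x.1), (f.vert_cutInv _).trans x.2⟩ : {w // f.vert w = v}) = w')
          ⟨w, hw⟩ ⟨w', hw'⟩ := by
      intro w w' h
      induction h with
      | rel w w' h =>
        obtain ⟨x, hx, rfl, rfl⟩ := h
        refine ⟨(f.vert_inv hx).symm, fun hw hw' => .rel _ _ ⟨⟨x, hw⟩, rfl, Subtype.ext ?_⟩⟩
        show Γ.ptV (f.cutInv x) = _
        rw [f.cutInv_of_notMem hx]
      | refl w => exact ⟨rfl, fun _ _ => .refl _⟩
      | symm _ _ _ ih => exact ⟨ih.1.symm, fun h h' => (ih.2 h' h).symm⟩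
      | trans _ _ _ _ _ ih ih' =>
        exact ⟨ih.1.trans ih'.1, fun h h' =>
          (ih.2 h (ih.1 ▸ h)).trans _ _ _ (ih'.2 (ih.1 ▸ h) h')⟩
    rintro ⟨w, hw⟩ ⟨w', hw'⟩
    exact (key w w' (f.conn w w' (hw.trans hw'.symm))).2 hw hw'

end PreHom

/-- A morphism `Γ ⟶ Δ` of non-Σ modular graphs: a contraction of some edges of `Γ`, leaving the
legs untouched, followed by an isomorphism onto `Δ`. It is given by the inclusion `gl.emb` of the
flags of `Δ` into those of `Γ`, the map `vert` of vertices, and the identification `gl` of the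
multicyclic orders of `Δ` with those which `Γ` induces on the legs of the preimages of the vertices
of `Δ`. The genus of a vertex is the genus of its preimage. -/
@[ext]
structure Hom (Γ Δ : Graph) extends PreHom Γ Δ where
  genus_eq : ∀ v, (Δ.genus v : ℤ) = (toPreHom.fiber v).totalGenus

section Genus

variable {Γ Δ : Graph}

theorem two_mul_numEdges (Γ : Graph) : 2 * Γ.numEdges = Nat.card {x // Γ.inv x ≠ x} := by
  classical
  have := Fintype.ofFinite Γ.fl.pt
  have h : 2 ∣ Γ.inv.support.card := by
    apply Equiv.Perm.two_dvd_card_support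
    ext x
    simp [sq, Γ.inv_inv]
  have e : Γ.inv.support.card = Nat.card {x // Γ.inv x ≠ x} := by
    rw [Nat.card_eq_fintype_card, Fintype.card_subtype]; rfl
  unfold numEdges
  omega

/-- The contracted half-edges over the vertex `v`. -/
abbrev PreHom.Con (f : PreHom Γ Δ) (v : Δ.Vert) : Type :=
  {x : Γ.fl.pt // x ∉ Set.range f.gl.emb ∧ f.vert (Γ.ptV x) = v}

theorem PreHom.two_mul_numEdges_fiber (f : PreHom Γ Δ) (v : Δ.Vert) :
    2 * (f.fiber v).numEdges = Nat.card (f.Con v) := by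
  rw [two_mul_numEdges]
  refine Nat.card_congr ⟨fun x => ⟨x.1.1, fun h => x.2 (Subtype.ext (f.cutInv_of_mem h)), x.1.2⟩,
    fun x => ⟨⟨x.1, x.2.2⟩, fun h => x.2.1 (f.cutInv_eq_iff.1 (congrArg Subtype.val h))⟩,
    fun _ => rfl, fun _ => rfl⟩

end Genus

/-- The identity, without the condition on the genera. -/
def PreHom.id (Γ : Graph) : PreHom Γ Γ where
  gl := Gluing.refl _ _
  vert v := v
  inv_emb _ := rfl
  mem_of_leg x _ := ⟨x, rfl⟩
  arcV a := by rcases a with a | a <;> rfl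
  conn v w h := by
    have h : v = w := h
    subst h
    exact .refl _

/-- The composition, without the condition on the genera. -/
def PreHom.comp {Γ Δ Λ : Graph} (f : PreHom Γ Δ) (g : PreHom Δ Λ) : PreHom Γ Λ where
  gl := f.gl.comp g.gl fun y _ => f.inv_emb y
  vert v := g.vert (f.vert v)
  inv_emb y := by
    show Γ.inv (f.gl.emb (g.gl.emb y)) = f.gl.emb (g.gl.emb (Λ.inv y))
    rw [f.inv_emb, g.inv_emb]
  mem_of_leg x hx := by
    obtain ⟨y, rfl⟩ := f.mem_of_leg x hx
    rw [f.inv_emb] at hx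
    obtain ⟨z, rfl⟩ := g.mem_of_leg y (f.gl.emb_injective hx)
    exact ⟨z, rfl⟩
  arcV a := by rw [Gluing.comp_arc, g.arcV, f.arcV]
  conn := by
    have ptV_emb : ∀ y, f.vert (Γ.ptV (f.gl.emb y)) = Δ.ptV y := fun y => by
      have := f.arcV (Sum.inl (f.gl.emb y))
      rw [show f.gl.arc (Sum.inl (f.gl.emb y)) = Sum.inl y from f.gl.hit_emb y] at this
      exact this.symm
    have base : ∀ v w, f.vert v = f.vert w → Relation.EqvGen (fun v w => ∃ x,
        x ∉ Set.range (f.gl.emb ∘ g.gl.emb) ∧ Γ.ptV x = v ∧ Γ.ptV (Γ.inv x) = w) v w :=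
      fun v w h => Relation.EqvGen.mono (r := fun v w => ∃ x, x ∉ Set.range f.gl.emb ∧
        Γ.ptV x = v ∧ Γ.ptV (Γ.inv x) = w) (fun _ _ ⟨x, hx, h1, h2⟩ =>
          ⟨x, fun ⟨z, hz⟩ => hx ⟨g.gl.emb z, hz⟩, h1, h2⟩) _ _ (f.conn v w h)
    have fsurj : Function.Surjective f.vert := fun v => by
      obtain ⟨a, ha⟩ := Δ.surj v
      obtain ⟨a', rfl⟩ := f.gl.arc_surjective a
      exact ⟨_, (f.arcV a').symm.trans ha⟩
    have key : ∀ t t', Relation.EqvGen (fun v w => ∃ x, x ∉ Set.range g.gl.emb ∧ Δ.ptV x = v ∧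
        Δ.ptV (Δ.inv x) = w) t t' → ∀ v w, f.vert v = t → f.vert w = t' →
        Relation.EqvGen (fun v w => ∃ x,
          x ∉ Set.range (f.gl.emb ∘ g.gl.emb) ∧ Γ.ptV x = v ∧ Γ.ptV (Γ.inv x) = w) v w := by
      intro t t' h
      induction h with
      | rel t t' h =>
        obtain ⟨y, hy, rfl, rfl⟩ := h
        intro v w hv hw
        refine (base v (Γ.ptV (f.gl.emb y)) (by rw [hv, ptV_emb])).trans _ _ _ ?_
        refine Relation.EqvGen.trans _ (Γ.ptV (Γ.inv (f.gl.emb y))) _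
          (.rel _ _ ⟨_, fun ⟨z, hz⟩ => hy ⟨z, f.gl.emb_injective hz⟩, rfl, rfl⟩) ?_
        refine base _ _ ?_
        rw [hw, f.inv_emb, ptV_emb]
      | refl t => exact fun v w hv hw => base v w (hv.trans hw.symm)
      | symm _ _ _ ih => exact fun v w hv hw => (ih w v hw hv).symm
      | trans _ t' _ _ _ ih ih' =>
        intro v w hv hw
        obtain ⟨c, hc⟩ := fsurj t'
        exact (ih v c hv hc).trans _ _ _ (ih' c w hc hw)
    exact fun v w h => key _ _ (g.conn _ _ h) v w rfl rfl

theorem PreHom.ptV_emb {Γ Δ : Graph} (f : PreHom Γ Δ) (y : Δ.fl.pt) :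
    f.vert (Γ.ptV (f.gl.emb y)) = Δ.ptV y := by
  have := f.arcV (Sum.inl (f.gl.emb y))
  rw [show f.gl.arc (Sum.inl (f.gl.emb y)) = Sum.inl y from f.gl.hit_emb y] at this
  exact this.symm

theorem genus_id (Γ : Graph) (v : Γ.Vert) :
    (Γ.genus v : ℤ) = ((PreHom.id Γ).fiber v).totalGenus := by
  have h1 : ((PreHom.id Γ).fiber v).numEdges = 0 := by
    have h := (PreHom.id Γ).two_mul_numEdges_fiber v
    have : IsEmpty ((PreHom.id Γ).Con v) := ⟨fun x => x.2.1 ⟨x.1, rfl⟩⟩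
    rw [Nat.card_of_isEmpty] at h
    omega
  let u : Unique ((PreHom.id Γ).fiber v).Vert :=
    { default := ⟨v, rfl⟩, uniq := fun w => Subtype.ext w.2 }
  rw [totalGenus, h1, finsum_unique, Nat.card_unique]
  simp [u, default]

theorem genus_comp {Γ Δ Λ : Graph} (f : Hom Γ Δ) (g : Hom Δ Λ) (u : Λ.Vert) :
    (Λ.genus u : ℤ) = ((f.toPreHom.comp g.toPreHom).fiber u).totalGenus := by
  classical
  have := Fintype.ofFinite Γ.Vert
  have := Fintype.ofFinite Δ.Vert
  set h := f.toPreHom.comp g.toPreHom with hh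
  have hcon : Nat.card (h.Con u) =
      (∑ v : {v // g.vert v = u}, Nat.card (f.Con v.1)) + Nat.card (g.Con u) := by
    rw [← Nat.card_sigma, ← Nat.card_sum]
    refine (Nat.card_congr (Equiv.ofBijective (Sum.elim
      (fun p => ⟨p.2.1, fun ⟨z, hz⟩ => p.2.2.1 ⟨g.gl.emb z, hz⟩, by
        show g.vert (f.vert (Γ.ptV p.2.1)) = u
        rw [p.2.2.2, p.1.2]⟩)
      (fun y => ⟨f.gl.emb y.1, fun ⟨z, hz⟩ => y.2.1 ⟨z, f.gl.emb_injective hz⟩, by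
        show g.vert (f.vert (Γ.ptV (f.gl.emb y.1))) = u
        rw [f.ptV_emb, y.2.2]⟩)) ⟨?_, ?_⟩)).symm
    · rintro (⟨⟨v, hv⟩, x, hx, hxv⟩ | ⟨y, hy, hyv⟩) (⟨⟨v', hv'⟩, x', hx', hxv'⟩ | ⟨y', hy', hyv'⟩) e
      · have e : x = x' := congrArg Subtype.val e
        subst e
        have : v = v' := hxv.symm.trans hxv'
        subst this
        rfl
      · exact absurd ⟨y', (congrArg Subtype.val e).symm⟩ hx
      · exact absurd ⟨y, congrArg Subtype.val e⟩ hx'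
      · have e : y = y' := f.gl.emb_injective (congrArg Subtype.val e)
        subst e
        rfl
    · rintro ⟨x, hx, hxu⟩
      by_cases hf : x ∈ Set.range f.gl.emb
      · obtain ⟨y, rfl⟩ := hf
        refine ⟨Sum.inr ⟨y, fun ⟨z, hz⟩ => hx ⟨z, congrArg f.gl.emb hz⟩, ?_⟩, rfl⟩
        rw [← f.ptV_emb]
        exact hxu
      · exact ⟨Sum.inl ⟨⟨f.vert (Γ.ptV x), hxu⟩, x, hf, rfl⟩, rfl⟩
  let eV : (Σ v : {v // g.vert v = u}, {w // f.vert w = v.1}) ≃ {w // g.vert (f.vert w) = u} :=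
    { toFun := fun p => ⟨p.2.1, by rw [p.2.2, p.1.2]⟩
      invFun := fun w => ⟨⟨f.vert w.1, w.2⟩, w.1, rfl⟩
      left_inv := by
        rintro ⟨⟨v, hv⟩, w, hw⟩
        have hw : f.vert w = v := hw
        subst hw
        rfl
      right_inv := fun _ => rfl }
  have hV : Nat.card {w // g.vert (f.vert w) = u} =
      ∑ v : {v // g.vert v = u}, Nat.card {w // f.vert w = v.1} := by
    rw [← Nat.card_sigma]
    exact (Nat.card_congr eV).symm
  have hS : ∑ᶠ w : {w // g.vert (f.vert w) = u}, (Γ.genus w.1 : ℤ) =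
      ∑ v : {v // g.vert v = u}, ∑ᶠ w : {w // f.vert w = v.1}, (Γ.genus w.1 : ℤ) := by
    simp only [finsum_eq_sum_of_fintype]
    rw [← Fintype.sum_sigma', ← eV.sum_comp]
    rfl
  have e1 : 2 * ((h.fiber u).numEdges : ℤ) =
      (∑ v : {v // g.vert v = u}, 2 * ((f.fiber v.1).numEdges : ℤ)) +
        2 * ((g.fiber u).numEdges : ℤ) := by
    have := h.two_mul_numEdges_fiber u
    rw [hcon, ← g.two_mul_numEdges_fiber u] at this
    simp only [← f.two_mul_numEdges_fiber] at this
    exact_mod_cast this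
  rw [← Finset.mul_sum] at e1
  have e2 : (g.fiber u).totalGenus = ((g.fiber u).numEdges : ℤ) -
      Nat.card {v // g.vert v = u} + 1 + ∑ v : {v // g.vert v = u}, (Δ.genus v.1 : ℤ) := by
    rw [totalGenus, ← finsum_eq_sum_of_fintype]
  have e3 : ∀ v : {v // g.vert v = u}, (Δ.genus v.1 : ℤ) = ((f.fiber v.1).numEdges : ℤ) -
      Nat.card {w // f.vert w = v.1} + 1 + ∑ᶠ w : {w // f.vert w = v.1}, (Γ.genus w.1 : ℤ) :=
    fun v => f.genus_eq v.1
  have e4 : (h.fiber u).totalGenus = ((h.fiber u).numEdges : ℤ) -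
      Nat.card {w // g.vert (f.vert w) = u} + 1 +
        ∑ᶠ w : {w // g.vert (f.vert w) = u}, (Γ.genus w.1 : ℤ) := rfl
  rw [g.genus_eq u, e2, e4, hS, hV]
  simp only [e3, Finset.sum_add_distrib, Finset.sum_sub_distrib, Nat.cast_sum]
  simp only [Finset.sum_const, Finset.card_univ, Nat.card_eq_fintype_card]
  simp
  linarith

/-- The category of non-Σ modular graphs. -/
instance : Category Graph where
  Hom := Hom
  id Γ := ⟨PreHom.id Γ, genus_id Γ⟩
  comp f g := ⟨f.toPreHom.comp g.toPreHom, genus_comp f g⟩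
  id_comp f := rfl
  comp_id {Γ Δ} f := by
    refine Hom.ext (Gluing.ext rfl (funext fun x => ?_) rfl) rfl
    show (Gluing.refl Δ.fl Δ.inv).arc (f.gl.hit x) = f.gl.hit x
    rcases f.gl.hit x with y | e <;> rfl
  assoc f g h := by
    refine Hom.ext (Gluing.ext rfl (funext fun x => ?_) rfl) rfl
    exact (Gluing.comp_arc g.gl h.gl (fun y _ => g.inv_emb y) (f.gl.hit x)).symm

/-- An arc located at the vertex `v`, as an arc of `Leg(v)`. -/
def restrictArc (Γ : Graph) (v : Γ.Vert) : (a : Γ.fl.Arc) → Γ.arcV a = v → (Γ.legAt v).Arc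
  | Sum.inl x, h => Sum.inl ⟨x, h⟩
  | Sum.inr e, h => Sum.inr ⟨e, h⟩

theorem map_restrictArc (Γ : Graph) (v : Γ.Vert) (a : Γ.fl.Arc) (h : Γ.arcV a = v) :
    Sum.map Subtype.val Subtype.val (Γ.restrictArc v a h) = a := by
  rcases a with a | a <;> rfl

theorem restrictArc_congr (Γ : Graph) (v : Γ.Vert) {a a' : Γ.fl.Arc} (haa' : a = a')
    (h : Γ.arcV a = v) : Γ.restrictArc v a h = Γ.restrictArc v a' (haa' ▸ h) := by
  subst haa'; rfl

/-- The identification of the flags of `Δ` at `v` with the legs of the preimage of `v`. -/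
noncomputable def PreHom.fiberGluing {Γ Δ : Graph} (f : PreHom Γ Δ) (v : Δ.Vert) :
    Gluing (f.fiber v).fl (f.fiber v).inv (Δ.legAt v) where
  emb y := ⟨f.gl.emb y.1, (f.ptV_emb y.1).trans y.2⟩
  hit x := Δ.restrictArc v (f.gl.hit x.1) ((f.arcV (Sum.inl x.1)).trans x.2)
  emp e := ⟨f.gl.emp e.1, (f.arcV (Sum.inr e.1)).trans e.2⟩
  hit_emb y := Δ.restrictArc_congr v (f.gl.hit_emb y.1) _
  hit_succ y := Δ.restrictArc_congr v (f.gl.hit_succ y.1) _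
  hit_inv x hx := by
    have hx' : x.1 ∉ Set.range f.gl.emb := fun ⟨y, hy⟩ =>
      hx ⟨⟨y, by rw [← f.ptV_emb, hy]; exact x.2⟩, Subtype.ext hy⟩
    refine Δ.restrictArc_congr v ?_ _
    show f.gl.hit x.1 = f.gl.hit (Γ.fl.succ (f.cutInv x.1))
    rw [f.cutInv_of_notMem hx', f.gl.hit_inv _ hx']
  surj := by
    rintro (⟨y, hy⟩ | ⟨e, he⟩)
    · exact ⟨Sum.inl ⟨f.gl.emb y, (f.ptV_emb y).trans hy⟩, Δ.restrictArc_congr v (f.gl.hit_emb y) _⟩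
    · obtain ⟨x | e', h⟩ := f.gl.arc_surjective (Sum.inr e)
      · have h' : f.gl.hit x = Sum.inr e := h
        have hv : f.vert (Γ.ptV x) = v :=
          (f.arcV (Sum.inl x)).symm.trans ((congrArg Δ.arcV h).trans he)
        exact ⟨Sum.inl ⟨x, hv⟩, Δ.restrictArc_congr v h' _⟩
      · have h' : f.gl.emp e' = e := Sum.inr_injective h
        have hv : f.vert (Γ.empV e') = v :=
          (f.arcV (Sum.inr e')).symm.trans ((congrArg Δ.arcV h).trans he)
        exact ⟨Sum.inr ⟨e', hv⟩, congrArg Sum.inr (Subtype.ext h')⟩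
  ker := by
    have mem_range : ∀ x : {x // f.vert (Γ.ptV x) = v}, x.1 ∉ Set.range f.gl.emb →
        x ∉ Set.range (fun y : {y // Δ.ptV y = v} =>
          (⟨f.gl.emb y.1, (f.ptV_emb y.1).trans y.2⟩ : {x // f.vert (Γ.ptV x) = v})) :=
      fun x hx ⟨y, hy⟩ => hx ⟨y.1, congrArg Subtype.val hy⟩
    have key : ∀ a a' : Γ.fl.Arc, Relation.EqvGen f.gl.Adj a a' →
        ∀ b b' : (f.fiber v).fl.Arc, Sum.map Subtype.val Subtype.val b = a →
          Sum.map Subtype.val Subtype.val b' = a' → Relation.EqvGen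
          (fun b b' : (f.fiber v).fl.Arc => ∃ x, x ∉ Set.range (fun y : {y // Δ.ptV y = v} =>
            (⟨f.gl.emb y.1, (f.ptV_emb y.1).trans y.2⟩ : {x // f.vert (Γ.ptV x) = v})) ∧
            b = Sum.inl x ∧ b' = Sum.inl ((f.fiber v).fl.succ ((f.fiber v).inv x))) b b' := by
      have hinj : Function.Injective (Sum.map Subtype.val Subtype.val :
          (f.fiber v).fl.Arc → Γ.fl.Arc) :=
        Sum.map_injective.2 ⟨Subtype.val_injective, Subtype.val_injective⟩
      have hV : ∀ b : (f.fiber v).fl.Arc, f.vert (Γ.arcV (Sum.map Subtype.val Subtype.val b)) = v := by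
        rintro (b | b) <;> exact b.2
      intro a a' h
      induction h with
      | rel a a' h =>
        obtain ⟨x, hx, rfl, rfl⟩ := h
        intro b b' hb hb'
        rcases b with b | b
        · have hb : b.1 = x := Sum.inl_injective hb
          subst hb
          refine .rel _ _ ⟨b, mem_range b hx, rfl, hinj ?_⟩
          refine hb'.trans (congrArg Sum.inl ?_)
          show _ = Γ.fl.succ (f.cutInv b.1)
          rw [f.cutInv_of_notMem hx]
        · cases hb
      | refl a =>
        intro b b' hb hb'
        rw [hinj (hb.trans hb'.symm)]
        exact .refl _
      | symm _ _ _ ih => exact fun b b' hb hb' => (ih b' b hb' hb).symm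
      | trans a c a' h h' ih ih' =>
        intro b b' hb hb'
        have hc : f.vert (Γ.arcV c) = v := by
          rw [← f.arcV, ← (f.gl.arc_eq_iff a c).2 h, f.arcV, ← hb]
          exact hV b
        obtain ⟨d, hd⟩ : ∃ d : (f.fiber v).fl.Arc, Sum.map Subtype.val Subtype.val d = c := by
          rcases c with c | c
          exacts [⟨Sum.inl ⟨c, hc⟩, rfl⟩, ⟨Sum.inr ⟨c, hc⟩, rfl⟩]
        exact (ih b d hb hd).trans _ _ _ (ih' d b' hd hb')
    intro b b' h
    have harc : ∀ b : (f.fiber v).fl.Arc, Sum.map Subtype.val Subtype.val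
        ((Sum.elim (fun x => Δ.restrictArc v (f.gl.hit x.1) ((f.arcV (Sum.inl x.1)).trans x.2))
          (Sum.inr ∘ fun e => ⟨f.gl.emp e.1, (f.arcV (Sum.inr e.1)).trans e.2⟩) :
          (f.fiber v).fl.Arc → (Δ.legAt v).Arc) b) =
        f.gl.arc (Sum.map Subtype.val Subtype.val b) := by
      rintro (b | b)
      · exact Δ.map_restrictArc v _ _
      · rfl
    have h2 := congrArg (Sum.map Subtype.val Subtype.val : _ → Δ.fl.Arc) h
    rw [harc, harc, f.gl.arc_eq_iff] at h2
    exact key _ _ h2 b b' rfl rfl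

theorem range_canonical (S : MultCyc) (τ : Equiv.Perm S.pt) :
    Set.range (Gluing.canonical S τ).emb = {x | τ x = x} := Subtype.range_val

/-- The isomorphism from the legs of the preimage of the vertex `v` to `Leg(v)`. -/
noncomputable def PreHom.fiberLabel {Γ Δ : Graph} (f : PreHom Γ Δ) (v : Δ.Vert) :
    (f.fiber v).leg ⟶ Δ.legAt v :=
  (Gluing.canonical _ _).iso (f.fiberGluing v) (by
    rw [range_canonical]
    ext x
    have h : (f.fiber v).inv x = x ↔ x.1 ∈ Set.range f.gl.emb := by
      rw [← f.cutInv_eq_iff]; exact Subtype.ext_iff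
    refine h.trans ?_
    refine ⟨fun ⟨y, hy⟩ => ⟨⟨y, by rw [← f.ptV_emb, hy]; exact x.2⟩, Subtype.ext hy⟩, ?_⟩
    rintro ⟨y, rfl⟩
    exact ⟨y.1, rfl⟩)

end Graph

/-! ### The categories of labelled graphs -/

/-- An object of the category `Γ(S; g)`: a non-Σ modular graph of genus `g` together with an
isomorphism from its multicyclically ordered set of legs to `S`. -/
structure LGraph (S : MultCyc) (g : ℕ) : Type 1 where
  gr : Graph
  lab : gr.leg ⟶ S
  genus_eq : gr.totalGenus = g

namespace LGraph

variable {S T : MultCyc} {g : ℕ}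

/-- The way in which `S` arises from the flags of the graph by gluing along all edges. -/
noncomputable def gl (X : LGraph S g) : Gluing X.gr.fl X.gr.inv S :=
  (Gluing.canonical X.gr.fl X.gr.inv).map X.lab

/-- Morphisms of labelled graphs: morphisms of graphs that preserve the labelling of the boundary
by `S`. On legs this means that `f` preserves their labels; on oriented edge cycles without legs
and on empty components it means that `f` preserves the label of the resulting empty component. -/
@[ext]
structure Hom (X Y : LGraph S g) where
  hom : X.gr ⟶ Y.gr
  label : ∀ a, Y.gl.arc (hom.gl.arc a) = X.gl.arc a

/-- The category `Γ(S; g)`. -/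
instance : Category (LGraph S g) where
  Hom := Hom
  id X := ⟨𝟙 X.gr, fun a => by rcases a with a | a <;> rfl⟩
  comp {X Y Z} f f' := ⟨f.hom ≫ f'.hom, fun a => by
    rw [← f.label, ← f'.label]
    exact congrArg _ (Gluing.comp_arc f.hom.gl f'.hom.gl (fun y _ => f.hom.inv_emb y) a)⟩
  id_comp f := Hom.ext (Category.id_comp f.hom)
  comp_id f := Hom.ext (Category.comp_id f.hom)
  assoc f f' f'' := Hom.ext (Category.assoc f.hom f'.hom f''.hom)

/-- Relabelling along an isomorphism. -/
noncomputable def relabel (X : LGraph S g) (f : S ⟶ T) : LGraph T g := ⟨X.gr, X.lab ≫ f, X.genus_eq⟩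

/-- The preimage of a vertex under a morphism of graphs, with its legs labelled by `Leg(v)`. -/
noncomputable def fiber {Γ Δ : Graph} (f : Γ ⟶ Δ) (v : Δ.Vert) :
    LGraph (Δ.legAt v) (Δ.genus v) :=
  ⟨f.toPreHom.fiber v, f.toPreHom.fiberLabel v, (f.genus_eq v).symm⟩

end LGraph

/-- The underlying graph of the corolla: one vertex of genus `g` with `S` as flags, and no edges. -/
abbrev corolla (S : MultCyc) (g : ℕ) : Graph where
  fl := S
  Vert := Unit
  ptV _ := ()
  empV _ := ()
  ptV_succ _ := rfl
  surj := fun _ => S.nonempty.elim fun a => ⟨a, by rcases a <;> rfl⟩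
  genus _ := g
  inv := 1
  inv_inv _ := rfl
  conn _ _ := .refl _

/-- The corolla `⋆`, with the evident labelling of its legs by `S`. -/
noncomputable def star (S : MultCyc) (g : ℕ) : LGraph S g where
  gr := corolla S g
  lab := (Gluing.canonical S 1).iso (Gluing.refl S _) (by
    rw [Graph.range_canonical]; exact (Set.range_id.trans (by ext; simp)).symm)
  genus_eq := by
    have h := (corolla S g).two_mul_numEdges
    have : IsEmpty {x // (corolla S g).inv x ≠ x} := ⟨fun x => x.2 rfl⟩
    rw [Nat.card_of_isEmpty] at h
    have h : (corolla S g).numEdges = 0 := by omega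
    have : Unique (corolla S g).Vert := inferInstanceAs (Unique Unit)
    rw [Graph.totalGenus, h, finsum_unique, Nat.card_unique]
    simp

theorem star_arc (S : MultCyc) (g : ℕ) (a : S.Arc) : (star S g).gl.arc a = a := by
  refine (Gluing.map_arc _ _ _).trans ?_
  refine (Gluing.iso_arc (Gluing.canonical S 1) (Gluing.refl S _) _ a).trans ?_
  rcases a with a | a <;> rfl

theorem LGraph.mem_range {S : MultCyc} {g : ℕ} (X : LGraph S g) (x : X.gr.fl.pt) :
    x ∈ Set.range X.gl.emb ↔ X.gr.inv x = x := by
  have : Set.range X.gl.emb = {x | X.gr.inv x = x} := by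
    rw [← Graph.range_canonical]
    exact X.lab.pt.symm.surjective.range_comp (Gluing.canonical X.gr.fl X.gr.inv).emb
  rw [this]; rfl

/-- The contraction of all edges, without the condition on the genera. -/
noncomputable def toStarPre {S : MultCyc} {g : ℕ} (X : LGraph S g) :
    X.gr.PreHom (star S g).gr where
  gl := X.gl
  vert _ := ()
  inv_emb y := (X.mem_range _).1 ⟨y, rfl⟩
  mem_of_leg x hx := (X.mem_range x).2 hx
  arcV _ := rfl
  conn v w _ := by
    have h := X.gr.conn v w
    induction h with
    | rel v w h =>
      obtain ⟨x, hv, hw⟩ := h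
      by_cases hx : X.gr.inv x = x
      · rw [hx, hv] at hw
        rw [hw]
        exact .refl _
      · exact .rel _ _ ⟨x, fun h => hx ((X.mem_range x).1 h), hv, hw⟩
    | refl v => exact .refl v
    | symm _ _ _ ih => exact ih.symm
    | trans _ _ _ _ _ ih ih' => exact ih.trans _ _ _ ih'

/-- The contraction of all edges of a labelled graph. -/
noncomputable def toStar {S : MultCyc} {g : ℕ} (X : LGraph S g) : X ⟶ star S g where
  hom :=
    { toPreHom := toStarPre X
      genus_eq := fun v => by
        have h1 : ((toStarPre X).fiber v).numEdges = X.gr.numEdges := by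
          have h := (toStarPre X).two_mul_numEdges_fiber v
          have e : Nat.card ((toStarPre X).Con v) = Nat.card {x // X.gr.inv x ≠ x} :=
            Nat.card_congr (Equiv.subtypeEquivRight fun x =>
              ⟨fun h h' => h.1 ((X.mem_range x).2 h'),
                fun h => ⟨fun h' => h ((X.mem_range x).1 h'), rfl⟩⟩)
          rw [e, ← X.gr.two_mul_numEdges] at h
          omega
        let eV : ((toStarPre X).fiber v).Vert ≃ X.gr.Vert := Equiv.subtypeUnivEquiv fun _ => rfl
        have h2 : ∑ᶠ w, (((toStarPre X).fiber v).genus w : ℤ) = ∑ᶠ w, (X.gr.genus w : ℤ) :=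
          finsum_eq_of_bijective eV eV.bijective fun _ => rfl
        rw [Graph.totalGenus, h1, Nat.card_congr eV, h2]
        exact X.genus_eq.symm }
  label a := star_arc S g _

/-- The corolla is a terminal object of `Γ(S; g)`. -/
noncomputable def isTerminalStar (S : MultCyc) (g : ℕ) : IsTerminal (star S g) :=
  IsTerminal.ofUniqueHom toStar fun X f => by
    have harc : f.hom.gl.arc = X.gl.arc := funext fun a => by
      exact (star_arc S g _).symm.trans (f.label a)
    have hhit : f.hom.gl.hit = X.gl.hit := funext fun x => congrFun harc (Sum.inl x)
    have hemp : f.hom.gl.emp = X.gl.emp :=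
      funext fun e => Sum.inr_injective (congrFun harc (Sum.inr e))
    have hemb : f.hom.gl.emb = X.gl.emb := funext fun y => by
      obtain ⟨z, hz⟩ := (X.mem_range (f.hom.gl.emb y)).2 (f.hom.inv_emb y)
      have h1 := f.hom.gl.hit_emb y
      rw [← hz, hhit, X.gl.hit_emb] at h1
      rw [← hz, Sum.inl_injective h1]
    exact LGraph.Hom.ext (Graph.Hom.ext (Gluing.ext hemb hhit hemp) rfl)

/-! ### Merging and cutting -/

section MergeCut

open Classical in
/-- The merging `S ∪ T ∖ {u, v}` of the disjoint union of `S` and `T`. The component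
`a₁ < ⋯ < aₖ < u` of `u` and the component `v < b₁ < ⋯ < bₗ` of `v` are replaced by the cyclically
ordered set represented by `a₁ < ⋯ < aₖ < b₁ < ⋯ < bₗ`. -/
noncomputable abbrev merge (S T : MultCyc) (u : S.pt) (v : T.pt) : MultCyc :=
  glue (S.sum T) (Equiv.swap (Sum.inl u) (Sum.inr v))

open Classical in
/-- The cut `S ∖ {u, v}`. If `u` and `v` lie in different components, these are replaced by one as
for `merge`. If they lie in the same component, it is replaced by the two open intervals with
boundary points `u` and `v`. -/
noncomputable abbrev cut (S : MultCyc) (u v : S.pt) : MultCyc := glue S (Equiv.swap u v)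

variable {S T : MultCyc}

open Classical in
/-- An element of `S` as an element of the merging. -/
def mergeLeft {u : S.pt} {v : T.pt} (x : S.pt) (h : x ≠ u) : (merge S T u v).pt :=
  ⟨Sum.inl x, Equiv.swap_apply_of_ne_of_ne (by simpa using h) (by simp)⟩

open Classical in
/-- An element of `T` as an element of the merging. -/
def mergeRight {u : S.pt} {v : T.pt} (x : T.pt) (h : x ≠ v) : (merge S T u v).pt :=
  ⟨Sum.inr x, Equiv.swap_apply_of_ne_of_ne (by simp) (by simpa using h)⟩

open Classical in
/-- An element of `S` as an element of the cut. -/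
def cutPt {u v : S.pt} (x : S.pt) (hu : x ≠ u) (hv : x ≠ v) : (cut S u v).pt :=
  ⟨x, Equiv.swap_apply_of_ne_of_ne hu hv⟩

/-- The arc of the merging on which an arc of `S` lies. -/
noncomputable def mergeArcLeft (u : S.pt) (v : T.pt) (a : S.Arc) : (merge S T u v).Arc :=
  (Gluing.canonical (S.sum T) _).arc (Sum.map Sum.inl Sum.inl a)

/-- The arc of the merging on which an arc of `T` lies. -/
noncomputable def mergeArcRight (u : S.pt) (v : T.pt) (a : T.Arc) : (merge S T u v).Arc :=
  (Gluing.canonical (S.sum T) _).arc (Sum.map Sum.inr Sum.inr a)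

/-- The arc of the cut on which an arc of `S` lies. -/
noncomputable def cutArc (u v : S.pt) (a : S.Arc) : (cut S u v).Arc :=
  (Gluing.canonical S _).arc a

theorem card_swap_ne {α : Type} [DecidableEq α] {a b : α} (h : a ≠ b) :
    Nat.card {x // Equiv.swap a b x ≠ x} = 2 := by
  have e : {x | Equiv.swap a b x ≠ x} = {a, b} := by
    ext x
    rcases eq_or_ne x a with rfl | ha
    · simp [h.symm]
    · rcases eq_or_ne x b with rfl | hb
      · simp [h]
      · simp [Equiv.swap_apply_of_ne_of_ne ha hb, ha, hb]
  rw [← Set.ncard_pair h, ← e]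
  rfl

/-- The graph with two vertices with flags `S` and `T` of genera `g` and `h`, and one edge, which
joins the flags `u` and `v`. Its legs form the merging of `S` and `T` at `u` and `v`. -/
noncomputable def edgeGraph (u : S.pt) (v : T.pt) (g h : ℕ) : LGraph (merge S T u v) (g + h) := by
  classical
  exact
  { gr :=
      { fl := S.sum T
        Vert := Bool
        ptV := Sum.elim (fun _ => false) (fun _ => true)
        empV := Sum.elim (fun _ => false) (fun _ => true)
        ptV_succ := by rintro (x | x) <;> rfl
        surj := by
          rintro (_ | _)
          · exact ⟨Sum.inl (Sum.inl u), rfl⟩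
          · exact ⟨Sum.inl (Sum.inr v), rfl⟩
        genus := fun i => cond i h g
        inv := Equiv.swap (Sum.inl u) (Sum.inr v)
        inv_inv := fun x => by rw [← Equiv.Perm.mul_apply, Equiv.swap_mul_self]; rfl
        conn := by
          have key : Relation.EqvGen (fun i j : Bool => ∃ x : S.pt ⊕ T.pt,
              (Sum.elim (fun _ => false) (fun _ => true) x : Bool) = i ∧
              (Sum.elim (fun _ => false) (fun _ => true)
                (Equiv.swap (Sum.inl u) (Sum.inr v) x) : Bool) = j) false true :=
            .rel _ _ ⟨Sum.inl u, rfl, by rw [Equiv.swap_apply_left]; rfl⟩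
          rintro (_ | _) (_ | _)
          exacts [.refl _, key, key.symm, .refl _] }
    lab := 𝟙 _
    genus_eq := by
      rw [Graph.totalGenus, Graph.numEdges, card_swap_ne (by simp), finsum_eq_sum_of_fintype,
        Nat.card_eq_fintype_card]
      simp
      ring }

/-- The graph with one vertex with flags `S` of genus `g`, and one loop, which joins the flags `u`
and `v`. Its legs form the cut of `S` at `u` and `v`. -/
noncomputable def loopGraph (u v : S.pt) (huv : u ≠ v) (g : ℕ) : LGraph (cut S u v) (g + 1) := by
  classical
  exact
  { gr := { corolla S g with
        inv := Equiv.swap u v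
        inv_inv := fun x => by rw [← Equiv.Perm.mul_apply, Equiv.swap_mul_self]; rfl
        conn := fun _ _ => .refl _ }
    lab := 𝟙 _
    genus_eq := by
      rw [Graph.totalGenus, Graph.numEdges, card_swap_ne huv, finsum_eq_sum_of_fintype,
        Nat.card_eq_fintype_card]
      simp
      ring }

end MergeCut

/-! ### Unordered tensor products -/

section Tensor

variable {M : Type u} [Category.{v} M] [MonoidalCategory M] {ι κ : Type}

/-- The tensor product of the objects `X i` in the order of a list. -/
def listTensor (X : ι → M) : List ι → M
  | [] => 𝟙_ M
  | i :: l => X i ⊗ listTensor X l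

/-- The tensor product of the morphisms `m k`, mapping into the tensor product over the image of a
list under `p`. -/
def listTensorMapTo {X : κ → M} {Y : ι → M} (p : κ → ι) (m : ∀ k, X k ⟶ Y (p k)) :
    ∀ l : List κ, listTensor X l ⟶ listTensor Y (l.map p)
  | [] => 𝟙 _
  | k :: l => m k ⊗ₘ listTensorMapTo p m l

/-- The tensor product of the morphisms `m k`, mapping from the tensor product over the image of a
list under `p`. -/
def listTensorMapFrom {X : ι → M} {Y : κ → M} (p : κ → ι) (m : ∀ k, X (p k) ⟶ Y k) :
    ∀ l : List κ, listTensor X (l.map p) ⟶ listTensor Y l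
  | [] => 𝟙 _
  | k :: l => m k ⊗ₘ listTensorMapFrom p m l

/-- The tensor product over a concatenation of two lists. -/
def listTensorAppend (X : ι → M) :
    ∀ l l' : List ι, listTensor X (l ++ l') ⟶ listTensor X l ⊗ listTensor X l'
  | [], _ => (λ_ _).inv
  | i :: l, l' => X i ◁ listTensorAppend X l l' ≫ (α_ _ _ _).inv

/-- Given lists `fib k` and morphisms from the tensor product over `fib k` to `Y k`, the induced
morphism from the tensor product over the concatenation of the lists `fib k`, for `k` in a list, to
the tensor product of the `Y k`. -/
def listTensorBlock {X : ι → M} {Y : κ → M} (fib : κ → List ι)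
    (m : ∀ k, listTensor X (fib k) ⟶ Y k) :
    ∀ l : List κ, listTensor X (l.flatMap fib) ⟶ listTensor Y l
  | [] => 𝟙 _
  | k :: l => listTensorAppend X (fib k) (l.flatMap fib) ≫ (m k ⊗ₘ listTensorBlock fib m l)

variable [SymmetricCategory M]

open Classical in
/-- Moving the factor `X i` to the front by means of the commutativity constraint. -/
noncomputable def moveFront (X : ι → M) (i : ι) :
    ∀ l : List ι, i ∈ l → (listTensor X l ⟶ X i ⊗ listTensor X (l.erase i))
  | [], h => absurd h List.not_mem_nil
  | j :: l, h =>
    if hj : j = i then eqToHom (by subst hj; rw [List.erase_cons_head]; rfl)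
    else X j ◁ moveFront X i l ((List.mem_cons.1 h).resolve_left fun h => hj h.symm) ≫
      (α_ _ _ _).inv ≫ ((β_ (X j) (X i)).hom ▷ _) ≫ (α_ _ _ _).hom ≫
      X i ◁ eqToHom (by rw [List.erase_cons_tail (by simpa using hj)]; rfl)

open Classical in
/-- The canonical morphism (built from associativity and commutativity constraints) between the
tensor products over two orderings of the same set. -/
noncomputable def reorder (X : ι → M) :
    ∀ l l' : List ι, l.Perm l' → (listTensor X l ⟶ listTensor X l')
  | l, [], h => eqToHom (by rw [h.eq_nil])
  | l, i :: l', h => moveFront X i l (h.mem_iff.2 List.mem_cons_self) ≫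
      X i ◁ reorder X (l.erase i) l' (by simpa using h.erase i)

/-- A chosen ordering of a finite set. -/
noncomputable def ordering (ι : Type) [Finite ι] : List ι :=
  (Set.finite_univ : (Set.univ : Set ι).Finite).toFinset.toList

theorem mem_ordering {ι : Type} [Finite ι] (i : ι) : i ∈ ordering ι := by simp [ordering]

theorem nodup_ordering (ι : Type) [Finite ι] : (ordering ι).Nodup := Finset.nodup_toList _

theorem ordering_perm {ι : Type} [Finite ι] {l : List ι} (h : l.Nodup) (h' : ∀ i, i ∈ l) :
    (ordering ι).Perm l :=
  (List.perm_ext_iff_of_nodup (nodup_ordering ι) h).2 fun i => by simp [mem_ordering, h']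

theorem ordering_perm_flatMap {ι κ : Type} [Finite ι] [Finite κ] (p : ι → κ) :
    (ordering ι).Perm
      ((ordering κ).flatMap fun k => (ordering {i // p i = k}).map Subtype.val) := by
  refine ordering_perm (List.nodup_flatMap.2 ⟨fun k _ =>
    (nodup_ordering _).map Subtype.val_injective, ?_⟩) fun i => ?_
  · refine (nodup_ordering κ).imp fun {k k'} hkk' i hi hi' => hkk' ?_
    obtain ⟨j, -, rfl⟩ := List.mem_map.1 hi
    obtain ⟨j', -, hj'⟩ := List.mem_map.1 hi'
    rw [← j.2, ← j'.2, hj']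
  · exact List.mem_flatMap.2 ⟨p i, mem_ordering _, List.mem_map.2 ⟨⟨i, rfl⟩, mem_ordering _, rfl⟩⟩

theorem perm_ordering_unit : [()].Perm (ordering Unit) := (ordering_perm (by simp) (by simp)).symm

theorem perm_ordering_bool : [false, true].Perm (ordering Bool) :=
  (ordering_perm (by simp) (by simp)).symm

end Tensor

/-! ### Non-Σ modular modules and operads -/

section Operads

variable {M : Type u} [Category.{v} M]

/-- A non-Σ modular module in `M`: a functor from the product of the category of multicyclically
ordered finite sets and their isomorphisms with the discrete category of natural numbers. -/
abbrev NsModule (M : Type u) [Category.{v} M] := MultCyc × Discrete ℕ ⥤ M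

namespace NsModule

/-- The component `P((S; g))`. -/
def ob (P : NsModule M) (S : MultCyc) (g : ℕ) : M := P.obj (S, ⟨g⟩)

/-- The morphism of components induced by an isomorphism of multicyclically ordered sets. -/
def mp (P : NsModule M) {S T : MultCyc} {g h : ℕ} (f : S ⟶ T) (e : g = h) :
    P.ob S g ⟶ P.ob T h :=
  P.map (Prod.mkHom f (Discrete.eqToHom e) : (S, (⟨g⟩ : Discrete ℕ)) ⟶ (T, ⟨h⟩))

/-- `P` is geometric if `P((S; g))` is the initial object `0` unless `(S, g)` is geometric. -/
def IsGeometric [HasInitial M] (P : NsModule M) : Prop :=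
  ∀ (S : MultCyc) (g : ℕ), ¬ Geometric S g → Nonempty (P.ob S g ≅ ⊥_ M)

end NsModule

section Distinct

variable {S T : MultCyc}

theorem mergeLeft_ne_mergeRight {u : S.pt} {v : T.pt} {x : S.pt} {y : T.pt} (hx : x ≠ u)
    (hy : y ≠ v) : (mergeLeft x hx : (merge S T u v).pt) ≠ mergeRight y hy := by
  simp [mergeLeft, mergeRight]

theorem mergeLeft_ne {u : S.pt} {v : T.pt} {x y : S.pt} (hx : x ≠ u) (hy : y ≠ u) (h : x ≠ y) :
    (mergeLeft x hx : (merge S T u v).pt) ≠ mergeLeft y hy := by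
  simp [mergeLeft, h]

theorem cutPt_ne {u v x y : S.pt} (hxu : x ≠ u) (hxv : x ≠ v) (hyu : y ≠ u) (hyv : y ≠ v)
    (h : x ≠ y) : (cutPt x hxu hxv : (cut S u v).pt) ≠ cutPt y hyu hyv := by
  simp [cutPt, h]

end Distinct

open MultCyc in
/-- The structure of a non-Σ modular operad on the non-Σ modular module `P`: compositions `comp u v`
and contractions `contr u v` with the usual axioms. In each axiom the two sides are morphisms to the
components of `P` at two presentations of the same multicyclically ordered set, which are identified
by the isomorphism `φ` that is compatible with the evident identifications of elements and
components: the identity on the remaining elements, and, as for the components, such that each arc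
of the sets one starts from lies on corresponding arcs. There is exactly one such `φ`. -/
structure NsModularOperad [MonoidalCategory M] [SymmetricCategory M] (P : NsModule M) where
  comp : ∀ {S T : MultCyc} (u : S.pt) (v : T.pt) (g h : ℕ),
    P.ob S g ⊗ P.ob T h ⟶ P.ob (merge S T u v) (g + h)
  contr : ∀ {S : MultCyc} (u v : S.pt) (_ : u ≠ v) (g : ℕ), P.ob S g ⟶ P.ob (cut S u v) (g + 1)
  contr_symm : ∀ {S : MultCyc} (u v : S.pt) (huv : u ≠ v) (g : ℕ) (φ : cut S u v ⟶ cut S v u),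
    (∀ x, arcMap φ (cutArc u v x) = cutArc v u x) →
    contr u v huv g ≫ P.mp φ rfl = contr v u huv.symm g
  comp_symm : ∀ {S T : MultCyc} (u : S.pt) (v : T.pt) (g h : ℕ)
    (φ : merge S T u v ⟶ merge T S v u),
    (∀ x, arcMap φ (mergeArcLeft u v x) = mergeArcRight v u x) →
    (∀ x, arcMap φ (mergeArcRight u v x) = mergeArcLeft v u x) →
    comp u v g h ≫ P.mp φ (add_comm g h) = (β_ (P.ob S g) (P.ob T h)).hom ≫ comp v u h g
  comp_comp : ∀ {S₁ S₂ S₃ : MultCyc} (a : S₁.pt) (b c : S₂.pt) (d : S₃.pt) (hbc : b ≠ c)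
    (g₁ g₂ g₃ : ℕ)
    (φ : merge S₁ (merge S₂ S₃ c d) a (mergeLeft b hbc) ⟶
      merge (merge S₁ S₂ a b) S₃ (mergeRight c hbc.symm) d),
    (∀ x, arcMap φ (mergeArcLeft _ _ x) = mergeArcLeft _ _ (mergeArcLeft a b x)) →
    (∀ x, arcMap φ (mergeArcRight _ _ (mergeArcLeft c d x)) =
      mergeArcLeft _ _ (mergeArcRight a b x)) →
    (∀ x, arcMap φ (mergeArcRight _ _ (mergeArcRight c d x)) = mergeArcRight _ _ x) →
    (P.ob S₁ g₁ ◁ comp c d g₂ g₃) ≫ comp a (mergeLeft b hbc) g₁ (g₂ + g₃) ≫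
        P.mp φ (add_assoc g₁ g₂ g₃).symm =
      (α_ (P.ob S₁ g₁) (P.ob S₂ g₂) (P.ob S₃ g₃)).inv ≫ (comp a b g₁ g₂ ▷ P.ob S₃ g₃) ≫
        comp (mergeRight c hbc.symm) d (g₁ + g₂) g₃
  contr_contr : ∀ {S : MultCyc} (a b c d : S.pt) (hab : a ≠ b) (hac : a ≠ c) (had : a ≠ d)
    (hbc : b ≠ c) (hbd : b ≠ d) (hcd : c ≠ d) (g : ℕ)
    (φ : cut (cut S c d) (cutPt a hac had) (cutPt b hbc hbd) ⟶
      cut (cut S a b) (cutPt c hac.symm hbc.symm) (cutPt d had.symm hbd.symm)),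
    (∀ x, arcMap φ (cutArc _ _ (cutArc c d x)) = cutArc _ _ (cutArc a b x)) →
    contr c d hcd g ≫ contr _ _ (cutPt_ne hac had hbc hbd hab) (g + 1) ≫ P.mp φ rfl =
      contr a b hab g ≫
        contr _ _ (cutPt_ne hac.symm hbc.symm had.symm hbd.symm hcd) (g + 1)
  contr_comp : ∀ {S T : MultCyc} (a c : S.pt) (b d : T.pt) (hac : a ≠ c) (hbd : b ≠ d) (g h : ℕ)
    (φ : cut (merge S T c d) (mergeLeft a hac) (mergeRight b hbd) ⟶
      cut (merge S T a b) (mergeLeft c hac.symm) (mergeRight d hbd.symm)),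
    (∀ x, arcMap φ (cutArc _ _ (mergeArcLeft c d x)) = cutArc _ _ (mergeArcLeft a b x)) →
    (∀ x, arcMap φ (cutArc _ _ (mergeArcRight c d x)) = cutArc _ _ (mergeArcRight a b x)) →
    comp c d g h ≫ contr _ _ (mergeLeft_ne_mergeRight hac hbd) (g + h) ≫ P.mp φ rfl =
      comp a b g h ≫ contr _ _ (mergeLeft_ne_mergeRight hac.symm hbd.symm) (g + h)
  comp_contr : ∀ {S T : MultCyc} (a c d : S.pt) (b : T.pt) (hac : a ≠ c) (had : a ≠ d)
    (hcd : c ≠ d) (g h : ℕ)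
    (φ : merge (cut S c d) T (cutPt a hac had) b ⟶
      cut (merge S T a b) (mergeLeft c hac.symm) (mergeLeft d had.symm)),
    (∀ x, arcMap φ (mergeArcLeft _ _ (cutArc c d x)) = cutArc _ _ (mergeArcLeft a b x)) →
    (∀ x, arcMap φ (mergeArcRight _ _ x) = cutArc _ _ (mergeArcRight a b x)) →
    (contr c d hcd g ▷ P.ob T h) ≫ comp (cutPt a hac had) b (g + 1) h ≫
        P.mp φ (add_right_comm g 1 h) =
      comp a b g h ≫ contr _ _ (mergeLeft_ne hac.symm had.symm hcd) (g + h)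
  comp_natural : ∀ {S S' T T' : MultCyc} (ρ : S ⟶ S') (σ : T ⟶ T') (u : S.pt) (v : T.pt) (g h : ℕ)
    (φ : merge S T u v ⟶ merge S' T' (ρ.pt u) (σ.pt v)),
    (∀ x, arcMap φ (mergeArcLeft u v x) = mergeArcLeft _ _ (arcMap ρ x)) →
    (∀ x, arcMap φ (mergeArcRight u v x) = mergeArcRight _ _ (arcMap σ x)) →
    comp u v g h ≫ P.mp φ rfl = (P.mp ρ rfl ⊗ₘ P.mp σ rfl) ≫ comp (ρ.pt u) (σ.pt v) g h
  contr_natural : ∀ {S S' : MultCyc} (ρ : S ⟶ S') (u v : S.pt) (huv : u ≠ v) (g : ℕ)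
    (φ : cut S u v ⟶ cut S' (ρ.pt u) (ρ.pt v)),
    (∀ x, arcMap φ (cutArc u v x) = cutArc _ _ (arcMap ρ x)) →
    contr u v huv g ≫ P.mp φ rfl =
      P.mp ρ rfl ≫ contr (ρ.pt u) (ρ.pt v) (ρ.pt.injective.ne huv) g

/-! ### The value of a module on a graph -/

/-- The flags at a vertex of the preimage of `v` are the flags at this vertex in `Γ`. -/
def fiberLeg {Γ Δ : Graph} (f : Γ ⟶ Δ) (v : Δ.Vert) (w : {w // f.vert w = v}) :
    Γ.legAt w.1 ⟶ (LGraph.fiber f v).gr.legAt w where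
  pt :=
    { toFun := fun x => ⟨⟨x.1, by rw [x.2]; exact w.2⟩, Subtype.ext x.2⟩
      invFun := fun x => ⟨x.1.1, congrArg Subtype.val x.2⟩
      left_inv := fun _ => rfl
      right_inv := fun _ => rfl }
  emp :=
    { toFun := fun x => ⟨⟨x.1, by rw [x.2]; exact w.2⟩, Subtype.ext x.2⟩
      invFun := fun x => ⟨x.1.1, congrArg Subtype.val x.2⟩
      left_inv := fun _ => rfl
      right_inv := fun _ => rfl }
  map_succ _ := rfl

section GraphIso

variable {Γ Δ : Graph} (f : Γ ≅ Δ)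

theorem hom_emb_inv_emb (x : Γ.fl.pt) : f.hom.gl.emb (f.inv.gl.emb x) = x :=
  congrFun (congrArg (fun k : Γ ⟶ Γ => k.gl.emb) f.hom_inv_id) x

theorem inv_emb_hom_emb (x : Δ.fl.pt) : f.inv.gl.emb (f.hom.gl.emb x) = x :=
  hom_emb_inv_emb f.symm x

theorem inv_vert_hom_vert (w : Γ.Vert) : f.inv.vert (f.hom.vert w) = w :=
  congrFun (congrArg (fun k : Γ ⟶ Γ => k.vert) f.hom_inv_id) w

theorem inv_emp_hom_emp (e : Γ.fl.emp) : f.inv.gl.emp (f.hom.gl.emp e) = e :=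
  congrFun (congrArg (fun k : Γ ⟶ Γ => k.gl.emp) f.hom_inv_id) e

theorem ptV_inv_emb (x : Γ.fl.pt) : Δ.ptV (f.inv.gl.emb x) = f.hom.vert (Γ.ptV x) := by
  have h := f.inv.ptV_emb x
  rw [← h]
  exact (inv_vert_hom_vert f.symm _).symm

/-- The bijection of vertices given by an isomorphism of graphs. -/
def vertEquiv : Γ.Vert ≃ Δ.Vert where
  toFun := f.hom.vert
  invFun := f.inv.vert
  left_inv := inv_vert_hom_vert f
  right_inv := inv_vert_hom_vert f.symm

/-- The isomorphism of the multicyclically ordered sets of flags at corresponding vertices given by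
an isomorphism of graphs. -/
def legAtIso (w : Γ.Vert) : Γ.legAt w ⟶ Δ.legAt (f.hom.vert w) where
  pt :=
    { toFun := fun x => ⟨f.inv.gl.emb x.1, by rw [ptV_inv_emb, x.2]⟩
      invFun := fun y => ⟨f.hom.gl.emb y.1, by
        exact (ptV_inv_emb f.symm y.1).trans
          ((congrArg f.inv.vert y.2).trans (inv_vert_hom_vert f w))⟩
      left_inv := fun x => Subtype.ext (hom_emb_inv_emb f x.1)
      right_inv := fun y => Subtype.ext (inv_emb_hom_emb f y.1) }
  emp :=
    { toFun := fun e => ⟨f.hom.gl.emp e.1, by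
        exact (f.hom.arcV (Sum.inr e.1)).trans (congrArg f.hom.vert e.2)⟩
      invFun := fun e => ⟨f.inv.gl.emp e.1, by
        exact (f.inv.arcV (Sum.inr e.1)).trans
          ((congrArg f.inv.vert e.2).trans (inv_vert_hom_vert f w))⟩
      left_inv := fun e => Subtype.ext (inv_emp_hom_emp f e.1)
      right_inv := fun e => Subtype.ext (inv_emp_hom_emp f.symm e.1) }
  map_succ x := Subtype.ext (by
    show f.inv.gl.emb (Γ.fl.succ x.1) = Δ.fl.succ (f.inv.gl.emb x.1)
    have h := f.inv.gl.hit_succ x.1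
    have h' := f.inv.gl.hit_emb (f.hom.gl.emb (Δ.fl.succ (f.inv.gl.emb x.1)))
    rw [inv_emb_hom_emb] at h'
    rw [← Sum.inl_injective (h'.symm.trans h), inv_emb_hom_emb])

theorem genus_iso (w : Γ.Vert) : Γ.genus w = Δ.genus (f.hom.vert w) := by
  have h := f.hom.genus_eq (f.hom.vert w)
  have h1 : (f.hom.toPreHom.fiber (f.hom.vert w)).numEdges = 0 := by
    have h := f.hom.toPreHom.two_mul_numEdges_fiber (f.hom.vert w)
    have : IsEmpty (f.hom.toPreHom.Con (f.hom.vert w)) :=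
      ⟨fun x => x.2.1 ⟨_, hom_emb_inv_emb f x.1⟩⟩
    rw [Nat.card_of_isEmpty] at h
    omega
  let u : Unique (f.hom.toPreHom.fiber (f.hom.vert w)).Vert :=
    { default := ⟨w, rfl⟩
      uniq := fun w' => Subtype.ext ((vertEquiv f).injective w'.2) }
  rw [Graph.totalGenus, h1, finsum_unique, Nat.card_unique] at h
  have h2 : (Δ.genus (f.hom.vert w) : ℤ) = Γ.genus w := by
    rw [h]; simp [u, default]
  exact_mod_cast h2.symm

end GraphIso

namespace LGraph

/-- The underlying isomorphism of graphs. -/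
def isoGr {S : MultCyc} {g : ℕ} {X Y : LGraph S g} (f : X ≅ Y) : X.gr ≅ Y.gr where
  hom := f.hom.hom
  inv := f.inv.hom
  hom_inv_id := congrArg Hom.hom f.hom_inv_id
  inv_hom_id := congrArg Hom.hom f.inv_hom_id

end LGraph

/-- The flags at the vertex of a corolla. -/
def corollaLeg (S : MultCyc) (g : ℕ) : S ⟶ (corolla S g).legAt () where
  pt := (Equiv.subtypeUnivEquiv fun _ => rfl).symm
  emp := (Equiv.subtypeUnivEquiv fun _ => rfl).symm
  map_succ _ := rfl

/-- The flags at the first vertex of the graph with one edge. -/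
def edgeLegLeft {S T : MultCyc} (u : S.pt) (v : T.pt) (g h : ℕ) :
    S ⟶ (edgeGraph u v g h).gr.legAt false where
  pt :=
    { toFun := fun x => ⟨Sum.inl x, rfl⟩
      invFun := fun
        | ⟨Sum.inl x, _⟩ => x
        | ⟨Sum.inr _, h⟩ => absurd h (by rintro ⟨⟩)
      left_inv := fun _ => rfl
      right_inv := by rintro ⟨x | x, ⟨⟩⟩; rfl }
  emp :=
    { toFun := fun x => ⟨Sum.inl x, rfl⟩
      invFun := fun
        | ⟨Sum.inl x, _⟩ => x
        | ⟨Sum.inr _, h⟩ => absurd h (by rintro ⟨⟩)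
      left_inv := fun _ => rfl
      right_inv := by rintro ⟨x | x, ⟨⟩⟩; rfl }
  map_succ _ := rfl

/-- The flags at the second vertex of the graph with one edge. -/
def edgeLegRight {S T : MultCyc} (u : S.pt) (v : T.pt) (g h : ℕ) :
    T ⟶ (edgeGraph u v g h).gr.legAt true where
  pt :=
    { toFun := fun x => ⟨Sum.inr x, rfl⟩
      invFun := fun
        | ⟨Sum.inr x, _⟩ => x
        | ⟨Sum.inl _, h⟩ => absurd h (by rintro ⟨⟩)
      left_inv := fun _ => rfl
      right_inv := by rintro ⟨x | x, ⟨⟩⟩; rfl }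
  emp :=
    { toFun := fun x => ⟨Sum.inr x, rfl⟩
      invFun := fun
        | ⟨Sum.inr x, _⟩ => x
        | ⟨Sum.inl _, h⟩ => absurd h (by rintro ⟨⟩)
      left_inv := fun _ => rfl
      right_inv := by rintro ⟨x | x, ⟨⟩⟩; rfl }
  map_succ _ := rfl

namespace NsModule

variable [MonoidalCategory M]

/-- The tensor factor of `P(Γ)` at the vertex `w`. -/
abbrev factor (P : NsModule M) (Γ : Graph) (w : Γ.Vert) : M := P.ob (Γ.legAt w) (Γ.genus w)

/-- The unordered tensor product `P(Γ)` of the objects `P((Leg(w); g_w))` over all vertices `w` of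
the graph, realized by a chosen ordering of the vertices. -/
noncomputable def onGraph (P : NsModule M) (Γ : Graph) : M :=
  listTensor (P.factor Γ) (ordering Γ.Vert)

/-- The families of morphisms `α_Γ : P(Γ) ⟶ P((S; g))`, for all `(S, g)` and all `Γ` in
`Γ(S; g)`. -/
abbrev ContractionFamily (P : NsModule M) :=
  ∀ (S : MultCyc) (g : ℕ) (X : LGraph S g), P.onGraph X.gr ⟶ P.ob S g

variable [SymmetricCategory M] (P : NsModule M)

/-- The functoriality of `Γ ↦ P(Γ)` in isomorphisms of graphs. -/
noncomputable def onIso {Γ Δ : Graph} (f : Γ ≅ Δ) : P.onGraph Γ ⟶ P.onGraph Δ :=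
  listTensorMapTo (Y := P.factor Δ) (vertEquiv f)
      (fun w => P.mp (legAtIso f w) (genus_iso f w)) (ordering Γ.Vert) ≫
    reorder (P.factor Δ) _ (ordering Δ.Vert) (ordering_perm
      ((nodup_ordering Γ.Vert).map (vertEquiv f).injective) fun v =>
        List.mem_map.2 ⟨(vertEquiv f).symm v, mem_ordering _, Equiv.apply_symm_apply _ _⟩).symm

/-- For a family `α` and a morphism `f : Γ ⟶ Δ` of graphs, the tensor product over all vertices `v`
of `Δ` of the morphisms `α` of the preimages of `v`. Here `P(Γ)` is regrouped as the tensor product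
over `v` of the values of `P` on the preimages. -/
noncomputable def vertexwise (α : P.ContractionFamily) {Γ Δ : Graph} (f : Γ ⟶ Δ) :
    P.onGraph Γ ⟶ P.onGraph Δ :=
  reorder (P.factor Γ) (ordering Γ.Vert) _ (ordering_perm_flatMap f.vert) ≫
    listTensorBlock _ (fun v =>
      listTensorMapFrom (Y := P.factor (LGraph.fiber f v).gr) Subtype.val
          (fun w => P.mp (fiberLeg f v w) rfl) (ordering {w // f.vert w = v}) ≫
        α (Δ.legAt v) (Δ.genus v) (LGraph.fiber f v)) (ordering Δ.Vert)

/-- The canonical isomorphism from `P((S; g))` to the value of `P` on the corolla. -/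
noncomputable def toCorolla (S : MultCyc) (g : ℕ) : P.ob S g ⟶ P.onGraph (star S g).gr :=
  P.mp (corollaLeg S g) rfl ≫ (ρ_ _).inv ≫
    reorder (P.factor (corolla S g)) [()] (ordering Unit) perm_ordering_unit

/-- The canonical isomorphism from `P((S; g))` to the value of `P` on the graph with one loop. -/
noncomputable def toLoop {S : MultCyc} (u v : S.pt) (huv : u ≠ v) (g : ℕ) :
    P.ob S g ⟶ P.onGraph (loopGraph u v huv g).gr :=
  P.mp (corollaLeg S g) rfl ≫ (ρ_ _).inv ≫
    reorder (P.factor (loopGraph u v huv g).gr) [()] (ordering Unit) perm_ordering_unit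

/-- The canonical isomorphism from `P((S; g)) ⊗ P((T; h))` to the value of `P` on the graph with two
vertices and one edge. -/
noncomputable def toEdge {S T : MultCyc} (u : S.pt) (v : T.pt) (g h : ℕ) :
    P.ob S g ⊗ P.ob T h ⟶ P.onGraph (edgeGraph u v g h).gr :=
  (P.mp (edgeLegLeft u v g h) rfl ⊗ₘ (P.mp (edgeLegRight u v g h) rfl ≫ (ρ_ _).inv)) ≫
    reorder (P.factor (edgeGraph u v g h).gr) [false, true] (ordering Bool) perm_ordering_bool

/-- The functor `F` on `Γ(S; g)` has `Γ ↦ P(Γ)` as its object part, and extends the functor given by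
`P` on the isomorphisms as well as the family `α`: it acts on every morphism `f : Γ ⟶ Δ` by `α` of
the preimages of the vertices of `Δ`, and it sends the unique morphism `Γ ⟶ ⋆` to `α_Γ`. -/
structure Extends {S : MultCyc} {g : ℕ} (α : P.ContractionFamily) (F : LGraph S g ⥤ M) : Prop where
  obj : ∀ X, F.obj X = P.onGraph X.gr
  map_iso : ∀ {X Y : LGraph S g} (f : X ≅ Y),
    F.map f.hom = eqToHom (obj X) ≫ P.onIso (LGraph.isoGr f) ≫ eqToHom (obj Y).symm
  map : ∀ {X Y : LGraph S g} (f : X ⟶ Y),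
    F.map f = eqToHom (obj X) ≫ P.vertexwise α f.hom ≫ eqToHom (obj Y).symm
  map_star : ∀ X : LGraph S g, F.map ((isTerminalStar S g).from X) =
    eqToHom (obj X) ≫ α S g X ≫ P.toCorolla S g ≫ eqToHom (obj (star S g)).symm

end NsModule

/-- `α` is the family of contractions along graphs of the operad `O`. It is compatible with
isomorphisms of graphs and of multicyclically ordered sets, it is the identity on corollas, it is
given by `O.comp` and `O.contr` on graphs with one edge, and if a graph is obtained by grafting two
graphs at one leg each (a graph with two vertices and one edge being the result of contracting all
other edges), or one graph at two of its legs, then the contraction along it is the contraction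
along these graphs followed by `O.comp` or `O.contr`. -/
structure NsModularOperad.IsContraction [MonoidalCategory M] [SymmetricCategory M] {P : NsModule M}
    (O : NsModularOperad P) (α : P.ContractionFamily) : Prop where
  iso : ∀ {S : MultCyc} {g : ℕ} {X Y : LGraph S g} (f : X ≅ Y),
    P.onIso (LGraph.isoGr f) ≫ α S g Y = α S g X
  relabel : ∀ {S T : MultCyc} {g : ℕ} (X : LGraph S g) (f : S ⟶ T),
    α T g (X.relabel f) = α S g X ≫ P.mp f rfl
  star : ∀ (S : MultCyc) (g : ℕ), P.toCorolla S g ≫ α S g (star S g) = 𝟙 (P.ob S g)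
  edge : ∀ {S T : MultCyc} (u : S.pt) (v : T.pt) (g h : ℕ),
    P.toEdge u v g h ≫ α (merge S T u v) (g + h) (edgeGraph u v g h) = O.comp u v g h
  loop : ∀ {S : MultCyc} (u v : S.pt) (huv : u ≠ v) (g : ℕ),
    P.toLoop u v huv g ≫ α (cut S u v) (g + 1) (loopGraph u v huv g) = O.contr u v huv g
  graft : ∀ {S T : MultCyc} (u : S.pt) (v : T.pt) (g h : ℕ) (X : LGraph (merge S T u v) (g + h))
    (f : X ⟶ edgeGraph u v g h),
    α (merge S T u v) (g + h) X =
      P.vertexwise α f.hom ≫ α (merge S T u v) (g + h) (edgeGraph u v g h)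
  selfGraft : ∀ {S : MultCyc} (u v : S.pt) (huv : u ≠ v) (g : ℕ) (X : LGraph (cut S u v) (g + 1))
    (f : X ⟶ loopGraph u v huv g),
    α (cut S u v) (g + 1) X =
      P.vertexwise α f.hom ≫ α (cut S u v) (g + 1) (loopGraph u v huv g)

end Operads

end NsMod

namespace NsMod

/-! ### Coherence for unordered tensor products -/

section Coherence

variable {M : Type u} [Category.{v} M] [MonoidalCategory M] {ι κ μ : Type}

/-- The canonical morphism between the tensor products over equal lists. -/
def listCast (X : ι → M) {l l' : List ι} (h : l = l') : listTensor X l ⟶ listTensor X l' :=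
  eqToHom (congrArg (listTensor X) h)

@[simp]
theorem listCast_rfl (X : ι → M) (l : List ι) : listCast X (rfl : l = l) = 𝟙 _ := rfl

/-- Tensoring with the first factor. -/
def consMap (X : ι → M) (i : ι) {l l' : List ι} (f : listTensor X l ⟶ listTensor X l') :
    listTensor X (i :: l) ⟶ listTensor X (i :: l') := X i ◁ f

@[simp]
theorem consMap_id (X : ι → M) (i : ι) (l : List ι) :
    consMap X i (𝟙 (listTensor X l)) = 𝟙 (listTensor X (i :: l)) := whiskerLeft_id _ _

theorem consMap_comp (X : ι → M) (i : ι) {l l' l'' : List ι} (f : listTensor X l ⟶ listTensor X l')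
    (g : listTensor X l' ⟶ listTensor X l'') :
    consMap X i (f ≫ g) = consMap X i f ≫ consMap X i g := whiskerLeft_comp _ _ _

theorem consMap_comp_assoc (X : ι → M) (i : ι) {l l' l'' : List ι}
    (f : listTensor X l ⟶ listTensor X l') (g : listTensor X l' ⟶ listTensor X l'') {Z : M}
    (h : listTensor X (i :: l'') ⟶ Z) :
    consMap X i (f ≫ g) ≫ h = consMap X i f ≫ consMap X i g ≫ h := by
  rw [consMap_comp, Category.assoc]

theorem consMap_listCast (X : ι → M) (i : ι) {l l' : List ι} (h : l = l') :
    consMap X i (listCast X h) = listCast X (congrArg (List.cons i) h) := by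
  subst h; exact whiskerLeft_id _ _

variable [SymmetricCategory M]

/-- Exchanging the first two of three factors. -/
def swapFront (A B C : M) : A ⊗ B ⊗ C ⟶ B ⊗ A ⊗ C :=
  (α_ _ _ _).inv ≫ ((β_ A B).hom ▷ _) ≫ (α_ _ _ _).hom

theorem swapFront_natural {A A' B B' C C' : M} (f : A ⟶ A') (g : B ⟶ B') (h : C ⟶ C') :
    (f ⊗ₘ (g ⊗ₘ h)) ≫ swapFront A' B' C' = swapFront A B C ≫ (g ⊗ₘ (f ⊗ₘ h)) := by
  simp only [swapFront, Category.assoc]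
  rw [← associator_naturality, associator_inv_naturality_assoc]
  congr 1
  simp only [← Category.assoc]
  congr 1
  rw [← tensorHom_id, ← tensorHom_id, MonoidalCategory.tensorHom_comp_tensorHom,
    MonoidalCategory.tensorHom_comp_tensorHom, BraidedCategory.braiding_naturality]
  simp

theorem swapFront_natural_right (A B : M) {C C' : M} (h : C ⟶ C') :
    A ◁ B ◁ h ≫ swapFront A B C' = swapFront A B C ≫ B ◁ A ◁ h := by
  simpa using swapFront_natural (𝟙 A) (𝟙 B) h

@[simp]
theorem swapFront_swapFront (A B C : M) : swapFront A B C ≫ swapFront B A C = 𝟙 _ := by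
  simp [swapFront, ← comp_whiskerRight_assoc]

theorem swapFront_yangBaxter (A B C D : M) :
    swapFront A B (C ⊗ D) ≫ B ◁ swapFront A C D ≫ swapFront B C (A ⊗ D) =
      A ◁ swapFront B C D ≫ swapFront A C (B ⊗ D) ≫ C ◁ swapFront A B D := by
  have h := congrArg (fun k => (𝟙 (A ⊗ B ⊗ C ⊗ D) ⊗≫ (k ▷ D) ⊗≫ 𝟙 (C ⊗ B ⊗ A ⊗ D)))
    (BraidedCategory.yang_baxter' A B C)
  simp only [swapFront]
  refine Eq.trans ?_ (h.trans ?_) <;> monoidal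

/-- Exchanging the first two factors. -/
def consSwap (X : ι → M) (i j : ι) (l : List ι) :
    listTensor X (i :: j :: l) ⟶ listTensor X (j :: i :: l) := swapFront _ _ _

theorem consSwap_natural (X : ι → M) (i j : ι) {l l' : List ι}
    (f : listTensor X l ⟶ listTensor X l') :
    consMap X i (consMap X j f) ≫ consSwap X i j l' =
      consSwap X i j l ≫ consMap X j (consMap X i f) := swapFront_natural_right _ _ _

@[simp]
theorem consSwap_consSwap (X : ι → M) (i j : ι) (l : List ι) :
    consSwap X i j l ≫ consSwap X j i l = 𝟙 _ := swapFront_swapFront _ _ _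

theorem consSwap_yangBaxter (X : ι → M) (i j k : ι) (l : List ι) :
    consSwap X i j (k :: l) ≫ consMap X j (consSwap X i k l) ≫ consSwap X j k (i :: l) =
      consMap X i (consSwap X j k l) ≫ consSwap X i k (j :: l) ≫ consMap X k (consSwap X i j l) :=
  swapFront_yangBaxter _ _ _ _

open Classical in
/-- `moveFront`, as a morphism between tensor products over lists. -/
noncomputable def moveToFront (X : ι → M) (i : ι) (l : List ι) (h : i ∈ l) :
    listTensor X l ⟶ listTensor X (i :: l.erase i) := moveFront X i l h

open Classical in
theorem moveToFront_of_ne (X : ι → M) {i j : ι} (hj : j ≠ i) (l : List ι) (h : i ∈ l)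
    (h' : i ∈ j :: l) (e : j :: l.erase i = (j :: l).erase i) :
    moveToFront X i (j :: l) h' = consMap X j (moveToFront X i l h) ≫ consSwap X j i (l.erase i) ≫
      consMap X i (listCast X e) := by
  rw [moveToFront, moveFront, dif_neg hj]
  simp only [consSwap, swapFront, consMap]
  refine congrArg (fun k => X j ◁ moveFront X i l h ≫ k) ?_
  exact ((Category.assoc _ _ _).trans (congrArg (fun k => _ ≫ k) (Category.assoc _ _ _))).symm

open Classical in
/-- `moveFront`, with the list of the remaining factors given up to equality. -/
noncomputable def moveTo (X : ι → M) (i : ι) (l t : List ι) (h : i ∈ l) (ht : l.erase i = t) :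
    listTensor X l ⟶ listTensor X (i :: t) :=
  moveToFront X i l h ≫ consMap X i (listCast X ht)

open Classical in
theorem moveTo_head (X : ι → M) (i : ι) (t : List ι) (h : i ∈ i :: t)
    (ht : (i :: t).erase i = t) : moveTo X i (i :: t) t h ht = 𝟙 _ := by
  rw [moveTo, moveToFront, moveFront, dif_pos rfl, consMap_listCast, listCast]
  exact (eqToHom_trans _ _).trans (eqToHom_refl _ _)

open Classical in
theorem moveTo_cons (X : ι → M) {i j : ι} (hj : j ≠ i) (l t : List ι) (h : i ∈ l)
    (ht : l.erase i = t) (h' : i ∈ j :: l) (ht' : (j :: l).erase i = j :: t) :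
    moveTo X i (j :: l) (j :: t) h' ht' =
      consMap X j (moveTo X i l t h ht) ≫ consSwap X j i t := by
  subst ht
  have e : listCast X ht'.symm ≫ listCast X ht' = 𝟙 _ :=
    (eqToHom_trans _ _).trans (eqToHom_refl _ _)
  rw [moveTo, moveToFront_of_ne X hj l h h' ht'.symm, Category.assoc, Category.assoc,
    ← consMap_comp, e, moveTo, listCast_rfl, consMap_id, consMap_id, Category.comp_id,
    Category.comp_id]

open Classical in
theorem reorder_cons (X : ι → M) (i : ι) (l t l' : List ι) (h : l.Perm (i :: l')) (hi : i ∈ l)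
    (ht : l.erase i = t) (ht' : t.Perm l') :
    reorder X l (i :: l') h = moveTo X i l t hi ht ≫ consMap X i (reorder X t l' ht') := by
  subst ht
  rw [moveTo, listCast_rfl, consMap_id, Category.comp_id, reorder]
  rfl

theorem reorder_nil (X : ι → M) (h : ([] : List ι).Perm []) :
    reorder X [] [] h = 𝟙 _ := by
  rw [reorder, eqToHom_refl]

theorem reorder_cons_cons (X : ι → M) (i : ι) (l l' : List ι) (h : (i :: l).Perm (i :: l'))
    (h' : l.Perm l') : reorder X (i :: l) (i :: l') h = consMap X i (reorder X l l' h') := by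
  classical
  rw [reorder_cons X i (i :: l) l l' h List.mem_cons_self (List.erase_cons_head _ _) h',
    moveTo_head]
  exact Category.id_comp _

theorem reorder_refl (X : ι → M) : ∀ (l : List ι) (h : l.Perm l), reorder X l l h = 𝟙 _
  | [], h => reorder_nil X h
  | i :: l, h => by
    rw [reorder_cons_cons X i l l h (List.Perm.refl l), reorder_refl X l, consMap_id]

open Classical in
theorem moveTo_moveTo (X : ι → M) {i j : ι} (hij : i ≠ j) : ∀ (l t₁ t₂ t : List ι) (hi : i ∈ l)
    (hj : j ∈ l) (h₁ : l.erase j = t₁) (h₂ : l.erase i = t₂) (hi' : i ∈ t₁) (hj' : j ∈ t₂)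
    (h : t₁.erase i = t) (h' : t₂.erase j = t),
    moveTo X j l t₁ hj h₁ ≫ consMap X j (moveTo X i t₁ t hi' h) ≫ consSwap X j i t =
      moveTo X i l t₂ hi h₂ ≫ consMap X i (moveTo X j t₂ t hj' h')
  | k :: l, t₁, t₂, t, hi, hj, h₁, h₂, hi', hj', h, h' => by
    by_cases hkj : k = j
    · subst hkj
      rw [List.erase_cons_head] at h₁
      subst h₁
      rw [List.erase_cons_tail (by simpa using hij.symm)] at h₂
      subst h₂
      rw [List.erase_cons_head] at h'
      subst h'
      rw [moveTo_head, moveTo_head, moveTo_cons X hij.symm l _ hi' rfl, consMap_id,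
        Category.id_comp, Category.comp_id]
    · by_cases hki : k = i
      · subst hki
        rw [List.erase_cons_head] at h₂
        subst h₂
        rw [List.erase_cons_tail (by simpa using hkj)] at h₁
        subst h₁
        rw [List.erase_cons_head] at h
        subst h
        rw [moveTo_head, moveTo_head, moveTo_cons X hij l _ hj' rfl, consMap_id,
          Category.id_comp, Category.id_comp, Category.assoc, consSwap_consSwap, Category.comp_id]
      · have hi0 : i ∈ l := (List.mem_cons.1 hi).resolve_left (Ne.symm hki)
        have hj0 : j ∈ l := (List.mem_cons.1 hj).resolve_left (Ne.symm hkj)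
        rw [List.erase_cons_tail (by simpa using hkj)] at h₁
        rw [List.erase_cons_tail (by simpa using hki)] at h₂
        subst h₁ h₂
        rw [List.erase_cons_tail (by simpa using hki)] at h
        rw [List.erase_cons_tail (by simpa using hkj)] at h'
        subst h
        have hi1 : i ∈ l.erase j := (List.mem_erase_of_ne hij).2 hi0
        have hj1 : j ∈ l.erase i := (List.mem_erase_of_ne hij.symm).2 hj0
        have e : (l.erase i).erase j = (l.erase j).erase i := List.erase_comm _ _
        have ih := moveTo_moveTo X hij l _ _ _ hi0 hj0 rfl rfl hi1 hj1 rfl e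
        rw [moveTo_cons X hkj l _ hj0 rfl, moveTo_cons X hki l _ hi0 rfl,
          moveTo_cons X hki (l.erase j) _ hi1 rfl, moveTo_cons X hkj (l.erase i) _ hj1 e]
        have yb := consSwap_yangBaxter X k j i ((l.erase j).erase i)
        have n1 := consSwap_natural X k j (moveTo X i (l.erase j) _ hi1 rfl)
        have n2 := consSwap_natural X k i (moveTo X j (l.erase i) _ hj1 e)
        simp only [consMap_comp, Category.assoc]
        rw [← reassoc_of% n1, yb, ← reassoc_of% n2]
        simp only [← consMap_comp_assoc, ← ih]

open Classical in
theorem reorder_moveTo (X : ι → M) (i : ι) : ∀ (l l' t t' : List ι) (h : l.Perm l') (hi : i ∈ l)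
    (hi' : i ∈ l') (ht : l.erase i = t) (ht' : l'.erase i = t') (htt' : t.Perm t'),
    reorder X l l' h ≫ moveTo X i l' t' hi' ht' =
      moveTo X i l t hi ht ≫ consMap X i (reorder X t t' htt')
  | l, j :: l', t, t', h, hi, hi', ht, ht', htt' => by
    by_cases hj : j = i
    · subst hj
      rw [List.erase_cons_head] at ht'
      subst ht'
      rw [moveTo_head, Category.comp_id, reorder_cons X j l t l' h hi ht htt']
    · have hi0 : i ∈ l' := (List.mem_cons.1 hi').resolve_left (Ne.symm hj)
      rw [List.erase_cons_tail (by simpa using hj)] at ht'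
      subst ht ht'
      have hjl : j ∈ l := h.mem_iff.2 List.mem_cons_self
      have hp : (l.erase j).Perm l' := by simpa using h.erase j
      have hi1 : i ∈ l.erase j := (List.mem_erase_of_ne (Ne.symm hj)).2 hi
      have hj1 : j ∈ l.erase i := (List.mem_erase_of_ne hj).2 hjl
      have e : (l.erase i).erase j = (l.erase j).erase i := List.erase_comm _ _
      have ih := reorder_moveTo X i (l.erase j) l' _ _ hp hi1 hi0 rfl rfl (hp.erase i)
      rw [reorder_cons X j l _ l' h hjl rfl hp, moveTo_cons X hj l' _ hi0 rfl,
        reorder_cons X j (l.erase i) _ _ htt' hj1 e (hp.erase i)]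
      simp only [consMap_comp, Category.assoc]
      rw [← consMap_comp_assoc, ih, consMap_comp, Category.assoc, consSwap_natural]
      have := moveTo_moveTo X (Ne.symm hj) l _ _ _ hi hjl rfl rfl hi1 hj1 rfl e
      rw [← reassoc_of% this]

theorem reorder_comp (X : ι → M) : ∀ (l l' l'' : List ι) (h : l.Perm l') (h' : l'.Perm l''),
    reorder X l l' h ≫ reorder X l' l'' h' = reorder X l l'' (h.trans h')
  | l, l', [], h, h' => by
    obtain rfl := h'.eq_nil
    obtain rfl := h.eq_nil
    rw [reorder_nil, Category.comp_id]
  | l, l', i :: l'', h, h' => by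
    classical
    have hi' : i ∈ l' := h'.mem_iff.2 List.mem_cons_self
    have hi : i ∈ l := h.mem_iff.2 hi'
    have hp : (l'.erase i).Perm l'' := by simpa using h'.erase i
    rw [reorder_cons X i l' _ l'' h' hi' rfl hp,
      reorder_cons X i l _ l'' (h.trans h') hi rfl ((h.erase i).trans hp), ← reorder_comp X _ _ l''
        (h.erase i) hp, consMap_comp, ← Category.assoc, ← Category.assoc,
      reorder_moveTo X i l l' _ _ h hi hi' rfl rfl (h.erase i)]

theorem reorder_swap (X : ι → M) (i j : ι) (l : List ι) (hij : i ≠ j)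
    (h : (i :: j :: l).Perm (j :: i :: l)) :
    reorder X (i :: j :: l) (j :: i :: l) h = consSwap X i j l := by
  classical
  have e : (i :: j :: l).erase j = i :: l := by
    rw [List.erase_cons_tail (by simpa using hij), List.erase_cons_head]
  rw [reorder_cons X j _ _ _ h (by simp) e (List.Perm.refl _), reorder_refl, consMap_id,
    Category.comp_id, moveTo_cons X hij (j :: l) l List.mem_cons_self (List.erase_cons_head _ _),
    moveTo_head, consMap_id, Category.id_comp]

end Coherence

section Coherence

variable {M : Type u} [Category.{v} M] [MonoidalCategory M] {ι κ μ ι' κ' : Type}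

section Append

variable (X : ι → M)

theorem consMap_append (i : ι) {a a' b b' : List ι}
    (f : listTensor X (a ++ b) ⟶ listTensor X (a' ++ b')) (g : listTensor X a ⟶ listTensor X a')
    (h : listTensor X b ⟶ listTensor X b')
    (e : f ≫ listTensorAppend X a' b' = listTensorAppend X a b ≫ (g ⊗ₘ h)) :
    consMap X i f ≫ listTensorAppend X (i :: a') b' =
      listTensorAppend X (i :: a) b ≫ (consMap X i g ⊗ₘ h) := by
  change X i ◁ f ≫ X i ◁ listTensorAppend X a' b' ≫ (α_ _ _ _).inv =
    (X i ◁ listTensorAppend X a b ≫ (α_ _ _ _).inv) ≫ (X i ◁ g ⊗ₘ h)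
  rw [← whiskerLeft_comp_assoc, e]
  simp [MonoidalCategory.tensorHom_def]

variable [SymmetricCategory M]

theorem reorder_append_right (a : List ι) {b b' : List ι} (h : b.Perm b')
    (h' : (a ++ b).Perm (a ++ b')) :
    reorder X _ _ h' ≫ listTensorAppend X a b' =
      listTensorAppend X a b ≫ listTensor X a ◁ reorder X b b' h := by
  induction a with
  | nil =>
    change reorder X b b' h ≫ (λ_ _).inv = (λ_ _).inv ≫ 𝟙_ M ◁ reorder X b b' h
    simp
  | cons i a ih =>
    have h'' : (a ++ b).Perm (a ++ b') := h.append_left a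
    have e : reorder X (i :: (a ++ b)) (i :: (a ++ b')) h' = X i ◁ reorder X _ _ h'' :=
      reorder_cons_cons X i _ _ h' h''
    have key : ∀ r : X i ⊗ listTensor X (a ++ b) ⟶ X i ⊗ listTensor X (a ++ b'),
        r = X i ◁ reorder X _ _ h'' →
        r ≫ X i ◁ listTensorAppend X a b' ≫ (α_ _ _ _).inv =
          (X i ◁ listTensorAppend X a b ≫ (α_ _ _ _).inv) ≫
            (X i ⊗ listTensor X a) ◁ reorder X b b' h := by
      rintro _ rfl
      rw [← whiskerLeft_comp_assoc, ih h'']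
      simp
    exact key _ e

theorem consSwap_append (i j : ι) (a b : List ι) :
    consSwap X i j (a ++ b) ≫ listTensorAppend X (j :: i :: a) b =
      listTensorAppend X (i :: j :: a) b ≫ consSwap X i j a ▷ listTensor X b := by
  change swapFront (X i) (X j) (listTensor X (a ++ b)) ≫
      X j ◁ (X i ◁ listTensorAppend X a b ≫ (α_ _ _ _).inv) ≫ (α_ _ _ _).inv =
    (X i ◁ (X j ◁ listTensorAppend X a b ≫ (α_ _ _ _).inv) ≫ (α_ _ _ _).inv) ≫
      swapFront (X i) (X j) (listTensor X a) ▷ listTensor X b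
  have := swapFront_natural_right (X i) (X j) (listTensorAppend X a b)
  simp only [whiskerLeft_comp, Category.assoc, ← reassoc_of% this]
  simp [swapFront]

theorem reorder_append_left {a a' : List ι} (b : List ι) (h : a.Perm a') :
    ∀ h' : (a ++ b).Perm (a' ++ b), reorder X _ _ h' ≫ listTensorAppend X a' b =
      listTensorAppend X a b ≫ reorder X a a' h ▷ listTensor X b := by
  induction h with
  | nil =>
    intro h'
    rw [reorder_refl, reorder_refl]
    exact (Category.id_comp _).trans (by rw [id_whiskerRight, Category.comp_id])
  | @cons i a a' h ih =>
    intro h'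
    have h'' : (a ++ b).Perm (a' ++ b) := h.append_right b
    have e : reorder X (i :: (a ++ b)) (i :: (a' ++ b)) h' = consMap X i (reorder X _ _ h'') :=
      reorder_cons_cons X i _ _ h' h''
    rw [reorder_cons_cons X i _ _ _ h]
    refine (congrArg (fun k => k ≫ listTensorAppend X (i :: a') b) e).trans ?_
    have := consMap_append X i (reorder X _ _ h'') (reorder X a a' h) (𝟙 (listTensor X b))
      (by rw [ih h'', tensorHom_id])
    rwa [tensorHom_id] at this
  | swap i j a =>
    intro h'
    by_cases hij : i = j
    · subst hij
      rw [reorder_refl, reorder_refl]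
      exact (Category.id_comp _).trans (by rw [id_whiskerRight, Category.comp_id])
    · have e : reorder X (j :: i :: (a ++ b)) (i :: j :: (a ++ b)) h' =
        consSwap X j i (a ++ b) := reorder_swap X j i (a ++ b) (Ne.symm hij) h'
      rw [reorder_swap X j i a (Ne.symm hij)]
      exact (congrArg (fun k => k ≫ listTensorAppend X (i :: j :: a) b) e).trans
        (consSwap_append X j i a b)
  | @trans a a' a'' h₁ h₂ ih₁ ih₂ =>
    intro h'
    rw [← reorder_comp X _ _ _ (h₁.append_right b) (h₂.append_right b), Category.assoc, ih₂,
      ← Category.assoc, ih₁, Category.assoc, ← comp_whiskerRight, reorder_comp]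

theorem reorder_append {a a' b b' : List ι} (h : a.Perm a') (h' : b.Perm b')
    (h'' : (a ++ b).Perm (a' ++ b')) : reorder X _ _ h'' ≫ listTensorAppend X a' b' =
      listTensorAppend X a b ≫ (reorder X a a' h ⊗ₘ reorder X b b' h') := by
  rw [← reorder_comp X _ _ _ (h.append_right b) (h'.append_left a'), Category.assoc,
    reorder_append_right X a' h', ← Category.assoc, reorder_append_left X b h, Category.assoc,
    MonoidalCategory.tensorHom_def]

theorem reorder_insert (i : ι) : ∀ (b c : List ι) (_ : i ∉ b) (h : (i :: (b ++ c)).Perm (b ++ i :: c)),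
    reorder X _ _ h ≫ listTensorAppend X b (i :: c) =
      ((X i ◁ listTensorAppend X b c) : listTensor X (i :: (b ++ c)) ⟶ _) ≫
        swapFront (X i) (listTensor X b) (listTensor X c)
  | [], c, _, h => by
    have e : reorder X (i :: c) (i :: c) h = 𝟙 (X i ⊗ listTensor X c) := reorder_refl _ _ _
    have key : ∀ r : X i ⊗ listTensor X c ⟶ X i ⊗ listTensor X c, r = 𝟙 _ →
        r ≫ (λ_ (X i ⊗ listTensor X c)).inv =
          X i ◁ (λ_ (listTensor X c)).inv ≫ swapFront (X i) (𝟙_ M) (listTensor X c) := by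
      rintro _ rfl
      rw [Category.id_comp, swapFront, braiding_tensorUnit_right]
      monoidal
    exact key _ e
  | j :: b, c, hi, h => by
    have hij : i ≠ j := fun e => hi (by simp [e])
    have hib : i ∉ b := fun e => hi (by simp [e])
    have h1 : (i :: j :: (b ++ c)).Perm (j :: i :: (b ++ c)) := List.Perm.swap _ _ _
    have h2 : (i :: (b ++ c)).Perm (b ++ i :: c) := List.perm_middle.symm
    have e : reorder X (i :: j :: (b ++ c)) (j :: (b ++ i :: c)) h =
        swapFront (X i) (X j) (listTensor X (b ++ c)) ≫ X j ◁ reorder X _ _ h2 := by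
      rw [← reorder_comp X _ _ _ h1 (h2.cons j), reorder_swap X i j _ hij,
        reorder_cons_cons X j _ _ _ h2]
      rfl
    have ih := reorder_insert i b c hib h2
    have hx : ∀ A B C D : M, swapFront A B (C ⊗ D) ≫ B ◁ swapFront A C D ≫ (α_ B C (A ⊗ D)).inv =
        A ◁ (α_ B C D).inv ≫ swapFront A (B ⊗ C) D := by
      intro A B C D
      simp [swapFront, BraidedCategory.braiding_tensor_right_hom]
    have key : ∀ (L : M) (r : X i ⊗ X j ⊗ listTensor X (b ++ c) ⟶ X j ⊗ L)
        (s : X i ⊗ listTensor X (b ++ c) ⟶ L)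
        (q : L ⟶ listTensor X b ⊗ X i ⊗ listTensor X c),
        r = swapFront (X i) (X j) (listTensor X (b ++ c)) ≫ X j ◁ s →
        s ≫ q = X i ◁ listTensorAppend X b c ≫ swapFront (X i) (listTensor X b) (listTensor X c) →
        r ≫ X j ◁ q ≫ (α_ (X j) (listTensor X b) (X i ⊗ listTensor X c)).inv =
          X i ◁ (X j ◁ listTensorAppend X b c ≫ (α_ _ _ _).inv) ≫
            swapFront (X i) (X j ⊗ listTensor X b) (listTensor X c) := by
      rintro L _ s q rfl hs
      have n := swapFront_natural_right (X i) (X j) (listTensorAppend X b c)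
      rw [Category.assoc, ← whiskerLeft_comp_assoc, hs, whiskerLeft_comp, whiskerLeft_comp,
        Category.assoc, Category.assoc, ← hx, ← reassoc_of% n]
    exact key _ _ _ _ e ih

theorem reorder_exchange : ∀ (a b c : List ι) (_ : a.Disjoint b)
    (h : (a ++ (b ++ c)).Perm (b ++ (a ++ c))),
    reorder X _ _ h ≫ listTensorAppend X b (a ++ c) ≫ listTensor X b ◁ listTensorAppend X a c =
      listTensorAppend X a (b ++ c) ≫ listTensor X a ◁ listTensorAppend X b c ≫
        swapFront (listTensor X a) (listTensor X b) (listTensor X c)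
  | [], b, c, _, h => by
    have e : reorder X (b ++ c) (b ++ c) h = 𝟙 _ := reorder_refl _ _ _
    change reorder X (b ++ c) (b ++ c) h ≫ listTensorAppend X b c ≫ listTensor X b ◁ (λ_ _).inv =
      (λ_ _).inv ≫ 𝟙_ M ◁ listTensorAppend X b c ≫ swapFront (𝟙_ M) _ _
    rw [e, Category.id_comp, swapFront, braiding_tensorUnit_left]
    monoidal
  | i :: a, b, c, hd, h => by
    have hib : i ∉ b := fun e => hd List.mem_cons_self e
    have hd' : a.Disjoint b := fun x hx hx' => hd (List.mem_cons_of_mem _ hx) hx'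
    have h1 : (a ++ (b ++ c)).Perm (b ++ (a ++ c)) := by
      rw [← List.append_assoc, ← List.append_assoc]
      exact List.perm_append_comm.append_right c
    have h2 : (i :: (b ++ (a ++ c))).Perm (b ++ i :: (a ++ c)) := List.perm_middle.symm
    have e : reorder X (i :: (a ++ (b ++ c))) (b ++ i :: (a ++ c)) h =
        (X i ◁ reorder X _ _ h1 : listTensor X (i :: (a ++ (b ++ c))) ⟶ _) ≫
          reorder X _ _ h2 := by
      rw [← reorder_comp X _ _ _ (h1.cons i) h2, reorder_cons_cons X i _ _ _ h1]
      rfl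
    have ih := reorder_exchange a b c hd' h1
    have hins := reorder_insert X i b (a ++ c) hib h2
    have hx : ∀ A B C D : M, A ◁ swapFront B C D ≫ swapFront A C (B ⊗ D) ≫ C ◁ (α_ A B D).inv =
        (α_ A B (C ⊗ D)).inv ≫ swapFront (A ⊗ B) C D := by
      intro A B C D
      simp [swapFront, BraidedCategory.braiding_tensor_left_hom]
    have key : ∀ (L : M) (r : X i ⊗ listTensor X (a ++ (b ++ c)) ⟶ L)
        (s : X i ⊗ listTensor X (b ++ (a ++ c)) ⟶ L)
        (q : L ⟶ listTensor X b ⊗ X i ⊗ listTensor X (a ++ c)),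
        r = X i ◁ reorder X _ _ h1 ≫ s →
        s ≫ q = X i ◁ listTensorAppend X b (a ++ c) ≫
          swapFront (X i) (listTensor X b) (listTensor X (a ++ c)) →
        r ≫ q ≫ listTensor X b ◁ (X i ◁ listTensorAppend X a c ≫ (α_ _ _ _).inv) =
          (X i ◁ listTensorAppend X a (b ++ c) ≫ (α_ _ _ _).inv) ≫
            (X i ⊗ listTensor X a) ◁ listTensorAppend X b c ≫
              swapFront (X i ⊗ listTensor X a) (listTensor X b) (listTensor X c) := by
      rintro L _ s q rfl hs
      have n := swapFront_natural_right (X i) (listTensor X b) (listTensorAppend X a c)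
      have ih' := congrArg (fun k => X i ◁ k) ih
      simp only [whiskerLeft_comp] at ih'
      rw [Category.assoc, reassoc_of% hs, whiskerLeft_comp, ← reassoc_of% n, reassoc_of% ih', hx]
      simp
    exact key _ _ _ _ e hins

theorem append_assoc (a b c : List ι) (h : (a ++ b ++ c).Perm (a ++ (b ++ c))) :
    listTensorAppend X (a ++ b) c ≫ listTensorAppend X a b ▷ listTensor X c ≫ (α_ _ _ _).hom =
      reorder X _ _ h ≫ listTensorAppend X a (b ++ c) ≫
        listTensor X a ◁ listTensorAppend X b c := by
  induction a with
  | nil =>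
    have e : reorder X (b ++ c) (b ++ c) h = 𝟙 _ := reorder_refl _ _ _
    change listTensorAppend X b c ≫ (λ_ _).inv ▷ listTensor X c ≫ (α_ _ _ _).hom =
      reorder X (b ++ c) (b ++ c) h ≫ (λ_ _).inv ≫ 𝟙_ M ◁ listTensorAppend X b c
    rw [e, Category.id_comp]
    monoidal
  | cons i a ih =>
    have h1 : (a ++ b ++ c).Perm (a ++ (b ++ c)) := by rw [List.append_assoc]
    have e : reorder X (i :: (a ++ b ++ c)) (i :: (a ++ (b ++ c))) h = X i ◁ reorder X _ _ h1 :=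
      reorder_cons_cons X i _ _ h h1
    have key : ∀ r : X i ⊗ listTensor X (a ++ b ++ c) ⟶ X i ⊗ listTensor X (a ++ (b ++ c)),
        r = X i ◁ reorder X _ _ h1 →
        (X i ◁ listTensorAppend X (a ++ b) c ≫ (α_ _ _ _).inv) ≫
          (X i ◁ listTensorAppend X a b ≫ (α_ _ _ _).inv) ▷ listTensor X c ≫ (α_ _ _ _).hom =
        r ≫ (X i ◁ listTensorAppend X a (b ++ c) ≫ (α_ _ _ _).inv) ≫
          (X i ⊗ listTensor X a) ◁ listTensorAppend X b c := by
      rintro _ rfl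
      have := congrArg (fun k => X i ◁ k ≫ (α_ _ _ _).inv) (ih h1)
      simp only [whiskerLeft_comp, Category.assoc] at this
      refine Eq.trans ?_ (this.trans ?_)
      · monoidal
      · simp
    exact key _ e

end Append

end Coherence

section Coherence

variable {M : Type u} [Category.{v} M] [MonoidalCategory M] {ι κ μ ι' κ' : Type}

section Block

variable {X : ι → M} {Y : κ → M} {Z : μ → M}

variable [SymmetricCategory M]

theorem flatMap_perm {fib fib' : κ → List ι} (h : ∀ k, (fib k).Perm (fib' k)) :
    ∀ L : List κ, (L.flatMap fib).Perm (L.flatMap fib')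
  | [] => List.Perm.refl _
  | k :: L => (h k).append (flatMap_perm h L)

/-- Reordering inside the blocks. -/
theorem reorder_block {fib fib' : κ → List ι} (h : ∀ k, (fib k).Perm (fib' k))
    (m : ∀ k, listTensor X (fib k) ⟶ Y k) (m' : ∀ k, listTensor X (fib' k) ⟶ Y k)
    (e : ∀ k, m k = reorder X _ _ (h k) ≫ m' k) : ∀ (L : List κ)
    (hL : (L.flatMap fib).Perm (L.flatMap fib')),
    reorder X _ _ hL ≫ listTensorBlock fib' m' L = listTensorBlock fib m L
  | [], hL => by
    change reorder X [] [] hL ≫ 𝟙 (listTensor X []) = 𝟙 _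
    rw [reorder_nil, Category.comp_id]
  | k :: L, hL => by
    have ih := reorder_block h m m' e L (flatMap_perm h L)
    have ha := reorder_append X (h k) (flatMap_perm h L) hL
    change reorder X (fib k ++ L.flatMap fib) (fib' k ++ L.flatMap fib') hL ≫
        listTensorAppend X (fib' k) (L.flatMap fib') ≫ (m' k ⊗ₘ listTensorBlock fib' m' L) =
      listTensorAppend X (fib k) (L.flatMap fib) ≫ (m k ⊗ₘ listTensorBlock fib m L)
    rw [← Category.assoc, ha, Category.assoc, MonoidalCategory.tensorHom_comp_tensorHom, ih, e k]

theorem swapFront_natural' {A A' B B' C C' : M} (f : A ⟶ A') (g : B ⟶ B') (h : C ⟶ C') :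
    swapFront A B C ≫ (g ⊗ₘ (f ⊗ₘ h)) = (f ⊗ₘ (g ⊗ₘ h)) ≫ swapFront A' B' C' :=
  (swapFront_natural f g h).symm

/-- Reordering the blocks. -/
theorem reorder_blocks (fib : κ → List ι) (hd : ∀ k k', k ≠ k' → (fib k).Disjoint (fib k'))
    (m : ∀ k, listTensor X (fib k) ⟶ Y k) {L L' : List κ} (h : L.Perm L') :
    ∀ hL : (L.flatMap fib).Perm (L'.flatMap fib),
    reorder X _ _ hL ≫ listTensorBlock fib m L' = listTensorBlock fib m L ≫ reorder Y L L' h := by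
  induction h with
  | nil =>
    intro hL
    rw [reorder_refl, reorder_refl, Category.comp_id, Category.id_comp]
  | @cons k L L' h ih =>
    intro hL
    have h' : (L.flatMap fib).Perm (L'.flatMap fib) := h.flatMap_right fib
    have ha := reorder_append_right X (fib k) h' hL
    have e := reorder_cons_cons Y k L L' (h.cons k) h
    change reorder X (fib k ++ L.flatMap fib) (fib k ++ L'.flatMap fib) hL ≫
        listTensorAppend X (fib k) (L'.flatMap fib) ≫ (m k ⊗ₘ listTensorBlock fib m L') = _
    rw [← Category.assoc, ha, e]
    change (listTensorAppend X (fib k) (L.flatMap fib) ≫ _) ≫ _ =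
      (listTensorAppend X (fib k) (L.flatMap fib) ≫ (m k ⊗ₘ listTensorBlock fib m L)) ≫
        Y k ◁ reorder Y L L' h
    rw [Category.assoc, Category.assoc]
    congr 1
    simp only [← id_tensorHom, MonoidalCategory.tensorHom_comp_tensorHom, Category.id_comp,
      Category.comp_id, ih h']
  | swap k k' L =>
    intro hL
    by_cases hk : k = k'
    · subst hk
      rw [reorder_refl, reorder_refl]
      exact (Category.id_comp _).trans (Category.comp_id _).symm
    · have ha := reorder_exchange X (fib k') (fib k) (L.flatMap fib) (hd _ _ (Ne.symm hk)) hL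
      have e : reorder Y (k' :: k :: L) (k :: k' :: L) (List.Perm.swap k k' L) =
        swapFront (Y k') (Y k) (listTensor Y L) := reorder_swap Y k' k L (Ne.symm hk) _
      rw [e]
      change reorder X (fib k' ++ (fib k ++ L.flatMap fib)) (fib k ++ (fib k' ++ L.flatMap fib)) hL ≫
          listTensorAppend X (fib k) (fib k' ++ L.flatMap fib) ≫
            (m k ⊗ₘ (listTensorAppend X (fib k') (L.flatMap fib) ≫
              (m k' ⊗ₘ listTensorBlock fib m L))) =
        (listTensorAppend X (fib k') (fib k ++ L.flatMap fib) ≫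
          (m k' ⊗ₘ (listTensorAppend X (fib k) (L.flatMap fib) ≫
              (m k ⊗ₘ listTensorBlock fib m L)))) ≫ swapFront (Y k') (Y k) (listTensor Y L)
      have h1 : ∀ {A A' B C C' D : M} (f : A ⟶ A') (g : B ⟶ C) (h : C ⟶ C'),
          (f ⊗ₘ (g ≫ h)) = A ◁ g ≫ (f ⊗ₘ h) := by
        intros; simp [MonoidalCategory.tensorHom_def']
      rw [h1 (D := Y k), h1 (D := Y k), reassoc_of% ha, Category.assoc, Category.assoc,
        swapFront_natural']
  | @trans L L' L'' h h' ih ih' =>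
    intro hL
    rw [← reorder_comp X _ _ _ (h.flatMap_right fib) (h'.flatMap_right fib), Category.assoc, ih',
      ← Category.assoc, ih, Category.assoc, reorder_comp]

theorem block_append (fib : κ → List ι) (m : ∀ k, listTensor X (fib k) ⟶ Y k) :
    ∀ (L L' : List κ) (h : ((L ++ L').flatMap fib).Perm (L.flatMap fib ++ L'.flatMap fib)),
    listTensorBlock fib m (L ++ L') ≫ listTensorAppend Y L L' =
      reorder X _ _ h ≫ listTensorAppend X (L.flatMap fib) (L'.flatMap fib) ≫
        (listTensorBlock fib m L ⊗ₘ listTensorBlock fib m L')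
  | [], L', h => by
    have e : reorder X (L'.flatMap fib) (L'.flatMap fib) h = 𝟙 _ := reorder_refl _ _ _
    change listTensorBlock fib m L' ≫ (λ_ _).inv = reorder X (L'.flatMap fib) (L'.flatMap fib) h ≫
      (λ_ _).inv ≫ (𝟙 (𝟙_ M) ⊗ₘ listTensorBlock fib m L')
    rw [e]
    simp
  | k :: L, L', h => by
    have h1 : ((L ++ L').flatMap fib).Perm (L.flatMap fib ++ L'.flatMap fib) := by
      rw [List.flatMap_append]
    have ih := block_append fib m L L' h1
    have h2 : (fib k ++ L.flatMap fib ++ L'.flatMap fib).Perm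
        (fib k ++ (L.flatMap fib ++ L'.flatMap fib)) := by rw [List.append_assoc]
    have ha := append_assoc X (fib k) (L.flatMap fib) (L'.flatMap fib) h2
    have h3 : (fib k ++ (L ++ L').flatMap fib).Perm
        (fib k ++ (L.flatMap fib ++ L'.flatMap fib)) := h1.append_left _
    have hr := reorder_append_right X (fib k) h1 h3
    have hc : reorder X (fib k ++ (L ++ L').flatMap fib)
        (fib k ++ L.flatMap fib ++ L'.flatMap fib) h ≫ reorder X _ _ h2 = reorder X _ _ h3 :=
      reorder_comp X _ _ _ _ _
    change (listTensorAppend X (fib k) ((L ++ L').flatMap fib) ≫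
        (m k ⊗ₘ listTensorBlock fib m (L ++ L'))) ≫ Y k ◁ listTensorAppend Y L L' ≫ (α_ _ _ _).inv =
      reorder X (fib k ++ (L ++ L').flatMap fib) (fib k ++ L.flatMap fib ++ L'.flatMap fib) h ≫
        listTensorAppend X (fib k ++ L.flatMap fib) (L'.flatMap fib) ≫
          ((listTensorAppend X (fib k) (L.flatMap fib) ≫ (m k ⊗ₘ listTensorBlock fib m L)) ⊗ₘ
            listTensorBlock fib m L')
    have h4 : ∀ {A A' B C D D' : M} (f : A ⟶ B) (g : B ⟶ C) (h : D ⟶ D'),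
        ((f ≫ g) ⊗ₘ h) = f ▷ D ≫ (g ⊗ₘ h) := by
      intros; simp [MonoidalCategory.tensorHom_def]
    have h5 : ((m k ⊗ₘ listTensorBlock fib m L) ⊗ₘ listTensorBlock fib m L') =
        (α_ _ _ _).hom ≫ (m k ⊗ₘ (listTensorBlock fib m L ⊗ₘ listTensorBlock fib m L')) ≫
          (α_ _ _ _).inv := by simp
    rw [h4 (A' := Y k), h5, reassoc_of% ha, reassoc_of% hc, reassoc_of% hr, Category.assoc]
    congr 1
    rw [← Category.assoc, ← Category.assoc]
    refine Eq.trans ?_ (Category.assoc _ _ _)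
    congr 1
    simp only [← id_tensorHom, MonoidalCategory.tensorHom_comp_tensorHom, Category.id_comp,
      Category.comp_id]
    rw [ih, Category.assoc]

/-- Blocks of blocks. -/
theorem block_block (fib : κ → List ι) (m : ∀ k, listTensor X (fib k) ⟶ Y k) (fib' : μ → List κ)
    (n : ∀ j, listTensor Y (fib' j) ⟶ Z j) : ∀ (L : List μ)
    (h : ((L.flatMap fib').flatMap fib).Perm (L.flatMap fun j => (fib' j).flatMap fib)),
    listTensorBlock fib m (L.flatMap fib') ≫ listTensorBlock fib' n L =
      reorder X _ _ h ≫ listTensorBlock (fun j => (fib' j).flatMap fib)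
        (fun j => listTensorBlock fib m (fib' j) ≫ n j) L
  | [], h => by
    change 𝟙 (𝟙_ M) ≫ 𝟙 (𝟙_ M) = reorder X [] [] h ≫ 𝟙 (listTensor X [])
    rw [reorder_nil]
    rfl
  | j :: L, h => by
    have h1 : ((L.flatMap fib').flatMap fib).Perm (L.flatMap fun j => (fib' j).flatMap fib) := by
      rw [List.flatMap_assoc]
    have ih := block_block fib m fib' n L h1
    have h2 : ((fib' j ++ L.flatMap fib').flatMap fib).Perm
      ((fib' j).flatMap fib ++ (L.flatMap fib').flatMap fib) := by rw [List.flatMap_append]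
    have ha := block_append fib m (fib' j) (L.flatMap fib') h2
    have h3 : ((fib' j).flatMap fib ++ (L.flatMap fib').flatMap fib).Perm
      ((fib' j).flatMap fib ++ L.flatMap fun j => (fib' j).flatMap fib) := h1.append_left _
    have hr := reorder_append_right X ((fib' j).flatMap fib) h1 h3
    have hc : reorder X _ _ h2 ≫ reorder X _ _ h3 = reorder X ((fib' j ++ L.flatMap fib').flatMap fib)
      ((fib' j).flatMap fib ++ L.flatMap fun j => (fib' j).flatMap fib) h := reorder_comp X _ _ _ _ _
    change listTensorBlock fib m (fib' j ++ L.flatMap fib') ≫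
        listTensorAppend Y (fib' j) (L.flatMap fib') ≫ (n j ⊗ₘ listTensorBlock fib' n L) =
      reorder X ((fib' j ++ L.flatMap fib').flatMap fib)
        ((fib' j).flatMap fib ++ L.flatMap fun j => (fib' j).flatMap fib) h ≫
        listTensorAppend X ((fib' j).flatMap fib) (L.flatMap fun j => (fib' j).flatMap fib) ≫
          ((listTensorBlock fib m (fib' j) ≫ n j) ⊗ₘ
            listTensorBlock (fun j => (fib' j).flatMap fib)
              (fun j => listTensorBlock fib m (fib' j) ≫ n j) L)
    rw [reassoc_of% ha, ← hc, Category.assoc, reassoc_of% hr]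
    simp only [← id_tensorHom, MonoidalCategory.tensorHom_comp_tensorHom, Category.id_comp, ih]

end Block

section Map

variable [SymmetricCategory M] {X : ι → M} {Y : κ → M}

theorem mapTo_comp {Z : μ → M} (p : ι → κ) (q : κ → μ) (m : ∀ i, X i ⟶ Y (p i))
    (n : ∀ k, Y k ⟶ Z (q k)) : ∀ (l : List ι)
    (e : ((l.map p).map q).Perm (l.map fun i => q (p i))),
    listTensorMapTo p m l ≫ listTensorMapTo q n (l.map p) ≫ reorder Z _ _ e =
      listTensorMapTo (fun i => q (p i)) (fun i => m i ≫ n (p i)) l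
  | [], e => by
    change 𝟙 _ ≫ 𝟙 _ ≫ reorder Z [] [] e = 𝟙 (listTensor Z [])
    rw [reorder_nil]
    exact (Category.id_comp _).trans (Category.id_comp _)
  | i :: l, e => by
    have e' : ((l.map p).map q).Perm (l.map fun i => q (p i)) := by rw [List.map_map]; rfl
    have ih := mapTo_comp p q m n l e'
    have h : reorder Z (q (p i) :: (l.map p).map q) (q (p i) :: l.map fun i => q (p i)) e =
      Z (q (p i)) ◁ reorder Z _ _ e' := reorder_cons_cons Z _ _ _ _ e'
    change (m i ⊗ₘ listTensorMapTo p m l) ≫ (n (p i) ⊗ₘ listTensorMapTo q n (l.map p)) ≫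
      reorder Z (q (p i) :: (l.map p).map q) (q (p i) :: l.map fun i => q (p i)) e =
        ((m i ≫ n (p i)) ⊗ₘ listTensorMapTo _ _ l)
    rw [h, ← ih]
    change (m i ⊗ₘ listTensorMapTo p m l) ≫ (n (p i) ⊗ₘ listTensorMapTo q n (l.map p)) ≫
      Z (q (p i)) ◁ reorder Z _ _ e' = _
    simp [← id_tensorHom]

theorem mapTo_id (l : List ι) (e : (l.map fun i => i).Perm l) :
    listTensorMapTo (fun i => i) (fun i => 𝟙 (X i)) l ≫ reorder X _ _ e = 𝟙 _ := by
  induction l with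
  | nil =>
    change 𝟙 _ ≫ reorder X [] [] e = 𝟙 (listTensor X [])
    rw [reorder_nil, Category.id_comp]
  | cons i l ih =>
    have e' : (l.map fun i => i).Perm l := by rw [List.map_id']
    have h : reorder X (i :: l.map fun i => i) (i :: l) e = X i ◁ reorder X _ _ e' :=
      reorder_cons_cons X _ _ _ _ e'
    change (𝟙 (X i) ⊗ₘ listTensorMapTo (fun i => i) (fun i => 𝟙 (X i)) l) ≫
      reorder X (i :: l.map fun i => i) (i :: l) e = 𝟙 (X i ⊗ listTensor X l)
    rw [h]
    change _ ≫ X i ◁ reorder X _ _ e' = _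
    rw [id_tensorHom, ← whiskerLeft_comp, ih e', whiskerLeft_id]

theorem mapTo_reorder (p : ι → κ) (hp : Function.Injective p) (m : ∀ i, X i ⟶ Y (p i))
    {l l' : List ι} (h : l.Perm l') : ∀ h' : (l.map p).Perm (l'.map p),
    listTensorMapTo p m l ≫ reorder Y _ _ h' = reorder X l l' h ≫ listTensorMapTo p m l' := by
  induction h with
  | nil => intro h'; rw [reorder_refl, reorder_refl, Category.comp_id, Category.id_comp]
  | @cons i l l' h ih =>
    intro h'
    have e := reorder_cons_cons Y (p i) (l.map p) (l'.map p) h' (h.map p)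
    have e' := reorder_cons_cons X i l l' (h.cons i) h
    rw [e']
    refine (congrArg (fun k => listTensorMapTo p m (i :: l) ≫ k) e).trans ?_
    change (m i ⊗ₘ listTensorMapTo p m l) ≫ Y (p i) ◁ reorder Y _ _ (h.map p) =
      X i ◁ reorder X l l' h ≫ (m i ⊗ₘ listTensorMapTo p m l')
    simp only [← id_tensorHom, MonoidalCategory.tensorHom_comp_tensorHom, Category.id_comp,
      Category.comp_id, ih]
  | swap i j l =>
    intro h'
    by_cases hij : i = j
    · subst hij
      rw [reorder_refl, reorder_refl]
      exact (Category.comp_id _).trans (Category.id_comp _).symm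
    · have e := reorder_swap Y (p j) (p i) (l.map p) (fun e => hij (hp e.symm)) h'
      have e' := reorder_swap X j i l (Ne.symm hij) (List.Perm.swap i j l)
      rw [e']
      refine (congrArg (fun k => listTensorMapTo p m (j :: i :: l) ≫ k) e).trans ?_
      exact swapFront_natural (m j) (m i) (listTensorMapTo p m l)
  | trans h₁ h₂ ih₁ ih₂ =>
    intro h'
    rw [← reorder_comp Y _ _ _ (h₁.map p) (h₂.map p), ← Category.assoc, ih₁, Category.assoc, ih₂,
      ← Category.assoc, reorder_comp]

theorem mapTo_append (p : ι → κ) (m : ∀ i, X i ⟶ Y (p i)) : ∀ (l l' : List ι)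
    (h : ((l ++ l').map p).Perm (l.map p ++ l'.map p)),
    listTensorMapTo p m (l ++ l') ≫ reorder Y _ _ h ≫ listTensorAppend Y (l.map p) (l'.map p) =
      listTensorAppend X l l' ≫ (listTensorMapTo p m l ⊗ₘ listTensorMapTo p m l')
  | [], l', h => by
    have e : reorder Y (l'.map p) (l'.map p) h = 𝟙 _ := reorder_refl _ _ _
    change listTensorMapTo p m l' ≫ reorder Y (l'.map p) (l'.map p) h ≫ (λ_ _).inv =
      (λ_ _).inv ≫ (𝟙 (𝟙_ M) ⊗ₘ listTensorMapTo p m l')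
    rw [e]
    simp
  | i :: l, l', h => by
    have h' : ((l ++ l').map p).Perm (l.map p ++ l'.map p) := by rw [List.map_append]
    have ih := mapTo_append p m l l' h'
    have e : reorder Y (p i :: (l ++ l').map p) (p i :: (l.map p ++ l'.map p)) h =
      Y (p i) ◁ reorder Y _ _ h' := reorder_cons_cons Y _ _ _ _ h'
    have key : ∀ r : Y (p i) ⊗ listTensor Y ((l ++ l').map p) ⟶
        Y (p i) ⊗ listTensor Y (l.map p ++ l'.map p), r = Y (p i) ◁ reorder Y _ _ h' →
      (m i ⊗ₘ listTensorMapTo p m (l ++ l')) ≫ r ≫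
        Y (p i) ◁ listTensorAppend Y (l.map p) (l'.map p) ≫ (α_ _ _ _).inv =
      (X i ◁ listTensorAppend X l l' ≫ (α_ _ _ _).inv) ≫
        ((m i ⊗ₘ listTensorMapTo p m l) ⊗ₘ listTensorMapTo p m l') := by
      rintro _ rfl
      have h5 : ((m i ⊗ₘ listTensorMapTo p m l) ⊗ₘ listTensorMapTo p m l') =
        (α_ _ _ _).hom ≫ (m i ⊗ₘ (listTensorMapTo p m l ⊗ₘ listTensorMapTo p m l')) ≫
          (α_ _ _ _).inv := by simp
      rw [h5]
      simp only [Category.assoc, Iso.inv_hom_id_assoc]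
      rw [← whiskerLeft_comp_assoc]
      simp only [← id_tensorHom, ← Category.assoc]
      congr 1
      simp only [MonoidalCategory.tensorHom_comp_tensorHom, Category.id_comp,
        Category.comp_id, ih]
    exact key _ e

theorem mapFrom_reorder {Z : κ → M} (p : ι → κ) (hp : Function.Injective p)
    (m : ∀ i, Z (p i) ⟶ X i)
    {l l' : List ι} (h : l.Perm l') : ∀ h' : (l.map p).Perm (l'.map p),
    reorder Z _ _ h' ≫ listTensorMapFrom p m l' = listTensorMapFrom p m l ≫ reorder X l l' h := by
  induction h with
  | nil => intro h'; rw [reorder_refl, reorder_refl, Category.comp_id, Category.id_comp]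
  | @cons i l l' h ih =>
    intro h'
    have e := reorder_cons_cons Z (p i) (l.map p) (l'.map p) h' (h.map p)
    have e' := reorder_cons_cons X i l l' (h.cons i) h
    rw [e']
    refine (congrArg (fun k => k ≫ listTensorMapFrom p m (i :: l')) e).trans ?_
    change Z (p i) ◁ reorder Z _ _ (h.map p) ≫ (m i ⊗ₘ listTensorMapFrom p m l') =
      (m i ⊗ₘ listTensorMapFrom p m l) ≫ X i ◁ reorder X l l' h
    simp only [← id_tensorHom, MonoidalCategory.tensorHom_comp_tensorHom, Category.id_comp,
      Category.comp_id, ih]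
  | swap i j l =>
    intro h'
    by_cases hij : i = j
    · subst hij
      rw [reorder_refl, reorder_refl]
      exact (Category.id_comp _).trans (Category.comp_id _).symm
    · have e := reorder_swap Z (p j) (p i) (l.map p) (fun e => hij (hp e.symm)) h'
      have e' := reorder_swap X j i l (Ne.symm hij) (List.Perm.swap i j l)
      rw [e']
      refine (congrArg (fun k => k ≫ listTensorMapFrom p m (i :: j :: l)) e).trans ?_
      exact swapFront_natural' (m j) (m i) (listTensorMapFrom p m l)
  | trans h₁ h₂ ih₁ ih₂ =>
    intro h'
    rw [← reorder_comp Z _ _ _ (h₁.map p) (h₂.map p), Category.assoc, ih₂, ← Category.assoc, ih₁,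
      Category.assoc, reorder_comp]

theorem mapFrom_append {Z : κ → M} (p : ι → κ) (m : ∀ i, Z (p i) ⟶ X i) : ∀ (l l' : List ι)
    (h : ((l ++ l').map p).Perm (l.map p ++ l'.map p)),
    listTensorMapFrom p m (l ++ l') ≫ listTensorAppend X l l' =
      reorder Z _ _ h ≫ listTensorAppend Z (l.map p) (l'.map p) ≫
        (listTensorMapFrom p m l ⊗ₘ listTensorMapFrom p m l')
  | [], l', h => by
    have e : reorder Z (l'.map p) (l'.map p) h = 𝟙 _ := reorder_refl _ _ _
    change listTensorMapFrom p m l' ≫ (λ_ _).inv = reorder Z (l'.map p) (l'.map p) h ≫ (λ_ _).inv ≫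
      (𝟙 (𝟙_ M) ⊗ₘ listTensorMapFrom p m l')
    rw [e]
    simp
  | i :: l, l', h => by
    have h' : ((l ++ l').map p).Perm (l.map p ++ l'.map p) := by rw [List.map_append]
    have ih := mapFrom_append p m l l' h'
    have e : reorder Z (p i :: (l ++ l').map p) (p i :: (l.map p ++ l'.map p)) h =
      Z (p i) ◁ reorder Z _ _ h' := reorder_cons_cons Z _ _ _ _ h'
    have key : ∀ r : Z (p i) ⊗ listTensor Z ((l ++ l').map p) ⟶
        Z (p i) ⊗ listTensor Z (l.map p ++ l'.map p), r = Z (p i) ◁ reorder Z _ _ h' →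
      (m i ⊗ₘ listTensorMapFrom p m (l ++ l')) ≫ X i ◁ listTensorAppend X l l' ≫ (α_ _ _ _).inv =
      r ≫ (Z (p i) ◁ listTensorAppend Z (l.map p) (l'.map p) ≫ (α_ _ _ _).inv) ≫
        ((m i ⊗ₘ listTensorMapFrom p m l) ⊗ₘ listTensorMapFrom p m l') := by
      rintro _ rfl
      have h5 : ((m i ⊗ₘ listTensorMapFrom p m l) ⊗ₘ listTensorMapFrom p m l') =
        (α_ _ _ _).hom ≫ (m i ⊗ₘ (listTensorMapFrom p m l ⊗ₘ listTensorMapFrom p m l')) ≫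
          (α_ _ _ _).inv := by simp
      rw [h5]
      simp only [Category.assoc, Iso.inv_hom_id_assoc]
      simp only [← id_tensorHom, ← Category.assoc]
      congr 1
      simp only [MonoidalCategory.tensorHom_comp_tensorHom, Category.id_comp,
        Category.comp_id, Category.assoc, ih]
    exact key _ e

/-- A commutative square of index maps. -/
theorem mapFrom_mapTo {X' : ι' → M} {A A' : Type} {Y : A → M} {Y' : A' → M} (p : A → ι)
    (p' : A' → ι') (ea : A → A')
    (e : ι → ι') (x : ∀ i, X i ⟶ X' (e i)) (y : ∀ a, Y a ⟶ Y' (ea a))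
    (m : ∀ a, X (p a) ⟶ Y a) (m' : ∀ a, X' (p' a) ⟶ Y' a) (he : ∀ a, e (p a) = p' (ea a))
    (hm : ∀ a, m a ≫ y a = x (p a) ≫ eqToHom (congrArg X' (he a)) ≫ m' (ea a)) : ∀ (l : List A)
    (h : ((l.map p).map e).Perm ((l.map ea).map p')),
    listTensorMapFrom p m l ≫ listTensorMapTo ea y l =
      listTensorMapTo e x (l.map p) ≫ reorder X' _ _ h ≫ listTensorMapFrom p' m' (l.map ea)
  | [], h => by
    change 𝟙 _ ≫ 𝟙 _ = 𝟙 _ ≫ reorder X' [] [] h ≫ 𝟙 (𝟙_ M)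
    rw [reorder_nil]
    exact (Category.id_comp (𝟙 _ ≫ 𝟙 (𝟙_ M))).symm
  | a :: l, h => by
    have h' : ((l.map p).map e).Perm ((l.map ea).map p') := by
      rw [List.map_map, List.map_map, show e ∘ p = p' ∘ ea from funext he]
    have ih := mapFrom_mapTo p p' ea e x y m m' he hm l h'
    have hr : ∀ (i j : ι') (L L' : List ι') (e : i = j) (hL : L.Perm L')
        (hL' : (i :: L).Perm (j :: L')),
        reorder X' (i :: L) (j :: L') hL' = (eqToHom (congrArg X' e) ⊗ₘ reorder X' L L' hL) := by
      rintro i _ L L' rfl hL hL'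
      rw [eqToHom_refl, id_tensorHom]
      exact reorder_cons_cons X' i L L' hL' hL
    change (m a ⊗ₘ listTensorMapFrom p m l) ≫ (y a ⊗ₘ listTensorMapTo ea y l) =
      (x (p a) ⊗ₘ listTensorMapTo e x (l.map p)) ≫
        reorder X' (e (p a) :: (l.map p).map e) (p' (ea a) :: (l.map ea).map p') h ≫
          (m' (ea a) ⊗ₘ listTensorMapFrom p' m' (l.map ea))
    rw [hr _ _ _ _ (he a) h' h]
    change _ = (x (p a) ⊗ₘ listTensorMapTo e x (l.map p)) ≫
        (eqToHom (congrArg X' (he a)) ⊗ₘ reorder X' _ _ h') ≫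
          (m' (ea a) ⊗ₘ listTensorMapFrom p' m' (l.map ea))
    rw [MonoidalCategory.tensorHom_comp_tensorHom, MonoidalCategory.tensorHom_comp_tensorHom,
      MonoidalCategory.tensorHom_comp_tensorHom, ih, hm]

theorem block_mapTo {X' : ι' → M} {Y' : κ' → M} (e : ι → ι') (d : κ → κ')
    (x : ∀ i, X i ⟶ X' (e i)) (y : ∀ k, Y k ⟶ Y' (d k)) (fib : κ → List ι) (fib' : κ' → List ι')
    (m : ∀ k, listTensor X (fib k) ⟶ Y k) (m' : ∀ k, listTensor X' (fib' k) ⟶ Y' k)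
    (hf : ∀ k, ((fib k).map e).Perm (fib' (d k)))
    (hm : ∀ k, m k ≫ y k = listTensorMapTo e x (fib k) ≫ reorder X' _ _ (hf k) ≫ m' (d k)) :
    ∀ (L : List κ) (h : ((L.flatMap fib).map e).Perm ((L.map d).flatMap fib')),
    listTensorBlock fib m L ≫ listTensorMapTo d y L =
      listTensorMapTo e x (L.flatMap fib) ≫ reorder X' _ _ h ≫ listTensorBlock fib' m' (L.map d)
  | [], h => by
    change 𝟙 _ ≫ 𝟙 _ = 𝟙 _ ≫ reorder X' [] [] h ≫ 𝟙 (𝟙_ M)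
    rw [reorder_nil]
    exact (Category.id_comp (𝟙 _ ≫ 𝟙 (𝟙_ M))).symm
  | k :: L, h => by
    have h1 : ((L.flatMap fib).map e).Perm ((L.map d).flatMap fib') := by
      rw [List.map_flatMap, List.flatMap_map]
      exact flatMap_perm hf L
    have ih := block_mapTo e d x y fib fib' m m' hf hm L h1
    have h2 : ((fib k ++ L.flatMap fib).map e).Perm ((fib k).map e ++ (L.flatMap fib).map e) := by
      rw [List.map_append]
    have h3 := (hf k).append h1
    have hc : reorder X' _ _ h2 ≫ reorder X' _ _ h3 = reorder X' ((fib k ++ L.flatMap fib).map e)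
      (fib' (d k) ++ (L.map d).flatMap fib') h := reorder_comp X' _ _ _ _ _
    change (listTensorAppend X (fib k) (L.flatMap fib) ≫ (m k ⊗ₘ listTensorBlock fib m L)) ≫
      (y k ⊗ₘ listTensorMapTo d y L) = listTensorMapTo e x (fib k ++ L.flatMap fib) ≫
        reorder X' ((fib k ++ L.flatMap fib).map e) (fib' (d k) ++ (L.map d).flatMap fib') h ≫
          listTensorAppend X' (fib' (d k)) ((L.map d).flatMap fib') ≫
            (m' (d k) ⊗ₘ listTensorBlock fib' m' (L.map d))
    have ha := reorder_append X' (hf k) h1 h3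
    have hb := mapTo_append e x (fib k) (L.flatMap fib) h2
    rw [← hc]
    simp only [Category.assoc]
    rw [reassoc_of% ha, reassoc_of% hb, MonoidalCategory.tensorHom_comp_tensorHom, MonoidalCategory.tensorHom_comp_tensorHom,
      MonoidalCategory.tensorHom_comp_tensorHom, hm, ih]

theorem block_mapFrom {X' : ι' → M} {Y' : κ' → M} (e : ι' → ι) (d : κ' → κ)
    (x : ∀ i, X (e i) ⟶ X' i) (y : ∀ k, Y (d k) ⟶ Y' k) (fib : κ → List ι) (fib' : κ' → List ι')
    (m : ∀ k, listTensor X (fib k) ⟶ Y k) (m' : ∀ k, listTensor X' (fib' k) ⟶ Y' k)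
    (hf : ∀ k, (fib (d k)).Perm ((fib' k).map e))
    (hm : ∀ k, m (d k) ≫ y k = reorder X _ _ (hf k) ≫ listTensorMapFrom e x (fib' k) ≫ m' k) :
    ∀ (L : List κ') (h : ((L.map d).flatMap fib).Perm ((L.flatMap fib').map e)),
    listTensorBlock fib m (L.map d) ≫ listTensorMapFrom d y L =
      reorder X _ _ h ≫ listTensorMapFrom e x (L.flatMap fib') ≫ listTensorBlock fib' m' L
  | [], h => by
    change 𝟙 _ ≫ 𝟙 _ = reorder X [] [] h ≫ 𝟙 _ ≫ 𝟙 (𝟙_ M)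
    rw [reorder_nil]
    exact (Category.id_comp (𝟙 _ ≫ 𝟙 (𝟙_ M))).symm
  | k :: L, h => by
    have h1 : ((L.map d).flatMap fib).Perm ((L.flatMap fib').map e) := by
      rw [List.map_flatMap, List.flatMap_map]
      exact flatMap_perm hf L
    have ih := block_mapFrom e d x y fib fib' m m' hf hm L h1
    have h2 : ((fib' k ++ L.flatMap fib').map e).Perm
        ((fib' k).map e ++ (L.flatMap fib').map e) := by
      rw [List.map_append]
    have h3 := (hf k).append h1
    have h4 : (fib (d k) ++ (L.map d).flatMap fib).Perm ((fib' k ++ L.flatMap fib').map e) := h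
    have hc : reorder X (fib (d k) ++ (L.map d).flatMap fib) ((fib' k ++ L.flatMap fib').map e) h ≫
      reorder X _ _ h2 = reorder X _ _ h3 := reorder_comp X _ _ _ _ _
    change (listTensorAppend X (fib (d k)) ((L.map d).flatMap fib) ≫
      (m (d k) ⊗ₘ listTensorBlock fib m (L.map d))) ≫
      (y k ⊗ₘ listTensorMapFrom d y L) =
        reorder X (fib (d k) ++ (L.map d).flatMap fib) ((fib' k ++ L.flatMap fib').map e) h ≫
          listTensorMapFrom e x (fib' k ++ L.flatMap fib') ≫
          listTensorAppend X' (fib' k) (L.flatMap fib') ≫ (m' k ⊗ₘ listTensorBlock fib' m' L)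
    have ha := reorder_append X (hf k) h1 h3
    have hb := mapFrom_append e x (fib' k) (L.flatMap fib') h2
    rw [reassoc_of% hb, reassoc_of% hc, reassoc_of% ha, Category.assoc,
      MonoidalCategory.tensorHom_comp_tensorHom, MonoidalCategory.tensorHom_comp_tensorHom,
      MonoidalCategory.tensorHom_comp_tensorHom, hm, ih]

end Map

end Coherence

section Unordered

theorem disjoint_fibers {ι κ : Type} [Finite ι] (p : ι → κ) (k k' : κ) (h : k ≠ k') :
    ((ordering {i // p i = k}).map Subtype.val).Disjoint
      ((ordering {i // p i = k'}).map Subtype.val) := by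
  intro i hi hi'
  obtain ⟨j, -, rfl⟩ := List.mem_map.1 hi
  obtain ⟨j', -, hj'⟩ := List.mem_map.1 hi'
  exact h (by rw [← j.2, ← j'.2, hj'])

theorem val_perm {ι κ : Type} [Finite ι] {p : ι → κ} {k : κ} {l : List {i // p i = k}}
    (h : l.Perm (ordering _)) : (l.map Subtype.val).Perm
      ((ordering {i // p i = k}).map Subtype.val) := h.map _


variable {M : Type u} [Category.{v} M] [MonoidalCategory M] [SymmetricCategory M]
  {ι κ μ ι' κ' : Type} [Finite ι] [Finite κ] [Finite μ] [Finite ι'] [Finite κ']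

/-- The unordered tensor product of a finite family of objects. -/
noncomputable abbrev uTensor (X : ι → M) : M := listTensor X (ordering ι)

theorem map_ordering_perm (e : ι ≃ κ) : ((ordering ι).map e).Perm (ordering κ) :=
  (ordering_perm ((nodup_ordering ι).map e.injective) fun k =>
    List.mem_map.2 ⟨e.symm k, mem_ordering _, e.apply_symm_apply _⟩).symm

/-- The morphism of unordered tensor products given by a bijection and morphisms of factors. -/
noncomputable def uMap {X : ι → M} {Y : κ → M} (e : ι ≃ κ) (m : ∀ i, X i ⟶ Y (e i)) :
    uTensor X ⟶ uTensor Y :=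
  listTensorMapTo e m (ordering ι) ≫ reorder Y _ _ (map_ordering_perm e)

/-- The morphism of unordered tensor products given by a map of index sets and morphisms from the
unordered tensor products over the fibres. -/
noncomputable def uFib {X : ι → M} {Y : κ → M} (p : ι → κ)
    (m : ∀ k, uTensor (fun i : {i // p i = k} => X i.1) ⟶ Y k) : uTensor X ⟶ uTensor Y :=
  reorder X _ _ (ordering_perm_flatMap p) ≫ listTensorBlock _ (fun k =>
    listTensorMapFrom Subtype.val (fun i => 𝟙 (X i.1)) (ordering {i // p i = k}) ≫ m k) (ordering κ)

variable {X : ι → M} {Y : κ → M} {Z : μ → M}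

theorem uMap_comp (e : ι ≃ κ) (d : κ ≃ μ) (m : ∀ i, X i ⟶ Y (e i)) (n : ∀ k, Y k ⟶ Z (d k)) :
    uMap e m ≫ uMap d n = uMap (e.trans d) (fun i => m i ≫ n (e i)) := by
  have h : (((ordering ι).map e).map d).Perm ((ordering ι).map fun i => d (e i)) := by
    rw [List.map_map]; rfl
  unfold uMap
  have h1 := mapTo_reorder d d.injective n (map_ordering_perm e)
    ((map_ordering_perm e).map d)
  have h2 := mapTo_comp e d m n (ordering ι) h
  rw [Category.assoc, ← reassoc_of% h1, reorder_comp]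
  have hp : ((ordering ι).map fun i => d (e i)).Perm (ordering μ) :=
    map_ordering_perm (e.trans d)
  change _ = listTensorMapTo (fun i => d (e i)) (fun i => m i ≫ n (e i)) (ordering ι) ≫
    reorder Z ((ordering ι).map fun i => d (e i)) _ hp
  rw [← h2, Category.assoc, Category.assoc, reorder_comp]

theorem uMap_id (X : ι → M) : uMap (Equiv.refl ι) (fun i => 𝟙 (X i)) = 𝟙 (uTensor X) :=
  mapTo_id _ _

/-- `uFib` in terms of arbitrary orderings. -/
theorem reorder_uFib (p : ι → κ) (m : ∀ k, uTensor (fun i : {i // p i = k} => X i.1) ⟶ Y k)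
    (L : List κ) (hL : L.Perm (ordering κ)) (l : ∀ k, List {i // p i = k})
    (hl : ∀ k, (l k).Perm (ordering _))
    (h : (L.flatMap fun k => (l k).map Subtype.val).Perm (ordering ι)) :
    reorder X _ _ h ≫ uFib p m = listTensorBlock _ (fun k =>
      listTensorMapFrom Subtype.val (fun i => 𝟙 (X i.1)) (l k) ≫ reorder _ _ _ (hl k) ≫ m k) L ≫
        reorder Y _ _ hL := by
  unfold uFib
  rw [← Category.assoc, reorder_comp,
    ← reorder_comp X _ _ _ (flatMap_perm (fun k => val_perm (hl k)) L) (hL.flatMap_right _),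
    Category.assoc, reorder_blocks _ (disjoint_fibers p) _ hL, ← Category.assoc]
  congr 1
  refine reorder_block (fun k => val_perm (hl k)) _ _ (fun k => ?_) L _
  rw [← Category.assoc, ← Category.assoc]
  congr 1
  exact (mapFrom_reorder (X := fun i : {i // p i = k} => X i.1) Subtype.val Subtype.val_injective
    (fun i => 𝟙 (X i.1)) (hl k) _).symm

/-- The bijection of fibres given by a commutative square with bijections. -/
def fiberEquiv {p : ι → κ} {p' : ι' → κ'} (e : ι ≃ ι') (d : κ ≃ κ') (h : ∀ i, p' (e i) = d (p i))
    (k : κ) : {i // p i = k} ≃ {i // p' i = d k} where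
  toFun i := ⟨e i.1, by rw [h, i.2]⟩
  invFun i := ⟨e.symm i.1, d.injective (by rw [← h, e.apply_symm_apply, i.2])⟩
  left_inv i := Subtype.ext (e.symm_apply_apply _)
  right_inv i := Subtype.ext (e.apply_symm_apply _)

/-- Naturality of `uFib`. -/
theorem uFib_uMap {X' : ι' → M} {Y' : κ' → M} {p : ι → κ} {p' : ι' → κ'} (e : ι ≃ ι') (d : κ ≃ κ')
    (h : ∀ i, p' (e i) = d (p i)) (x : ∀ i, X i ⟶ X' (e i)) (y : ∀ k, Y k ⟶ Y' (d k))
    (m : ∀ k, uTensor (fun i : {i // p i = k} => X i.1) ⟶ Y k)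
    (m' : ∀ k, uTensor (fun i : {i // p' i = k} => X' i.1) ⟶ Y' k)
    (hm : ∀ k, m k ≫ y k = uMap (Y := fun i : {i // p' i = d k} => X' i.1) (fiberEquiv e d h k)
      (fun i => x i.1) ≫ m' (d k)) :
    uFib p m ≫ uMap d y = uMap e x ≫ uFib p' m' := by
  have hf : ∀ k, (((ordering {i // p i = k}).map Subtype.val).map e).Perm
      ((ordering {i // p' i = d k}).map Subtype.val) := fun k => by
    refine List.Perm.trans ?_ ((map_ordering_perm (fiberEquiv e d h k)).map Subtype.val)
    rw [List.map_map, List.map_map]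
    rfl
  have hF : (((ordering κ).flatMap fun k => (ordering {i // p i = k}).map Subtype.val).map e).Perm
      (((ordering κ).map d).flatMap fun k => (ordering {i // p' i = k}).map Subtype.val) := by
    rw [List.map_flatMap, List.flatMap_map]
    exact flatMap_perm hf _
  have hb := block_mapTo e d x y _ _
    (fun k => listTensorMapFrom Subtype.val (fun i => 𝟙 (X i.1)) (ordering {i // p i = k}) ≫ m k)
    (fun k => listTensorMapFrom Subtype.val (fun i => 𝟙 (X' i.1)) (ordering {i // p' i = k}) ≫ m' k)
    hf (fun k => ?_) (ordering κ) hF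
  · have h1 := mapTo_reorder e e.injective x (ordering_perm_flatMap p)
      ((ordering_perm_flatMap p).map e)
    unfold uFib
    rw [uMap, uMap, Category.assoc, reassoc_of% hb]
    rw [← reorder_blocks _ (disjoint_fibers p') _ (map_ordering_perm d)
      ((map_ordering_perm d).flatMap_right _)]
    rw [← Category.assoc, ← h1]
    simp only [← Category.assoc]
    congr 1
    simp only [Category.assoc, reorder_comp]
  · have hs : (((ordering {i // p i = k}).map Subtype.val).map e).Perm
        (((ordering {i // p i = k}).map (fiberEquiv e d h k)).map Subtype.val) := by
      rw [List.map_map, List.map_map]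
      rfl
    have h2 := mapFrom_mapTo (X := X) (X' := X') (Y := fun i : {i // p i = k} => X i.1)
      (Y' := fun i : {i // p' i = d k} => X' i.1)
      Subtype.val Subtype.val (fiberEquiv e d h k) e x (fun i => x i.1)
      (fun i => 𝟙 (X i.1)) (fun i => 𝟙 (X' i.1)) (fun _ => rfl) (fun i =>
        (Category.id_comp _).trans ((Category.comp_id _).symm.trans
          (congrArg (fun k => x i.1 ≫ k) (Category.comp_id (𝟙 _)).symm)))
      (ordering {i // p i = k}) hs
    have h3 := mapFrom_reorder (X := fun i : {i // p' i = d k} => X' i.1) Subtype.val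
      Subtype.val_injective (fun i => 𝟙 (X' i.1)) (map_ordering_perm (fiberEquiv e d h k))
      ((map_ordering_perm (fiberEquiv e d h k)).map Subtype.val)
    rw [Category.assoc, hm, ← reorder_comp X' _ _ _ hs
      ((map_ordering_perm (fiberEquiv e d h k)).map Subtype.val)]
    change _ ≫ (listTensorMapTo (Y := fun i : {i // p' i = d k} => X' i.1) (fiberEquiv e d h k)
      (fun i => x i.1) (ordering {i // p i = k}) ≫ reorder _ _ _ (map_ordering_perm _)) ≫
        m' (d k) = _
    rw [Category.assoc, reassoc_of% h2]
    simp only [Category.assoc]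
    rw [reassoc_of% h3]

/-- The index sets of an iterated fibre. -/
def fiberFiberEquiv (p : ι → κ) (q : κ → μ) (j : μ) (k : {k // q k = j}) :
    {i : {i // q (p i) = j} // (⟨p i.1, i.2⟩ : {k // q k = j}) = k} ≃ {i // p i = k.1} where
  toFun i := ⟨i.1.1, congrArg Subtype.val i.2⟩
  invFun i := ⟨⟨i.1, by rw [i.2, k.2]⟩, Subtype.ext i.2⟩
  left_inv _ := rfl
  right_inv _ := rfl

/-- Composition of `uFib`. -/
theorem uFib_uFib (p : ι → κ) (q : κ → μ)
    (m : ∀ k, uTensor (fun i : {i // p i = k} => X i.1) ⟶ Y k)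
    (n : ∀ j, uTensor (fun k : {k // q k = j} => Y k.1) ⟶ Z j) :
    uFib p m ≫ uFib q n = uFib (fun i => q (p i)) (fun j =>
      uFib (X := fun i : {i // q (p i) = j} => X i.1) (Y := fun k : {k // q k = j} => Y k.1)
        (fun i => ⟨p i.1, i.2⟩) (fun k =>
        uMap (Y := fun i : {i // p i = k.1} => X i.1) (fiberFiberEquiv p q j k)
          (fun i => 𝟙 (X i.1.1)) ≫ m k.1) ≫ n j) := by
  let fp : κ → List ι := fun k => (ordering {i // p i = k}).map Subtype.val
  let fq : μ → List κ := fun j => (ordering {k // q k = j}).map Subtype.val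
  let fr : μ → List ι := fun j => (ordering {i // q (p i) = j}).map Subtype.val
  have hmem : ∀ k i, i ∈ fp k ↔ p i = k := fun k i => by
    simp [fp, mem_ordering]
  have hmemq : ∀ k i, i ∈ fq k ↔ q i = k := fun k i => by
    simp [fq, mem_ordering]
  have hnd : ∀ k, (fp k).Nodup := fun k => (nodup_ordering _).map Subtype.val_injective
  have hfr : ∀ j, (fr j).Perm ((fq j).flatMap fp) := fun j => by
    refine (List.perm_ext_iff_of_nodup ((nodup_ordering _).map Subtype.val_injective)
      (List.nodup_flatMap.2 ⟨fun k _ => hnd k, ?_⟩)).2 fun i => ?_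
    · refine ((nodup_ordering _).map Subtype.val_injective).imp fun {k k'} hk => ?_
      exact disjoint_fibers p k k' hk
    · rw [List.mem_flatMap]
      simp only [hmem, hmemq]
      simp [fr, mem_ordering]
  have hB : ((ordering μ).flatMap fr).Perm ((ordering μ).flatMap fun j => (fq j).flatMap fp) :=
    flatMap_perm hfr _
  have hA : (((ordering μ).flatMap fq).flatMap fp).Perm
      ((ordering μ).flatMap fun j => (fq j).flatMap fp) := by
    rw [List.flatMap_assoc]
  have h1 := reorder_blocks fp (disjoint_fibers p) (fun k =>
    listTensorMapFrom Subtype.val (fun i => 𝟙 (X i.1)) (ordering {i // p i = k}) ≫ m k)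
    (ordering_perm_flatMap q) ((ordering_perm_flatMap q).flatMap_right _)
  have h2 := block_block fp (fun k =>
    listTensorMapFrom Subtype.val (fun i => 𝟙 (X i.1)) (ordering {i // p i = k}) ≫ m k) fq
    (fun j => listTensorMapFrom Subtype.val (fun i => 𝟙 (Y i.1)) (ordering {i // q i = j}) ≫ n j)
    (ordering μ) hA
  unfold uFib
  rw [Category.assoc, ← reassoc_of% h1, h2, ← Category.assoc, ← Category.assoc,
    reorder_comp, reorder_comp]
  refine Eq.trans ?_ (congrArg (fun k => reorder X _ _ (ordering_perm_flatMap fun i => q (p i)) ≫ k)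
    (reorder_block (X := X) hfr _ (fun j => listTensorBlock fp (fun k =>
      listTensorMapFrom Subtype.val (fun i => 𝟙 (X i.1)) (ordering {i // p i = k}) ≫ m k) (fq j) ≫
      listTensorMapFrom Subtype.val (fun i => 𝟙 (Y i.1)) (ordering {i // q i = j}) ≫ n j)
      (fun j => ?_) (ordering μ) hB))
  · rw [← Category.assoc, reorder_comp]
  let op : ∀ k : {k // q k = j}, List {i // q (p i) = j} := fun k =>
    (ordering {i : {i // q (p i) = j} // (⟨p i.1, i.2⟩ : {k // q k = j}) = k}).map Subtype.val
  have hop : ∀ k : {k // q k = j}, (fp k.1).Perm ((op k).map Subtype.val) := fun k => by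
    refine List.Perm.trans ((map_ordering_perm (fiberFiberEquiv p q j k)).map Subtype.val).symm ?_
    rw [List.map_map, List.map_map]
    rfl
  have hL : (((ordering {k // q k = j}).map Subtype.val).flatMap fp).Perm
      (((ordering {k // q k = j}).flatMap op).map Subtype.val) := by
    rw [List.map_flatMap, List.flatMap_map]
    exact flatMap_perm hop _
  have h3 := block_mapFrom (X := X) (Y := Y) (X' := fun i : {i // q (p i) = j} => X i.1)
    (Y' := fun k : {k // q k = j} => Y k.1) Subtype.val Subtype.val (fun i => 𝟙 (X i.1))
    (fun k => 𝟙 (Y k.1)) fp op (fun k =>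
    listTensorMapFrom Subtype.val (fun i => 𝟙 (X i.1)) (ordering {i // p i = k}) ≫ m k)
    (fun k => listTensorMapFrom Subtype.val (fun i => 𝟙 (X i.1.1)) (ordering _) ≫
      uMap (Y := fun i : {i // p i = k.1} => X i.1) (fiberFiberEquiv p q j k)
          (fun i => 𝟙 (X i.1.1)) ≫ m k.1) hop (fun k => ?_) (ordering _) hL
  · have h4 := mapFrom_reorder (Z := X) (X := fun i : {i // q (p i) = j} => X i.1) Subtype.val
      Subtype.val_injective (fun i => 𝟙 (X i.1))
      (ordering_perm_flatMap fun i : {i // q (p i) = j} => (⟨p i.1, i.2⟩ : {k // q k = j}))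
      ((ordering_perm_flatMap fun i : {i // q (p i) = j} =>
        (⟨p i.1, i.2⟩ : {k // q k = j})).map Subtype.val)
    have h9 := reorder_comp X (fr j) _ _ (hfr j) hL
    have h10 := (congrArg (fun k => reorder X (fr j) _ (hfr j) ≫ k) h3)
    refine Eq.symm (Eq.trans ?_ ((congrArg (fun k => k ≫ n j) h10).trans ?_))
    · simp only [Category.assoc]
      rfl
    · refine (congrArg (fun k => k ≫ n j) (Category.assoc _ _ _).symm).trans ?_
      refine (congrArg (fun k => (k ≫ _) ≫ n j) h9).trans ?_
      refine (congrArg (fun k => k ≫ n j) (Category.assoc _ _ _).symm).trans ?_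
      refine (congrArg (fun k => (k ≫ _) ≫ n j) h4).trans ?_
      simp only [Category.assoc]
      rfl
  · have hs : (((ordering {i : {i // q (p i) = j} //
        (⟨p i.1, i.2⟩ : {k // q k = j}) = k}).map Subtype.val).map Subtype.val).Perm
        (((ordering _).map (fiberFiberEquiv p q j k)).map Subtype.val) := by
      rw [List.map_map, List.map_map]
      rfl
    have h5 := mapFrom_reorder (Z := X) (X := fun i : {i // p i = k.1} => X i.1) Subtype.val
      Subtype.val_injective (fun i => 𝟙 (X i.1)) (map_ordering_perm (fiberFiberEquiv p q j k))
      ((map_ordering_perm (fiberFiberEquiv p q j k)).map Subtype.val)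
    have h6 : ∀ (l : List {i : {i // q (p i) = j} // (⟨p i.1, i.2⟩ : {k // q k = j}) = k})
        (hl : ((l.map Subtype.val).map Subtype.val).Perm
          ((l.map (fiberFiberEquiv p q j k)).map Subtype.val)),
        listTensorMapFrom Subtype.val (fun i => 𝟙 (X i.1)) (l.map Subtype.val) ≫
          listTensorMapFrom (Y := fun i : {i : {i // q (p i) = j} //
              (⟨p i.1, i.2⟩ : {k // q k = j}) = k} => X i.1.1)
            Subtype.val (fun i => 𝟙 (X i.1.1)) l ≫
            listTensorMapTo (Y := fun i : {i // p i = k.1} => X i.1) (fiberFiberEquiv p q j k)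
              (fun i => 𝟙 (X i.1.1)) l =
        reorder X _ _ hl ≫ listTensorMapFrom (Y := fun i : {i // p i = k.1} => X i.1)
          Subtype.val (fun i => 𝟙 (X i.1)) (l.map (fiberFiberEquiv p q j k)) := by
      intro l
      induction l with
      | nil =>
        intro hl
        change 𝟙 _ ≫ 𝟙 _ ≫ 𝟙 _ = reorder X [] [] hl ≫ 𝟙 _
        rw [reorder_nil]
        exact Category.id_comp _
      | cons i l ih =>
        intro hl
        have hl' : ((l.map Subtype.val).map Subtype.val).Perm
          ((l.map (fiberFiberEquiv p q j k)).map Subtype.val) := by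
          rw [List.map_map, List.map_map]
          rfl
        have e : reorder X (i.1.1 :: (l.map Subtype.val).map Subtype.val)
            (i.1.1 :: (l.map (fiberFiberEquiv p q j k)).map Subtype.val) hl =
            X i.1.1 ◁ reorder X _ _ hl' := reorder_cons_cons X _ _ _ _ hl'
        have key : ∀ r : X i.1.1 ⊗ listTensor X ((l.map Subtype.val).map Subtype.val) ⟶
          X i.1.1 ⊗ listTensor X ((l.map (fiberFiberEquiv p q j k)).map Subtype.val),
          r = X i.1.1 ◁ reorder X _ _ hl' →
          (𝟙 (X i.1.1) ⊗ₘ listTensorMapFrom Subtype.val (fun i => 𝟙 (X i.1)) (l.map Subtype.val)) ≫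
          (𝟙 (X i.1.1) ⊗ₘ listTensorMapFrom (Y := fun i : {i : {i // q (p i) = j} //
              (⟨p i.1, i.2⟩ : {k // q k = j}) = k} => X i.1.1)
            Subtype.val (fun i => 𝟙 (X i.1.1)) l) ≫
            (𝟙 (X i.1.1) ⊗ₘ listTensorMapTo (Y := fun i : {i // p i = k.1} => X i.1)
              (fiberFiberEquiv p q j k) (fun i => 𝟙 (X i.1.1)) l) =
          r ≫ (𝟙 (X i.1.1) ⊗ₘ listTensorMapFrom (Y := fun i : {i // p i = k.1} => X i.1)
            Subtype.val (fun i => 𝟙 (X i.1)) (l.map (fiberFiberEquiv p q j k))) := by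
          rintro _ rfl
          rw [← id_tensorHom]
          simp only [MonoidalCategory.tensorHom_comp_tensorHom, Category.id_comp, ih hl']
        exact key _ e
    have h7 := h6 (ordering _) hs
    unfold uMap
    simp only [Category.comp_id, Category.assoc]
    rw [reassoc_of% h7, ← reassoc_of% h5, ← Category.assoc, ← Category.assoc, reorder_comp,
      reorder_comp, reorder_refl, Category.id_comp]

end Unordered

section Unordered

variable {M : Type u} [Category.{v} M] [MonoidalCategory M] [SymmetricCategory M]
  {ι κ μ : Type} [Finite ι] [Finite κ] [Finite μ]
  {X : ι → M} {Y : κ → M}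

instance isIso_reorder {ι : Type} (X : ι → M) (l l' : List ι) (h : l.Perm l') :
    IsIso (reorder X l l' h) :=
  ⟨reorder X l' l h.symm, by rw [reorder_comp, reorder_refl], by rw [reorder_comp, reorder_refl]⟩

/-- The tensor product over a list with one element. -/
def one {ι : Type} (X : ι → M) (a : ι) : X a ⟶ listTensor X [a] := (ρ_ (X a)).inv

/-- The tensor product over a list with two elements. -/
def two {ι : Type} (X : ι → M) (a b : ι) : X a ⊗ X b ⟶ listTensor X [a, b] := X a ◁ one X b

/-- The tensor product over a list with three elements. -/
def three {ι : Type} (X : ι → M) (a b c : ι) : X a ⊗ X b ⊗ X c ⟶ listTensor X [a, b, c] :=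
  X a ◁ two X b c

instance (X : ι → M) (a : ι) : IsIso (one X a) :=
  inferInstanceAs (IsIso (ρ_ (X a)).inv)
instance (X : ι → M) (a b : ι) : IsIso (two X a b) :=
  inferInstanceAs (IsIso (X a ◁ one X b))
instance (X : ι → M) (a b c : ι) : IsIso (three X a b c) :=
  inferInstanceAs (IsIso (X a ◁ two X b c))

/-- The canonical morphism from the only factor to the unordered tensor product. -/
noncomputable def single (X : ι → M) (a : ι) (h : [a].Perm (ordering ι)) : X a ⟶ uTensor X :=
  one X a ≫ reorder X [a] _ h

/-- The canonical morphism to an unordered tensor product of two factors. -/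
noncomputable def pair (X : ι → M) (a b : ι) (h : [a, b].Perm (ordering ι)) :
    X a ⊗ X b ⟶ uTensor X :=
  two X a b ≫ reorder X [a, b] _ h

/-- The canonical morphism to an unordered tensor product of three factors. -/
noncomputable def triple (X : ι → M) (a b c : ι) (h : [a, b, c].Perm (ordering ι)) :
    X a ⊗ X b ⊗ X c ⟶ uTensor X :=
  three X a b c ≫ reorder X [a, b, c] _ h

instance (X : ι → M) (a : ι) (h) : IsIso (single X a h) := by unfold single; infer_instance
instance (X : ι → M) (a b : ι) (h) : IsIso (pair X a b h) := by unfold pair; infer_instance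
instance (X : ι → M) (a b c : ι) (h) : IsIso (triple X a b c h) := by
  unfold triple; infer_instance

section Small

variable {ι κ : Type} {X : ι → M} {Y : κ → M}

theorem one_mapTo (e : ι → κ) (m : ∀ i, X i ⟶ Y (e i)) (a : ι) :
    one X a ≫ listTensorMapTo e m [a] = m a ≫ one Y (e a) := by
  change (ρ_ (X a)).inv ≫ (m a ⊗ₘ 𝟙 (𝟙_ M)) = m a ≫ (ρ_ (Y (e a))).inv
  simp

theorem two_mapTo (e : ι → κ) (m : ∀ i, X i ⟶ Y (e i)) (a b : ι) :
    two X a b ≫ listTensorMapTo e m [a, b] = (m a ⊗ₘ m b) ≫ two Y (e a) (e b) := by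
  change X a ◁ one X b ≫ (m a ⊗ₘ listTensorMapTo e m [b]) = (m a ⊗ₘ m b) ≫ Y (e a) ◁ one Y (e b)
  rw [← id_tensorHom, ← id_tensorHom, MonoidalCategory.tensorHom_comp_tensorHom,
    MonoidalCategory.tensorHom_comp_tensorHom, Category.id_comp, Category.comp_id]
  exact congrArg (fun k => m a ⊗ₘ k) (one_mapTo e m b)

theorem one_mapFrom (p : κ → ι) (m : ∀ k, X (p k) ⟶ Y k) (a : κ) :
    one X (p a) ≫ listTensorMapFrom p m [a] = m a ≫ one Y a := by
  change (ρ_ (X (p a))).inv ≫ (m a ⊗ₘ 𝟙 (𝟙_ M)) = m a ≫ (ρ_ (Y a)).inv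
  simp

theorem two_mapFrom (p : κ → ι) (m : ∀ k, X (p k) ⟶ Y k) (a b : κ) :
    two X (p a) (p b) ≫ listTensorMapFrom p m [a, b] = (m a ⊗ₘ m b) ≫ two Y a b := by
  change X (p a) ◁ one X (p b) ≫ (m a ⊗ₘ listTensorMapFrom p m [b]) = (m a ⊗ₘ m b) ≫ Y a ◁ one Y b
  rw [← id_tensorHom, ← id_tensorHom, MonoidalCategory.tensorHom_comp_tensorHom,
    MonoidalCategory.tensorHom_comp_tensorHom, Category.id_comp, Category.comp_id]
  exact congrArg (fun k => m a ⊗ₘ k) (one_mapFrom p m b)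

theorem append_one (X : ι → M) (a : ι) (l : List ι) (r : X a ⊗ listTensor X l ⟶ listTensor X (a :: l))
    (hr : r = 𝟙 (X a ⊗ listTensor X l)) :
    r ≫ listTensorAppend X [a] l = one X a ▷ listTensor X l := by
  subst hr
  refine (Category.id_comp _).trans ?_
  change X a ◁ (λ_ (listTensor X l)).inv ≫ (α_ (X a) (𝟙_ M) (listTensor X l)).inv =
    (ρ_ (X a)).inv ▷ listTensor X l
  simp

theorem two_append (X : ι → M) (a b : ι) :
    two X a b ≫ listTensorAppend X [a] [b] = (one X a ⊗ₘ one X b) := by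
  have h := append_one X a [b] (𝟙 _) rfl
  refine (congrArg (fun k => k ≫ listTensorAppend X [a] [b])
    (Category.comp_id (X a ◁ one X b)).symm).trans ((Category.assoc _ _ _).trans ?_)
  rw [MonoidalCategory.tensorHom_def', ← h]

theorem three_append_right (X : ι → M) (a b c : ι) :
    three X a b c ≫ listTensorAppend X [a] [b, c] = (one X a ⊗ₘ two X b c) := by
  have h := append_one X a [b, c] (𝟙 _) rfl
  refine (congrArg (fun k => k ≫ listTensorAppend X [a] [b, c])
    (Category.comp_id (X a ◁ two X b c)).symm).trans ((Category.assoc _ _ _).trans ?_)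
  rw [MonoidalCategory.tensorHom_def', ← h]

theorem three_append_left (X : ι → M) (a b c : ι) :
    three X a b c ≫ listTensorAppend X [a, b] [c] =
      (α_ (X a) (X b) (X c)).inv ≫ (two X a b ⊗ₘ one X c) := by
  have key : ∀ t : listTensor X [b, c] ⟶ listTensor X [b] ⊗ listTensor X [c],
      two X b c ≫ t = (one X b ⊗ₘ one X c) →
      X a ◁ two X b c ≫ X a ◁ t ≫ (α_ (X a) (listTensor X [b]) (listTensor X [c])).inv =
      (α_ (X a) (X b) (X c)).inv ≫ ((X a ◁ one X b) ⊗ₘ one X c) := by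
    intro t ht
    rw [← Category.assoc, ← whiskerLeft_comp, ht]
    simp [MonoidalCategory.tensorHom_def]
  exact key _ (two_append X b c)

theorem two_swap (X : ι → M) (a b : ι) :
    two X b a ≫ consSwap X b a [] = (β_ (X b) (X a)).hom ≫ two X a b := by
  change X b ◁ (ρ_ (X a)).inv ≫ swapFront (X b) (X a) (𝟙_ M) =
    (β_ (X b) (X a)).hom ≫ X a ◁ (ρ_ (X b)).inv
  simp [swapFront]

theorem append_nil_right (X : ι → M) (l : List ι) :
    ∀ h : l.Perm (l ++ []), reorder X _ _ h ≫ listTensorAppend X l [] = (ρ_ _).inv := by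
  induction l with
  | nil =>
    intro h
    change reorder X [] [] h ≫ (λ_ (𝟙_ M)).inv = (ρ_ (𝟙_ M)).inv
    rw [reorder_nil, unitors_inv_equal]
    exact Category.id_comp _
  | cons i l ih =>
    intro h
    have h' : l.Perm (l ++ []) := by rw [List.append_nil]
    have e : reorder X (i :: l) (i :: (l ++ [])) (h'.cons i) = X i ◁ reorder X l (l ++ []) h' :=
      reorder_cons_cons X _ _ _ _ _
    have key : ∀ (r : listTensor X l ⟶ listTensor X (l ++ []))
        (r' : X i ⊗ listTensor X l ⟶ X i ⊗ listTensor X (l ++ []))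
        (t : listTensor X (l ++ []) ⟶ listTensor X l ⊗ 𝟙_ M), r ≫ t = (ρ_ _).inv →
        r' = X i ◁ r → r' ≫ X i ◁ t ≫ (α_ (X i) (listTensor X l) (𝟙_ M)).inv =
          (ρ_ (X i ⊗ listTensor X l)).inv := by
      rintro r _ t h rfl
      rw [← Category.assoc, ← whiskerLeft_comp, h]
      simp
    exact key _ _ _ (ih h') e

theorem block_one (fib : κ → List ι) (m : ∀ k, listTensor X (fib k) ⟶ Y k) (k : κ)
    (h : (fib k).Perm ([k].flatMap fib)) :
    reorder X _ _ h ≫ listTensorBlock fib m [k] = m k ≫ one Y k := by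
  have h' : (fib k).Perm (fib k ++ []) := h
  have key : ∀ (r : listTensor X (fib k) ⟶ listTensor X (fib k ++ []))
      (t : listTensor X (fib k ++ []) ⟶ listTensor X (fib k) ⊗ 𝟙_ M), r ≫ t = (ρ_ _).inv →
      r ≫ t ≫ (m k ⊗ₘ 𝟙 (𝟙_ M)) = m k ≫ (ρ_ (Y k)).inv := by
    intro r t h
    rw [← Category.assoc, h]
    simp
  exact key _ _ (append_nil_right X (fib k) h')

theorem block_two (fib : κ → List ι) (m : ∀ k, listTensor X (fib k) ⟶ Y k) (k k' : κ)
    (h : (fib k ++ fib k').Perm ([k, k'].flatMap fib)) :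
    reorder X _ _ h ≫ listTensorBlock fib m [k, k'] =
      listTensorAppend X (fib k) (fib k') ≫ (m k ⊗ₘ m k') ≫ two Y k k' := by
  have h1 : (fib k').Perm ([k'].flatMap fib) := by simp
  have h2 := reorder_append_right (X := X) (fib k) h1 (h1.append_left _)
  have h3 := block_one fib m k' h1
  have key : ∀ (r : listTensor X (fib k ++ fib k') ⟶ listTensor X (fib k ++ [k'].flatMap fib)),
      r ≫ listTensorAppend X (fib k) ([k'].flatMap fib) = listTensorAppend X (fib k) (fib k') ≫
        listTensor X (fib k) ◁ reorder X _ _ h1 →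
      r ≫ listTensorAppend X (fib k) ([k'].flatMap fib) ≫ (m k ⊗ₘ listTensorBlock fib m [k']) =
      listTensorAppend X (fib k) (fib k') ≫ (m k ⊗ₘ m k') ≫ Y k ◁ one Y k' := by
    intro r hr
    rw [← Category.assoc, hr, Category.assoc, ← id_tensorHom, ← id_tensorHom,
      MonoidalCategory.tensorHom_comp_tensorHom, MonoidalCategory.tensorHom_comp_tensorHom, h3,
      Category.id_comp, Category.comp_id]
  exact key _ h2

end Small

theorem perm_single {a : ι} (h : ∀ i, i = a) : [a].Perm (ordering ι) :=
  (ordering_perm (List.nodup_singleton a) fun i => by simp [h i]).symm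

theorem perm_pair {a b : ι} (hab : a ≠ b) (h : ∀ i, i = a ∨ i = b) : [a, b].Perm (ordering ι) :=
  (ordering_perm (by simp [hab]) fun i => by simpa using h i).symm

theorem perm_triple {a b c : ι} (hab : a ≠ b) (hac : a ≠ c) (hbc : b ≠ c)
    (h : ∀ i, i = a ∨ i = b ∨ i = c) : [a, b, c].Perm (ordering ι) :=
  (ordering_perm (by simp [hab, hac, hbc]) fun i => by simpa using h i).symm

/-- A list that contains every element exactly once. -/
theorem reorder_uMap (e : ι ≃ κ) (m : ∀ i, X i ⟶ Y (e i)) (l : List ι) (h : l.Perm (ordering ι))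
    (h' : (l.map e).Perm (ordering κ)) :
    reorder X _ _ h ≫ uMap e m = listTensorMapTo e m l ≫ reorder Y _ _ h' := by
  have h1 := mapTo_reorder e e.injective m h (h.map e)
  unfold uMap
  rw [← Category.assoc, ← h1, Category.assoc, reorder_comp]

theorem single_uMap (e : ι ≃ κ) (m : ∀ i, X i ⟶ Y (e i)) (a : ι)
    (h : [a].Perm (ordering ι)) (h' : [e a].Perm (ordering κ)) :
    single X a h ≫ uMap e m = m a ≫ single Y (e a) h' := by
  rw [single, Category.assoc, reorder_uMap e m _ h h', ← Category.assoc, one_mapTo, Category.assoc]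
  rfl

theorem pair_uMap (e : ι ≃ κ) (m : ∀ i, X i ⟶ Y (e i)) (a b : ι)
    (h : [a, b].Perm (ordering ι)) (h' : [e a, e b].Perm (ordering κ)) :
    pair X a b h ≫ uMap e m = (m a ⊗ₘ m b) ≫ pair Y (e a) (e b) h' := by
  rw [pair, Category.assoc, reorder_uMap e m _ h h', ← Category.assoc, two_mapTo, Category.assoc]
  rfl

theorem pair_swap (X : ι → M) (a b : ι) (hab : a ≠ b) (h : [a, b].Perm (ordering ι))
    (h' : [b, a].Perm (ordering ι)) :
    pair X b a h' = (β_ (X b) (X a)).hom ≫ pair X a b h := by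
  have e := reorder_comp X _ _ _ (List.Perm.swap a b []) h
  rw [reorder_swap X b a [] hab.symm] at e
  rw [pair, pair, ← reassoc_of% (two_swap X a b), e]

/-- `uFib` for a map to a set with one element. -/
theorem reorder_uFib_one (p : ι → κ) (m : ∀ k, uTensor (fun i : {i // p i = k} => X i.1) ⟶ Y k)
    (k : κ) (hk : [k].Perm (ordering κ)) (l : List {i // p i = k}) (hl : l.Perm (ordering _))
    (h : (l.map Subtype.val).Perm (ordering ι)) :
    reorder X _ _ h ≫ uFib p m =
      listTensorMapFrom Subtype.val (fun i => 𝟙 (X i.1)) l ≫ reorder _ _ _ hl ≫ m k ≫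
        single Y k hk := by
  classical
  obtain ⟨L, hL, e⟩ : ∃ L : ∀ k, List {i // p i = k}, (∀ k, (L k).Perm (ordering _)) ∧
      L k = l := by
    refine ⟨Function.update (fun k => ordering _) k l, fun k' => ?_, Function.update_self _ _ _⟩
    by_cases hk : k' = k
    · subst hk; rwa [Function.update_self]
    · rw [Function.update_of_ne hk]
  subst e
  have h1 : ((L k).map Subtype.val).Perm ([k].flatMap fun k => (L k).map Subtype.val) := by simp
  have h2 := reorder_uFib p m [k] hk L hL (h1.symm.trans h)
  rw [← reorder_comp X _ _ _ h1 (h1.symm.trans h), Category.assoc, h2, ← Category.assoc,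
    block_one (fun k => (L k).map Subtype.val) _ k h1, single]
  simp only [Category.assoc]

/-- `uFib` for a map to a set with two elements. -/
theorem reorder_uFib_two (p : ι → κ) (m : ∀ k, uTensor (fun i : {i // p i = k} => X i.1) ⟶ Y k)
    (k k' : κ) (hne : k ≠ k') (hk : [k, k'].Perm (ordering κ)) (l : List {i // p i = k})
    (hl : l.Perm (ordering _)) (l' : List {i // p i = k'}) (hl' : l'.Perm (ordering _))
    (h : (l.map Subtype.val ++ l'.map Subtype.val).Perm (ordering ι)) :
    reorder X _ _ h ≫ uFib p m = listTensorAppend X _ _ ≫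
      ((listTensorMapFrom Subtype.val (fun i => 𝟙 (X i.1)) l ≫ reorder _ _ _ hl ≫ m k) ⊗ₘ
        (listTensorMapFrom Subtype.val (fun i => 𝟙 (X i.1)) l' ≫ reorder _ _ _ hl' ≫ m k')) ≫
        pair Y k k' hk := by
  classical
  obtain ⟨L, hL, e, e'⟩ : ∃ L : ∀ k, List {i // p i = k}, (∀ k, (L k).Perm (ordering _)) ∧
      L k = l ∧ L k' = l' := by
    refine ⟨Function.update (Function.update (fun k => ordering _) k l) k' l', fun k₁ => ?_, ?_,
      Function.update_self _ _ _⟩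
    · by_cases hk' : k₁ = k'
      · subst hk'; rwa [Function.update_self]
      · rw [Function.update_of_ne hk']
        by_cases hk : k₁ = k
        · subst hk; rwa [Function.update_self]
        · rw [Function.update_of_ne hk]
    · rw [Function.update_of_ne hne, Function.update_self]
  subst e e'
  have h1 : ((L k).map Subtype.val ++ (L k').map Subtype.val).Perm
    ([k, k'].flatMap fun k => (L k).map Subtype.val) := by simp
  have h2 := reorder_uFib p m [k, k'] hk L hL (h1.symm.trans h)
  rw [← reorder_comp X _ _ _ h1 (h1.symm.trans h), Category.assoc, h2, ← Category.assoc,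
    block_two (fun k => (L k).map Subtype.val) _ k k' h1, pair]
  simp only [Category.assoc]

theorem single_uFib (p : ι → κ) (m : ∀ k, uTensor (fun i : {i // p i = k} => X i.1) ⟶ Y k)
    (a : ι) (ha : [a].Perm (ordering ι)) (k : κ) (hk : [k].Perm (ordering κ)) (h : p a = k)
    (ha' : [⟨a, h⟩].Perm (ordering {i // p i = k})) :
    single X a ha ≫ uFib p m =
      single (fun i : {i // p i = k} => X i.1) ⟨a, h⟩ ha' ≫ m k ≫ single Y k hk := by
  have h1 := one_mapFrom (X := X) (Y := fun i : {i // p i = k} => X i.1) Subtype.val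
    (fun i => 𝟙 (X i.1)) ⟨a, h⟩
  have h2 := reorder_uFib_one (X := X) p m k hk [⟨a, h⟩] ha' ha
  rw [single, Category.assoc]
  refine (congrArg (fun k => one X a ≫ k) h2).trans ?_
  refine (Category.assoc _ _ _).symm.trans ((congrArg (fun k => k ≫ _) h1).trans ?_)
  rw [Category.id_comp]
  unfold single
  simp only [Category.assoc]

theorem pair_uFib_one (p : ι → κ) (m : ∀ k, uTensor (fun i : {i // p i = k} => X i.1) ⟶ Y k)
    (a b : ι) (hab : [a, b].Perm (ordering ι)) (k : κ) (hk : [k].Perm (ordering κ)) (ha : p a = k)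
    (hb : p b = k) (hab' : [⟨a, ha⟩, ⟨b, hb⟩].Perm (ordering {i // p i = k})) :
    pair X a b hab ≫ uFib p m =
      pair (fun i : {i // p i = k} => X i.1) ⟨a, ha⟩ ⟨b, hb⟩ hab' ≫ m k ≫ single Y k hk := by
  have h1 := two_mapFrom (X := X) (Y := fun i : {i // p i = k} => X i.1) Subtype.val
    (fun i => 𝟙 (X i.1)) ⟨a, ha⟩ ⟨b, hb⟩
  have h2 := reorder_uFib_one (X := X) p m k hk [⟨a, ha⟩, ⟨b, hb⟩] hab' hab
  rw [pair, Category.assoc]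
  refine (congrArg (fun k => two X a b ≫ k) h2).trans ?_
  refine (Category.assoc _ _ _).symm.trans ((congrArg (fun k => k ≫ _) h1).trans ?_)
  rw [id_tensorHom_id, Category.id_comp, pair]
  simp only [Category.assoc]

theorem pair_uFib_two (p : ι → κ) (m : ∀ k, uTensor (fun i : {i // p i = k} => X i.1) ⟶ Y k)
    (a b : ι) (hab : [a, b].Perm (ordering ι)) (k k' : κ) (hne : k ≠ k')
    (hk : [k, k'].Perm (ordering κ)) (ha : p a = k) (hb : p b = k')
    (ha' : [⟨a, ha⟩].Perm (ordering {i // p i = k}))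
    (hb' : [⟨b, hb⟩].Perm (ordering {i // p i = k'})) :
    pair X a b hab ≫ uFib p m =
      ((single (fun i : {i // p i = k} => X i.1) ⟨a, ha⟩ ha' ≫ m k) ⊗ₘ
        (single (fun i : {i // p i = k'} => X i.1) ⟨b, hb⟩ hb' ≫ m k')) ≫ pair Y k k' hk := by
  have h1 := one_mapFrom (X := X) (Y := fun i : {i // p i = k} => X i.1) Subtype.val
    (fun i => 𝟙 (X i.1)) ⟨a, ha⟩
  have h1' := one_mapFrom (X := X) (Y := fun i : {i // p i = k'} => X i.1) Subtype.val
    (fun i => 𝟙 (X i.1)) ⟨b, hb⟩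
  have h2 := reorder_uFib_two (X := X) p m k k' hne hk [⟨a, ha⟩] ha' [⟨b, hb⟩] hb' hab
  rw [pair, Category.assoc]
  refine (congrArg (fun k => two X a b ≫ k) h2).trans ?_
  refine (Category.assoc _ _ _).symm.trans ((congrArg (fun k => k ≫ _) (two_append X a b)).trans ?_)
  rw [← Category.assoc]
  congr 1
  refine (MonoidalCategory.tensorHom_comp_tensorHom _ _ _ _).trans ?_
  refine congrArg₂ (fun f g => f ⊗ₘ g) ?_ ?_
  · refine (Category.assoc _ _ _).symm.trans ((congrArg (fun k => k ≫ _) h1).trans ?_)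
    rw [Category.id_comp, single, Category.assoc]
  · refine (Category.assoc _ _ _).symm.trans ((congrArg (fun k => k ≫ _) h1').trans ?_)
    rw [Category.id_comp, single, Category.assoc]

theorem triple_uFib_left (p : ι → κ) (m : ∀ k, uTensor (fun i : {i // p i = k} => X i.1) ⟶ Y k)
    (a b c : ι) (habc : [a, b, c].Perm (ordering ι)) (k k' : κ) (hne : k ≠ k')
    (hk : [k, k'].Perm (ordering κ)) (ha : p a = k) (hb : p b = k) (hc : p c = k')
    (hab' : [⟨a, ha⟩, ⟨b, hb⟩].Perm (ordering {i // p i = k}))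
    (hc' : [⟨c, hc⟩].Perm (ordering {i // p i = k'})) :
    triple X a b c habc ≫ uFib p m = (α_ (X a) (X b) (X c)).inv ≫
      ((pair (fun i : {i // p i = k} => X i.1) ⟨a, ha⟩ ⟨b, hb⟩ hab' ≫ m k) ⊗ₘ
        (single (fun i : {i // p i = k'} => X i.1) ⟨c, hc⟩ hc' ≫ m k')) ≫ pair Y k k' hk := by
  have h1 := two_mapFrom (X := X) (Y := fun i : {i // p i = k} => X i.1) Subtype.val
    (fun i => 𝟙 (X i.1)) ⟨a, ha⟩ ⟨b, hb⟩
  have h1' := one_mapFrom (X := X) (Y := fun i : {i // p i = k'} => X i.1) Subtype.val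
    (fun i => 𝟙 (X i.1)) ⟨c, hc⟩
  have h2 := reorder_uFib_two (X := X) p m k k' hne hk [⟨a, ha⟩, ⟨b, hb⟩] hab' [⟨c, hc⟩] hc' habc
  rw [triple, Category.assoc]
  refine (congrArg (fun k => three X a b c ≫ k) h2).trans ?_
  refine (Category.assoc _ _ _).symm.trans
    ((congrArg (fun k => k ≫ _) (three_append_left X a b c)).trans ?_)
  rw [Category.assoc]
  congr 1
  rw [← Category.assoc]
  congr 1
  refine (MonoidalCategory.tensorHom_comp_tensorHom _ _ _ _).trans ?_
  refine congrArg₂ (fun f g => f ⊗ₘ g) ?_ ?_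
  · refine (Category.assoc _ _ _).symm.trans ((congrArg (fun k => k ≫ _) h1).trans ?_)
    rw [id_tensorHom_id, Category.id_comp, pair, Category.assoc]
  · refine (Category.assoc _ _ _).symm.trans ((congrArg (fun k => k ≫ _) h1').trans ?_)
    rw [Category.id_comp, single, Category.assoc]

theorem triple_uFib_right (p : ι → κ) (m : ∀ k, uTensor (fun i : {i // p i = k} => X i.1) ⟶ Y k)
    (a b c : ι) (habc : [a, b, c].Perm (ordering ι)) (k k' : κ) (hne : k ≠ k')
    (hk : [k, k'].Perm (ordering κ)) (ha : p a = k) (hb : p b = k') (hc : p c = k')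
    (ha' : [⟨a, ha⟩].Perm (ordering {i // p i = k}))
    (hbc' : [⟨b, hb⟩, ⟨c, hc⟩].Perm (ordering {i // p i = k'})) :
    triple X a b c habc ≫ uFib p m =
      ((single (fun i : {i // p i = k} => X i.1) ⟨a, ha⟩ ha' ≫ m k) ⊗ₘ
        (pair (fun i : {i // p i = k'} => X i.1) ⟨b, hb⟩ ⟨c, hc⟩ hbc' ≫ m k')) ≫
          pair Y k k' hk := by
  have h1 := one_mapFrom (X := X) (Y := fun i : {i // p i = k} => X i.1) Subtype.val
    (fun i => 𝟙 (X i.1)) ⟨a, ha⟩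
  have h1' := two_mapFrom (X := X) (Y := fun i : {i // p i = k'} => X i.1) Subtype.val
    (fun i => 𝟙 (X i.1)) ⟨b, hb⟩ ⟨c, hc⟩
  have h2 := reorder_uFib_two (X := X) p m k k' hne hk [⟨a, ha⟩] ha' [⟨b, hb⟩, ⟨c, hc⟩] hbc' habc
  rw [triple, Category.assoc]
  refine (congrArg (fun k => three X a b c ≫ k) h2).trans ?_
  refine (Category.assoc _ _ _).symm.trans
    ((congrArg (fun k => k ≫ _) (three_append_right X a b c)).trans ?_)
  rw [← Category.assoc]
  congr 1
  refine (MonoidalCategory.tensorHom_comp_tensorHom _ _ _ _).trans ?_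
  refine congrArg₂ (fun f g => f ⊗ₘ g) ?_ ?_
  · refine (Category.assoc _ _ _).symm.trans ((congrArg (fun k => k ≫ _) h1).trans ?_)
    rw [Category.id_comp, single, Category.assoc]
  · refine (Category.assoc _ _ _).symm.trans ((congrArg (fun k => k ≫ _) h1').trans ?_)
    rw [id_tensorHom_id, Category.id_comp, pair, Category.assoc]

theorem mapTo_mapFrom {ι κ : Type} {X : ι → M} {Y : κ → M} (p : ι → κ) (m : ∀ i, X i ⟶ Y (p i))
    (n : ∀ i, Y (p i) ⟶ X i) (h : ∀ i, m i ≫ n i = 𝟙 _) (l : List ι) :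
    listTensorMapTo p m l ≫ listTensorMapFrom p n l = 𝟙 _ := by
  induction l with
  | nil => exact Category.comp_id (𝟙 (𝟙_ M))
  | cons i l ih =>
    change (m i ⊗ₘ listTensorMapTo p m l) ≫ (n i ⊗ₘ listTensorMapFrom p n l) = 𝟙 (X i ⊗ _)
    rw [MonoidalCategory.tensorHom_comp_tensorHom, h, ih, id_tensorHom_id]

theorem uMap_uFib_one (p : ι → κ) (m : ∀ k, uTensor (fun i : {i // p i = k} => X i.1) ⟶ Y k)
    (k : κ) (hk : [k].Perm (ordering κ)) (hp : ∀ i, p i = k) :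
    uMap (Y := X) (Equiv.subtypeUnivEquiv hp) (fun i : {i // p i = k} => 𝟙 (X i.1)) ≫ uFib p m =
      m k ≫ single Y k hk := by
  have h1 : ((ordering {i // p i = k}).map Subtype.val).Perm (ordering ι) :=
    map_ordering_perm (Equiv.subtypeUnivEquiv hp)
  have h2 := reorder_uFib_one (X := X) p m k hk _ (List.Perm.refl _) h1
  have h3 := mapTo_mapFrom (X := fun i : {i // p i = k} => X i.1) (Y := X) Subtype.val
    (fun i => 𝟙 (X i.1)) (fun i => 𝟙 (X i.1)) (fun _ => Category.comp_id _) (ordering _)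
  refine (Category.assoc _ _ _).trans ?_
  refine (congrArg (fun k => _ ≫ k) h2).trans ((Category.assoc _ _ _).symm.trans ?_)
  refine (congrArg (fun k => k ≫ _) h3).trans ?_
  rw [Category.id_comp, reorder_refl, Category.id_comp]

theorem block_singletons {X Y : ι → M} (m : ∀ k : ι, listTensor X [k] ⟶ Y k) (L : List ι)
    (h : L.Perm (L.flatMap fun k => [k])) : ∀ h' : (L.map fun k => k).Perm L,
    reorder X _ _ h ≫ listTensorBlock (fun k => [k]) m L =
      listTensorMapTo (fun k => k) (fun k => one X k ≫ m k) L ≫ reorder Y _ _ h' := by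
  induction L with
  | nil =>
    intro h'
    change reorder X [] [] h ≫ 𝟙 (𝟙_ M) = 𝟙 (𝟙_ M) ≫ reorder Y [] [] h'
    rw [reorder_nil, reorder_nil]
    rfl
  | cons k L ih =>
    intro h'
    have h1 : L.Perm (L.flatMap fun k => [k]) := by simp
    have h2 : (L.map fun k => k).Perm L := by simp
    have e1 : reorder X (k :: L) (k :: L.flatMap fun k => [k]) h = X k ◁ reorder X _ _ h1 :=
      reorder_cons_cons X _ _ _ _ _
    have e2 : reorder Y (k :: L.map fun k => k) (k :: L) h' = Y k ◁ reorder Y _ _ h2 :=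
      reorder_cons_cons Y _ _ _ _ _
    have e3 := append_one X k (L.flatMap fun k => [k]) (𝟙 _) rfl
    have key : ∀ (r : X k ⊗ listTensor X L ⟶ X k ⊗ listTensor X (L.flatMap fun k => [k]))
        (r' : Y k ⊗ listTensor Y (L.map fun k => k) ⟶ Y k ⊗ listTensor Y L)
        (t : X k ⊗ listTensor X (L.flatMap fun k => [k]) ⟶
          listTensor X [k] ⊗ listTensor X (L.flatMap fun k => [k])),
        r = X k ◁ reorder X _ _ h1 → r' = Y k ◁ reorder Y _ _ h2 → 𝟙 _ ≫ t = one X k ▷ _ →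
        r ≫ t ≫ (m k ⊗ₘ listTensorBlock (fun k => [k]) m L) =
          ((one X k ≫ m k) ⊗ₘ listTensorMapTo (fun k => k) (fun k => one X k ≫ m k) L) ≫ r' := by
      rintro _ _ t rfl rfl h3
      rw [Category.id_comp] at h3
      subst h3
      rw [← id_tensorHom, ← id_tensorHom, ← tensorHom_id]
      simp only [MonoidalCategory.tensorHom_comp_tensorHom, Category.id_comp, Category.comp_id,
        ← ih h1 h2]
    exact key _ _ _ e1 e2 e3

theorem uFib_id {Y : ι → M} (m : ∀ k, uTensor (fun i : {i // i = k} => X i.1) ⟶ Y k)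
    (h : ∀ k : ι, [⟨k, rfl⟩].Perm (ordering {i // i = k})) :
    uFib (fun i => i) m = uMap (Equiv.refl ι) (fun k =>
      single (fun i : {i // i = k} => X i.1) ⟨k, rfl⟩ (h k) ≫ m k) := by
  have h1 : (ordering ι).Perm ((ordering ι).flatMap fun k => [k]) := by simp
  have h3 : ((ordering ι).map fun k => k).Perm (ordering ι) := by simp
  have h2 := reorder_uFib (X := X) (fun i => i) m (ordering ι) (List.Perm.refl _)
    (fun k => [⟨k, rfl⟩]) h h1.symm
  have h4 := block_singletons (X := X) (Y := Y) (fun k =>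
    listTensorMapFrom Subtype.val (fun i => 𝟙 (X i.1)) [(⟨k, rfl⟩ : {i // i = k})] ≫ reorder _ _ _ (h k) ≫ m k)
    (ordering ι) h1 h3
  have h5 : reorder X _ _ h1 ≫ reorder X _ _ h1.symm = 𝟙 _ := by rw [reorder_comp, reorder_refl]
  rw [← Category.id_comp (uFib _ m), ← h5, Category.assoc]
  refine (congrArg (fun k => _ ≫ k) h2).trans ?_
  rw [reorder_refl, Category.comp_id]
  refine h4.trans ?_
  have h6 : (fun k => one X k ≫ listTensorMapFrom Subtype.val (fun i => 𝟙 (X i.1))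
        [(⟨k, rfl⟩ : {i // i = k})] ≫ reorder _ _ _ (h k) ≫ m k) =
      fun k => single (fun i : {i // i = k} => X i.1) ⟨k, rfl⟩ (h k) ≫ m k := funext fun k => by
    have h1 := one_mapFrom (X := X) (Y := fun i : {i // i = k} => X i.1) Subtype.val
      (fun i => 𝟙 (X i.1)) ⟨k, rfl⟩
    refine (Category.assoc _ _ _).symm.trans ((congrArg (fun k => k ≫ _) h1).trans ?_)
    rw [Category.id_comp, single, Category.assoc]
  exact congrArg (fun n => listTensorMapTo (fun k => k) n (ordering ι) ≫ reorder Y _ _ h3) h6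

theorem uFib_equiv (e : ι ≃ κ) (m : ∀ k, uTensor (fun i : {i // e i = k} => X i.1) ⟶ Y k)
    (h : ∀ i, [⟨i, rfl⟩].Perm (ordering {j // e j = e i})) :
    uFib e m = uMap e (fun i =>
      single (fun j : {j // e j = e i} => X j.1) ⟨i, rfl⟩ (h i) ≫ m (e i)) := by
  have h0 : ∀ k : κ, [⟨k, rfl⟩].Perm (ordering {j // j = k}) := fun k => perm_single fun i =>
    Subtype.ext i.2
  let X' : κ → M := fun k => uTensor (fun i : {i // e i = k} => X i.1)
  let x : ∀ i, X i ⟶ X' (e i) := fun i => single (fun j : {j // e j = e i} => X j.1) ⟨i, rfl⟩ (h i)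
  let m' : ∀ k, uTensor (fun i : {i : κ // i = k} => X' i.1) ⟶ Y k := fun k =>
    inv (single (fun i : {i : κ // i = k} => X' i.1) ⟨k, rfl⟩ (h0 k)) ≫ m k
  have h1 := uFib_uMap (X := X) (X' := X') (p := e) (p' := fun k => k) e (Equiv.refl κ)
    (fun _ => rfl) x (fun k => 𝟙 (Y k)) m m' (fun k => by
      obtain ⟨i, rfl⟩ := e.surjective k
      refine (Category.comp_id (m (e i))).trans ?_
      refine (cancel_epi (single (fun j : {j // e j = e i} => X j.1) ⟨i, rfl⟩ (h i))).1 ?_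
      have h2 := single_uMap (X := fun j : {j // e j = e i} => X j.1)
        (Y := fun j : {j : κ // j = e i} => X' j.1) (fiberEquiv (p := e) (p' := fun k => k) e
          (Equiv.refl κ) (fun _ => rfl) (e i)) (fun i => x i.1) ⟨i, rfl⟩ (h i) (h0 (e i))
      refine Eq.trans ?_ (Category.assoc _ _ _)
      refine Eq.trans ?_ (congrArg (fun k => k ≫ m' (e i)) h2).symm
      refine Eq.trans ?_ (Category.assoc _ _ _).symm
      exact (congrArg (fun k => x i ≫ k) (IsIso.hom_inv_id_assoc
        (single (fun j : {j : κ // j = e i} => X' j.1) ⟨e i, rfl⟩ (h0 (e i))) (m (e i)))).symm)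
  have h2 := uMap_id Y
  rw [uFib_id m' h0] at h1
  have h3 : uFib e m ≫ 𝟙 _ = _ := (congrArg (fun k => uFib e m ≫ k) h2).symm.trans h1
  rw [Category.comp_id] at h3
  rw [h3]
  refine (uMap_comp _ _ _ _).trans ?_
  congr 1
  funext i
  simp only [m']
  exact congrArg (fun k => x i ≫ k) (IsIso.hom_inv_id_assoc _ _)

end Unordered

theorem eqvGen_iff {α : Type} {r : α → α → Prop} {p : α → Prop} (h : ∀ a b, r a b → (p a ↔ p b))
    {a b : α} (hab : Relation.EqvGen r a b) : p a ↔ p b := by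
  induction hab with
  | rel a b hab => exact h a b hab
  | refl => rfl
  | symm _ _ _ ih => exact ih.symm
  | trans _ _ _ _ _ ih ih' => exact ih.trans ih'

namespace MultCyc

variable {S T U : MultCyc}

@[simp]
theorem arcMap_id (a : S.Arc) : arcMap (𝟙 S) a = a := by rcases a with a | a <;> rfl

theorem arcMap_comp (f : S ⟶ T) (g : T ⟶ U) (a : S.Arc) :
    arcMap (f ≫ g) a = arcMap g (arcMap f a) := by rcases a with a | a <;> rfl

theorem hom_ext_arc {f g : S ⟶ T} (h : ∀ a, arcMap f a = arcMap g a) : f = g :=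
  Hom.ext (Equiv.ext fun x => Sum.inl_injective (h (Sum.inl x)))
    (Equiv.ext fun x => Sum.inr_injective (h (Sum.inr x)))

theorem arcMap_injective (f : S ⟶ T) : Function.Injective (arcMap f) :=
  Sum.map_injective.2 ⟨f.pt.injective, f.emp.injective⟩

theorem arcMap_surjective (f : S ⟶ T) : Function.Surjective (arcMap f) :=
  Sum.map_surjective.2 ⟨f.pt.surjective, f.emp.surjective⟩

/-- The inverse of an isomorphism of multicyclically ordered sets. -/
def inv (f : S ⟶ T) : T ⟶ S where
  pt := f.pt.symm
  emp := f.emp.symm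
  map_succ x := by
    apply f.pt.injective
    rw [f.map_succ, Equiv.apply_symm_apply, Equiv.apply_symm_apply]

theorem comp_inv (f : S ⟶ T) : f ≫ inv f = 𝟙 S :=
  Hom.ext (Equiv.ext fun x => f.pt.symm_apply_apply x) (Equiv.ext fun x => f.emp.symm_apply_apply x)

theorem inv_comp (f : S ⟶ T) : inv f ≫ f = 𝟙 T :=
  Hom.ext (Equiv.ext fun x => f.pt.apply_symm_apply x) (Equiv.ext fun x => f.emp.apply_symm_apply x)

end MultCyc

namespace Gluing

variable {S T U : MultCyc} {inv : S.pt → S.pt}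

theorem arc_emb (G : Gluing S inv T) (y : T.pt) : G.arc (Sum.inl (G.emb y)) = Sum.inl y :=
  G.hit_emb y

theorem arc_succ_emb (G : Gluing S inv T) (y : T.pt) :
    G.arc (Sum.inl (S.succ (G.emb y))) = Sum.inl (T.succ y) :=
  G.hit_succ y

theorem arc_inv (G : Gluing S inv T) {x : S.pt} (hx : x ∉ Set.range G.emb) :
    G.arc (Sum.inl x) = G.arc (Sum.inl (S.succ (inv x))) :=
  G.hit_inv x hx

theorem eq_emb_of_arc_eq (G : Gluing S inv T) {x : S.pt} {y : T.pt} (hx : x ∈ Set.range G.emb)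
    (h : G.arc (Sum.inl x) = Sum.inl y) : x = G.emb y := by
  obtain ⟨z, rfl⟩ := hx
  rw [G.arc_emb] at h
  rw [Sum.inl_injective h]

theorem ext_arc {G G' : Gluing S inv T} (h : ∀ a, G.arc a = G'.arc a)
    (he : ∀ y, G.emb y = G'.emb y) : G = G' :=
  Gluing.ext (funext he) (funext fun x => h (Sum.inl x))
    (funext fun x => Sum.inr_injective (h (Sum.inr x)))

/-- A gluing given by its map of arcs. -/
def ofArc (emb : T.pt → S.pt) (arc : S.Arc → T.Arc) (emp : S.emp → T.emp)
    (h_emp : ∀ e, arc (Sum.inr e) = Sum.inr (emp e))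
    (h_emb : ∀ y, arc (Sum.inl (emb y)) = Sum.inl y)
    (h_succ : ∀ y, arc (Sum.inl (S.succ (emb y))) = Sum.inl (T.succ y))
    (h_inv : ∀ x, x ∉ Set.range emb → arc (Sum.inl x) = arc (Sum.inl (S.succ (inv x))))
    (h_surj : Function.Surjective arc)
    (h_ker : ∀ a a', arc a = arc a' → Relation.EqvGen (fun a a' => ∃ x, x ∉ Set.range emb ∧
      a = Sum.inl x ∧ a' = Sum.inl (S.succ (inv x))) a a') : Gluing S inv T :=
  have e : (Sum.elim (fun x => arc (Sum.inl x)) (Sum.inr ∘ emp) : S.Arc → T.Arc) = arc :=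
    funext fun a => by rcases a with a | a; exacts [rfl, (h_emp a).symm]
  { emb := emb
    hit := fun x => arc (Sum.inl x)
    emp := emp
    hit_emb := h_emb
    hit_succ := h_succ
    hit_inv := h_inv
    surj := by rw [e]; exact h_surj
    ker := by rw [e]; exact h_ker }

theorem ofArc_arc (emb : T.pt → S.pt) (arc : S.Arc → T.Arc) (emp : S.emp → T.emp)
    (h_emp h_emb h_succ h_inv h_surj h_ker) (a : S.Arc) :
    (ofArc (inv := inv) emb arc emp h_emp h_emb h_succ h_inv h_surj h_ker).arc a = arc a := by
  rcases a with a | a; exacts [rfl, (h_emp a).symm]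

/-- A gluing that glues less is a first step. -/
theorem exists_factor (G : Gluing S inv T) (G' : Gluing S inv U)
    (h : Set.range G'.emb ⊆ Set.range G.emb) (inv' : T.pt → T.pt)
    (hinv : ∀ y, G.emb y ∉ Set.range G'.emb → inv (G.emb y) = G.emb (inv' y)) :
    ∃ H : Gluing T inv' U, (∀ a, H.arc (G.arc a) = G'.arc a) ∧
      ∀ y, G.emb (H.emb y) = G'.emb y := by
  choose emb hemb using fun y => h ⟨y, rfl⟩
  choose pre hpre using G.arc_surjective
  have harc : ∀ a, G'.arc (pre (G.arc a)) = G'.arc a := fun a => by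
    rw [G'.arc_eq_iff]
    exact Relation.EqvGen.mono (r := G.Adj) (fun _ _ ⟨x, hx, h1, h2⟩ =>
      ⟨x, fun hx' => hx (h hx'), h1, h2⟩) _ _ ((G.arc_eq_iff _ _).1 (hpre _))
  have hout : ∀ y, y ∉ Set.range emb → G.emb y ∉ Set.range G'.emb := by
    rintro y hy ⟨z, hz⟩
    exact hy ⟨z, G.emb_injective ((hemb z).trans hz)⟩
  have key : ∀ a a', Relation.EqvGen G'.Adj a a' → Relation.EqvGen (fun a a' : T.Arc =>
      ∃ x, x ∉ Set.range emb ∧ a = Sum.inl x ∧ a' = Sum.inl (T.succ (inv' x)))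
      (G.arc a) (G.arc a') := by
    intro a a' h
    induction h with
    | rel a a' h =>
      obtain ⟨x, hx, rfl, rfl⟩ := h
      by_cases hG : x ∈ Set.range G.emb
      · obtain ⟨y, rfl⟩ := hG
        refine .rel _ _ ⟨y, fun ⟨z, hz⟩ => hx ⟨z, ?_⟩, G.arc_emb y, ?_⟩
        · rw [← hemb, hz]
        · rw [hinv y hx, G.arc_succ_emb]
      · rw [G.arc_inv hG]
        exact .refl _
    | refl => exact .refl _
    | symm _ _ _ ih => exact ih.symm
    | trans _ _ _ _ _ ih ih' => exact ih.trans _ _ _ ih'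
  have hemp : ∀ e, ∃ e', G'.arc (pre (Sum.inr e)) = Sum.inr e' := by
    intro e
    rcases hy : G'.arc (pre (Sum.inr e)) with y | e'
    · exfalso
      have h1 : G'.arc (pre (Sum.inr e)) = G'.arc (Sum.inl (G'.emb y)) := by rw [hy, G'.arc_emb]
      have h2 := key _ _ ((G'.arc_eq_iff _ _).1 h1)
      rw [hpre] at h2
      have h3 := eqvGen_iff (p := fun a => a = Sum.inr e) (fun a a' ⟨x, _, h, h'⟩ => by
        rw [h, h']; simp) h2
      have h4 := h3.1 rfl
      rw [← hemb, G.arc_emb] at h4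
      cases h4
    · exact ⟨e', rfl⟩
  choose emp hemp using hemp
  refine ⟨ofArc emb (fun t => G'.arc (pre t)) emp hemp (fun y => ?_) (fun y => ?_)
    (fun x hx => ?_) (fun t => ?_) (fun t t' htt' => ?_), fun a => ?_, hemb⟩
  · rw [← G.arc_emb, harc, hemb, G'.arc_emb]
  · rw [← G.arc_succ_emb, harc, hemb, G'.arc_succ_emb]
  · rw [← G.arc_emb x, harc, G'.arc_inv (hout x hx), hinv x (hout x hx), ← harc, G.arc_succ_emb]
  · obtain ⟨a, rfl⟩ := G'.arc_surjective t
    exact ⟨G.arc a, harc a⟩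
  · have := key _ _ ((G'.arc_eq_iff _ _).1 htt')
    rwa [hpre, hpre] at this
  · exact (ofArc_arc _ _ _ _ _ _ _ _ _ _).trans (harc a)

/-- Restriction of a gluing to a union of components. -/
theorem exists_restrict {S' T' : MultCyc} (G : Gluing S inv T) (iS : S'.pt → S.pt)
    (jS : S'.emp → S.emp) (iT : T'.pt → T.pt) (jT : T'.emp → T.emp) (inv' : S'.pt → S'.pt)
    (hS : Function.Injective (Sum.map iS jS : S'.Arc → S.Arc))
    (hT : Function.Injective (Sum.map iT jT : T'.Arc → T.Arc))
    (sS : ∀ x, iS (S'.succ x) = S.succ (iS x)) (sT : ∀ x, iT (T'.succ x) = T.succ (iT x))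
    (h1 : ∀ a, ∃ t, (Sum.map iT jT : T'.Arc → T.Arc) t = G.arc (Sum.map iS jS a))
    (h2 : ∀ a t, G.arc a = (Sum.map iT jT : T'.Arc → T.Arc) t →
      ∃ b, (Sum.map iS jS : S'.Arc → S.Arc) b = a)
    (hinv : ∀ x, iS x ∉ Set.range G.emb → iS (inv' x) = inv (iS x)) :
    ∃ G' : Gluing S' inv' T', (∀ a, Sum.map iT jT (G'.arc a) = G.arc (Sum.map iS jS a)) ∧
      ∀ y, iS (G'.emb y) = G.emb (iT y) := by
  choose arc harc using h1
  have hmem : ∀ y, ∃ x, iS x = G.emb (iT y) := fun y => by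
    obtain ⟨x | e, h⟩ := h2 (Sum.inl (G.emb (iT y))) (Sum.inl y) (G.arc_emb _)
    · exact ⟨x, Sum.inl_injective h⟩
    · cases h
  choose emb hemb using hmem
  have hemp : ∀ e, ∃ e', arc (Sum.inr e) = Sum.inr e' := fun e => by
    have h := harc (Sum.inr e)
    rcases ht : arc (Sum.inr e) with y | e'
    · rw [ht] at h; exact absurd h Sum.inl_ne_inr
    · exact ⟨e', rfl⟩
  choose emp hemp using hemp
  have hout : ∀ x, x ∉ Set.range emb → iS x ∉ Set.range G.emb := by
    rintro x hx ⟨y, hy⟩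
    have h := harc (Sum.inl x)
    rw [show (Sum.map iS jS (Sum.inl x) : S.Arc) = Sum.inl (iS x) from rfl, ← hy, G.arc_emb] at h
    rcases ht : arc (Sum.inl x) with t | t
    · rw [ht] at h
      refine hx ⟨t, Sum.inl_injective (hS (congrArg Sum.inl ?_))⟩
      rw [hemb, ← hy]
      exact congrArg G.emb (Sum.inl_injective h)
    · rw [ht] at h; cases h
  refine ⟨ofArc emb arc emp hemp (fun y => hT ?_) (fun y => hT ?_)
    (fun x hx => hT ?_) (fun t => ?_) (fun a a' haa' => ?_), fun a => ?_, hemb⟩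
  · rw [harc]
    show G.arc (Sum.inl (iS (emb y))) = _
    rw [hemb, G.arc_emb]; rfl
  · rw [harc]
    show G.arc (Sum.inl (iS (S'.succ (emb y)))) = _
    rw [sS, hemb, G.arc_succ_emb, ← sT]; rfl
  · rw [harc, harc]
    show G.arc (Sum.inl (iS x)) = G.arc (Sum.inl (iS (S'.succ (inv' x))))
    rw [sS, hinv x (hout x hx), G.arc_inv (hout x hx)]
  · obtain ⟨a, ha⟩ := G.arc_surjective (Sum.map iT jT t)
    obtain ⟨b, rfl⟩ := h2 a t ha
    exact ⟨b, hT ((harc b).trans ha)⟩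
  · have key : ∀ a a', Relation.EqvGen G.Adj a a' → ∀ b b', Sum.map iS jS b = a →
        Sum.map iS jS b' = a' → Relation.EqvGen (fun a a' : S'.Arc =>
        ∃ x, x ∉ Set.range emb ∧ a = Sum.inl x ∧ a' = Sum.inl (S'.succ (inv' x))) b b' := by
      intro a a' h
      induction h with
      | rel a a' h =>
        obtain ⟨x, hx, rfl, rfl⟩ := h
        intro b b' hb hb'
        rcases b with b | b
        · have hb : iS b = x := Sum.inl_injective hb
          subst hb
          refine .rel _ _ ⟨b, fun ⟨y, hy⟩ => hx ⟨iT y, ?_⟩, rfl, hS ?_⟩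
          · rw [← hy, hemb]
          · rw [hb']
            show _ = Sum.inl (iS _)
            rw [sS, hinv b hx]
        · cases hb
      | refl a =>
        intro b b' hb hb'
        rw [hS (hb.trans hb'.symm)]
        exact .refl _
      | symm _ _ _ ih => exact fun b b' hb hb' => (ih b' b hb' hb).symm
      | trans a c a' h h' ih ih' =>
        intro b b' hb hb'
        obtain ⟨d, hd⟩ : ∃ d : S'.Arc, Sum.map iS jS d = c := by
          refine h2 c (arc b) ?_
          rw [harc, hb]
          exact ((G.arc_eq_iff a c).2 h).symm
        exact (ih b d hb hd).trans _ _ _ (ih' d b' hd hb')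
    refine key _ _ ((G.arc_eq_iff _ _).1 ?_) a a' rfl rfl
    rw [← harc, ← harc, haa']
  · exact (congrArg _ (ofArc_arc _ _ _ _ _ _ _ _ _ _)).trans (harc a)

end Gluing
namespace Graph

open MultCyc (arcMap)

variable {Γ Δ Λ : Graph}

theorem id_arc (a : Γ.fl.Arc) : (𝟙 Γ : Γ ⟶ Γ).gl.arc a = a := by rcases a with a | a <;> rfl

theorem comp_arc (f : Γ ⟶ Δ) (k : Δ ⟶ Λ) (a : Γ.fl.Arc) :
    (f ≫ k).gl.arc a = k.gl.arc (f.gl.arc a) :=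
  Gluing.comp_arc f.gl k.gl (fun y _ => f.inv_emb y) a

theorem exists_arcV (Γ : Graph) (v : Γ.Vert) : ∃ a, Γ.arcV a = v := Γ.surj v

theorem Hom.vert_surjective (f : Γ ⟶ Δ) : Function.Surjective f.vert := fun v => by
  obtain ⟨a, ha⟩ := Δ.surj v
  obtain ⟨a', rfl⟩ := f.gl.arc_surjective a
  exact ⟨_, (f.arcV a').symm.trans ha⟩

theorem hom_ext_arc {f g : Γ ⟶ Δ} (h : ∀ a, f.gl.arc a = g.gl.arc a)
    (he : ∀ y, f.gl.emb y = g.gl.emb y) : f = g := by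
  refine Hom.ext (Gluing.ext_arc h he) (funext fun v => ?_)
  obtain ⟨a, rfl⟩ := Γ.exists_arcV v
  rw [← f.arcV, ← g.arcV, h]

/-- The morphism given by an isomorphism of the flags and of the vertices. -/
def mkHom (F : Γ.fl ⟶ Δ.fl) (e : Γ.Vert ≃ Δ.Vert)
    (harc : ∀ a, Δ.arcV (arcMap F a) = e (Γ.arcV a))
    (hg : ∀ v, Δ.genus (e v) = Γ.genus v) (hinv : ∀ x, Δ.inv (F.pt x) = F.pt (Γ.inv x)) :
    Γ ⟶ Δ :=
  have hr : ∀ x, x ∈ Set.range ((Gluing.refl Γ.fl Γ.inv).map F).emb := fun x =>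
    ⟨F.pt x, F.pt.symm_apply_apply x⟩
  let p : PreHom Γ Δ :=
    { gl := (Gluing.refl Γ.fl Γ.inv).map F
      vert := e
      inv_emb := fun y => by
        show Γ.inv (F.pt.symm y) = F.pt.symm (Δ.inv y)
        rw [Equiv.eq_symm_apply, ← hinv, Equiv.apply_symm_apply]
      mem_of_leg := fun x _ => hr x
      arcV := fun a => by
        rw [Gluing.map_arc]
        refine (congrArg _ (congrArg _ ?_)).trans (harc a)
        rcases a with a | a <;> rfl
      conn := fun v w h => by
        rw [e.injective h]
        exact .refl _ }
  { toPreHom := p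
    genus_eq := fun v => by
      obtain ⟨w, rfl⟩ := e.surjective v
      have h1 : (p.fiber (e w)).numEdges = 0 := by
        have h := p.two_mul_numEdges_fiber (e w)
        have : IsEmpty (p.Con (e w)) := ⟨fun x => x.2.1 (hr x.1)⟩
        rw [Nat.card_of_isEmpty] at h
        omega
      let u : Unique (p.fiber (e w)).Vert :=
        { default := ⟨w, rfl⟩
          uniq := fun w' => Subtype.ext (e.injective w'.2) }
      rw [Graph.totalGenus, h1, finsum_unique, Nat.card_unique, hg]
      simp [u, default] }

/-- The isomorphism of graphs given by isomorphisms of the flags and of the vertices. -/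
def mkIso (F : Γ.fl ⟶ Δ.fl) (e : Γ.Vert ≃ Δ.Vert)
    (harc : ∀ a, Δ.arcV (arcMap F a) = e (Γ.arcV a))
    (hg : ∀ v, Δ.genus (e v) = Γ.genus v) (hinv : ∀ x, Δ.inv (F.pt x) = F.pt (Γ.inv x)) :
    Γ ≅ Δ where
  hom := mkHom F e harc hg hinv
  inv := mkHom (MultCyc.inv F) e.symm (fun a => by
      obtain ⟨b, rfl⟩ := MultCyc.arcMap_surjective F a
      rw [← MultCyc.arcMap_comp, MultCyc.comp_inv, MultCyc.arcMap_id, harc, Equiv.symm_apply_apply])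
    (fun v => by rw [← hg, Equiv.apply_symm_apply])
    (fun x => by
      show Γ.inv (F.pt.symm x) = F.pt.symm (Δ.inv x)
      rw [Equiv.eq_symm_apply, ← hinv, Equiv.apply_symm_apply])
  hom_inv_id := Hom.ext (Gluing.ext (funext fun x => F.pt.symm_apply_apply x)
    (funext fun x => congrArg Sum.inl (F.pt.symm_apply_apply x))
    (funext fun x => F.emp.symm_apply_apply x)) (funext fun v => e.symm_apply_apply v)
  inv_hom_id := Hom.ext (Gluing.ext (funext fun x => F.pt.apply_symm_apply x)
    (funext fun x => congrArg Sum.inl (F.pt.apply_symm_apply x))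
    (funext fun x => F.emp.apply_symm_apply x)) (funext fun v => e.apply_symm_apply v)

theorem mkIso_arc (F : Γ.fl ⟶ Δ.fl) (e : Γ.Vert ≃ Δ.Vert) (harc hg hinv) (a : Γ.fl.Arc) :
    (mkIso F e harc hg hinv).hom.gl.arc a = arcMap F a := by
  rcases a with a | a <;> rfl

/-- The isomorphism of flags given by an isomorphism of graphs. -/
def flIso (f : Γ ≅ Δ) : Γ.fl ⟶ Δ.fl where
  pt := ⟨f.inv.gl.emb, f.hom.gl.emb, hom_emb_inv_emb f, inv_emb_hom_emb f⟩
  emp := ⟨f.hom.gl.emp, f.inv.gl.emp, inv_emp_hom_emp f, inv_emp_hom_emp f.symm⟩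
  map_succ x := by
    have h := f.inv.gl.arc_succ_emb x
    have h' := f.inv.gl.arc_emb (f.hom.gl.emb (Δ.fl.succ (f.inv.gl.emb x)))
    rw [inv_emb_hom_emb] at h'
    have h2 := Sum.inl_injective (h'.symm.trans h)
    show f.inv.gl.emb (Γ.fl.succ x) = Δ.fl.succ (f.inv.gl.emb x)
    rw [← h2, inv_emb_hom_emb]

theorem flIso_arc (f : Γ ≅ Δ) (a : Γ.fl.Arc) : arcMap (flIso f) a = f.hom.gl.arc a := by
  rcases a with x | e
  · have h := f.hom.gl.arc_emb (f.inv.gl.emb x)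
    rw [hom_emb_inv_emb] at h
    exact h.symm
  · rfl

/-- Contraction of all edges does not change the total genus. -/
theorem PreHom.totalGenus_fiber (p : PreHom Γ Δ) [Subsingleton Δ.Vert]
    (h : ∀ x ∈ Set.range p.gl.emb, Γ.inv x = x) (v : Δ.Vert) :
    (p.fiber v).totalGenus = Γ.totalGenus := by
  have h1 : (p.fiber v).numEdges = Γ.numEdges := by
    have h' := p.two_mul_numEdges_fiber v
    have e : Nat.card (p.Con v) = Nat.card {x // Γ.inv x ≠ x} :=
      Nat.card_congr (Equiv.subtypeEquivRight fun x =>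
        ⟨fun hx hx' => hx.1 (p.mem_of_leg x hx'), fun hx => ⟨fun hx' => hx (h x hx'),
          Subsingleton.elim _ _⟩⟩)
    rw [e, ← Γ.two_mul_numEdges] at h'
    omega
  let eV : (p.fiber v).Vert ≃ Γ.Vert := Equiv.subtypeUnivEquiv fun _ => Subsingleton.elim _ _
  have h2 : ∑ᶠ w, ((p.fiber v).genus w : ℤ) = ∑ᶠ w, (Γ.genus w : ℤ) :=
    finsum_eq_of_bijective eV eV.bijective fun _ => rfl
  rw [Graph.totalGenus, h1, Nat.card_congr eV, h2]
  rfl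

theorem card_vert_le (Γ : Graph) : Nat.card Γ.Vert ≤ Γ.numEdges + 1 := by
  classical
  have := Fintype.ofFinite Γ.Vert
  have := Fintype.ofFinite Γ.fl.pt
  let G : SimpleGraph Γ.Vert :=
    { Adj := fun v w => v ≠ w ∧ ∃ x, Γ.ptV x = v ∧ Γ.ptV (Γ.inv x) = w
      symm := ⟨fun v w ⟨h, x, h1, h2⟩ => ⟨h.symm, Γ.inv x, h2, by rw [Γ.inv_inv, h1]⟩⟩
      loopless := ⟨fun v h => h.1 rfl⟩ }
  have hne : Nonempty Γ.Vert := Γ.fl.nonempty.map Γ.arcV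
  have hc : G.Connected := by
    refine ⟨fun v w => ?_⟩
    have h := Γ.conn v w
    induction h with
    | rel v w h =>
      by_cases hvw : v = w
      · subst hvw; exact .refl _
      · exact SimpleGraph.Adj.reachable (G := G) ⟨hvw, h⟩
    | refl v => exact .refl _
    | symm _ _ _ ih => exact ih.symm
    | trans _ _ _ _ _ ih ih' => exact ih.trans ih'
  have h1 := hc.card_vert_le_card_edgeSet_add_one
  have h2 := G.dart_card_eq_twice_card_edges
  choose fl hfl using fun d : G.Dart => d.adj.2
  have h3 : Fintype.card G.Dart ≤ Fintype.card {x // Γ.inv x ≠ x} := by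
    refine Fintype.card_le_of_injective (fun d => ⟨fl d, fun h => d.adj.1 ?_⟩) fun d d' h => ?_
    · rw [← (hfl d).1, ← (hfl d).2, h]
    · have h : fl d = fl d' := congrArg Subtype.val h
      refine SimpleGraph.Dart.ext _ _ (Prod.ext ?_ ?_)
      · rw [← (hfl d).1, ← (hfl d').1, h]
      · rw [← (hfl d).2, ← (hfl d').2, h]
  have h4 := Γ.two_mul_numEdges
  rw [Nat.card_eq_fintype_card] at h4
  have h5 : Nat.card G.edgeSet = G.edgeFinset.card := by
    rw [Nat.card_eq_fintype_card, SimpleGraph.edgeFinset_card]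
  omega

theorem totalGenus_nonneg (Γ : Graph) : 0 ≤ Γ.totalGenus := by
  have h := Γ.card_vert_le
  have h' : 0 ≤ ∑ᶠ v, (Γ.genus v : ℤ) := finsum_nonneg fun v => by positivity
  unfold totalGenus
  omega

end Graph

open MultCyc (arcMap)

/-- A graph labelled by its own legs. -/
noncomputable def LGraph.ofGraph (Γ : Graph) : LGraph Γ.leg Γ.totalGenus.toNat :=
  ⟨Γ, 𝟙 _, (Int.toNat_of_nonneg Γ.totalGenus_nonneg).symm⟩

namespace Graph

variable {Γ Δ Λ : Graph}

theorem Hom.totalGenus_eq (f : Γ ⟶ Δ) : Γ.totalGenus = Δ.totalGenus := by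
  have h := (f ≫ (toStar (LGraph.ofGraph Δ)).hom).genus_eq ()
  have : Subsingleton (star Δ.leg Δ.totalGenus.toNat).gr.Vert := inferInstanceAs (Subsingleton Unit)
  have h2 := (f ≫ (toStar (LGraph.ofGraph Δ)).hom).toPreHom.totalGenus_fiber (by
    rintro _ ⟨y, rfl⟩
    exact (f ≫ (toStar (LGraph.ofGraph Δ)).hom).inv_emb y) ()
  exact h2.symm.trans (h.symm.trans (Int.toNat_of_nonneg Δ.totalGenus_nonneg))

/-- A morphism that contracts at least the edges contracted by `f` factors through `f`. -/
theorem exists_factor (f : Γ ⟶ Δ) (f' : Γ ⟶ Λ) (h : Set.range f'.gl.emb ⊆ Set.range f.gl.emb) :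
    ∃ k : Δ ⟶ Λ, f ≫ k = f' := by
  obtain ⟨H, harc, hemb⟩ := f.gl.exists_factor f'.gl h Δ.inv fun y _ => f.inv_emb y
  choose pre hpre using f.vert_surjective
  have hvert : ∀ w, f'.vert (pre (f.vert w)) = f'.vert w := fun w => by
    have := f.conn _ _ (hpre (f.vert w))
    refine (eqvGen_iff (p := fun w' => f'.vert w' = f'.vert w) (fun a b ⟨x, hx, h1, h2⟩ => ?_)
      this).2 rfl
    rw [← h1, ← h2, f'.vert_inv fun hx' => hx (h hx')]
  have hout : ∀ y, f.gl.emb y ∈ Set.range f'.gl.emb ↔ y ∈ Set.range H.emb := fun y =>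
    ⟨fun ⟨z, hz⟩ => ⟨z, f.gl.emb_injective ((hemb z).trans hz)⟩,
      fun ⟨z, hz⟩ => ⟨z, by rw [← hemb, hz]⟩⟩
  let k : PreHom Δ Λ :=
    { gl := H
      vert := fun v => f'.vert (pre v)
      inv_emb := fun y => f.gl.emb_injective (by
        rw [← f.inv_emb, hemb, hemb, f'.inv_emb])
      mem_of_leg := fun y hy => (hout y).1 (f'.mem_of_leg _ (by rw [f.inv_emb, hy]))
      arcV := fun t => by
        obtain ⟨a, rfl⟩ := f.gl.arc_surjective t
        rw [harc, f'.arcV, f.arcV, hvert]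
      conn := fun v w hvw => by
        have h' := f'.conn _ _ hvw
        have key : ∀ a b, Relation.EqvGen (fun v w => ∃ x, x ∉ Set.range f'.gl.emb ∧
            Γ.ptV x = v ∧ Γ.ptV (Γ.inv x) = w) a b → Relation.EqvGen (fun v w => ∃ x,
            x ∉ Set.range H.emb ∧ Δ.ptV x = v ∧ Δ.ptV (Δ.inv x) = w) (f.vert a) (f.vert b) := by
          intro a b hab
          induction hab with
          | rel a b hab =>
            obtain ⟨x, hx, rfl, rfl⟩ := hab
            by_cases hf : x ∈ Set.range f.gl.emb
            · obtain ⟨y, rfl⟩ := hf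
              refine .rel _ _ ⟨y, fun hy => hx ((hout y).2 hy), (f.ptV_emb y).symm, ?_⟩
              rw [f.inv_emb, f.ptV_emb]
            · rw [f.vert_inv hf]
              exact .refl _
          | refl => exact .refl _
          | symm _ _ _ ih => exact ih.symm
          | trans _ _ _ _ _ ih ih' => exact ih.trans _ _ _ ih'
        have := key _ _ h'
        rwa [hpre, hpre] at this }
  have hfk : f.toPreHom.comp k = f'.toPreHom :=
    PreHom.ext (Gluing.ext_arc (fun a =>
      (Gluing.comp_arc f.gl H (fun y _ => f.inv_emb y) a).trans (harc a)) hemb)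
      (funext hvert)
  let Λ' : Graph := { Λ with genus := fun v => (k.fiber v).totalGenus.toNat }
  let k' : Δ ⟶ Λ' := ⟨{ k with }, fun v => Int.toNat_of_nonneg (k.fiber v).totalGenus_nonneg⟩
  have hg : ∀ v, (Λ.genus v : ℤ) = (k.fiber v).totalGenus := fun v => by
    rw [f'.genus_eq v, ← hfk, ← Int.toNat_of_nonneg (k.fiber v).totalGenus_nonneg]
    exact ((f ≫ k').genus_eq v).symm
  exact ⟨⟨k, hg⟩, Hom.ext (congrArg PreHom.gl hfk) (congrArg PreHom.vert hfk)⟩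

/-- The contraction of a set of edges. -/
theorem exists_contraction (Γ : Graph) (E : Γ.fl.pt → Prop) (hE : ∀ x, E x → E (Γ.inv x))
    (hE' : ∀ x, E x → Γ.inv x ≠ x) :
    ∃ (Δ : Graph) (f : Γ ⟶ Δ), ∀ x, x ∈ Set.range f.gl.emb ↔ ¬ E x := by
  classical
  have hE2 : ∀ x, E (Γ.inv x) ↔ E x := fun x => ⟨fun h => Γ.inv_inv x ▸ hE _ h, hE x⟩
  let τ : Equiv.Perm Γ.fl.pt :=
    Function.Involutive.toPerm (fun x => if E x then Γ.inv x else x) fun x => by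
      by_cases h : E x
      · simp only [if_pos h, if_pos (hE x h), Γ.inv_inv]
      · simp only [if_neg h]
  have hτ : ∀ x, E x → τ x = Γ.inv x := fun x h => if_pos h
  have hτ' : ∀ x, ¬ E x → τ x = x := fun x h => if_neg h
  have hfix : ∀ x, τ x = x ↔ ¬ E x := fun x =>
    ⟨fun h hx => hE' x hx (by rw [← hτ x hx, h]), hτ' x⟩
  let G0 := Gluing.canonical Γ.fl τ
  have hr0 : ∀ x, x ∈ Set.range G0.emb ↔ ¬ E x := fun x => by
    rw [range_canonical]; exact hfix x
  have hτi : ∀ x, x ∉ Set.range G0.emb → τ x = Γ.inv x := fun x hx =>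
    hτ x (not_not.1 fun h => hx ((hr0 x).2 h))
  let G : Gluing Γ.fl Γ.inv (glue Γ.fl τ) :=
    { G0 with
      hit_inv := fun x hx => by rw [← hτi x hx]; exact G0.hit_inv x hx
      ker := fun a a' h => Relation.EqvGen.mono (fun _ _ ⟨x, hx, h1, h2⟩ =>
        ⟨x, hx, h1, by rw [h2, hτi x hx]⟩) _ _ (G0.ker a a' h) }
  have hr : ∀ x, x ∈ Set.range G.emb ↔ ¬ E x := hr0
  let r : Γ.Vert → Γ.Vert → Prop := fun v w => ∃ x, x ∉ Set.range G.emb ∧ Γ.ptV x = v ∧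
    Γ.ptV (Γ.inv x) = w
  let mk : Γ.Vert → Quot r := Quot.mk r
  choose pre hpre using G.arc_surjective
  have hV : ∀ a, mk (Γ.arcV (pre (G.arc a))) = mk (Γ.arcV a) := fun a => by
    refine (eqvGen_iff (p := fun b => mk (Γ.arcV b) = mk (Γ.arcV a)) (fun b c ⟨x, hx, h1, h2⟩ => ?_)
      ((G.arc_eq_iff _ _).1 (hpre (G.arc a)))).2 rfl
    have h3 : mk (Γ.arcV b) = mk (Γ.arcV c) := by
      rw [h1, h2]
      refine (Quot.sound ⟨x, hx, rfl, rfl⟩ : mk (Γ.ptV x) = mk (Γ.ptV (Γ.inv x))).trans ?_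
      exact congrArg mk (Γ.ptV_succ _).symm
    rw [h3]
  have hmkE : ∀ v w, mk v = mk w → Relation.EqvGen r v w := fun v w h => Quot.eqvGen_exact h
  let inv' : {x // τ x = x} → {x // τ x = x} := fun x => ⟨Γ.inv x.1, by
    rw [hfix, hE2, ← hfix]; exact x.2⟩
  have hemb : ∀ y, G.emb y = y.1 := fun _ => rfl
  have hptV : ∀ y, mk (Γ.arcV (pre (Sum.inl y))) = mk (Γ.ptV (G.emb y)) := fun y => by
    rw [← G.arc_emb]; exact hV _
  let Δ0 : Graph :=
    { fl := glue Γ.fl τ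
      Vert := Quot r
      finite_vert := Quot.finite r
      ptV := fun y => mk (Γ.arcV (pre (Sum.inl y)))
      empV := fun e => mk (Γ.arcV (pre (Sum.inr e)))
      ptV_succ := fun y => by
        have h1 := hV (Sum.inl (Γ.fl.succ (G.emb y)))
        rw [G.arc_succ_emb] at h1
        rw [h1, hptV]
        exact congrArg mk (Γ.ptV_succ _)
      surj := fun v => by
        obtain ⟨w, rfl⟩ := Quot.exists_rep v
        obtain ⟨a, rfl⟩ := Γ.exists_arcV w
        have h := hV a
        rcases ht : G.arc a with t | t
        · exact ⟨Sum.inl t, by rw [ht] at h; exact h⟩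
        · exact ⟨Sum.inr t, by rw [ht] at h; exact h⟩
      genus := fun _ => 0
      inv := Function.Involutive.toPerm inv' fun x => Subtype.ext (Γ.inv_inv x.1)
      inv_inv := fun x => Subtype.ext (Γ.inv_inv x.1)
      conn := fun v w => by
        obtain ⟨v, rfl⟩ := Quot.exists_rep v
        obtain ⟨w, rfl⟩ := Quot.exists_rep w
        have h := Γ.conn v w
        induction h with
        | rel v w h =>
          obtain ⟨x, rfl, rfl⟩ := h
          by_cases hx : x ∈ Set.range G.emb
          · obtain ⟨y, rfl⟩ := hx
            exact .rel _ _ ⟨y, hptV y, hptV (inv' y)⟩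
          · rw [show Quot.mk r (Γ.ptV x) = Quot.mk r (Γ.ptV (Γ.inv x)) from
              Quot.sound ⟨x, hx, rfl, rfl⟩]
            exact .refl _
        | refl => exact .refl _
        | symm _ _ _ ih => exact ih.symm
        | trans _ _ _ _ _ ih ih' => exact ih.trans _ _ _ ih' }
  let p : PreHom Γ Δ0 :=
    { gl := G
      vert := mk
      inv_emb := fun _ => rfl
      mem_of_leg := fun x hx => (hr x).2 fun h => hE' x h hx
      arcV := fun a => by
        refine Eq.trans ?_ (hV a)
        rcases G.arc a with t | t <;> rfl
      conn := hmkE }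
  exact ⟨{ Δ0 with genus := fun v => (p.fiber v).totalGenus.toNat },
    ⟨{ p with }, fun v => Int.toNat_of_nonneg (p.fiber v).totalGenus_nonneg⟩, hr⟩

end Graph

theorem eqvGen_subtype {α : Type} {r : α → α → Prop} {q : α → Prop}
    {r' : {a // q a} → {a // q a} → Prop} (h : ∀ a b, r a b → (q a ↔ q b))
    (h' : ∀ a b (ha : q a) (hb : q b), r a b → r' ⟨a, ha⟩ ⟨b, hb⟩) {a b : α}
    (hab : Relation.EqvGen r a b) (ha : q a) (hb : q b) :
    Relation.EqvGen r' ⟨a, ha⟩ ⟨b, hb⟩ := by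
  induction hab with
  | rel a b hab => exact .rel _ _ (h' a b ha hb hab)
  | refl => exact .refl _
  | symm _ _ _ ih => exact (ih hb ha).symm
  | trans a c b h1 _ ih ih' =>
    have hc : q c := (eqvGen_iff h h1).1 ha
    exact (ih ha hc).trans _ _ _ (ih' hc hb)

namespace Graph

variable {Γ Δ Λ : Graph}

/-- The inclusion of the arcs at a vertex. -/
def incl (Γ : Graph) (v : Γ.Vert) : (Γ.legAt v).Arc → Γ.fl.Arc := Sum.map Subtype.val Subtype.val

theorem incl_injective (Γ : Graph) (v : Γ.Vert) : Function.Injective (Γ.incl v) :=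
  Sum.map_injective.2 ⟨Subtype.val_injective, Subtype.val_injective⟩

/-- The inclusion of the arcs of the preimage of a vertex. -/
def PreHom.inclFiber (f : PreHom Γ Δ) (v : Δ.Vert) : (f.fiber v).fl.Arc → Γ.fl.Arc :=
  Sum.map Subtype.val Subtype.val

theorem PreHom.inclFiber_injective (f : PreHom Γ Δ) (v : Δ.Vert) :
    Function.Injective (f.inclFiber v) :=
  Sum.map_injective.2 ⟨Subtype.val_injective, Subtype.val_injective⟩

theorem PreHom.exists_inclFiber (f : PreHom Γ Δ) {v : Δ.Vert} {a : Γ.fl.Arc}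
    (h : f.vert (Γ.arcV a) = v) : ∃ b, f.inclFiber v b = a := by
  rcases a with x | e
  exacts [⟨Sum.inl ⟨x, h⟩, rfl⟩, ⟨Sum.inr ⟨e, h⟩, rfl⟩]

theorem PreHom.vert_inclFiber (f : PreHom Γ Δ) (v : Δ.Vert) (a : (f.fiber v).fl.Arc) :
    f.vert (Γ.arcV (f.inclFiber v a)) = v := by
  rcases a with a | a <;> exact a.2

theorem PreHom.incl_fiberGluing_arc (f : PreHom Γ Δ) (v : Δ.Vert) (a : (f.fiber v).fl.Arc) :
    Δ.incl v ((f.fiberGluing v).arc a) = f.gl.arc (f.inclFiber v a) := by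
  rcases a with a | a
  · exact Δ.map_restrictArc v _ _
  · rfl

theorem PreHom.fiber_inv (f : PreHom Γ Δ) (v : Δ.Vert) (x : (f.fiber v).fl.pt) :
    ((f.fiber v).inv x).1 = f.cutInv x.1 := rfl

theorem numEdges_fiber_add_le (f : PreHom Γ Δ) (v : Δ.Vert) :
    (f.fiber v).numEdges + Δ.numEdges ≤ Γ.numEdges := by
  have h1 := f.two_mul_numEdges_fiber v
  have h2 := Δ.two_mul_numEdges
  have h3 := Γ.two_mul_numEdges
  have h4 : Nat.card (f.Con v ⊕ {y // Δ.inv y ≠ y}) ≤ Nat.card {x // Γ.inv x ≠ x} := by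
    refine Nat.card_le_card_of_injective (Sum.elim
      (fun x => ⟨x.1, fun h => x.2.1 (f.mem_of_leg _ h)⟩)
      (fun y => ⟨f.gl.emb y.1, fun h => y.2 (f.gl.emb_injective (by rw [← f.inv_emb, h]))⟩)) ?_
    rintro (x | y) (x' | y') h
    · exact congrArg Sum.inl (Subtype.ext (congrArg Subtype.val h :))
    · exact absurd ⟨y'.1, (congrArg Subtype.val h :).symm⟩ x.2.1
    · exact absurd ⟨y.1, (congrArg Subtype.val h :)⟩ x'.2.1
    · exact congrArg Sum.inr (Subtype.ext (f.gl.emb_injective (congrArg Subtype.val h :)))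
  rw [Nat.card_sum] at h4
  omega

theorem numEdges_eq_zero_iff (Γ : Graph) : Γ.numEdges = 0 ↔ ∀ x, Γ.inv x = x := by
  have h := Γ.two_mul_numEdges
  constructor
  · intro h0 x
    by_contra hx
    have : Nonempty {x // Γ.inv x ≠ x} := ⟨⟨x, hx⟩⟩
    have := Nat.card_pos (α := {x // Γ.inv x ≠ x})
    omega
  · intro h0
    have : IsEmpty {x // Γ.inv x ≠ x} := ⟨fun x => x.2 (h0 x.1)⟩
    rw [Nat.card_of_isEmpty] at h
    omega

/-- The restriction of `f` to the preimages of a vertex under `f ≫ k` and under `k`. -/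
theorem exists_restrictGluing (f : Γ ⟶ Δ) (k : Δ ⟶ Λ) (u : Λ.Vert) :
    ∃ G : Gluing ((f ≫ k).toPreHom.fiber u).fl ((f ≫ k).toPreHom.fiber u).inv
      (k.toPreHom.fiber u).fl,
    (∀ a, k.toPreHom.inclFiber u (G.arc a) = f.gl.arc ((f ≫ k).toPreHom.inclFiber u a)) ∧
    ∀ y, (G.emb y).1 = f.gl.emb y.1 := by
  refine Gluing.exists_restrict (S' := ((f ≫ k).toPreHom.fiber u).fl)
    (T' := (k.toPreHom.fiber u).fl) f.gl Subtype.val Subtype.val Subtype.val Subtype.val _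
    ((f ≫ k).toPreHom.inclFiber_injective u) (k.toPreHom.inclFiber_injective u) (fun _ => rfl)
    (fun _ => rfl) (fun a => ?_) (fun a t h => ?_) (fun x hx => ?_)
  · refine k.toPreHom.exists_inclFiber ?_
    rw [f.arcV]
    exact (f ≫ k).toPreHom.vert_inclFiber u a
  · refine (f ≫ k).toPreHom.exists_inclFiber ?_
    show k.vert (f.vert _) = u
    rw [← f.arcV, h]
    exact k.toPreHom.vert_inclFiber u t
  · exact (f ≫ k).toPreHom.cutInv_of_notMem fun ⟨y, hy⟩ => hx ⟨_, hy⟩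

/-- `restrict`, without the condition on the genera. -/
noncomputable def restrictPre (f : Γ ⟶ Δ) (k : Δ ⟶ Λ) (u : Λ.Vert) :
    PreHom ((f ≫ k).toPreHom.fiber u) (k.toPreHom.fiber u) where
  gl := (exists_restrictGluing f k u).choose
  vert w := ⟨f.vert w.1, w.2⟩
  inv_emb y := Subtype.ext (by
    have h := (exists_restrictGluing f k u).choose_spec.2
    refine Eq.trans ?_ (h _).symm
    refine ((f ≫ k).toPreHom.fiber_inv u _).trans ?_
    rw [h]
    by_cases hy : y.1 ∈ Set.range k.gl.emb
    · have e2 : ((k.toPreHom.fiber u).inv y).1 = y.1 := k.toPreHom.cutInv_of_mem hy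
      rw [e2]
      obtain ⟨z, hz⟩ := hy
      exact (f ≫ k).toPreHom.cutInv_of_mem ⟨z, congrArg f.gl.emb hz⟩
    · have e2 : ((k.toPreHom.fiber u).inv y).1 = Δ.inv y.1 := k.toPreHom.cutInv_of_notMem hy
      rw [e2, ← f.inv_emb]
      exact (f ≫ k).toPreHom.cutInv_of_notMem fun ⟨z, hz⟩ => hy ⟨z, f.gl.emb_injective hz⟩)
  mem_of_leg x hx := by
    have h := (exists_restrictGluing f k u).choose_spec.2
    obtain ⟨z, hz⟩ := (f ≫ k).toPreHom.cutInv_eq_iff.1 (congrArg Subtype.val hx)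
    have hz : f.gl.emb (k.gl.emb z) = x.1 := hz
    refine ⟨⟨k.gl.emb z, ?_⟩, Subtype.ext ((h _).trans hz)⟩
    have h2 := x.2
    rw [← hz] at h2
    rw [← f.ptV_emb]
    exact h2
  arcV a := by
    have h := (exists_restrictGluing f k u).choose_spec.1 a
    have h1 : ∀ t, ((k.toPreHom.fiber u).arcV t).1 = Δ.arcV (k.toPreHom.inclFiber u t) := by
      rintro (t | t) <;> rfl
    have h2 : ∀ t, (((f ≫ k).toPreHom.fiber u).arcV t).1 =
      Γ.arcV ((f ≫ k).toPreHom.inclFiber u t) := by rintro (t | t) <;> rfl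
    exact Subtype.ext ((h1 _).trans ((congrArg Δ.arcV h).trans
      ((f.arcV _).trans (congrArg f.vert (h2 a)).symm)))
  conn v w hvw := by
    have h := (exists_restrictGluing f k u).choose_spec.2
    refine eqvGen_subtype (fun a b ⟨x, hx, h1, h2⟩ => ?_) (fun a b ha hb ⟨x, hx, h1, h2⟩ => ?_)
      (f.conn v.1 w.1 (congrArg Subtype.val hvw)) v.2 w.2
    · show k.vert (f.vert a) = u ↔ k.vert (f.vert b) = u
      rw [← h1, ← h2, f.vert_inv hx]
    · subst h1 h2
      refine ⟨⟨x, ha⟩, fun ⟨y, hy⟩ => hx ⟨y.1, ?_⟩, rfl, Subtype.ext ?_⟩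
      · exact (h y).symm.trans (congrArg Subtype.val hy)
      · exact congrArg Γ.ptV ((f ≫ k).toPreHom.cutInv_of_notMem fun ⟨y, hy⟩ => hx ⟨_, hy⟩)

theorem restrictPre_arc (f : Γ ⟶ Δ) (k : Δ ⟶ Λ) (u : Λ.Vert)
    (a : ((f ≫ k).toPreHom.fiber u).fl.Arc) :
    k.toPreHom.inclFiber u ((restrictPre f k u).gl.arc a) =
      f.gl.arc ((f ≫ k).toPreHom.inclFiber u a) :=
  (exists_restrictGluing f k u).choose_spec.1 a

theorem restrictPre_emb (f : Γ ⟶ Δ) (k : Δ ⟶ Λ) (u : Λ.Vert) (y : (k.toPreHom.fiber u).fl.pt) :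
    ((restrictPre f k u).gl.emb y).1 = f.gl.emb y.1 :=
  (exists_restrictGluing f k u).choose_spec.2 y

/-- The preimage of a vertex under `f` is the preimage under a restriction of `f`. -/
noncomputable def restrictFiberIso (f : Γ ⟶ Δ) (k : Δ ⟶ Λ) (u : Λ.Vert)
    (v : (k.toPreHom.fiber u).Vert) :
    f.toPreHom.fiber v.1 ≅ (restrictPre f k u).fiber v :=
  mkIso
    { pt :=
        { toFun := fun x => ⟨⟨x.1, (congrArg k.vert x.2).trans v.2⟩, Subtype.ext x.2⟩
          invFun := fun x => ⟨x.1.1, congrArg Subtype.val x.2⟩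
          left_inv := fun _ => rfl
          right_inv := fun _ => rfl }
      emp :=
        { toFun := fun x => ⟨⟨x.1, (congrArg k.vert x.2).trans v.2⟩, Subtype.ext x.2⟩
          invFun := fun x => ⟨x.1.1, congrArg Subtype.val x.2⟩
          left_inv := fun _ => rfl
          right_inv := fun _ => rfl }
      map_succ := fun _ => rfl }
    { toFun := fun x => ⟨⟨x.1, (congrArg k.vert x.2).trans v.2⟩, Subtype.ext x.2⟩
      invFun := fun x => ⟨x.1.1, congrArg Subtype.val x.2⟩
      left_inv := fun _ => rfl
      right_inv := fun _ => rfl }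
    (fun a => by rcases a with a | a <;> rfl) (fun _ => rfl) (fun x => by
      refine Subtype.ext (Subtype.ext ?_)
      show ((restrictPre f k u).cutInv ⟨x.1, (congrArg k.vert x.2).trans v.2⟩).1 =
        f.toPreHom.cutInv x.1
      by_cases hx : x.1 ∈ Set.range f.gl.emb
      · rw [f.toPreHom.cutInv_of_mem hx]
        obtain ⟨y, hy⟩ := hx
        have hyu : k.vert (Δ.ptV y) = u := by
          rw [← f.ptV_emb, hy]
          exact (congrArg k.vert x.2).trans v.2
        exact congrArg Subtype.val ((restrictPre f k u).cutInv_of_mem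
          ⟨⟨y, hyu⟩, Subtype.ext ((restrictPre_emb f k u ⟨y, hyu⟩).trans hy)⟩)
      · rw [f.toPreHom.cutInv_of_notMem hx]
        have hx' : (⟨x.1, (congrArg k.vert x.2).trans v.2⟩ : ((f ≫ k).toPreHom.fiber u).fl.pt) ∉
            Set.range (restrictPre f k u).gl.emb := fun ⟨y, hy⟩ =>
          hx ⟨y.1, (restrictPre_emb f k u y).symm.trans (congrArg Subtype.val hy)⟩
        refine (congrArg Subtype.val ((restrictPre f k u).cutInv_of_notMem hx')).trans ?_
        exact (f ≫ k).toPreHom.cutInv_of_notMem fun ⟨y, hy⟩ => hx ⟨_, hy⟩)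

end Graph

namespace LGraph

variable {S T : MultCyc} {g h : ℕ}

/-- A labelled graph given by a gluing along all edges. -/
noncomputable def ofGluing (Γ : Graph) (H : Gluing Γ.fl Γ.inv S)
    (hH : ∀ x, x ∈ Set.range H.emb ↔ Γ.inv x = x) (hg : Γ.totalGenus = g) : LGraph S g where
  gr := Γ
  lab := (Gluing.canonical Γ.fl Γ.inv).iso H (by
    rw [Graph.range_canonical]; exact Set.ext fun x => (hH x).symm)
  genus_eq := hg

theorem ofGluing_arc (Γ : Graph) (H : Gluing Γ.fl Γ.inv S) (hH) (hg : Γ.totalGenus = g)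
    (a : Γ.fl.Arc) : (ofGluing Γ H hH hg).gl.arc a = H.arc a :=
  (Gluing.map_arc _ _ _).trans (Gluing.iso_arc _ _ _ _)

theorem relabel_arc (X : LGraph S g) (f : S ⟶ T) (a : X.gr.fl.Arc) :
    (X.relabel f).gl.arc a = arcMap f (X.gl.arc a) := by
  refine (Gluing.map_arc _ _ _).trans ((MultCyc.arcMap_comp _ _ _).trans ?_)
  exact congrArg (arcMap f) (Gluing.map_arc _ _ _).symm

theorem incl_fiber_arc {Γ Δ : Graph} (f : Γ ⟶ Δ) (v : Δ.Vert) (a : (fiber f v).gr.fl.Arc) :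
    Δ.incl v ((fiber f v).gl.arc a) = f.gl.arc (f.toPreHom.inclFiber v a) := by
  refine Eq.trans (congrArg (Δ.incl v) ?_) (f.toPreHom.incl_fiberGluing_arc v a)
  exact (Gluing.map_arc _ _ _).trans (Gluing.iso_arc _ _ _ _)

theorem comp_hom {X Y Z : LGraph S g} (f : X ⟶ Y) (k : Y ⟶ Z) : (f ≫ k).hom = f.hom ≫ k.hom := rfl

theorem exists_label (X : LGraph S g) (Y : LGraph T h) (F : X.gr ≅ Y.gr) :
    g = h ∧ ∃ φ : S ⟶ T, ∀ a, arcMap φ (X.gl.arc a) = Y.gl.arc (F.hom.gl.arc a) := by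
  refine ⟨?_, ?_⟩
  · have := F.hom.totalGenus_eq
    rw [X.genus_eq, Y.genus_eq] at this
    exact_mod_cast this
  · let G : Gluing X.gr.fl X.gr.inv T := F.hom.gl.comp Y.gl fun y _ => F.hom.inv_emb y
    refine ⟨X.gl.iso G ?_, fun a => (X.gl.iso_arc G _ a).trans (Gluing.comp_arc _ _ _ _)⟩
    ext x
    rw [X.mem_range]
    constructor
    · intro hx
      obtain ⟨y, rfl⟩ := F.hom.mem_of_leg x hx
      obtain ⟨z, hz⟩ := (Y.mem_range y).2 (F.hom.gl.emb_injective (by rw [← F.hom.inv_emb, hx]))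
      exact ⟨z, congrArg F.hom.gl.emb hz⟩
    · rintro ⟨z, rfl⟩
      show X.gr.inv (F.hom.gl.emb (Y.gl.emb z)) = F.hom.gl.emb (Y.gl.emb z)
      rw [F.hom.inv_emb, (Y.mem_range _).1 ⟨z, rfl⟩]

theorem exists_lift (X : LGraph S g) {Δ : Graph} (f : X.gr ⟶ Δ) :
    ∃ (Y : LGraph S g) (e : Y.gr = Δ), ∃ k : X ⟶ Y, k.hom ≫ eqToHom e = f := by
  obtain ⟨H, harc, hemb⟩ := f.gl.exists_factor X.gl (by
    rintro _ ⟨y, rfl⟩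
    exact f.mem_of_leg _ ((X.mem_range _).1 ⟨y, rfl⟩)) Δ.inv fun y _ => f.inv_emb y
  have hH : ∀ x, x ∈ Set.range H.emb ↔ Δ.inv x = x := fun x => by
    constructor
    · rintro ⟨y, rfl⟩
      refine f.gl.emb_injective ?_
      rw [← f.inv_emb, hemb, (X.mem_range _).1 ⟨y, rfl⟩]
    · intro hx
      obtain ⟨y, hy⟩ := (X.mem_range (f.gl.emb x)).2 (by rw [f.inv_emb, hx])
      exact ⟨y, f.gl.emb_injective ((hemb y).trans hy)⟩
  refine ⟨ofGluing Δ H hH (f.totalGenus_eq.symm.trans X.genus_eq), rfl, ⟨f, fun a => ?_⟩, ?_⟩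
  · rw [← harc]
    exact ofGluing_arc _ _ _ _ _
  · exact Category.comp_id f

/-- The contraction of a set of edges of a labelled graph. -/
theorem exists_contraction (X : LGraph S g) (E : X.gr.fl.pt → Prop)
    (hE : ∀ x, E x → E (X.gr.inv x)) (hE' : ∀ x, E x → X.gr.inv x ≠ x) :
    ∃ (Y : LGraph S g) (f : X ⟶ Y), ∀ x, x ∈ Set.range f.hom.gl.emb ↔ ¬ E x := by
  obtain ⟨Δ, f, hf⟩ := X.gr.exists_contraction E hE hE'
  obtain ⟨Y, rfl, k, hk⟩ := X.exists_lift f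
  have hk : k.hom = f := (Category.comp_id _).symm.trans hk
  exact ⟨Y, k, by rw [hk]; exact hf⟩

theorem exists_factor {X Y Z : LGraph S g} (f : X ⟶ Y) (f' : X ⟶ Z)
    (h : Set.range f'.hom.gl.emb ⊆ Set.range f.hom.gl.emb) : ∃ k : Y ⟶ Z, f ≫ k = f' := by
  obtain ⟨k, hk⟩ := Graph.exists_factor f.hom f'.hom h
  refine ⟨⟨k, fun t => ?_⟩, Hom.ext hk⟩
  obtain ⟨a, rfl⟩ := f.hom.gl.arc_surjective t
  rw [f.label, ← f'.label, ← hk, Graph.comp_arc]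

/-- The restriction of `f` to the preimages of a vertex under `f ≫ k` and under `k`. -/
noncomputable def restrict {Γ Δ Λ : Graph} (f : Γ ⟶ Δ) (k : Δ ⟶ Λ) (u : Λ.Vert) :
    fiber (f ≫ k) u ⟶ fiber k u where
  hom :=
    { toPreHom := Graph.restrictPre f k u
      genus_eq := fun v =>
        (f.genus_eq v.1).trans (Graph.restrictFiberIso f k u v).hom.totalGenus_eq }
  label a := by
    refine Graph.incl_injective Λ u ?_
    rw [incl_fiber_arc, incl_fiber_arc, Graph.comp_arc]
    exact congrArg k.gl.arc (Graph.restrictPre_arc f k u a)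

theorem restrictFiberIso_label {Γ Δ Λ : Graph} (f : Γ ⟶ Δ) (k : Δ ⟶ Λ) (u : Λ.Vert)
    (v : {v // k.vert v = u}) (a : (fiber f v.1).gr.fl.Arc) :
    arcMap (fiberLeg k u v) ((fiber f v.1).gl.arc a) =
      (fiber (restrict f k u).hom v).gl.arc ((Graph.restrictFiberIso f k u v).hom.gl.arc a) := by
  have hi : Function.Injective fun b => k.toPreHom.inclFiber u ((fiber k u).gr.incl v b) :=
    (k.toPreHom.inclFiber_injective u).comp (Graph.incl_injective _ _)
  have h1 : ∀ b : (Δ.legAt v.1).Arc, k.toPreHom.inclFiber u ((fiber k u).gr.incl v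
      (arcMap (fiberLeg k u v) b)) = Δ.incl v.1 b := by rintro (b | b) <;> rfl
  refine hi ?_
  show k.toPreHom.inclFiber u ((fiber k u).gr.incl v _) =
    k.toPreHom.inclFiber u ((fiber k u).gr.incl v _)
  refine (h1 _).trans ((incl_fiber_arc f v.1 a).trans ?_)
  refine Eq.trans ?_ (congrArg (k.toPreHom.inclFiber u)
    (incl_fiber_arc (restrict f k u).hom v _)).symm
  refine Eq.trans (congrArg f.gl.arc ?_) (Graph.restrictPre_arc f k u _).symm
  rcases a with a | a <;> rfl

end LGraph

section Unordered

variable {M : Type u} [Category.{v} M] [MonoidalCategory M]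

theorem isIso_mapTo {ι κ : Type} {X : ι → M} {Y : κ → M} (e : ι → κ) (m : ∀ i, X i ⟶ Y (e i))
    [∀ i, IsIso (m i)] (l : List ι) : IsIso (listTensorMapTo e m l) := by
  induction l with
  | nil => exact inferInstanceAs (IsIso (𝟙 (𝟙_ M)))
  | cons i l ih => exact inferInstanceAs (IsIso (m i ⊗ₘ listTensorMapTo e m l))

variable [SymmetricCategory M]

instance isIso_uMap {ι κ : Type} [Finite ι] [Finite κ] {X : ι → M} {Y : κ → M} (e : ι ≃ κ)
    (m : ∀ i, X i ⟶ Y (e i)) [∀ i, IsIso (m i)] : IsIso (uMap e m) := by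
  have := isIso_mapTo e m (ordering ι)
  unfold uMap
  infer_instance

theorem mapFrom_mapTo_self {ι κ : Type} {X : ι → M} {Y Z : κ → M} (p : κ → ι)
    (m : ∀ k, X (p k) ⟶ Y k) (n : ∀ k, Y k ⟶ Z k) (l : List κ) : ∀ h : (l.map fun k => k).Perm l,
    listTensorMapFrom p m l ≫ listTensorMapTo (fun k => k) n l ≫ reorder Z _ _ h =
      listTensorMapFrom p (fun k => m k ≫ n k) l := by
  induction l with
  | nil =>
    intro h
    change 𝟙 (𝟙_ M) ≫ 𝟙 (𝟙_ M) ≫ reorder Z [] [] h = 𝟙 (𝟙_ M)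
    rw [reorder_nil]
    exact (Category.id_comp _).trans (Category.id_comp _)
  | cons k l ih =>
    intro h
    have h' : (l.map fun k => k).Perm l := by simp
    have e : reorder Z (k :: l.map fun k => k) (k :: l) h = Z k ◁ reorder Z _ _ h' :=
      reorder_cons_cons Z _ _ _ _ _
    have key : ∀ r : Z k ⊗ listTensor Z (l.map fun k => k) ⟶ Z k ⊗ listTensor Z l,
        r = Z k ◁ reorder Z _ _ h' → (m k ⊗ₘ listTensorMapFrom p m l) ≫
          (n k ⊗ₘ listTensorMapTo (fun k => k) n l) ≫ r =
          ((m k ≫ n k) ⊗ₘ listTensorMapFrom p (fun k => m k ≫ n k) l) := by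
      rintro _ rfl
      rw [← id_tensorHom, MonoidalCategory.tensorHom_comp_tensorHom,
        MonoidalCategory.tensorHom_comp_tensorHom, ih h', Category.comp_id]
    exact key _ e

end Unordered

namespace NsModule

section

variable {M : Type u} [Category.{v} M] (P : NsModule M) {S T U : MultCyc} {g h k : ℕ}

theorem mp_id (S : MultCyc) (g : ℕ) (e : g = g) : P.mp (𝟙 S) e = 𝟙 (P.ob S g) :=
  P.map_id (S, (⟨g⟩ : Discrete ℕ))

theorem mp_comp (f : S ⟶ T) (f' : T ⟶ U) (e : g = h) (e' : h = k) :
    P.mp f e ≫ P.mp f' e' = P.mp (f ≫ f') (e.trans e') := by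
  subst e e'
  exact (P.map_comp _ _).symm

instance (f : S ⟶ T) (e : g = h) : IsIso (P.mp f e) :=
  ⟨P.mp (MultCyc.inv f) e.symm, by rw [mp_comp, MultCyc.comp_inv, mp_id],
    by rw [mp_comp, MultCyc.inv_comp, mp_id]⟩

end

variable {M : Type u} [Category.{v} M] [MonoidalCategory M] [SymmetricCategory M] (P : NsModule M)

theorem onIso_eq {Γ Δ : Graph} (f : Γ ≅ Δ) :
    P.onIso f = uMap (Y := P.factor Δ) (vertEquiv f)
      (fun w => P.mp (legAtIso f w) (genus_iso f w)) := rfl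

theorem onIso_comp {Γ Δ Λ : Graph} (f : Γ ≅ Δ) (k : Δ ≅ Λ) :
    P.onIso f ≫ P.onIso k = P.onIso (f ≪≫ k) := by
  refine (uMap_comp (X := P.factor Γ) (Y := P.factor Δ) (Z := P.factor Λ) (vertEquiv f)
    (vertEquiv k) (fun w => P.mp (legAtIso f w) (genus_iso f w))
    (fun w => P.mp (legAtIso k w) (genus_iso k w))).trans ?_
  refine congrArg (uMap (Y := P.factor Λ) _) (funext fun w => ?_)
  refine (P.mp_comp _ _ _ _).trans ?_
  rfl

/-- The family of morphisms that defines `vertexwise`. -/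
noncomputable def onFiber (α : P.ContractionFamily) {Γ Δ : Graph} (f : Γ ⟶ Δ) (v : Δ.Vert) :
    uTensor (fun w : {w // f.vert w = v} => P.factor Γ w.1) ⟶ P.factor Δ v :=
  uMap (Y := P.factor (LGraph.fiber f v).gr) (Equiv.refl _) (fun w => P.mp (fiberLeg f v w) rfl) ≫
    α (Δ.legAt v) (Δ.genus v) (LGraph.fiber f v)

theorem vertexwise_eq (α : P.ContractionFamily) {Γ Δ : Graph} (f : Γ ⟶ Δ) :
    P.vertexwise α f = uFib (X := P.factor Γ) (Y := P.factor Δ) f.vert (P.onFiber α f) := by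
  have h : ∀ v, listTensorMapFrom (Y := P.factor (LGraph.fiber f v).gr) Subtype.val
      (fun w => P.mp (fiberLeg f v w) rfl) (ordering {w // f.vert w = v}) ≫
        α (Δ.legAt v) (Δ.genus v) (LGraph.fiber f v) =
      listTensorMapFrom Subtype.val (fun i : {w // f.vert w = v} => 𝟙 (P.factor Γ i.1))
        (ordering {w // f.vert w = v}) ≫ P.onFiber α f v := by
    intro v
    have h1 := mapFrom_mapTo_self (X := P.factor Γ) (Y := fun w : {w // f.vert w = v} =>
      P.factor Γ w.1) (Z := P.factor (LGraph.fiber f v).gr) Subtype.val (fun i => 𝟙 (P.factor Γ i.1))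
      (fun w => P.mp (fiberLeg f v w) rfl) (ordering {w // f.vert w = v}) (by simp)
    have h2 : (fun w : {w // f.vert w = v} => 𝟙 (P.factor Γ w.1) ≫ P.mp (fiberLeg f v w) rfl) =
        fun w => P.mp (fiberLeg f v w) rfl := funext fun w => Category.id_comp _
    refine (congrArg (fun k => k ≫ α (Δ.legAt v) (Δ.genus v) (LGraph.fiber f v))
      ((congrArg (fun k => listTensorMapFrom Subtype.val k _) h2.symm).trans h1.symm)).trans ?_
    exact Category.assoc _ _ _
  have h' := funext h
  exact congrArg (fun m => reorder (P.factor Γ) _ _ (ordering_perm_flatMap f.vert) ≫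
    listTensorBlock _ m (ordering Δ.Vert)) h'

/-- Naturality of `α` on graphs with at most `n` edges, with respect to isomorphisms of graphs and
relabelling. -/
def NaturalUpTo (α : P.ContractionFamily) (n : ℕ) : Prop :=
  ∀ {S T : MultCyc} {g h : ℕ} (X : LGraph S g) (Y : LGraph T h) (F : X.gr ≅ Y.gr) (φ : S ⟶ T)
    (e : g = h), X.gr.numEdges ≤ n →
    (∀ a, arcMap φ (X.gl.arc a) = Y.gl.arc (F.hom.gl.arc a)) →
    P.onIso F ≫ α T h Y = α S g X ≫ P.mp φ e

/-- The values of `α` on corollas are the canonical ones. -/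
def StarUnit (α : P.ContractionFamily) : Prop :=
  ∀ (S : MultCyc) (g : ℕ), P.toCorolla S g ≫ α S g (star S g) = 𝟙 (P.ob S g)

/-- The morphism to `P(Γ)` for a graph with one vertex. -/
noncomputable def in₁ (Γ : Graph) (v : Γ.Vert) (hv : ∀ w, w = v) {S : MultCyc} {g : ℕ}
    (ρ : S ⟶ Γ.legAt v) (e : g = Γ.genus v) : P.ob S g ⟶ P.onGraph Γ :=
  P.mp ρ e ≫ single (P.factor Γ) v (perm_single hv)

instance (Γ : Graph) (v : Γ.Vert) (hv : ∀ w, w = v) {S : MultCyc} {g : ℕ}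
    (ρ : S ⟶ Γ.legAt v) (e : g = Γ.genus v) : IsIso (P.in₁ Γ v hv ρ e) := by
  have h : IsIso (single (P.factor Γ) v (perm_single hv)) := inferInstance
  exact @IsIso.comp_isIso _ _ _ _ _ (P.mp ρ e) (single (P.factor Γ) v (perm_single hv))
    (inferInstanceAs (IsIso (P.mp ρ e))) h

theorem in₁_onIso {Γ Δ : Graph} (F : Γ ≅ Δ) (v : Γ.Vert) (hv : ∀ w, w = v) {S : MultCyc} {g : ℕ}
    (ρ : S ⟶ Γ.legAt v) (e : g = Γ.genus v) (hv' : ∀ w, w = F.hom.vert v) :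
    P.in₁ Γ v hv ρ e ≫ P.onIso F =
      P.in₁ Δ (F.hom.vert v) hv' (ρ ≫ legAtIso F v) (e.trans (genus_iso F v)) := by
  have h := single_uMap (X := P.factor Γ) (Y := P.factor Δ) (vertEquiv F)
    (fun w => P.mp (legAtIso F w) (genus_iso F w)) v (perm_single hv) (perm_single hv')
  refine (Category.assoc _ _ _).trans ((congrArg (fun k => P.mp ρ e ≫ k) h).trans ?_)
  refine (Category.assoc _ _ _).symm.trans ?_
  exact congrArg (fun k => k ≫ single (P.factor Δ) (F.hom.vert v) (perm_single hv'))
    (P.mp_comp _ _ _ _)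

theorem toLoop_eq {S : MultCyc} (u v : S.pt) (huv : u ≠ v) (g : ℕ) :
    P.toLoop u v huv g = P.in₁ (loopGraph u v huv g).gr () (fun _ => rfl) (corollaLeg S g) rfl :=
  rfl

end NsModule

namespace Graph

/-- The flags of a graph with one vertex. -/
noncomputable def flagsOne (Γ : Graph) (v : Γ.Vert) (hv : ∀ w, w = v) {S : MultCyc}
    (ρ : S ⟶ Γ.legAt v) : S ⟶ Γ.fl where
  pt := ρ.pt.trans (Equiv.subtypeUnivEquiv fun _ => hv _)
  emp := ρ.emp.trans (Equiv.subtypeUnivEquiv fun _ => hv _)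
  map_succ x := congrArg Subtype.val (ρ.map_succ x)

theorem flagsOne_arc (Γ : Graph) (v : Γ.Vert) (hv : ∀ w, w = v) {S : MultCyc}
    (ρ : S ⟶ Γ.legAt v) (a : S.Arc) :
    arcMap (Γ.flagsOne v hv ρ) a = Γ.incl v (arcMap ρ a) := by rcases a with a | a <;> rfl

theorem eq_of_numEdges_eq_zero {Γ : Graph} (h : Γ.numEdges = 0) (w v : Γ.Vert) : w = v := by
  refine (eqvGen_iff (p := fun w' => w' = v) (fun a b ⟨x, h1, h2⟩ => ?_) (Γ.conn w v)).2 rfl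
  rw [Γ.numEdges_eq_zero_iff.1 h x] at h2
  rw [← h1, ← h2]

end Graph

namespace NsModule

variable {M : Type u} [Category.{v} M] [MonoidalCategory M] [SymmetricCategory M] {P : NsModule M}
  {α : P.ContractionFamily}

/-- The value of `α` on a graph without edges. -/
theorem eval_star {n : ℕ} (hn : P.NaturalUpTo α n) (hs : P.StarUnit α) {S W : MultCyc} {g k : ℕ}
    (X : LGraph W k) (h0 : X.gr.numEdges = 0) (v : X.gr.Vert) (hv : ∀ w, w = v)
    (ρ : S ⟶ X.gr.legAt v) (e : g = X.gr.genus v) :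
    ∃ (φ : S ⟶ W) (e' : g = k),
      (∀ a, arcMap φ a = X.gl.arc (X.gr.incl v (arcMap ρ a))) ∧
      P.in₁ X.gr v hv ρ e ≫ α W k X = P.mp φ e' := by
  let E : Unit ≃ X.gr.Vert :=
    { toFun := fun _ => v
      invFun := fun _ => ()
      left_inv := fun _ => rfl
      right_inv := fun w => (hv w).symm }
  let F : (star S g).gr ≅ X.gr := Graph.mkIso (Γ := corolla S g) (X.gr.flagsOne v hv ρ) E
    (fun a => hv _) (fun _ => e.symm)
    (fun x => X.gr.numEdges_eq_zero_iff.1 h0 _)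
  obtain ⟨e', φ, hφ⟩ := (star S g).exists_label X F
  have hF : ∀ a, F.hom.gl.arc a = X.gr.incl v (arcMap ρ a) := fun a =>
    (Graph.mkIso_arc _ _ _ _ _ a).trans (X.gr.flagsOne_arc v hv ρ a)
  refine ⟨φ, e', fun a => ?_, ?_⟩
  · exact (congrArg (arcMap φ) (star_arc S g a).symm).trans
      ((hφ a).trans (congrArg X.gl.arc (hF a)))
  · have h00 : (star S g).gr.numEdges = 0 := (Graph.numEdges_eq_zero_iff _).2 fun _ => rfl
    have h1 := hn (star S g) X F φ e' (by rw [h00]; exact Nat.zero_le n) hφ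
    have h2 := congrArg (fun k => P.toCorolla S g ≫ k) h1
    have h3 := P.in₁_onIso F () (fun _ => rfl) (corollaLeg S g) rfl hv
    have h4 : P.in₁ X.gr v hv ρ e = P.toCorolla S g ≫ P.onIso F := h3.symm
    rw [h4, Category.assoc, h2, ← Category.assoc, hs, Category.id_comp]

theorem vertexwise_iso {n : ℕ} (hn : P.NaturalUpTo α n) (hs : P.StarUnit α) {Γ Δ : Graph}
    (f : Γ ≅ Δ) : P.vertexwise α f.hom = P.onIso f := by
  have hv : ∀ w, ∀ w' : {w' // f.hom.vert w' = f.hom.vert w}, w' = ⟨w, rfl⟩ := fun w w' =>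
    Subtype.ext ((vertEquiv f).injective w'.2)
  rw [vertexwise_eq, onIso_eq]
  refine (uFib_equiv (X := P.factor Γ) (Y := P.factor Δ) (vertEquiv f) (P.onFiber α f.hom)
    (fun w => perm_single (hv w))).trans ?_
  refine congrArg (uMap (Y := P.factor Δ) (vertEquiv f)) (funext fun w => ?_)
  have h0 : (LGraph.fiber f.hom (f.hom.vert w)).gr.numEdges = 0 :=
    (Graph.numEdges_eq_zero_iff _).2 fun x => Subtype.ext
      (f.hom.toPreHom.cutInv_of_mem ⟨_, hom_emb_inv_emb f x.1⟩)
  obtain ⟨φ, e, hφ, h⟩ := eval_star hn hs (LGraph.fiber f.hom (f.hom.vert w)) h0 ⟨w, rfl⟩ (hv w)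
    (fiberLeg f.hom (f.hom.vert w) ⟨w, rfl⟩) rfl
  have h1 := single_uMap (X := fun w' : {w' // f.hom.vert w' = f.hom.vert w} => P.factor Γ w'.1)
    (Y := P.factor (LGraph.fiber f.hom (f.hom.vert w)).gr) (Equiv.refl _)
    (fun w' => P.mp (fiberLeg f.hom (f.hom.vert w) w') rfl) ⟨w, rfl⟩ (perm_single (hv w))
    (perm_single (hv w))
  have h2 : φ = legAtIso f w := by
    refine MultCyc.hom_ext_arc fun a => Graph.incl_injective _ _ ?_
    refine (congrArg _ (hφ a)).trans ((LGraph.incl_fiber_arc _ _ _).trans ?_)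
    refine Eq.trans (Graph.flIso_arc f _).symm ?_
    rcases a with a | a <;> rfl
  subst h2
  refine (Category.assoc _ _ _).symm.trans ?_
  refine (congrArg (fun k => k ≫ α _ _ (LGraph.fiber f.hom (f.hom.vert w))) h1).trans ?_
  exact h

/-- `vertexwise` of a composition. -/
theorem vertexwise_comp {n : ℕ} (hn : P.NaturalUpTo α n) {Γ Δ Λ : Graph} (f : Γ ⟶ Δ) (k : Δ ⟶ Λ)
    (hle : ∀ v, (LGraph.fiber f v).gr.numEdges ≤ n)
    (h : ∀ u, α _ _ (LGraph.fiber (f ≫ k) u) =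
      P.vertexwise α (LGraph.restrict f k u).hom ≫ α _ _ (LGraph.fiber k u)) :
    P.vertexwise α (f ≫ k) = P.vertexwise α f ≫ P.vertexwise α k := by
  rw [vertexwise_eq, vertexwise_eq, vertexwise_eq]
  refine Eq.trans ?_ (uFib_uFib (X := P.factor Γ) (Y := P.factor Δ) (Z := P.factor Λ) f.vert k.vert
    (P.onFiber α f) (P.onFiber α k)).symm
  refine congrArg (uFib (X := P.factor Γ) (Y := P.factor Λ) _) (funext fun u => ?_)
  unfold onFiber
  rw [h u, vertexwise_eq]
  refine (Category.assoc _ _ _).symm.trans (Eq.trans ?_ (Category.assoc _ _ _))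
  refine congrArg (fun k' => k' ≫ α _ _ (LGraph.fiber k u)) ?_
  refine (uFib_uMap (p := fun i : {w // k.vert (f.vert w) = u} =>
    (⟨f.vert i.1, i.2⟩ : {v // k.vert v = u})) (p' := (LGraph.restrict f k u).hom.vert)
    (Equiv.refl _) (Equiv.refl _) (fun _ => rfl) _ _ _ _ fun v => ?_).symm
  have h1 := hn (LGraph.fiber f v.1) (LGraph.fiber (LGraph.restrict f k u).hom v)
    (Graph.restrictFiberIso f k u v) (fiberLeg k u v) rfl (hle _)
    (LGraph.restrictFiberIso_label f k u v)
  refine (congrArg (fun z => z ≫ P.mp (fiberLeg k u v) rfl) (Category.assoc _ _ _).symm).trans ?_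
  refine (Category.assoc _ _ _).trans ?_
  refine (congrArg (fun z => _ ≫ z) h1.symm).trans ?_
  refine (Category.assoc _ _ _).symm.trans ?_
  refine Eq.trans ?_ (Category.assoc _ _ _)
  refine congrArg (fun z => z ≫ α _ _ (LGraph.fiber (LGraph.restrict f k u).hom v)) ?_
  refine (congrArg (fun z => z ≫ P.onIso (Graph.restrictFiberIso f k u v))
    (uMap_comp _ _ _ _)).trans ?_
  refine (uMap_comp _ _ _ _).trans (Eq.trans ?_ (uMap_comp _ _ _ _).symm)
  refine congrArg (uMap (Y := P.factor (LGraph.fiber (LGraph.restrict f k u).hom v).gr) _)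
    (funext fun w => ?_)
  refine (Category.assoc _ _ _).trans ((Category.id_comp _).trans ?_)
  exact (P.mp_comp _ _ _ _).trans (P.mp_comp (fiberLeg (f ≫ k) u w.1)
    (fiberLeg (LGraph.restrict f k u).hom v w) rfl rfl).symm

theorem factor_of_numEdges_eq_zero {n : ℕ} (hn : P.NaturalUpTo α n) (hs : P.StarUnit α)
    {S : MultCyc} {g : ℕ} {X Y : LGraph S g} (h : X ⟶ Y) (hX : X.gr.numEdges ≤ n)
    (hY : Y.gr.numEdges = 0) : α S g X = P.vertexwise α h.hom ≫ α S g Y := by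
  obtain ⟨v⟩ : Nonempty Y.gr.Vert := Y.gr.fl.nonempty.map Y.gr.arcV
  have hv : ∀ w, w = v := fun w => Graph.eq_of_numEdges_eq_zero hY w v
  have hp : ∀ w, h.hom.vert w = v := fun w => hv _
  obtain ⟨φ, e, hφ, h1⟩ := eval_star hn hs Y hY v hv (𝟙 _) rfl
  let F : (LGraph.fiber h.hom v).gr ≅ X.gr := Graph.mkIso (Γ := h.hom.toPreHom.fiber v)
    { pt := Equiv.subtypeUnivEquiv fun _ => hv _
      emp := Equiv.subtypeUnivEquiv fun _ => hv _
      map_succ := fun _ => rfl }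
    (Equiv.subtypeUnivEquiv hp) (fun a => by rcases a with a | a <;> rfl) (fun _ => rfl)
    (fun x => by
      show X.gr.inv x.1 = h.hom.toPreHom.cutInv x.1
      by_cases hx : x.1 ∈ Set.range h.hom.gl.emb
      · rw [h.hom.toPreHom.cutInv_of_mem hx]
        obtain ⟨y, hy⟩ := hx
        rw [← hy, h.hom.inv_emb, Y.gr.numEdges_eq_zero_iff.1 hY]
      · rw [h.hom.toPreHom.cutInv_of_notMem hx])
  have hF : ∀ a, F.hom.gl.arc a = h.hom.toPreHom.inclFiber v a := fun a => by
    rcases a with a | a <;> rfl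
  have h2 := hn (LGraph.fiber h.hom v) X F φ e
    ((Nat.le_add_right _ _).trans ((Graph.numEdges_fiber_add_le h.hom.toPreHom v).trans hX))
    (fun a => by
      have h3 := hφ ((LGraph.fiber h.hom v).gl.arc a)
      rw [MultCyc.arcMap_id] at h3
      rw [h3, hF, ← h.label]
      exact congrArg Y.gl.arc (LGraph.incl_fiber_arc _ _ _))
  have h4 := uMap_uFib_one (X := P.factor X.gr) (Y := P.factor Y.gr) h.hom.vert
    (P.onFiber α h.hom) v (perm_single hv) hp
  have h1' : single (P.factor Y.gr) v (perm_single hv) ≫ α S g Y = P.mp φ e := by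
    refine Eq.trans ?_ h1
    refine congrArg (fun k => k ≫ α S g Y) (Eq.trans (Category.id_comp _).symm ?_)
    exact congrArg (fun k => k ≫ single (P.factor Y.gr) v (perm_single hv)) (P.mp_id _ _ _).symm
  have : IsIso (uMap (Y := P.factor X.gr) (Equiv.subtypeUnivEquiv hp)
    (fun i : {i // h.hom.vert i = v} => 𝟙 (P.factor X.gr i.1))) :=
    @isIso_uMap _ _ _ _ _ _ _ _ _ _ _ _ fun i =>
      inferInstanceAs (IsIso (𝟙 (P.factor X.gr i.1)))
  refine (cancel_epi (uMap (Y := P.factor X.gr) (Equiv.subtypeUnivEquiv hp)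
    (fun i : {i // h.hom.vert i = v} => 𝟙 (P.factor X.gr i.1)))).1 ?_
  rw [vertexwise_eq]
  refine Eq.trans ?_ (Category.assoc _ _ _)
  refine Eq.trans ?_ (congrArg (fun k => k ≫ α S g Y) h4).symm
  refine Eq.trans ?_ (Category.assoc _ _ _).symm
  refine Eq.trans ?_ (congrArg (fun k => P.onFiber α h.hom v ≫ k) h1').symm
  refine Eq.trans ?_ (Category.assoc _ _ _).symm
  refine Eq.trans ?_ (congrArg (fun k => uMap (Y := P.factor (LGraph.fiber h.hom v).gr)
    (Equiv.refl _) (fun w => P.mp (fiberLeg h.hom v w) rfl) ≫ k) h2)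
  refine Eq.trans ?_ (Category.assoc _ _ _)
  refine congrArg (fun k => k ≫ α S g X) ?_
  refine Eq.trans ?_ (uMap_comp _ _ _ _).symm
  refine congrArg (uMap (Y := P.factor X.gr) _) (funext fun w => ?_)
  refine Eq.trans ?_ (P.mp_comp _ _ _ _).symm
  exact (P.mp_id _ _ _).symm

end NsModule

theorem incl_legAtIso {Γ Δ : Graph} (F : Γ ≅ Δ) (w : Γ.Vert) (a : (Γ.legAt w).Arc) :
    Δ.incl (F.hom.vert w) (arcMap (legAtIso F w) a) = F.hom.gl.arc (Γ.incl w a) := by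
  refine Eq.trans ?_ (Graph.flIso_arc F _)
  rcases a with a | a <;> rfl

namespace Graph

/-- The flags `x` and `y` form the only edge of the graph. -/
def OnlyEdge (Γ : Graph) (x y : Γ.fl.pt) : Prop :=
  x ≠ y ∧ Γ.inv x = y ∧ ∀ z, Γ.inv z ≠ z → z = x ∨ z = y

theorem OnlyEdge.symm {Γ : Graph} {x y : Γ.fl.pt} (h : Γ.OnlyEdge x y) : Γ.OnlyEdge y x :=
  ⟨h.1.symm, by rw [← h.2.1, Γ.inv_inv], fun z hz => (h.2.2 z hz).symm⟩

theorem OnlyEdge.inv_eq {Γ : Graph} {x y : Γ.fl.pt} (h : Γ.OnlyEdge x y) [DecidableEq Γ.fl.pt]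
    (z : Γ.fl.pt) : Γ.inv z = Equiv.swap x y z := by
  rcases eq_or_ne z x with rfl | hx
  · rw [h.2.1, Equiv.swap_apply_left]
  · rcases eq_or_ne z y with rfl | hy
    · rw [h.symm.2.1, Equiv.swap_apply_right]
    · rw [Equiv.swap_apply_of_ne_of_ne hx hy]
      by_contra hz
      exact (h.2.2 z hz).elim hx hy

theorem OnlyEdge.inv_map {Γ Δ : Graph} {x y : Γ.fl.pt} (h : Γ.OnlyEdge x y)
    (p : Γ.fl.pt ≃ Δ.fl.pt) (h' : Δ.OnlyEdge (p x) (p y)) (z : Γ.fl.pt) :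
    Δ.inv (p z) = p (Γ.inv z) := by
  classical
  rw [h.inv_eq, h'.inv_eq]
  exact (p.injective.swap_apply _ _ _)

theorem OnlyEdge.map {Γ Δ : Graph} (F : Γ ≅ Δ) {x y : Γ.fl.pt} (h : Γ.OnlyEdge x y) :
    Δ.OnlyEdge (F.inv.gl.emb x) (F.inv.gl.emb y) := by
  refine ⟨fun e => h.1 (F.inv.gl.emb_injective e), by rw [F.inv.inv_emb, h.2.1], fun z hz => ?_⟩
  obtain ⟨z, rfl⟩ : ∃ z', F.inv.gl.emb z' = z := ⟨_, inv_emb_hom_emb F z⟩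
  rw [F.inv.inv_emb] at hz
  exact (h.2.2 z fun e => hz (congrArg _ e)).imp (congrArg _) (congrArg _)

theorem OnlyEdge.numEdges {Γ : Graph} {x y : Γ.fl.pt} (h : Γ.OnlyEdge x y) : Γ.numEdges = 1 := by
  classical
  have := Γ.two_mul_numEdges
  have e : Nat.card {z // Γ.inv z ≠ z} = Nat.card {z // Equiv.swap x y z ≠ z} :=
    Nat.card_congr (Equiv.subtypeEquivRight fun z => by rw [h.inv_eq])
  rw [e, card_swap_ne h.1] at this
  omega

theorem exists_onlyEdge {Γ : Graph} (h : Γ.numEdges = 1) : ∃ x y, Γ.OnlyEdge x y := by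
  have h1 := Γ.two_mul_numEdges
  rw [h] at h1
  have := Fintype.ofFinite Γ.fl.pt
  have h0 : ¬ ∀ x, Γ.inv x = x := fun h' => by
    rw [(Γ.numEdges_eq_zero_iff).2 h'] at h
    cases h
  push Not at h0
  obtain ⟨x, hx⟩ := h0
  have hx' : Γ.inv (Γ.inv x) ≠ Γ.inv x := by rw [Γ.inv_inv]; exact hx.symm
  refine ⟨x, Γ.inv x, hx.symm, rfl, fun z hz => ?_⟩
  by_contra hne
  push Not at hne
  have h3 : ({x, Γ.inv x, z} : Set Γ.fl.pt).ncard ≤ {z | Γ.inv z ≠ z}.ncard :=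
    Set.ncard_le_ncard (by rintro w (rfl | rfl | rfl); exacts [hx, hx', hz])
  have h4 : ({x, Γ.inv x, z} : Set Γ.fl.pt).ncard = 3 :=
    Set.ncard_eq_three.2 ⟨x, Γ.inv x, z, hx.symm, hne.1.symm, hne.2.symm, rfl⟩
  have h5 : {z | Γ.inv z ≠ z}.ncard = Nat.card {z // Γ.inv z ≠ z} := rfl
  omega

theorem ne_of_perm {Γ : Graph} {v w : Γ.Vert} (hp : [v, w].Perm (ordering Γ.Vert)) : v ≠ w := by
  have := hp.nodup_iff.2 (nodup_ordering _)
  simpa using this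

theorem eq_or_eq_of_perm {Γ : Graph} {v w : Γ.Vert} (hp : [v, w].Perm (ordering Γ.Vert))
    (x : Γ.Vert) : x = v ∨ x = w := by
  simpa using hp.mem_iff.2 (mem_ordering x)

theorem incl_left_ne {Γ : Graph} {v w : Γ.Vert} (h : v ≠ w) (x : (Γ.legAt v).pt)
    (y : (Γ.legAt w).pt) : x.1 ≠ y.1 := fun e => h (by rw [← x.2, ← y.2, e])

/-- The flags of a graph with two vertices. -/
noncomputable def flagsTwo (Γ : Graph) {v w : Γ.Vert} (hp : [v, w].Perm (ordering Γ.Vert))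
    {S T : MultCyc} (ρ : S ⟶ Γ.legAt v) (σ : T ⟶ Γ.legAt w) : S.sum T ⟶ Γ.fl where
  pt := Equiv.ofBijective (Sum.elim (fun x => (ρ.pt x).1) fun x => (σ.pt x).1) (by
    constructor
    · refine Function.Injective.sumElim (Subtype.val_injective.comp ρ.pt.injective)
        (Subtype.val_injective.comp σ.pt.injective) fun a b e => ?_
      exact incl_left_ne (ne_of_perm hp) _ _ e
    · intro x
      rcases eq_or_eq_of_perm hp (Γ.ptV x) with h | h
      · exact ⟨Sum.inl (ρ.pt.symm ⟨x, h⟩), by simp⟩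
      · exact ⟨Sum.inr (σ.pt.symm ⟨x, h⟩), by simp⟩)
  emp := Equiv.ofBijective (Sum.elim (fun x => (ρ.emp x).1) fun x => (σ.emp x).1) (by
    constructor
    · refine Function.Injective.sumElim (Subtype.val_injective.comp ρ.emp.injective)
        (Subtype.val_injective.comp σ.emp.injective) fun a b e => ne_of_perm hp ?_
      rw [← (ρ.emp a).2, ← (σ.emp b).2]
      exact congrArg Γ.empV e
    · intro x
      rcases eq_or_eq_of_perm hp (Γ.empV x) with h | h
      · exact ⟨Sum.inl (ρ.emp.symm ⟨x, h⟩), by simp⟩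
      · exact ⟨Sum.inr (σ.emp.symm ⟨x, h⟩), by simp⟩)
  map_succ := by
    rintro (x | x)
    · exact congrArg Subtype.val (ρ.map_succ x)
    · exact congrArg Subtype.val (σ.map_succ x)

theorem flagsTwo_arc_left (Γ : Graph) {v w : Γ.Vert} (hp : [v, w].Perm (ordering Γ.Vert))
    {S T : MultCyc} (ρ : S ⟶ Γ.legAt v) (σ : T ⟶ Γ.legAt w) (a : S.Arc) :
    arcMap (Γ.flagsTwo hp ρ σ) (Sum.map Sum.inl Sum.inl a) = Γ.incl v (arcMap ρ a) := by
  rcases a with a | a <;> rfl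

theorem flagsTwo_arc_right (Γ : Graph) {v w : Γ.Vert} (hp : [v, w].Perm (ordering Γ.Vert))
    {S T : MultCyc} (ρ : S ⟶ Γ.legAt v) (σ : T ⟶ Γ.legAt w) (a : T.Arc) :
    arcMap (Γ.flagsTwo hp ρ σ) (Sum.map Sum.inr Sum.inr a) = Γ.incl w (arcMap σ a) := by
  rcases a with a | a <;> rfl

end Graph

theorem edgeGraph_arc_left {S T : MultCyc} (u : S.pt) (v : T.pt) (g h : ℕ) (a : S.Arc) :
    (edgeGraph u v g h).gl.arc (Sum.map Sum.inl Sum.inl a) = mergeArcLeft u v a :=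
  (Gluing.map_arc _ _ _).trans (MultCyc.arcMap_id _)

theorem edgeGraph_arc_right {S T : MultCyc} (u : S.pt) (v : T.pt) (g h : ℕ) (a : T.Arc) :
    (edgeGraph u v g h).gl.arc (Sum.map Sum.inr Sum.inr a) = mergeArcRight u v a :=
  (Gluing.map_arc _ _ _).trans (MultCyc.arcMap_id _)

theorem loopGraph_arc {S : MultCyc} (u v : S.pt) (huv : u ≠ v) (g : ℕ) (a : S.Arc) :
    (loopGraph u v huv g).gl.arc a = cutArc u v a :=
  (Gluing.map_arc _ _ _).trans (MultCyc.arcMap_id _)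

theorem edgeGraph_onlyEdge {S T : MultCyc} (u : S.pt) (v : T.pt) (g h : ℕ) :
    (edgeGraph u v g h).gr.OnlyEdge (Sum.inl u) (Sum.inr v) := by
  classical
  refine ⟨Sum.inl_ne_inr, Equiv.swap_apply_left (Sum.inl u : S.pt ⊕ T.pt) (Sum.inr v),
    fun z hz => ?_⟩
  by_contra hne
  push Not at hne
  exact hz (Equiv.swap_apply_of_ne_of_ne (a := (Sum.inl u : S.pt ⊕ T.pt)) (b := Sum.inr v)
    hne.1 hne.2)

theorem loopGraph_onlyEdge {S : MultCyc} (u v : S.pt) (huv : u ≠ v) (g : ℕ) :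
    (loopGraph u v huv g).gr.OnlyEdge u v := by
  classical
  refine ⟨huv, Equiv.swap_apply_left _ _, fun z hz => ?_⟩
  by_contra hne
  push Not at hne
  exact hz (Equiv.swap_apply_of_ne_of_ne hne.1 hne.2)

/-- The bijection from `Bool` to the vertices of a graph with two vertices. -/
noncomputable def boolVert {Γ : Graph} {v w : Γ.Vert} (hp : [v, w].Perm (ordering Γ.Vert)) :
    Bool ≃ Γ.Vert := by
  classical
  exact
  { toFun := fun b => cond b w v
    invFun := fun x => decide (x = w)
    left_inv := by rintro (_ | _) <;> simp [Graph.ne_of_perm hp]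
    right_inv := fun x => by
      rcases Graph.eq_or_eq_of_perm hp x with rfl | rfl <;> simp [Graph.ne_of_perm hp] }

namespace NsModule

variable {M : Type u} [Category.{v} M] [MonoidalCategory M] [SymmetricCategory M] (P : NsModule M)

/-- The morphism to `P(Γ)` for a graph with two vertices. -/
noncomputable def in₂ (Γ : Graph) (v w : Γ.Vert) (hp : [v, w].Perm (ordering Γ.Vert))
    {S T : MultCyc} {g h : ℕ} (ρ : S ⟶ Γ.legAt v) (σ : T ⟶ Γ.legAt w) (e : g = Γ.genus v)
    (e' : h = Γ.genus w) : P.ob S g ⊗ P.ob T h ⟶ P.onGraph Γ :=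
  (P.mp ρ e ⊗ₘ P.mp σ e') ≫ pair (P.factor Γ) v w hp

instance (Γ : Graph) (v w : Γ.Vert) (hp : [v, w].Perm (ordering Γ.Vert))
    {S T : MultCyc} {g h : ℕ} (ρ : S ⟶ Γ.legAt v) (σ : T ⟶ Γ.legAt w) (e : g = Γ.genus v)
    (e' : h = Γ.genus w) : IsIso (P.in₂ Γ v w hp ρ σ e e') := by
  have h1 : IsIso (pair (P.factor Γ) v w hp) := inferInstance
  exact @IsIso.comp_isIso _ _ _ _ _ (P.mp ρ e ⊗ₘ P.mp σ e') (pair (P.factor Γ) v w hp)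
    (inferInstanceAs (IsIso (P.mp ρ e ⊗ₘ P.mp σ e'))) h1

theorem in₂_onIso {Γ Δ : Graph} (F : Γ ≅ Δ) (v w : Γ.Vert) (hp : [v, w].Perm (ordering Γ.Vert))
    {S T : MultCyc} {g h : ℕ} (ρ : S ⟶ Γ.legAt v) (σ : T ⟶ Γ.legAt w) (e : g = Γ.genus v)
    (e' : h = Γ.genus w) (hp' : [F.hom.vert v, F.hom.vert w].Perm (ordering Δ.Vert)) :
    P.in₂ Γ v w hp ρ σ e e' ≫ P.onIso F = P.in₂ Δ (F.hom.vert v) (F.hom.vert w) hp'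
      (ρ ≫ legAtIso F v) (σ ≫ legAtIso F w) (e.trans (genus_iso F v))
      (e'.trans (genus_iso F w)) := by
  have h := pair_uMap (X := P.factor Γ) (Y := P.factor Δ) (vertEquiv F)
    (fun w => P.mp (legAtIso F w) (genus_iso F w)) v w hp hp'
  refine (Category.assoc _ _ _).trans ((congrArg (fun k => (P.mp ρ e ⊗ₘ P.mp σ e') ≫ k) h).trans ?_)
  refine (Category.assoc _ _ _).symm.trans ?_
  refine congrArg (fun k => k ≫ pair (P.factor Δ) (F.hom.vert v) (F.hom.vert w) hp') ?_
  refine (MonoidalCategory.tensorHom_comp_tensorHom _ _ _ _).trans ?_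
  exact congrArg₂ (fun k k' => k ⊗ₘ k') (P.mp_comp _ _ _ _) (P.mp_comp _ _ _ _)

theorem toEdge_eq {S T : MultCyc} (u : S.pt) (v : T.pt) (g h : ℕ) :
    P.toEdge u v g h = P.in₂ (edgeGraph u v g h).gr false true perm_ordering_bool
      (edgeLegLeft u v g h) (edgeLegRight u v g h) rfl rfl := by
  have key : ∀ {A B C D : M} (f : A ⟶ B) (k : C ⟶ D) {E : M} (r : B ⊗ D ⊗ 𝟙_ M ⟶ E),
      (f ⊗ₘ (k ≫ (ρ_ _).inv)) ≫ r = (f ⊗ₘ k) ≫ (B ◁ (ρ_ D).inv) ≫ r := by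
    intro A B C D f k E r
    rw [← id_tensorHom, MonoidalCategory.tensorHom_comp_tensorHom_assoc, Category.comp_id]
  exact key _ _ _

/-- Data like the structure maps of an operad. -/
structure Ops (P : NsModule M) where
  comp : ∀ {S T : MultCyc} (u : S.pt) (v : T.pt) (g h : ℕ),
    P.ob S g ⊗ P.ob T h ⟶ P.ob (merge S T u v) (g + h)
  contr : ∀ {S : MultCyc} (u v : S.pt) (_ : u ≠ v) (g : ℕ), P.ob S g ⟶ P.ob (cut S u v) (g + 1)

/-- The values of `α` on graphs with at most one edge are the canonical ones, respectively those
given by the operations `R`. -/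
structure Evaluates {P : NsModule M} (R : Ops P) (α : P.ContractionFamily) : Prop where
  star : ∀ {S W : MultCyc} {g k : ℕ} (X : LGraph W k) (_ : X.gr.numEdges = 0) (v : X.gr.Vert)
    (hv : ∀ w, w = v) (ρ : S ⟶ X.gr.legAt v) (e : g = X.gr.genus v),
    ∃ (φ : S ⟶ W) (e' : g = k),
      (∀ a, arcMap φ a = X.gl.arc (X.gr.incl v (arcMap ρ a))) ∧
      P.in₁ X.gr v hv ρ e ≫ α W k X = P.mp φ e'
  edge : ∀ {S T W : MultCyc} {g h k : ℕ} (X : LGraph W k) (v w : X.gr.Vert)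
    (hp : [v, w].Perm (ordering X.gr.Vert)) (ρ : S ⟶ X.gr.legAt v) (σ : T ⟶ X.gr.legAt w)
    (e : g = X.gr.genus v) (e' : h = X.gr.genus w) (u : S.pt) (t : T.pt)
    (_ : X.gr.OnlyEdge (ρ.pt u).1 (σ.pt t).1),
    ∃ (φ : merge S T u t ⟶ W) (e'' : g + h = k),
      (∀ a, arcMap φ (mergeArcLeft u t a) = X.gl.arc (X.gr.incl v (arcMap ρ a))) ∧
      (∀ a, arcMap φ (mergeArcRight u t a) = X.gl.arc (X.gr.incl w (arcMap σ a))) ∧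
      P.in₂ X.gr v w hp ρ σ e e' ≫ α W k X = R.comp u t g h ≫ P.mp φ e''
  loop : ∀ {S W : MultCyc} {g k : ℕ} (X : LGraph W k) (v : X.gr.Vert) (hv : ∀ w, w = v)
    (ρ : S ⟶ X.gr.legAt v) (e : g = X.gr.genus v) (u t : S.pt) (hut : u ≠ t)
    (_ : X.gr.OnlyEdge (ρ.pt u).1 (ρ.pt t).1),
    ∃ (φ : cut S u t ⟶ W) (e' : g + 1 = k),
      (∀ a, arcMap φ (cutArc u t a) = X.gl.arc (X.gr.incl v (arcMap ρ a))) ∧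
      P.in₁ X.gr v hv ρ e ≫ α W k X = R.contr u t hut g ≫ P.mp φ e'

variable {P}

/-- The isomorphism from the standard graph with one edge to a graph with two vertices and one
edge. -/
theorem exists_edgeIso (Γ : Graph) (v w : Γ.Vert) (hp : [v, w].Perm (ordering Γ.Vert))
    {S T : MultCyc} {g h : ℕ} (ρ : S ⟶ Γ.legAt v) (σ : T ⟶ Γ.legAt w) (e : g = Γ.genus v)
    (e' : h = Γ.genus w) (u : S.pt) (t : T.pt) (hΓ : Γ.OnlyEdge (ρ.pt u).1 (σ.pt t).1) :
    ∃ F : (edgeGraph u t g h).gr ≅ Γ,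
      (∀ a, F.hom.gl.arc (Sum.map Sum.inl Sum.inl a) = Γ.incl v (arcMap ρ a)) ∧
      (∀ a, F.hom.gl.arc (Sum.map Sum.inr Sum.inr a) = Γ.incl w (arcMap σ a)) ∧
      P.toEdge u t g h ≫ P.onIso F = P.in₂ Γ v w hp ρ σ e e' := by
  classical
  let F : (edgeGraph u t g h).gr ≅ Γ := Graph.mkIso (Γ := (edgeGraph u t g h).gr)
    (Γ.flagsTwo hp ρ σ) (boolVert hp)
    (by
      rintro ((a | a) | (a | a))
      exacts [(ρ.pt a).2, (σ.pt a).2, (ρ.emp a).2, (σ.emp a).2])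
    (by rintro (_ | _); exacts [e.symm, e'.symm])
    ((edgeGraph_onlyEdge u t g h).inv_map (Γ.flagsTwo hp ρ σ).pt hΓ)
  have hl : ∀ a, F.hom.gl.arc (Sum.map Sum.inl Sum.inl a) = Γ.incl v (arcMap ρ a) := fun a =>
    (Graph.mkIso_arc _ _ _ _ _ _).trans (Γ.flagsTwo_arc_left hp ρ σ a)
  have hr : ∀ a, F.hom.gl.arc (Sum.map Sum.inr Sum.inr a) = Γ.incl w (arcMap σ a) := fun a =>
    (Graph.mkIso_arc _ _ _ _ _ _).trans (Γ.flagsTwo_arc_right hp ρ σ a)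
  refine ⟨F, hl, hr, ?_⟩
  rw [toEdge_eq]
  refine (P.in₂_onIso F false true perm_ordering_bool _ _ rfl rfl hp).trans ?_
  have h1 : edgeLegLeft u t g h ≫ legAtIso F false = ρ := MultCyc.hom_ext_arc fun a =>
    Graph.incl_injective _ _ ((congrArg _ (MultCyc.arcMap_comp _ _ _)).trans
      ((incl_legAtIso F false _).trans (Eq.trans (by rcases a with a | a <;> rfl) (hl a))))
  have h2 : edgeLegRight u t g h ≫ legAtIso F true = σ := MultCyc.hom_ext_arc fun a =>
    Graph.incl_injective _ _ ((congrArg _ (MultCyc.arcMap_comp _ _ _)).trans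
      ((incl_legAtIso F true _).trans (Eq.trans (by rcases a with a | a <;> rfl) (hr a))))
  rw [h1, h2]
  rfl

/-- The isomorphism from the standard graph with one loop to a graph with one vertex and one
edge. -/
theorem exists_loopIso (Γ : Graph) (v : Γ.Vert) (hv : ∀ w, w = v)
    {S : MultCyc} {g : ℕ} (ρ : S ⟶ Γ.legAt v) (e : g = Γ.genus v) (u t : S.pt) (hut : u ≠ t)
    (hΓ : Γ.OnlyEdge (ρ.pt u).1 (ρ.pt t).1) :
    ∃ F : (loopGraph u t hut g).gr ≅ Γ,
      (∀ a : S.Arc, F.hom.gl.arc a = Γ.incl v (arcMap ρ a)) ∧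
      P.toLoop u t hut g ≫ P.onIso F = P.in₁ Γ v hv ρ e := by
  classical
  let E : Unit ≃ Γ.Vert :=
    { toFun := fun _ => v
      invFun := fun _ => ()
      left_inv := fun _ => rfl
      right_inv := fun w => (hv w).symm }
  let F : (loopGraph u t hut g).gr ≅ Γ := Graph.mkIso (Γ := (loopGraph u t hut g).gr)
    (Γ.flagsOne v hv ρ) E (fun a => hv _) (fun _ => e.symm)
    ((loopGraph_onlyEdge u t hut g).inv_map (Γ.flagsOne v hv ρ).pt hΓ)
  have hl : ∀ a : S.Arc, F.hom.gl.arc a = Γ.incl v (arcMap ρ a) := fun a =>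
    (Graph.mkIso_arc (Γ := (loopGraph u t hut g).gr) _ _ _ _ _ a).trans (Γ.flagsOne_arc v hv ρ a)
  refine ⟨F, hl, ?_⟩
  rw [toLoop_eq]
  refine (P.in₁_onIso F () (fun _ => rfl) _ rfl hv).trans ?_
  have h1 : corollaLeg S g ≫ legAtIso F () = ρ := MultCyc.hom_ext_arc fun a =>
    Graph.incl_injective _ _ ((congrArg _ (MultCyc.arcMap_comp _ _ _)).trans
      ((incl_legAtIso F () _).trans (Eq.trans (by rcases a with a | a <;> rfl) (hl a))))
  have h2 : ∀ ρ', ρ' = ρ → P.in₁ Γ v hv ρ' e = P.in₁ Γ v hv ρ e := by rintro _ rfl; rfl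
  exact h2 _ h1

theorem evaluates_of_natural {α : P.ContractionFamily} {n : ℕ} (hn : P.NaturalUpTo α n)
    (h1 : 1 ≤ n) (hs : P.StarUnit α) (R : Ops P)
    (he : ∀ {S T : MultCyc} (u : S.pt) (v : T.pt) (g h : ℕ),
      P.toEdge u v g h ≫ α (merge S T u v) (g + h) (edgeGraph u v g h) = R.comp u v g h)
    (hl : ∀ {S : MultCyc} (u v : S.pt) (huv : u ≠ v) (g : ℕ),
      P.toLoop u v huv g ≫ α (cut S u v) (g + 1) (loopGraph u v huv g) = R.contr u v huv g) :
    Evaluates R α where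
  star X h0 v hv ρ e := eval_star hn hs X h0 v hv ρ e
  edge {S T W g h k} X v w hp ρ σ e e' u t hX := by
    obtain ⟨F, h2, h3, h4⟩ := exists_edgeIso (P := P) X.gr v w hp ρ σ e e' u t hX
    obtain ⟨e'', φ, hφ⟩ := (edgeGraph u t g h).exists_label X F
    refine ⟨φ, e'', fun a => ?_, fun a => ?_, ?_⟩
    · rw [← edgeGraph_arc_left u t g h, hφ, h2]
    · rw [← edgeGraph_arc_right u t g h, hφ, h3]
    · rw [← h4, Category.assoc, hn (edgeGraph u t g h) X F φ e'' (by
        rw [(edgeGraph_onlyEdge u t g h).numEdges]; exact h1) hφ, ← Category.assoc, he]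
  loop {S W g k} X v hv ρ e u t hut hX := by
    obtain ⟨F, h2, h4⟩ := exists_loopIso (P := P) X.gr v hv ρ e u t hut hX
    obtain ⟨e'', φ, hφ⟩ := (loopGraph u t hut g).exists_label X F
    refine ⟨φ, e'', fun a => ?_, ?_⟩
    · rw [← loopGraph_arc u t hut g]
      exact (hφ a).trans (congrArg _ (h2 a))
    · rw [← h4, Category.assoc, hn (loopGraph u t hut g) X F φ e'' (by
        rw [(loopGraph_onlyEdge u t hut g).numEdges]; exact h1) hφ, ← Category.assoc, hl]

end NsModule

theorem mergeArcLeft_inl {S T : MultCyc} {u : S.pt} {t : T.pt} {x : S.pt} (h : x ≠ u) :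
    mergeArcLeft u t (Sum.inl x) = Sum.inl (mergeLeft x h) :=
  (Gluing.canonical (S.sum T) _).arc_emb (mergeLeft x h)

theorem mergeArcRight_inl {S T : MultCyc} {u : S.pt} {t : T.pt} {x : T.pt} (h : x ≠ t) :
    mergeArcRight u t (Sum.inl x) = Sum.inl (mergeRight x h) :=
  (Gluing.canonical (S.sum T) _).arc_emb (mergeRight x h)

theorem cutArc_inl {S : MultCyc} {u t x : S.pt} (h : x ≠ u) (h' : x ≠ t) :
    cutArc u t (Sum.inl x) = Sum.inl (cutPt x h h') :=
  (Gluing.canonical S _).arc_emb (cutPt x h h')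

namespace Graph

variable {Γ Δ : Graph}

/-- The edges of the graph are `{a, b}` and `{c, d}`. -/
structure TwoEdges (Γ : Graph) (a b c d : Γ.fl.pt) : Prop where
  ab : a ≠ b
  cd : c ≠ d
  ac : a ≠ c
  ad : a ≠ d
  inv_a : Γ.inv a = b
  inv_c : Γ.inv c = d
  all : ∀ z, Γ.inv z ≠ z → z = a ∨ z = b ∨ z = c ∨ z = d

namespace TwoEdges

variable {a b c d : Γ.fl.pt} (h : Γ.TwoEdges a b c d)

include h

theorem inv_b : Γ.inv b = a := by rw [← h.inv_a, Γ.inv_inv]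

theorem inv_d : Γ.inv d = c := by rw [← h.inv_c, Γ.inv_inv]

theorem bc : b ≠ c := fun e => h.ad (by rw [← h.inv_b, e, h.inv_c])

theorem bd : b ≠ d := fun e => h.ac (by rw [← h.inv_b, e, h.inv_d])

theorem swap : Γ.TwoEdges c d a b :=
  ⟨h.cd, h.ab, h.ac.symm, h.bc.symm, h.inv_c, h.inv_a, fun z hz => by
    rcases h.all z hz with h | h | h | h <;> simp [h]⟩

theorem flip : Γ.TwoEdges b a d c :=
  ⟨h.ab.symm, h.cd.symm, h.bd, h.bc, h.inv_b, h.inv_d, fun z hz => by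
    rcases h.all z hz with h | h | h | h <;> simp [h]⟩

end TwoEdges

/-- The flags `c` and `d` are the only contracted ones. -/
def Hom.Contracts (k : Γ ⟶ Δ) (c d : Γ.fl.pt) : Prop :=
  ∀ x, x ∉ Set.range k.gl.emb ↔ x = c ∨ x = d

theorem Hom.Contracts.flip {k : Γ ⟶ Δ} {c d : Γ.fl.pt} (h : Hom.Contracts k c d) :
    Hom.Contracts k d c := fun x => (h x).trans or_comm

theorem TwoEdges.onlyEdge {a b c d : Γ.fl.pt} (h : Γ.TwoEdges a b c d) {k : Γ ⟶ Δ}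
    (hk : Hom.Contracts k c d) {z z' : Δ.fl.pt} (hz : a = k.gl.emb z) (hz' : b = k.gl.emb z') :
    Δ.OnlyEdge z z' := by
  refine ⟨fun e => h.ab (by rw [hz, hz', e]), k.gl.emb_injective ?_, fun y hy => ?_⟩
  · rw [← k.inv_emb, ← hz, ← hz', h.inv_a]
  · have h1 : Γ.inv (k.gl.emb y) ≠ k.gl.emb y := fun e => hy (k.gl.emb_injective (by
      rw [← k.inv_emb, e]))
    have h2 := fun h' => (hk (k.gl.emb y)).2 h' ⟨y, rfl⟩
    rcases h.all _ h1 with e | e | e | e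
    · exact Or.inl (k.gl.emb_injective (e.trans hz))
    · exact Or.inr (k.gl.emb_injective (e.trans hz'))
    · exact (h2 (Or.inl e)).elim
    · exact (h2 (Or.inr e)).elim

theorem TwoEdges.mem_a {a b c d : Γ.fl.pt} (h : Γ.TwoEdges a b c d) {k : Γ ⟶ Δ}
    (hk : Hom.Contracts k c d) : a ∈ Set.range k.gl.emb := by
  by_contra h'
  exact ((hk a).1 h').elim h.ac h.ad

theorem TwoEdges.mem_b {a b c d : Γ.fl.pt} (h : Γ.TwoEdges a b c d) {k : Γ ⟶ Δ}
    (hk : Hom.Contracts k c d) : b ∈ Set.range k.gl.emb := by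
  by_contra h'
  exact ((hk b).1 h').elim h.bc h.bd

theorem Hom.Contracts.vert_eq {a b c d : Γ.fl.pt} {k : Γ ⟶ Δ} (hk : Hom.Contracts k c d)
    (h : Γ.TwoEdges a b c d) : k.vert (Γ.ptV c) = k.vert (Γ.ptV d) := by
  rw [← k.toPreHom.vert_inv ((hk c).2 (Or.inl rfl)), h.inv_c]

theorem Hom.Contracts.vert_ne {a b c d : Γ.fl.pt} {k : Γ ⟶ Δ} (hk : Hom.Contracts k c d)
    (h : Γ.TwoEdges a b c d) {v w : Γ.Vert} (hvw : w ≠ v)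
    (hv : Γ.ptV c = v ↔ Γ.ptV d = v) : k.vert v ≠ k.vert w := fun e => hvw
  ((eqvGen_iff (p := fun x => x = v) (fun x y ⟨z, hz, h1, h2⟩ => by
    rcases (hk z).1 hz with rfl | rfl
    · rw [← h1, ← h2, h.inv_c]; exact hv
    · rw [← h1, ← h2, h.inv_d]; exact hv.symm) (k.conn v w e)).1 rfl)

theorem Hom.Contracts.fiber_onlyEdge {a b c d : Γ.fl.pt} {k : Γ ⟶ Δ} (hk : Hom.Contracts k c d)
    (h : Γ.TwoEdges a b c d) {y : Δ.Vert} (hc : k.vert (Γ.ptV c) = y)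
    (hd : k.vert (Γ.ptV d) = y) : (k.toPreHom.fiber y).OnlyEdge ⟨c, hc⟩ ⟨d, hd⟩ := by
  refine ⟨fun e => h.cd (congrArg Subtype.val e), Subtype.ext ?_, fun z hz => ?_⟩
  · exact (k.toPreHom.cutInv_of_notMem ((hk c).2 (Or.inl rfl))).trans h.inv_c
  · have h1 : z.1 ∉ Set.range k.gl.emb := fun h' => hz (Subtype.ext (k.toPreHom.cutInv_of_mem h'))
    exact ((hk z.1).1 h1).imp Subtype.ext Subtype.ext

theorem Hom.Contracts.numEdges_fiber {a b c d : Γ.fl.pt} {k : Γ ⟶ Δ}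
    (hk : Hom.Contracts k c d) (h : Γ.TwoEdges a b c d) {y : Δ.Vert}
    (hc : k.vert (Γ.ptV c) ≠ y) : (k.toPreHom.fiber y).numEdges = 0 := by
  refine (numEdges_eq_zero_iff _).2 fun z => Subtype.ext (k.toPreHom.cutInv_of_mem ?_)
  by_contra h1
  rcases (hk z.1).1 h1 with e | e
  · exact hc (by rw [← e]; exact z.2)
  · exact hc (by rw [hk.vert_eq h, ← e]; exact z.2)

/-- A flag that survives the contraction, in terms of arcs. -/
theorem eq_emb_of_incl_eq {k : Γ ⟶ Δ} {x : Γ.fl.pt} (hx : x ∈ Set.range k.gl.emb) {y : Δ.Vert}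
    {z : (Δ.legAt y).pt} (h : Δ.incl y (Sum.inl z) = k.gl.arc (Sum.inl x)) :
    x = k.gl.emb z.1 := k.gl.eq_emb_of_arc_eq hx h.symm

theorem fiber_arc (k : Γ ⟶ Δ) {S : MultCyc} {v : Γ.Vert} {y : Δ.Vert} (hv : k.vert v = y)
    (ρ : S ⟶ Γ.legAt v) (a : S.Arc) :
    Δ.incl y ((LGraph.fiber k y).gl.arc ((LGraph.fiber k y).gr.incl ⟨v, hv⟩
      (arcMap (ρ ≫ fiberLeg k y ⟨v, hv⟩) a))) = k.gl.arc (Γ.incl v (arcMap ρ a)) := by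
  refine (LGraph.incl_fiber_arc _ _ _).trans (congrArg k.gl.arc ?_)
  rcases a with a | a <;> rfl

end Graph

namespace NsModule

variable {M : Type u} [Category.{v} M] [MonoidalCategory M] [SymmetricCategory M] (P : NsModule M)
  (α : P.ContractionFamily) {Γ Δ : Graph} (k : Γ ⟶ Δ) {S T U V : MultCyc} {g h m : ℕ}

/-- The morphism to `P(Γ)` for a graph with three vertices. -/
noncomputable def in₃ (Γ : Graph) (v₁ v₂ v₃ : Γ.Vert) (hp : [v₁, v₂, v₃].Perm (ordering Γ.Vert))
    (ρ₁ : S ⟶ Γ.legAt v₁) (ρ₂ : T ⟶ Γ.legAt v₂) (ρ₃ : U ⟶ Γ.legAt v₃) (e₁ : g = Γ.genus v₁)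
    (e₂ : h = Γ.genus v₂) (e₃ : m = Γ.genus v₃) :
    P.ob S g ⊗ P.ob T h ⊗ P.ob U m ⟶ P.onGraph Γ :=
  (P.mp ρ₁ e₁ ⊗ₘ (P.mp ρ₂ e₂ ⊗ₘ P.mp ρ₃ e₃)) ≫ triple (P.factor Γ) v₁ v₂ v₃ hp

instance (Γ : Graph) (v₁ v₂ v₃ : Γ.Vert) (hp : [v₁, v₂, v₃].Perm (ordering Γ.Vert))
    (ρ₁ : S ⟶ Γ.legAt v₁) (ρ₂ : T ⟶ Γ.legAt v₂) (ρ₃ : U ⟶ Γ.legAt v₃) (e₁ : g = Γ.genus v₁)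
    (e₂ : h = Γ.genus v₂) (e₃ : m = Γ.genus v₃) :
    IsIso (P.in₃ Γ v₁ v₂ v₃ hp ρ₁ ρ₂ ρ₃ e₁ e₂ e₃) := by
  have h1 : IsIso (triple (P.factor Γ) v₁ v₂ v₃ hp) := inferInstance
  exact @IsIso.comp_isIso _ _ _ _ _ (P.mp ρ₁ e₁ ⊗ₘ (P.mp ρ₂ e₂ ⊗ₘ P.mp ρ₃ e₃))
    (triple (P.factor Γ) v₁ v₂ v₃ hp)
    (inferInstanceAs (IsIso (P.mp ρ₁ e₁ ⊗ₘ (P.mp ρ₂ e₂ ⊗ₘ P.mp ρ₃ e₃)))) h1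

variable {P}

theorem single_onFiber {v : Γ.Vert} {y : Δ.Vert} (hv : k.vert v = y)
    (hu : ∀ w : {w // k.vert w = y}, w = ⟨v, hv⟩) (ρ : S ⟶ Γ.legAt v) (e : g = Γ.genus v) :
    P.mp ρ e ≫ single (fun i : {i // k.vert i = y} => P.factor Γ i.1) ⟨v, hv⟩ (perm_single hu) ≫
      P.onFiber α k y =
    P.in₁ (LGraph.fiber k y).gr ⟨v, hv⟩ hu (ρ ≫ fiberLeg k y ⟨v, hv⟩) e ≫
      α _ _ (LGraph.fiber k y) := by
  have h1 := single_uMap (X := fun i : {i // k.vert i = y} => P.factor Γ i.1)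
    (Y := P.factor (LGraph.fiber k y).gr) (Equiv.refl _) (fun w => P.mp (fiberLeg k y w) rfl)
    ⟨v, hv⟩ (perm_single hu) (perm_single hu)
  refine (congrArg (fun z => P.mp ρ e ≫ z) ((Category.assoc _ _ _).symm.trans
    (congrArg (fun z => z ≫ α _ _ (LGraph.fiber k y)) h1))).trans ?_
  refine (congrArg (fun z => P.mp ρ e ≫ z) (Category.assoc _ _ _)).trans ?_
  refine (Category.assoc _ _ _).symm.trans ?_
  refine (congrArg (fun z => z ≫ _) (P.mp_comp _ _ _ _)).trans ?_
  exact (Category.assoc _ _ _).symm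

theorem pair_onFiber {v w : Γ.Vert} {y : Δ.Vert} (hv : k.vert v = y) (hw : k.vert w = y)
    (hp : [⟨v, hv⟩, ⟨w, hw⟩].Perm (ordering {w // k.vert w = y})) (ρ : S ⟶ Γ.legAt v)
    (σ : T ⟶ Γ.legAt w) (e : g = Γ.genus v) (e' : h = Γ.genus w) :
    (P.mp ρ e ⊗ₘ P.mp σ e') ≫ pair (fun i : {i // k.vert i = y} => P.factor Γ i.1) ⟨v, hv⟩
      ⟨w, hw⟩ hp ≫ P.onFiber α k y =
    P.in₂ (LGraph.fiber k y).gr ⟨v, hv⟩ ⟨w, hw⟩ hp (ρ ≫ fiberLeg k y ⟨v, hv⟩)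
      (σ ≫ fiberLeg k y ⟨w, hw⟩) e e' ≫ α _ _ (LGraph.fiber k y) := by
  have h1 := pair_uMap (X := fun i : {i // k.vert i = y} => P.factor Γ i.1)
    (Y := P.factor (LGraph.fiber k y).gr) (Equiv.refl _) (fun w => P.mp (fiberLeg k y w) rfl)
    ⟨v, hv⟩ ⟨w, hw⟩ hp hp
  refine (congrArg (fun z => (P.mp ρ e ⊗ₘ P.mp σ e') ≫ z) ((Category.assoc _ _ _).symm.trans
    (congrArg (fun z => z ≫ α _ _ (LGraph.fiber k y)) h1))).trans ?_
  refine (congrArg (fun z => (P.mp ρ e ⊗ₘ P.mp σ e') ≫ z) (Category.assoc _ _ _)).trans ?_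
  refine (Category.assoc _ _ _).symm.trans ?_
  refine (congrArg (fun z => z ≫ _) (MonoidalCategory.tensorHom_comp_tensorHom _ _ _ _)).trans ?_
  refine (congrArg (fun z => z ≫ _) (congrArg₂ (fun k k' => k ⊗ₘ k') (P.mp_comp _ _ _ _)
    (P.mp_comp _ _ _ _))).trans ?_
  exact (Category.assoc _ _ _).symm

variable {α k}

theorem in₁_vertexwise {v : Γ.Vert} (hv : ∀ w, w = v) (ρ : S ⟶ Γ.legAt v) (e : g = Γ.genus v)
    {y : Δ.Vert} (hy : ∀ z, z = y) (hvy : k.vert v = y)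
    (hu : ∀ w : {w // k.vert w = y}, w = ⟨v, hvy⟩)
    {n : P.ob S g ⟶ P.ob V m} {φ : V ⟶ Δ.legAt y} {e' : m = Δ.genus y}
    (H : P.in₁ (LGraph.fiber k y).gr ⟨v, hvy⟩ hu (ρ ≫ fiberLeg k y ⟨v, hvy⟩) e ≫
      α _ _ (LGraph.fiber k y) = n ≫ P.mp φ e') :
    P.in₁ Γ v hv ρ e ≫ P.vertexwise α k = n ≫ P.in₁ Δ y hy φ e' := by
  rw [vertexwise_eq]
  have h1 := single_uFib (X := P.factor Γ) (Y := P.factor Δ) k.vert (P.onFiber α k) v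
    (perm_single hv) y (perm_single hy) hvy (perm_single hu)
  refine (Category.assoc _ _ _).trans ((congrArg (fun z => P.mp ρ e ≫ z) h1).trans ?_)
  refine Eq.trans (congrArg (fun z => P.mp ρ e ≫ z) (Category.assoc _ _ _).symm) ?_
  refine (Category.assoc _ _ _).symm.trans ?_
  refine (congrArg (fun z => z ≫ _) ((single_onFiber α k hvy hu ρ e).trans H)).trans ?_
  exact Category.assoc _ _ _

theorem in₂_vertexwise_one {v w : Γ.Vert} (hp : [v, w].Perm (ordering Γ.Vert))
    (ρ : S ⟶ Γ.legAt v) (σ : T ⟶ Γ.legAt w) (e : g = Γ.genus v) (e' : h = Γ.genus w)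
    {y : Δ.Vert} (hy : ∀ z, z = y) (hv : k.vert v = y) (hw : k.vert w = y)
    (hp' : [⟨v, hv⟩, ⟨w, hw⟩].Perm (ordering {w // k.vert w = y}))
    {n : P.ob S g ⊗ P.ob T h ⟶ P.ob V m} {φ : V ⟶ Δ.legAt y} {e'' : m = Δ.genus y}
    (H : P.in₂ (LGraph.fiber k y).gr ⟨v, hv⟩ ⟨w, hw⟩ hp' (ρ ≫ fiberLeg k y ⟨v, hv⟩)
      (σ ≫ fiberLeg k y ⟨w, hw⟩) e e' ≫ α _ _ (LGraph.fiber k y) = n ≫ P.mp φ e'') :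
    P.in₂ Γ v w hp ρ σ e e' ≫ P.vertexwise α k = n ≫ P.in₁ Δ y hy φ e'' := by
  rw [vertexwise_eq]
  have h1 := pair_uFib_one (X := P.factor Γ) (Y := P.factor Δ) k.vert (P.onFiber α k) v w
    hp y (perm_single hy) hv hw hp'
  refine (Category.assoc _ _ _).trans ((congrArg (fun z => (P.mp ρ e ⊗ₘ P.mp σ e') ≫ z) h1).trans ?_)
  refine Eq.trans (congrArg (fun z => (P.mp ρ e ⊗ₘ P.mp σ e') ≫ z) (Category.assoc _ _ _).symm) ?_
  refine (Category.assoc _ _ _).symm.trans ?_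
  refine (congrArg (fun z => z ≫ _) ((pair_onFiber α k hv hw hp' ρ σ e e').trans H)).trans ?_
  exact Category.assoc _ _ _

theorem in₂_vertexwise_two {v w : Γ.Vert} (hp : [v, w].Perm (ordering Γ.Vert))
    (ρ : S ⟶ Γ.legAt v) (σ : T ⟶ Γ.legAt w) (e : g = Γ.genus v) (e' : h = Γ.genus w)
    {y z : Δ.Vert} (hyz : [y, z].Perm (ordering Δ.Vert)) (hv : k.vert v = y) (hw : k.vert w = z)
    (hu : ∀ w : {w // k.vert w = y}, w = ⟨v, hv⟩) (hu' : ∀ w' : {w // k.vert w = z}, w' = ⟨w, hw⟩)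
    {m' : ℕ} {n : P.ob S g ⟶ P.ob U m} {n' : P.ob T h ⟶ P.ob V m'} {φ : U ⟶ Δ.legAt y}
    {ψ : V ⟶ Δ.legAt z} {e₁ : m = Δ.genus y} {e₂ : m' = Δ.genus z}
    (H : P.in₁ (LGraph.fiber k y).gr ⟨v, hv⟩ hu (ρ ≫ fiberLeg k y ⟨v, hv⟩) e ≫
      α _ _ (LGraph.fiber k y) = n ≫ P.mp φ e₁)
    (H' : P.in₁ (LGraph.fiber k z).gr ⟨w, hw⟩ hu' (σ ≫ fiberLeg k z ⟨w, hw⟩) e' ≫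
      α _ _ (LGraph.fiber k z) = n' ≫ P.mp ψ e₂) :
    P.in₂ Γ v w hp ρ σ e e' ≫ P.vertexwise α k = (n ⊗ₘ n') ≫ P.in₂ Δ y z hyz φ ψ e₁ e₂ := by
  rw [vertexwise_eq]
  have h1 := pair_uFib_two (X := P.factor Γ) (Y := P.factor Δ) k.vert (P.onFiber α k) v w
    hp y z (Graph.ne_of_perm hyz) hyz hv hw (perm_single hu) (perm_single hu')
  refine (Category.assoc _ _ _).trans ((congrArg (fun z => (P.mp ρ e ⊗ₘ P.mp σ e') ≫ z) h1).trans ?_)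
  refine (Category.assoc _ _ _).symm.trans ?_
  refine (congrArg (fun z => z ≫ _) (MonoidalCategory.tensorHom_comp_tensorHom _ _ _ _)).trans ?_
  refine (congrArg (fun z => z ≫ _) (congrArg₂ (fun k k' => k ⊗ₘ k')
    ((single_onFiber α k hv hu ρ e).trans H) ((single_onFiber α k hw hu' σ e').trans H'))).trans ?_
  refine (congrArg (fun z => z ≫ _)
    (MonoidalCategory.tensorHom_comp_tensorHom _ _ _ _).symm).trans ?_
  exact Category.assoc _ _ _

theorem in₃_vertexwise_right {v₁ v₂ v₃ : Γ.Vert} (hp : [v₁, v₂, v₃].Perm (ordering Γ.Vert))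
    (ρ₁ : S ⟶ Γ.legAt v₁) (ρ₂ : T ⟶ Γ.legAt v₂) (ρ₃ : U ⟶ Γ.legAt v₃) (e₁ : g = Γ.genus v₁)
    (e₂ : h = Γ.genus v₂) (e₃ : m = Γ.genus v₃)
    {y z : Δ.Vert} (hyz : [y, z].Perm (ordering Δ.Vert)) (h₁ : k.vert v₁ = y) (h₂ : k.vert v₂ = z)
    (h₃ : k.vert v₃ = z)
    (hu : ∀ w : {w // k.vert w = y}, w = ⟨v₁, h₁⟩)
    (hu' : [⟨v₂, h₂⟩, ⟨v₃, h₃⟩].Perm (ordering {w // k.vert w = z}))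
    {l l' : ℕ} {V' : MultCyc} {n : P.ob S g ⟶ P.ob V l} {n' : P.ob T h ⊗ P.ob U m ⟶ P.ob V' l'}
    {φ : V ⟶ Δ.legAt y} {ψ : V' ⟶ Δ.legAt z} {e : l = Δ.genus y} {e' : l' = Δ.genus z}
    (H : P.in₁ (LGraph.fiber k y).gr ⟨v₁, h₁⟩ hu (ρ₁ ≫ fiberLeg k y ⟨v₁, h₁⟩) e₁ ≫
      α _ _ (LGraph.fiber k y) = n ≫ P.mp φ e)
    (H' : P.in₂ (LGraph.fiber k z).gr ⟨v₂, h₂⟩ ⟨v₃, h₃⟩ hu' (ρ₂ ≫ fiberLeg k z ⟨v₂, h₂⟩)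
      (ρ₃ ≫ fiberLeg k z ⟨v₃, h₃⟩) e₂ e₃ ≫ α _ _ (LGraph.fiber k z) = n' ≫ P.mp ψ e') :
    P.in₃ Γ v₁ v₂ v₃ hp ρ₁ ρ₂ ρ₃ e₁ e₂ e₃ ≫ P.vertexwise α k =
      (n ⊗ₘ n') ≫ P.in₂ Δ y z hyz φ ψ e e' := by
  rw [vertexwise_eq]
  have h1 := triple_uFib_right (X := P.factor Γ) (Y := P.factor Δ) k.vert (P.onFiber α k) v₁ v₂ v₃
    hp y z (Graph.ne_of_perm hyz) hyz h₁ h₂ h₃ (perm_single hu) hu'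
  refine (Category.assoc _ _ _).trans ((congrArg (fun z =>
    (P.mp ρ₁ e₁ ⊗ₘ (P.mp ρ₂ e₂ ⊗ₘ P.mp ρ₃ e₃)) ≫ z) h1).trans ?_)
  refine (Category.assoc _ _ _).symm.trans ?_
  refine (congrArg (fun z => z ≫ _) (MonoidalCategory.tensorHom_comp_tensorHom _ _ _ _)).trans ?_
  refine (congrArg (fun z => z ≫ _) (congrArg₂ (fun k k' => k ⊗ₘ k')
    ((single_onFiber α k h₁ hu ρ₁ e₁).trans H)
    ((pair_onFiber α k h₂ h₃ hu' ρ₂ ρ₃ e₂ e₃).trans H'))).trans ?_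
  refine (congrArg (fun z => z ≫ _)
    (MonoidalCategory.tensorHom_comp_tensorHom _ _ _ _).symm).trans ?_
  exact Category.assoc _ _ _

theorem in₃_vertexwise_left {v₁ v₂ v₃ : Γ.Vert} (hp : [v₁, v₂, v₃].Perm (ordering Γ.Vert))
    (ρ₁ : S ⟶ Γ.legAt v₁) (ρ₂ : T ⟶ Γ.legAt v₂) (ρ₃ : U ⟶ Γ.legAt v₃) (e₁ : g = Γ.genus v₁)
    (e₂ : h = Γ.genus v₂) (e₃ : m = Γ.genus v₃)
    {y z : Δ.Vert} (hyz : [y, z].Perm (ordering Δ.Vert)) (h₁ : k.vert v₁ = y) (h₂ : k.vert v₂ = y)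
    (h₃ : k.vert v₃ = z)
    (hu : [⟨v₁, h₁⟩, ⟨v₂, h₂⟩].Perm (ordering {w // k.vert w = y}))
    (hu' : ∀ w : {w // k.vert w = z}, w = ⟨v₃, h₃⟩)
    {l l' : ℕ} {V' : MultCyc} {n : P.ob S g ⊗ P.ob T h ⟶ P.ob V l} {n' : P.ob U m ⟶ P.ob V' l'}
    {φ : V ⟶ Δ.legAt y} {ψ : V' ⟶ Δ.legAt z} {e : l = Δ.genus y} {e' : l' = Δ.genus z}
    (H : P.in₂ (LGraph.fiber k y).gr ⟨v₁, h₁⟩ ⟨v₂, h₂⟩ hu (ρ₁ ≫ fiberLeg k y ⟨v₁, h₁⟩)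
      (ρ₂ ≫ fiberLeg k y ⟨v₂, h₂⟩) e₁ e₂ ≫ α _ _ (LGraph.fiber k y) = n ≫ P.mp φ e)
    (H' : P.in₁ (LGraph.fiber k z).gr ⟨v₃, h₃⟩ hu' (ρ₃ ≫ fiberLeg k z ⟨v₃, h₃⟩) e₃ ≫
      α _ _ (LGraph.fiber k z) = n' ≫ P.mp ψ e') :
    P.in₃ Γ v₁ v₂ v₃ hp ρ₁ ρ₂ ρ₃ e₁ e₂ e₃ ≫ P.vertexwise α k =
      (α_ _ _ _).inv ≫ (n ⊗ₘ n') ≫ P.in₂ Δ y z hyz φ ψ e e' := by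
  rw [vertexwise_eq]
  have h1 := triple_uFib_left (X := P.factor Γ) (Y := P.factor Δ) k.vert (P.onFiber α k) v₁ v₂ v₃
    hp y z (Graph.ne_of_perm hyz) hyz h₁ h₂ h₃ hu (perm_single hu')
  refine (Category.assoc _ _ _).trans ((congrArg (fun z =>
    (P.mp ρ₁ e₁ ⊗ₘ (P.mp ρ₂ e₂ ⊗ₘ P.mp ρ₃ e₃)) ≫ z) h1).trans ?_)
  refine (Category.assoc _ _ _).symm.trans ?_
  refine (congrArg (fun z => z ≫ _)
    (associator_inv_naturality (P.mp ρ₁ e₁) (P.mp ρ₂ e₂) (P.mp ρ₃ e₃))).trans ?_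
  refine (Category.assoc _ _ _).trans (congrArg (fun z => (α_ _ _ _).inv ≫ z) ?_)
  refine (Category.assoc _ _ _).symm.trans ?_
  refine (congrArg (fun z => z ≫ _) (MonoidalCategory.tensorHom_comp_tensorHom _ _ _ _)).trans ?_
  refine (congrArg (fun z => z ≫ _) (congrArg₂ (fun k k' => k ⊗ₘ k')
    ((pair_onFiber α k h₁ h₂ hu ρ₁ ρ₂ e₁ e₂).trans H)
    ((single_onFiber α k h₃ hu' ρ₃ e₃).trans H'))).trans ?_
  refine (congrArg (fun z => z ≫ _)
    (MonoidalCategory.tensorHom_comp_tensorHom _ _ _ _).symm).trans ?_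
  exact Category.assoc _ _ _

end NsModule

namespace NsModule

variable {M : Type u} [Category.{v} M] [MonoidalCategory M] [SymmetricCategory M] {P : NsModule M}
  {α : P.ContractionFamily} {R : Ops P}

section Three

variable {S₁ S₂ S₃ W : MultCyc} {g₁ g₂ g₃ m : ℕ} {Z Y : LGraph W m} {k : Z ⟶ Y}
  {v₁ v₂ v₃ : Z.gr.Vert} (hp : [v₁, v₂, v₃].Perm (ordering Z.gr.Vert))
  (ρ₁ : S₁ ⟶ Z.gr.legAt v₁) (ρ₂ : S₂ ⟶ Z.gr.legAt v₂) (ρ₃ : S₃ ⟶ Z.gr.legAt v₃)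
  (e₁ : g₁ = Z.gr.genus v₁) (e₂ : g₂ = Z.gr.genus v₂) (e₃ : g₃ = Z.gr.genus v₃)
  {a : S₁.pt} {b c : S₂.pt} {d : S₃.pt} (hbc : b ≠ c)

/-- Contracting first the edge `{c, d}`. -/
theorem Evaluates.comp_comp_right (hE : Evaluates R α)
    (hZ : Z.gr.TwoEdges (ρ₁.pt a).1 (ρ₂.pt b).1 (ρ₂.pt c).1 (ρ₃.pt d).1)
    (hk : Graph.Hom.Contracts k.hom (ρ₂.pt c).1 (ρ₃.pt d).1) :
    ∃ (φ : merge S₁ (merge S₂ S₃ c d) a (mergeLeft b hbc) ⟶ W) (e : g₁ + (g₂ + g₃) = m),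
      (∀ x, arcMap φ (mergeArcLeft _ _ x) = Z.gl.arc (Z.gr.incl v₁ (arcMap ρ₁ x))) ∧
      (∀ x, arcMap φ (mergeArcRight _ _ (mergeArcLeft c d x)) =
        Z.gl.arc (Z.gr.incl v₂ (arcMap ρ₂ x))) ∧
      (∀ x, arcMap φ (mergeArcRight _ _ (mergeArcRight c d x)) =
        Z.gl.arc (Z.gr.incl v₃ (arcMap ρ₃ x))) ∧
      P.in₃ Z.gr v₁ v₂ v₃ hp ρ₁ ρ₂ ρ₃ e₁ e₂ e₃ ≫ P.vertexwise α k.hom ≫ α W m Y =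
        (P.ob S₁ g₁ ◁ R.comp c d g₂ g₃) ≫ R.comp a (mergeLeft b hbc) g₁ (g₂ + g₃) ≫ P.mp φ e := by
  have hn := hp.nodup_iff.2 (nodup_ordering _)
  simp only [List.nodup_cons, List.mem_cons, List.not_mem_nil, or_false, not_or,
    List.nodup_nil, and_true, not_false_eq_true] at hn
  obtain ⟨⟨h12, h13⟩, h23⟩ := hn
  have hm : ∀ x, x = v₁ ∨ x = v₂ ∨ x = v₃ := fun x => by simpa using hp.mem_iff.2 (mem_ordering x)
  have hc1 : Z.gr.ptV (ρ₂.pt c).1 = v₂ := (ρ₂.pt c).2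
  have hd1 : Z.gr.ptV (ρ₃.pt d).1 = v₃ := (ρ₃.pt d).2
  have h32 : k.hom.vert v₃ = k.hom.vert v₂ := by
    have := hk.vert_eq hZ
    rw [hc1, hd1] at this
    exact this.symm
  have hne : k.hom.vert v₁ ≠ k.hom.vert v₂ := hk.vert_ne hZ (Ne.symm h12)
    (by rw [hc1, hd1]; exact iff_of_false (Ne.symm h12) (Ne.symm h13))
  have hyz : [k.hom.vert v₁, k.hom.vert v₂].Perm (ordering Y.gr.Vert) := perm_pair hne fun y => by
    obtain ⟨w, rfl⟩ := k.hom.vert_surjective y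
    rcases hm w with rfl | rfl | rfl
    exacts [Or.inl rfl, Or.inr rfl, Or.inr h32]
  have hu : ∀ w : {w // k.hom.vert w = k.hom.vert v₁}, w = ⟨v₁, rfl⟩ := by
    rintro ⟨w, hw⟩
    rcases hm w with rfl | rfl | rfl
    exacts [rfl, (hne hw.symm).elim, (hne (h32 ▸ hw.symm)).elim]
  have hu' : [⟨v₂, rfl⟩, ⟨v₃, h32⟩].Perm (ordering {w // k.hom.vert w = k.hom.vert v₂}) :=
    perm_pair (fun e => h23 (congrArg Subtype.val e)) (by
      rintro ⟨w, hw⟩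
      rcases hm w with rfl | rfl | rfl
      exacts [(hne hw).elim, Or.inl rfl, Or.inr rfl])
  obtain ⟨φ₁, e₁', hφ₁, H₁⟩ := hE.star (LGraph.fiber k.hom (k.hom.vert v₁))
    (hk.numEdges_fiber hZ (by rw [hc1]; exact hne.symm)) ⟨v₁, rfl⟩ hu
    (ρ₁ ≫ fiberLeg k.hom _ ⟨v₁, rfl⟩) e₁
  obtain ⟨φ₂, e₂', hφ₂, hφ₃, H₂⟩ := hE.edge (LGraph.fiber k.hom (k.hom.vert v₂)) ⟨v₂, rfl⟩
    ⟨v₃, h32⟩ hu' (ρ₂ ≫ fiberLeg k.hom _ ⟨v₂, rfl⟩) (ρ₃ ≫ fiberLeg k.hom _ ⟨v₃, h32⟩) e₂ e₃ c d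
    (hk.fiber_onlyEdge hZ _ _)
  have A₁ : ∀ x, Y.gr.incl _ (arcMap φ₁ x) = k.hom.gl.arc (Z.gr.incl v₁ (arcMap ρ₁ x)) :=
    fun x => (congrArg _ (hφ₁ x)).trans (Graph.fiber_arc k.hom rfl ρ₁ x)
  have A₂ : ∀ x, Y.gr.incl _ (arcMap φ₂ (mergeArcLeft c d x)) =
      k.hom.gl.arc (Z.gr.incl v₂ (arcMap ρ₂ x)) :=
    fun x => (congrArg _ (hφ₂ x)).trans (Graph.fiber_arc k.hom rfl ρ₂ x)
  have A₃ : ∀ x, Y.gr.incl _ (arcMap φ₂ (mergeArcRight c d x)) =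
      k.hom.gl.arc (Z.gr.incl v₃ (arcMap ρ₃ x)) :=
    fun x => (congrArg _ (hφ₃ x)).trans (Graph.fiber_arc k.hom h32 ρ₃ x)
  have B := A₂ (Sum.inl b)
  rw [mergeArcLeft_inl hbc] at B
  obtain ⟨φ, e, h1, h2, H⟩ := hE.edge Y _ _ hyz φ₁ φ₂ e₁' e₂' a (mergeLeft b hbc)
    (hZ.onlyEdge hk (Graph.eq_emb_of_incl_eq (hZ.mem_a hk) (A₁ (Sum.inl a)))
      (Graph.eq_emb_of_incl_eq (hZ.mem_b hk) B))
  refine ⟨φ, e, fun x => ?_, fun x => ?_, fun x => ?_, ?_⟩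
  · rw [h1, A₁, k.label]
  · rw [h2, A₂, k.label]
  · rw [h2, A₃, k.label]
  · have := in₃_vertexwise_right (α := α) (k := k.hom) hp ρ₁ ρ₂ ρ₃ e₁ e₂ e₃ hyz rfl rfl h32 hu hu'
      (H₁.trans (Category.id_comp _).symm) H₂
    rw [← Category.assoc, this, Category.assoc, H, id_tensorHom]

/-- Contracting first the edge `{a, b}`. -/
theorem Evaluates.comp_comp_left (hE : Evaluates R α)
    (hZ : Z.gr.TwoEdges (ρ₁.pt a).1 (ρ₂.pt b).1 (ρ₂.pt c).1 (ρ₃.pt d).1)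
    (hk : Graph.Hom.Contracts k.hom (ρ₁.pt a).1 (ρ₂.pt b).1) :
    ∃ (φ : merge (merge S₁ S₂ a b) S₃ (mergeRight c hbc.symm) d ⟶ W) (e : g₁ + g₂ + g₃ = m),
      (∀ x, arcMap φ (mergeArcLeft _ _ (mergeArcLeft a b x)) =
        Z.gl.arc (Z.gr.incl v₁ (arcMap ρ₁ x))) ∧
      (∀ x, arcMap φ (mergeArcLeft _ _ (mergeArcRight a b x)) =
        Z.gl.arc (Z.gr.incl v₂ (arcMap ρ₂ x))) ∧
      (∀ x, arcMap φ (mergeArcRight _ _ x) = Z.gl.arc (Z.gr.incl v₃ (arcMap ρ₃ x))) ∧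
      P.in₃ Z.gr v₁ v₂ v₃ hp ρ₁ ρ₂ ρ₃ e₁ e₂ e₃ ≫ P.vertexwise α k.hom ≫ α W m Y =
        (α_ _ _ _).inv ≫ (R.comp a b g₁ g₂ ▷ P.ob S₃ g₃) ≫
          R.comp (mergeRight c hbc.symm) d (g₁ + g₂) g₃ ≫ P.mp φ e := by
  have hn := hp.nodup_iff.2 (nodup_ordering _)
  simp only [List.nodup_cons, List.mem_cons, List.not_mem_nil, or_false, not_or,
    List.nodup_nil, and_true, not_false_eq_true] at hn
  obtain ⟨⟨h12, h13⟩, h23⟩ := hn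
  have hm : ∀ x, x = v₁ ∨ x = v₂ ∨ x = v₃ := fun x => by simpa using hp.mem_iff.2 (mem_ordering x)
  have ha1 : Z.gr.ptV (ρ₁.pt a).1 = v₁ := (ρ₁.pt a).2
  have hb1 : Z.gr.ptV (ρ₂.pt b).1 = v₂ := (ρ₂.pt b).2
  have h21 : k.hom.vert v₂ = k.hom.vert v₁ := by
    have := hk.vert_eq hZ.swap
    rw [ha1, hb1] at this
    exact this.symm
  have hne : k.hom.vert v₃ ≠ k.hom.vert v₁ := hk.vert_ne hZ.swap h13
    (by rw [ha1, hb1]; exact iff_of_false h13 h23)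
  have hyz : [k.hom.vert v₁, k.hom.vert v₃].Perm (ordering Y.gr.Vert) :=
    perm_pair hne.symm fun y => by
      obtain ⟨w, rfl⟩ := k.hom.vert_surjective y
      rcases hm w with rfl | rfl | rfl
      exacts [Or.inl rfl, Or.inl h21, Or.inr rfl]
  have hu' : ∀ w : {w // k.hom.vert w = k.hom.vert v₃}, w = ⟨v₃, rfl⟩ := by
    rintro ⟨w, hw⟩
    rcases hm w with rfl | rfl | rfl
    exacts [(hne hw.symm).elim, (hne (h21 ▸ hw.symm)).elim, rfl]
  have hu : [⟨v₁, rfl⟩, ⟨v₂, h21⟩].Perm (ordering {w // k.hom.vert w = k.hom.vert v₁}) :=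
    perm_pair (fun e => h12 (congrArg Subtype.val e)) (by
      rintro ⟨w, hw⟩
      rcases hm w with rfl | rfl | rfl
      exacts [Or.inl rfl, Or.inr rfl, (hne hw).elim])
  obtain ⟨φ₂, e₂', hφ₂, H₂⟩ := hE.star (LGraph.fiber k.hom (k.hom.vert v₃))
    (hk.numEdges_fiber hZ.swap (by rw [ha1]; exact hne.symm)) ⟨v₃, rfl⟩ hu'
    (ρ₃ ≫ fiberLeg k.hom _ ⟨v₃, rfl⟩) e₃
  obtain ⟨φ₁, e₁', hφ₁, hφ₁', H₁⟩ := hE.edge (LGraph.fiber k.hom (k.hom.vert v₁)) ⟨v₁, rfl⟩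
    ⟨v₂, h21⟩ hu (ρ₁ ≫ fiberLeg k.hom _ ⟨v₁, rfl⟩) (ρ₂ ≫ fiberLeg k.hom _ ⟨v₂, h21⟩) e₁ e₂ a b
    (hk.fiber_onlyEdge hZ.swap _ _)
  have A₁ : ∀ x, Y.gr.incl _ (arcMap φ₁ (mergeArcLeft a b x)) =
      k.hom.gl.arc (Z.gr.incl v₁ (arcMap ρ₁ x)) :=
    fun x => (congrArg _ (hφ₁ x)).trans (Graph.fiber_arc k.hom rfl ρ₁ x)
  have A₂ : ∀ x, Y.gr.incl _ (arcMap φ₁ (mergeArcRight a b x)) =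
      k.hom.gl.arc (Z.gr.incl v₂ (arcMap ρ₂ x)) :=
    fun x => (congrArg _ (hφ₁' x)).trans (Graph.fiber_arc k.hom h21 ρ₂ x)
  have A₃ : ∀ x, Y.gr.incl _ (arcMap φ₂ x) = k.hom.gl.arc (Z.gr.incl v₃ (arcMap ρ₃ x)) :=
    fun x => (congrArg _ (hφ₂ x)).trans (Graph.fiber_arc k.hom rfl ρ₃ x)
  have B := A₂ (Sum.inl c)
  rw [mergeArcRight_inl hbc.symm] at B
  obtain ⟨φ, e, h1, h2, H⟩ := hE.edge Y _ _ hyz φ₁ φ₂ e₁' e₂' (mergeRight c hbc.symm) d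
    (hZ.swap.onlyEdge hk (Graph.eq_emb_of_incl_eq (hZ.swap.mem_a hk) B)
      (Graph.eq_emb_of_incl_eq (hZ.swap.mem_b hk) (A₃ (Sum.inl d))))
  refine ⟨φ, e, fun x => ?_, fun x => ?_, fun x => ?_, ?_⟩
  · rw [h1, A₁, k.label]
  · rw [h1, A₂, k.label]
  · rw [h2, A₃, k.label]
  · have := in₃_vertexwise_left (α := α) (k := k.hom) hp ρ₁ ρ₂ ρ₃ e₁ e₂ e₃ hyz rfl h21 rfl hu hu'
      H₁ (H₂.trans (Category.id_comp _).symm)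
    rw [← Category.assoc, this, Category.assoc, Category.assoc, H, tensorHom_id]

end Three

/-- Contracting first the edge `{c, d}` of a graph with one vertex. -/
theorem Evaluates.contr_contr {S W : MultCyc} {g m : ℕ} {Z Y : LGraph W m} {k : Z ⟶ Y}
    {v : Z.gr.Vert} (hv : ∀ w, w = v) (ρ : S ⟶ Z.gr.legAt v) (e₁ : g = Z.gr.genus v)
    {a b c d : S.pt} (hab : a ≠ b) (hac : a ≠ c) (had : a ≠ d) (hbc : b ≠ c) (hbd : b ≠ d)
    (hcd : c ≠ d) (hE : Evaluates R α)
    (hZ : Z.gr.TwoEdges (ρ.pt a).1 (ρ.pt b).1 (ρ.pt c).1 (ρ.pt d).1)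
    (hk : Graph.Hom.Contracts k.hom (ρ.pt c).1 (ρ.pt d).1) :
    ∃ (φ : cut (cut S c d) (cutPt a hac had) (cutPt b hbc hbd) ⟶ W) (e : g + 1 + 1 = m),
      (∀ x, arcMap φ (cutArc _ _ (cutArc c d x)) = Z.gl.arc (Z.gr.incl v (arcMap ρ x))) ∧
      P.in₁ Z.gr v hv ρ e₁ ≫ P.vertexwise α k.hom ≫ α W m Y =
        R.contr c d hcd g ≫ R.contr _ _ (cutPt_ne hac had hbc hbd hab) (g + 1) ≫ P.mp φ e := by
  have hy : ∀ y, y = k.hom.vert v := fun y => by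
    obtain ⟨w, rfl⟩ := k.hom.vert_surjective y
    rw [hv w]
  have hu : ∀ w : {w // k.hom.vert w = k.hom.vert v}, w = ⟨v, rfl⟩ := fun w => Subtype.ext (hv _)
  obtain ⟨φ₁, e', hφ, H⟩ := hE.loop (LGraph.fiber k.hom (k.hom.vert v)) ⟨v, rfl⟩ hu
    (ρ ≫ fiberLeg k.hom _ ⟨v, rfl⟩) e₁ c d hcd
    (hk.fiber_onlyEdge hZ ((hy _)) ((hy _)))
  have A : ∀ x, Y.gr.incl _ (arcMap φ₁ (cutArc c d x)) =
      k.hom.gl.arc (Z.gr.incl v (arcMap ρ x)) :=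
    fun x => (congrArg _ (hφ x)).trans (Graph.fiber_arc k.hom rfl ρ x)
  have B := A (Sum.inl a)
  have B' := A (Sum.inl b)
  rw [cutArc_inl hac had] at B
  rw [cutArc_inl hbc hbd] at B'
  obtain ⟨φ, e, h1, H'⟩ := hE.loop Y _ hy φ₁ e' (cutPt a hac had) (cutPt b hbc hbd)
    (cutPt_ne hac had hbc hbd hab)
    (hZ.onlyEdge hk (Graph.eq_emb_of_incl_eq (hZ.mem_a hk) B)
      (Graph.eq_emb_of_incl_eq (hZ.mem_b hk) B'))
  refine ⟨φ, e, fun x => ?_, ?_⟩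
  · rw [h1, A, k.label]
  · have := in₁_vertexwise (α := α) (k := k.hom) hv ρ e₁ hy rfl hu H
    rw [← Category.assoc, this, Category.assoc, H']

section Two

variable {S T W : MultCyc} {g h m : ℕ} {Z Y : LGraph W m} {k : Z ⟶ Y}
  {v w : Z.gr.Vert} (hp : [v, w].Perm (ordering Z.gr.Vert))
  (ρ : S ⟶ Z.gr.legAt v) (σ : T ⟶ Z.gr.legAt w) (e₁ : g = Z.gr.genus v) (e₂ : h = Z.gr.genus w)

/-- Contracting first the edge `{c, d}` of a graph with two vertices joined by two edges. -/
theorem Evaluates.contr_comp {a c : S.pt} {b d : T.pt} (hac : a ≠ c) (hbd : b ≠ d)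
    (hE : Evaluates R α)
    (hZ : Z.gr.TwoEdges (ρ.pt a).1 (σ.pt b).1 (ρ.pt c).1 (σ.pt d).1)
    (hk : Graph.Hom.Contracts k.hom (ρ.pt c).1 (σ.pt d).1) :
    ∃ (φ : cut (merge S T c d) (mergeLeft a hac) (mergeRight b hbd) ⟶ W) (e : g + h + 1 = m),
      (∀ x, arcMap φ (cutArc _ _ (mergeArcLeft c d x)) = Z.gl.arc (Z.gr.incl v (arcMap ρ x))) ∧
      (∀ x, arcMap φ (cutArc _ _ (mergeArcRight c d x)) = Z.gl.arc (Z.gr.incl w (arcMap σ x))) ∧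
      P.in₂ Z.gr v w hp ρ σ e₁ e₂ ≫ P.vertexwise α k.hom ≫ α W m Y =
        R.comp c d g h ≫ R.contr _ _ (mergeLeft_ne_mergeRight hac hbd) (g + h) ≫ P.mp φ e := by
  have hm := Graph.eq_or_eq_of_perm hp
  have hc1 : Z.gr.ptV (ρ.pt c).1 = v := (ρ.pt c).2
  have hd1 : Z.gr.ptV (σ.pt d).1 = w := (σ.pt d).2
  have h21 : k.hom.vert w = k.hom.vert v := by
    have := hk.vert_eq hZ
    rw [hc1, hd1] at this
    exact this.symm
  have hy : ∀ y, y = k.hom.vert v := fun y => by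
    obtain ⟨x, rfl⟩ := k.hom.vert_surjective y
    rcases hm x with rfl | rfl
    exacts [rfl, h21]
  have hu : [⟨v, rfl⟩, ⟨w, h21⟩].Perm (ordering {w // k.hom.vert w = k.hom.vert v}) :=
    perm_pair (fun e => Graph.ne_of_perm hp (congrArg Subtype.val e)) (by
      rintro ⟨x, hx⟩
      rcases hm x with rfl | rfl
      exacts [Or.inl rfl, Or.inr rfl])
  obtain ⟨φ₁, e', hφ, hφ', H⟩ := hE.edge (LGraph.fiber k.hom (k.hom.vert v)) ⟨v, rfl⟩ ⟨w, h21⟩ hu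
    (ρ ≫ fiberLeg k.hom _ ⟨v, rfl⟩) (σ ≫ fiberLeg k.hom _ ⟨w, h21⟩) e₁ e₂ c d
    (hk.fiber_onlyEdge hZ ((hy _)) ((hy _)))
  have A : ∀ x, Y.gr.incl _ (arcMap φ₁ (mergeArcLeft c d x)) =
      k.hom.gl.arc (Z.gr.incl v (arcMap ρ x)) :=
    fun x => (congrArg _ (hφ x)).trans (Graph.fiber_arc k.hom rfl ρ x)
  have A' : ∀ x, Y.gr.incl _ (arcMap φ₁ (mergeArcRight c d x)) =
      k.hom.gl.arc (Z.gr.incl w (arcMap σ x)) :=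
    fun x => (congrArg _ (hφ' x)).trans (Graph.fiber_arc k.hom h21 σ x)
  have B := A (Sum.inl a)
  have B' := A' (Sum.inl b)
  rw [mergeArcLeft_inl hac] at B
  rw [mergeArcRight_inl hbd] at B'
  obtain ⟨φ, e, h1, H'⟩ := hE.loop Y _ hy φ₁ e' (mergeLeft a hac) (mergeRight b hbd)
    (mergeLeft_ne_mergeRight hac hbd)
    (hZ.onlyEdge hk (Graph.eq_emb_of_incl_eq (hZ.mem_a hk) B)
      (Graph.eq_emb_of_incl_eq (hZ.mem_b hk) B'))
  refine ⟨φ, e, fun x => ?_, fun x => ?_, ?_⟩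
  · rw [h1, A, k.label]
  · rw [h1, A', k.label]
  · have := in₂_vertexwise_one (α := α) (k := k.hom) hp ρ σ e₁ e₂ hy rfl h21 hu H
    rw [← Category.assoc, this, Category.assoc, H']

variable {a c d : S.pt} {b : T.pt} (hac : a ≠ c) (had : a ≠ d) (hcd : c ≠ d)

/-- Contracting first the loop `{c, d}` of a graph with two vertices. -/
theorem Evaluates.comp_contr (hE : Evaluates R α)
    (hZ : Z.gr.TwoEdges (ρ.pt a).1 (σ.pt b).1 (ρ.pt c).1 (ρ.pt d).1)
    (hk : Graph.Hom.Contracts k.hom (ρ.pt c).1 (ρ.pt d).1) :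
    ∃ (φ : merge (cut S c d) T (cutPt a hac had) b ⟶ W) (e : g + 1 + h = m),
      (∀ x, arcMap φ (mergeArcLeft _ _ (cutArc c d x)) = Z.gl.arc (Z.gr.incl v (arcMap ρ x))) ∧
      (∀ x, arcMap φ (mergeArcRight _ _ x) = Z.gl.arc (Z.gr.incl w (arcMap σ x))) ∧
      P.in₂ Z.gr v w hp ρ σ e₁ e₂ ≫ P.vertexwise α k.hom ≫ α W m Y =
        (R.contr c d hcd g ▷ P.ob T h) ≫ R.comp (cutPt a hac had) b (g + 1) h ≫ P.mp φ e := by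
  have hm := Graph.eq_or_eq_of_perm hp
  have hvw := Graph.ne_of_perm hp
  have hc1 : Z.gr.ptV (ρ.pt c).1 = v := (ρ.pt c).2
  have hd1 : Z.gr.ptV (ρ.pt d).1 = v := (ρ.pt d).2
  have hne : k.hom.vert w ≠ k.hom.vert v := hk.vert_ne hZ hvw
    (by rw [hc1, hd1])
  have hyz : [k.hom.vert v, k.hom.vert w].Perm (ordering Y.gr.Vert) :=
    perm_pair hne.symm fun y => by
      obtain ⟨x, rfl⟩ := k.hom.vert_surjective y
      rcases hm x with rfl | rfl
      exacts [Or.inl rfl, Or.inr rfl]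
  have hu : ∀ x : {x // k.hom.vert x = k.hom.vert v}, x = ⟨v, rfl⟩ := by
    rintro ⟨x, hx⟩
    rcases hm x with rfl | rfl
    exacts [rfl, (hne hx).elim]
  have hu' : ∀ x : {x // k.hom.vert x = k.hom.vert w}, x = ⟨w, rfl⟩ := by
    rintro ⟨x, hx⟩
    rcases hm x with rfl | rfl
    exacts [(hne hx.symm).elim, rfl]
  obtain ⟨φ₁, e₁', hφ₁, H₁⟩ := hE.loop (LGraph.fiber k.hom (k.hom.vert v)) ⟨v, rfl⟩ hu
    (ρ ≫ fiberLeg k.hom _ ⟨v, rfl⟩) e₁ c d hcd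
    (hk.fiber_onlyEdge hZ (congrArg _ hc1) (congrArg _ hd1))
  obtain ⟨φ₂, e₂', hφ₂, H₂⟩ := hE.star (LGraph.fiber k.hom (k.hom.vert w))
    (hk.numEdges_fiber hZ (by rw [hc1]; exact hne.symm)) ⟨w, rfl⟩ hu'
    (σ ≫ fiberLeg k.hom _ ⟨w, rfl⟩) e₂
  have A : ∀ x, Y.gr.incl _ (arcMap φ₁ (cutArc c d x)) =
      k.hom.gl.arc (Z.gr.incl v (arcMap ρ x)) :=
    fun x => (congrArg _ (hφ₁ x)).trans (Graph.fiber_arc k.hom rfl ρ x)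
  have A' : ∀ x, Y.gr.incl _ (arcMap φ₂ x) = k.hom.gl.arc (Z.gr.incl w (arcMap σ x)) :=
    fun x => (congrArg _ (hφ₂ x)).trans (Graph.fiber_arc k.hom rfl σ x)
  have B := A (Sum.inl a)
  rw [cutArc_inl hac had] at B
  obtain ⟨φ, e, h1, h2, H⟩ := hE.edge Y _ _ hyz φ₁ φ₂ e₁' e₂' (cutPt a hac had) b
    (hZ.onlyEdge hk (Graph.eq_emb_of_incl_eq (hZ.mem_a hk) B)
      (Graph.eq_emb_of_incl_eq (hZ.mem_b hk) (A' (Sum.inl b))))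
  refine ⟨φ, e, fun x => ?_, fun x => ?_, ?_⟩
  · rw [h1, A, k.label]
  · rw [h2, A', k.label]
  · have := in₂_vertexwise_two (α := α) (k := k.hom) hp ρ σ e₁ e₂ hyz rfl rfl hu hu' H₁
      (H₂.trans (Category.id_comp _).symm)
    rw [← Category.assoc, this, Category.assoc, H, tensorHom_id]

/-- Contracting first the edge `{a, b}` of a graph with two vertices and a loop `{c, d}`. -/
theorem Evaluates.contr_comp_loop (hE : Evaluates R α)
    (hZ : Z.gr.TwoEdges (ρ.pt a).1 (σ.pt b).1 (ρ.pt c).1 (ρ.pt d).1)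
    (hk : Graph.Hom.Contracts k.hom (ρ.pt a).1 (σ.pt b).1) :
    ∃ (φ : cut (merge S T a b) (mergeLeft c hac.symm) (mergeLeft d had.symm) ⟶ W)
      (e : g + h + 1 = m),
      (∀ x, arcMap φ (cutArc _ _ (mergeArcLeft a b x)) = Z.gl.arc (Z.gr.incl v (arcMap ρ x))) ∧
      (∀ x, arcMap φ (cutArc _ _ (mergeArcRight a b x)) = Z.gl.arc (Z.gr.incl w (arcMap σ x))) ∧
      P.in₂ Z.gr v w hp ρ σ e₁ e₂ ≫ P.vertexwise α k.hom ≫ α W m Y =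
        R.comp a b g h ≫ R.contr _ _ (mergeLeft_ne hac.symm had.symm hcd) (g + h) ≫ P.mp φ e := by
  have hm := Graph.eq_or_eq_of_perm hp
  have ha1 : Z.gr.ptV (ρ.pt a).1 = v := (ρ.pt a).2
  have hb1 : Z.gr.ptV (σ.pt b).1 = w := (σ.pt b).2
  have h21 : k.hom.vert w = k.hom.vert v := by
    have := hk.vert_eq hZ.swap
    rw [ha1, hb1] at this
    exact this.symm
  have hy : ∀ y, y = k.hom.vert v := fun y => by
    obtain ⟨x, rfl⟩ := k.hom.vert_surjective y
    rcases hm x with rfl | rfl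
    exacts [rfl, h21]
  have hu : [⟨v, rfl⟩, ⟨w, h21⟩].Perm (ordering {w // k.hom.vert w = k.hom.vert v}) :=
    perm_pair (fun e => Graph.ne_of_perm hp (congrArg Subtype.val e)) (by
      rintro ⟨x, hx⟩
      rcases hm x with rfl | rfl
      exacts [Or.inl rfl, Or.inr rfl])
  obtain ⟨φ₁, e', hφ, hφ', H⟩ := hE.edge (LGraph.fiber k.hom (k.hom.vert v)) ⟨v, rfl⟩ ⟨w, h21⟩ hu
    (ρ ≫ fiberLeg k.hom _ ⟨v, rfl⟩) (σ ≫ fiberLeg k.hom _ ⟨w, h21⟩) e₁ e₂ a b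
    (hk.fiber_onlyEdge hZ.swap ((hy _)) ((hy _)))
  have A : ∀ x, Y.gr.incl _ (arcMap φ₁ (mergeArcLeft a b x)) =
      k.hom.gl.arc (Z.gr.incl v (arcMap ρ x)) :=
    fun x => (congrArg _ (hφ x)).trans (Graph.fiber_arc k.hom rfl ρ x)
  have A' : ∀ x, Y.gr.incl _ (arcMap φ₁ (mergeArcRight a b x)) =
      k.hom.gl.arc (Z.gr.incl w (arcMap σ x)) :=
    fun x => (congrArg _ (hφ' x)).trans (Graph.fiber_arc k.hom h21 σ x)
  have B := A (Sum.inl c)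
  have B' := A (Sum.inl d)
  rw [mergeArcLeft_inl hac.symm] at B
  rw [mergeArcLeft_inl had.symm] at B'
  obtain ⟨φ, e, h1, H'⟩ := hE.loop Y _ hy φ₁ e' (mergeLeft c hac.symm) (mergeLeft d had.symm)
    (mergeLeft_ne hac.symm had.symm hcd)
    (hZ.swap.onlyEdge hk (Graph.eq_emb_of_incl_eq (hZ.swap.mem_a hk) B)
      (Graph.eq_emb_of_incl_eq (hZ.swap.mem_b hk) B'))
  refine ⟨φ, e, fun x => ?_, fun x => ?_, ?_⟩
  · rw [h1, A, k.label]
  · rw [h1, A', k.label]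
  · have := in₂_vertexwise_one (α := α) (k := k.hom) hp ρ σ e₁ e₂ hy rfl h21 hu H
    rw [← Category.assoc, this, Category.assoc, H']

end Two

end NsModule

namespace MultCyc

theorem arcMap_comp_inv {S T U : MultCyc} (φ : S ⟶ U) (ψ : T ⟶ U) {a : S.Arc} {b : T.Arc}
    (h : arcMap φ a = arcMap ψ b) : arcMap (φ ≫ inv ψ) a = b := by
  rw [arcMap_comp, h, ← arcMap_comp, comp_inv, arcMap_id]

end MultCyc

namespace Graph

variable {Γ : Graph}

theorem OnlyEdge.vert {x y : Γ.fl.pt} (h : Γ.OnlyEdge x y) (w : Γ.Vert) :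
    w = Γ.ptV x ∨ w = Γ.ptV y := by
  refine (eqvGen_iff (p := fun w => w = Γ.ptV x ∨ w = Γ.ptV y) (fun a b ⟨z, h1, h2⟩ => ?_)
    (Γ.conn (Γ.ptV x) w)).1 (Or.inl rfl)
  by_cases hz : Γ.inv z = z
  · rw [← h1, ← h2, hz]
  · rcases h.2.2 z hz with rfl | rfl
    · rw [← h1, ← h2, h.2.1]; simp
    · rw [← h1, ← h2, h.symm.2.1]; simp

theorem OnlyEdge.eq_vert {x y : Γ.fl.pt} (h : Γ.OnlyEdge x y) (hxy : Γ.ptV x = Γ.ptV y)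
    (w : Γ.Vert) : w = Γ.ptV x := (h.vert w).elim id fun e => e.trans hxy.symm

theorem OnlyEdge.perm {x y : Γ.fl.pt} (h : Γ.OnlyEdge x y) (hxy : Γ.ptV x ≠ Γ.ptV y) :
    [Γ.ptV x, Γ.ptV y].Perm (ordering Γ.Vert) := perm_pair hxy h.vert

theorem OnlyEdge.eq_or {x y x' y' : Γ.fl.pt} (h : Γ.OnlyEdge x y) (h' : Γ.OnlyEdge x' y') :
    x' = x ∧ y' = y ∨ x' = y ∧ y' = x := by
  rcases h.2.2 x' (by rw [h'.2.1]; exact h'.1.symm) with rfl | rfl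
  · exact Or.inl ⟨rfl, by rw [← h'.2.1, h.2.1]⟩
  · exact Or.inr ⟨rfl, by rw [← h'.2.1, h.symm.2.1]⟩

end Graph

namespace NsModule

variable {M : Type u} [Category.{v} M] [MonoidalCategory M] [SymmetricCategory M] {P : NsModule M}
  {α : P.ContractionFamily} {R : Ops P}

theorem mp_eq_comp {A B W : MultCyc} {g h m : ℕ} (φ : A ⟶ W) (ψ : B ⟶ W) (e : g = m) (e' : h = m) :
    P.mp φ e = P.mp (φ ≫ MultCyc.inv ψ) (e.trans e'.symm) ≫ P.mp ψ e' := by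
  rw [mp_comp, Category.assoc, MultCyc.inv_comp, Category.comp_id]

theorem in₁_comp {Γ : Graph} {v : Γ.Vert} (hv : ∀ w, w = v) {S T : MultCyc} {g h : ℕ}
    (ρ : S ⟶ T) (σ : T ⟶ Γ.legAt v) (e : g = h) (e' : h = Γ.genus v) :
    P.in₁ Γ v hv (ρ ≫ σ) (e.trans e') = P.mp ρ e ≫ P.in₁ Γ v hv σ e' :=
  (congrArg (fun z => z ≫ single (P.factor Γ) v (perm_single hv)) (P.mp_comp ρ σ e e').symm).trans
    (Category.assoc _ _ _)

theorem in₂_comp {Γ : Graph} {v w : Γ.Vert} (hp : [v, w].Perm (ordering Γ.Vert))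
    {S T S' T' : MultCyc} {g h g' h' : ℕ} (ρ : S ⟶ S') (σ : S' ⟶ Γ.legAt v) (ρ' : T ⟶ T')
    (σ' : T' ⟶ Γ.legAt w) (e₁ : g = g') (e₂ : g' = Γ.genus v) (e₃ : h = h')
    (e₄ : h' = Γ.genus w) :
    P.in₂ Γ v w hp (ρ ≫ σ) (ρ' ≫ σ') (e₁.trans e₂) (e₃.trans e₄) =
      (P.mp ρ e₁ ⊗ₘ P.mp ρ' e₃) ≫ P.in₂ Γ v w hp σ σ' e₂ e₄ := by
  refine Eq.trans ?_ (Category.assoc _ _ _)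
  refine congrArg (fun z => z ≫ pair (P.factor Γ) v w hp) ?_
  refine Eq.trans ?_ (MonoidalCategory.tensorHom_comp_tensorHom _ _ _ _).symm
  exact congrArg₂ (fun k k' => k ⊗ₘ k') (P.mp_comp ρ σ e₁ e₂).symm (P.mp_comp ρ' σ' e₃ e₄).symm

theorem in₂_swap {Γ : Graph} {v w : Γ.Vert} (hp : [v, w].Perm (ordering Γ.Vert))
    (hp' : [w, v].Perm (ordering Γ.Vert)) {S T : MultCyc} {g h : ℕ} (ρ : S ⟶ Γ.legAt v)
    (σ : T ⟶ Γ.legAt w) (e : g = Γ.genus v) (e' : h = Γ.genus w) :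
    P.in₂ Γ w v hp' σ ρ e' e = (β_ _ _).hom ≫ P.in₂ Γ v w hp ρ σ e e' := by
  have h1 := pair_swap (P.factor Γ) v w (Graph.ne_of_perm hp) hp hp'
  refine (congrArg (fun z => (P.mp σ e' ⊗ₘ P.mp ρ e) ≫ z) h1).trans ?_
  refine (Category.assoc _ _ _).symm.trans (Eq.trans ?_ (Category.assoc _ _ _))
  exact congrArg (fun z => z ≫ pair (P.factor Γ) v w hp)
    (BraidedCategory.braiding_naturality (P.mp σ e') (P.mp ρ e))

theorem Evaluates.natural (hE : Evaluates R α) : P.NaturalUpTo α 1 := by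
  intro S T g h X Y F φ e hX hφ
  have arc : ∀ {v : X.gr.Vert} (a : (X.gr.legAt v).Arc),
      Y.gl.arc (Y.gr.incl (F.hom.vert v) (arcMap (𝟙 _ ≫ legAtIso F v) a)) =
        arcMap φ (X.gl.arc (X.gr.incl v (arcMap (𝟙 _) a))) := fun a => by
    rw [hφ, Category.id_comp, incl_legAtIso, MultCyc.arcMap_id]
  rcases Nat.le_one_iff_eq_zero_or_eq_one.1 hX with h0 | h1
  · obtain ⟨v⟩ : Nonempty X.gr.Vert := X.gr.fl.nonempty.map X.gr.arcV
    have hv : ∀ w, w = v := fun w => Graph.eq_of_numEdges_eq_zero h0 w v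
    have h0' : Y.gr.numEdges = 0 := (Graph.numEdges_eq_zero_iff _).2 fun y => by
      rw [← inv_emb_hom_emb F y, F.inv.inv_emb, (Graph.numEdges_eq_zero_iff _).1 h0]
    have hv' : ∀ w, w = F.hom.vert v := fun w => Graph.eq_of_numEdges_eq_zero h0' _ _
    obtain ⟨φ₁, e₁, A, H⟩ := hE.star X h0 v hv (𝟙 _) rfl
    obtain ⟨φ₂, e₂, A', H'⟩ := hE.star Y h0' _ hv' (𝟙 _ ≫ legAtIso F v) (genus_iso F v)
    have h2 : φ₁ ≫ φ = φ₂ := MultCyc.hom_ext_arc fun a => by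
      rw [MultCyc.arcMap_comp, A, A', arc]
    rw [← cancel_epi (P.in₁ X.gr v hv (𝟙 _) rfl), ← Category.assoc,
      P.in₁_onIso F v hv (𝟙 _) rfl hv', H', ← Category.assoc, H, mp_comp]
    subst h2
    rfl
  · obtain ⟨x, y, hxy⟩ := Graph.exists_onlyEdge h1
    by_cases hv : X.gr.ptV x = X.gr.ptV y
    · have hv1 := hxy.eq_vert hv
      have hv' : ∀ w, w = F.hom.vert (X.gr.ptV x) := fun w => by
        rw [← inv_vert_hom_vert F.symm w]
        exact congrArg _ (hv1 _)
      have hne : (⟨x, rfl⟩ : (X.gr.legAt (X.gr.ptV x)).pt) ≠ ⟨y, hv.symm⟩ :=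
        fun e => hxy.1 (congrArg Subtype.val e)
      obtain ⟨φ₁, e₁, A, H⟩ := hE.loop X _ hv1 (𝟙 _) rfl ⟨x, rfl⟩ ⟨y, hv.symm⟩ hne hxy
      obtain ⟨φ₂, e₂, A', H'⟩ := hE.loop Y _ hv' (𝟙 _ ≫ legAtIso F _) (genus_iso F _)
        ⟨x, rfl⟩ ⟨y, hv.symm⟩ hne (hxy.map F)
      have h2 : φ₁ ≫ φ = φ₂ := MultCyc.hom_ext_arc fun a => by
        obtain ⟨a, rfl⟩ := (Gluing.canonical _ _).arc_surjective a
        have A := A a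
        have A' := A' a
        unfold cutArc at A A'
        rw [MultCyc.arcMap_comp, A, A', arc]
      rw [← cancel_epi (P.in₁ X.gr _ hv1 (𝟙 _) rfl), ← Category.assoc,
        P.in₁_onIso F _ hv1 (𝟙 _) rfl hv', H', ← Category.assoc, H, Category.assoc, mp_comp]
      subst h2
      rfl
    · have hp := hxy.perm hv
      have hp' : [F.hom.vert (X.gr.ptV x), F.hom.vert (X.gr.ptV y)].Perm (ordering Y.gr.Vert) :=
        perm_pair (fun e => hv ((vertEquiv F).injective e)) fun w => by
          rw [← inv_vert_hom_vert F.symm w]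
          exact (hxy.vert (F.inv.vert w)).imp (congrArg _) (congrArg _)
      obtain ⟨φ₁, e₁, A, B, H⟩ := hE.edge X _ _ hp (𝟙 _) (𝟙 _) rfl rfl ⟨x, rfl⟩ ⟨y, rfl⟩ hxy
      obtain ⟨φ₂, e₂, A', B', H'⟩ := hE.edge Y _ _ hp' (𝟙 _ ≫ legAtIso F _) (𝟙 _ ≫ legAtIso F _)
        (genus_iso F _) (genus_iso F _) ⟨x, rfl⟩ ⟨y, rfl⟩ (hxy.map F)
      have h2 : φ₁ ≫ φ = φ₂ := MultCyc.hom_ext_arc fun a => by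
        obtain ⟨a, rfl⟩ := (Gluing.canonical _ _).arc_surjective a
        rcases a with (a | a) | (a | a)
        · exact (MultCyc.arcMap_comp _ _ _).trans ((congrArg _ (A (Sum.inl a))).trans
            ((arc _).symm.trans (A' (Sum.inl a)).symm))
        · exact (MultCyc.arcMap_comp _ _ _).trans ((congrArg _ (B (Sum.inl a))).trans
            ((arc _).symm.trans (B' (Sum.inl a)).symm))
        · exact (MultCyc.arcMap_comp _ _ _).trans ((congrArg _ (A (Sum.inr a))).trans
            ((arc _).symm.trans (A' (Sum.inr a)).symm))
        · exact (MultCyc.arcMap_comp _ _ _).trans ((congrArg _ (B (Sum.inr a))).trans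
            ((arc _).symm.trans (B' (Sum.inr a)).symm))
      rw [← cancel_epi (P.in₂ X.gr _ _ hp (𝟙 _) (𝟙 _) rfl rfl), ← Category.assoc,
        P.in₂_onIso F _ _ hp (𝟙 _) (𝟙 _) rfl rfl hp', H', ← Category.assoc, H, Category.assoc,
        mp_comp]
      subst h2
      rfl

end NsModule

/-- The structure maps of an operad. -/
def NsModularOperad.ops {M : Type u} [Category.{v} M] [MonoidalCategory M] [SymmetricCategory M]
    {P : NsModule M} (O : NsModularOperad P) : NsModule.Ops P := ⟨O.comp, O.contr⟩

namespace NsModule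

variable {M : Type u} [Category.{v} M] [MonoidalCategory M] [SymmetricCategory M] {P : NsModule M}
  {α : P.ContractionFamily} {O : NsModularOperad P}

section TwoEdges

variable {W : MultCyc} {m : ℕ} {Z Y Y' : LGraph W m} {k : Z ⟶ Y} {k' : Z ⟶ Y'}
  {a b c d : Z.gr.fl.pt}

theorem vertexwise_eq_of_loops (hE : Evaluates O.ops α) (hZ : Z.gr.TwoEdges a b c d)
    (hk : Graph.Hom.Contracts k.hom c d) (hk' : Graph.Hom.Contracts k'.hom a b)
    (hv : ∀ w, w = Z.gr.ptV a) :
    P.vertexwise α k.hom ≫ α W m Y = P.vertexwise α k'.hom ≫ α W m Y' := by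
  have q : ∀ {x y : Z.gr.fl.pt} (hx) (hy), x ≠ y → (⟨x, hx⟩ : (Z.gr.legAt (Z.gr.ptV a)).pt) ≠
    ⟨y, hy⟩ := fun _ _ h e => h (congrArg Subtype.val e)
  obtain ⟨φ, e, A, H⟩ := hE.contr_contr (k := k) hv (𝟙 (Z.gr.legAt (Z.gr.ptV a))) rfl
    (a := ⟨a, rfl⟩) (b := ⟨b, hv _⟩) (c := ⟨c, hv _⟩) (d := ⟨d, hv _⟩)
    (q _ _ hZ.ab) (q _ _ hZ.ac) (q _ _ hZ.ad) (q _ _ hZ.bc) (q _ _ hZ.bd) (q _ _ hZ.cd) hZ hk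
  obtain ⟨φ', e', A', H'⟩ := hE.contr_contr (k := k') hv (𝟙 (Z.gr.legAt (Z.gr.ptV a))) rfl
    (a := ⟨c, hv _⟩) (b := ⟨d, hv _⟩) (c := ⟨a, rfl⟩) (d := ⟨b, hv _⟩)
    (q _ _ hZ.swap.ab) (q _ _ hZ.swap.ac) (q _ _ hZ.swap.ad) (q _ _ hZ.swap.bc)
    (q _ _ hZ.swap.bd) (q _ _ hZ.swap.cd) hZ.swap hk'
  have h1 := O.contr_contr (S := Z.gr.legAt (Z.gr.ptV a)) ⟨a, rfl⟩ ⟨b, hv _⟩ ⟨c, hv _⟩ ⟨d, hv _⟩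
    (q _ _ hZ.ab) (q _ _ hZ.ac) (q _ _ hZ.ad) (q _ _ hZ.bc) (q _ _ hZ.bd) (q _ _ hZ.cd)
    (Z.gr.genus (Z.gr.ptV a)) (φ ≫ MultCyc.inv φ')
    fun x => MultCyc.arcMap_comp_inv _ _ ((A x).trans (A' x).symm)
  rw [← cancel_epi (P.in₁ Z.gr _ hv (𝟙 _) rfl), H, H', mp_eq_comp φ φ' e e']
  refine Eq.trans ?_ (congrArg (fun z => z ≫ P.mp φ' e') h1 |>.trans (Category.assoc _ _ _))
  simp only [Category.assoc]
  rfl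

theorem vertexwise_eq_of_double (hE : Evaluates O.ops α) (hZ : Z.gr.TwoEdges a b c d)
    (hk : Graph.Hom.Contracts k.hom c d) (hk' : Graph.Hom.Contracts k'.hom a b)
    (hp : [Z.gr.ptV a, Z.gr.ptV b].Perm (ordering Z.gr.Vert)) (hc : Z.gr.ptV c = Z.gr.ptV a)
    (hd : Z.gr.ptV d = Z.gr.ptV b) :
    P.vertexwise α k.hom ≫ α W m Y = P.vertexwise α k'.hom ≫ α W m Y' := by
  have q : ∀ {v} {x y : Z.gr.fl.pt} (hx) (hy), x ≠ y → (⟨x, hx⟩ : (Z.gr.legAt v).pt) ≠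
    ⟨y, hy⟩ := fun _ _ h e => h (congrArg Subtype.val e)
  obtain ⟨φ, e, A, B, H⟩ := hE.contr_comp (k := k) hp (𝟙 _) (𝟙 _) rfl rfl
    (a := ⟨a, rfl⟩) (b := ⟨b, rfl⟩) (c := ⟨c, hc⟩) (d := ⟨d, hd⟩) (q _ _ hZ.ac) (q _ _ hZ.bd)
    hZ hk
  obtain ⟨φ', e', A', B', H'⟩ := hE.contr_comp (k := k') hp (𝟙 _) (𝟙 _) rfl rfl
    (c := ⟨a, rfl⟩) (d := ⟨b, rfl⟩) (a := ⟨c, hc⟩) (b := ⟨d, hd⟩) (q _ _ hZ.swap.ac)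
    (q _ _ hZ.swap.bd) hZ.swap hk'
  have h1 := O.contr_comp (S := Z.gr.legAt (Z.gr.ptV a)) (T := Z.gr.legAt (Z.gr.ptV b))
    ⟨a, rfl⟩ ⟨c, hc⟩ ⟨b, rfl⟩ ⟨d, hd⟩ (q _ _ hZ.ac) (q _ _ hZ.bd)
    (Z.gr.genus (Z.gr.ptV a)) (Z.gr.genus (Z.gr.ptV b)) (φ ≫ MultCyc.inv φ')
    (fun x => MultCyc.arcMap_comp_inv _ _ ((A x).trans (A' x).symm))
    (fun x => MultCyc.arcMap_comp_inv _ _ ((B x).trans (B' x).symm))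
  rw [← cancel_epi (P.in₂ Z.gr _ _ hp (𝟙 _) (𝟙 _) rfl rfl), H, H', mp_eq_comp φ φ' e e']
  refine Eq.trans ?_ (congrArg (fun z => z ≫ P.mp φ' e') h1 |>.trans (Category.assoc _ _ _))
  simp only [Category.assoc]
  rfl

theorem vertexwise_eq_of_loop (hE : Evaluates O.ops α) (hZ : Z.gr.TwoEdges a b c d)
    (hk : Graph.Hom.Contracts k.hom c d) (hk' : Graph.Hom.Contracts k'.hom a b)
    (hp : [Z.gr.ptV a, Z.gr.ptV b].Perm (ordering Z.gr.Vert)) (hc : Z.gr.ptV c = Z.gr.ptV a)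
    (hd : Z.gr.ptV d = Z.gr.ptV a) :
    P.vertexwise α k.hom ≫ α W m Y = P.vertexwise α k'.hom ≫ α W m Y' := by
  have q : ∀ {v} {x y : Z.gr.fl.pt} (hx) (hy), x ≠ y → (⟨x, hx⟩ : (Z.gr.legAt v).pt) ≠
    ⟨y, hy⟩ := fun _ _ h e => h (congrArg Subtype.val e)
  obtain ⟨φ, e, A, B, H⟩ := hE.comp_contr (k := k) hp (𝟙 _) (𝟙 _) rfl rfl
    (a := ⟨a, rfl⟩) (b := ⟨b, rfl⟩) (c := ⟨c, hc⟩) (d := ⟨d, hd⟩) (q _ _ hZ.ac) (q _ _ hZ.ad)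
    (q _ _ hZ.cd) hZ hk
  obtain ⟨φ', e', A', B', H'⟩ := hE.contr_comp_loop (k := k') hp (𝟙 _) (𝟙 _) rfl rfl
    (a := ⟨a, rfl⟩) (b := ⟨b, rfl⟩) (c := ⟨c, hc⟩) (d := ⟨d, hd⟩) (q _ _ hZ.ac) (q _ _ hZ.ad)
    (q _ _ hZ.cd) hZ hk'
  have h1 := O.comp_contr (S := Z.gr.legAt (Z.gr.ptV a)) (T := Z.gr.legAt (Z.gr.ptV b))
    ⟨a, rfl⟩ ⟨c, hc⟩ ⟨d, hd⟩ ⟨b, rfl⟩ (q _ _ hZ.ac) (q _ _ hZ.ad) (q _ _ hZ.cd)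
    (Z.gr.genus (Z.gr.ptV a)) (Z.gr.genus (Z.gr.ptV b)) (φ ≫ MultCyc.inv φ')
    (fun x => MultCyc.arcMap_comp_inv _ _ ((A x).trans (A' x).symm))
    (fun x => MultCyc.arcMap_comp_inv _ _ ((B x).trans (B' x).symm))
  rw [← cancel_epi (P.in₂ Z.gr _ _ hp (𝟙 _) (𝟙 _) rfl rfl), H, H', mp_eq_comp φ φ' e e']
  refine Eq.trans ?_ (congrArg (fun z => z ≫ P.mp φ' e') h1 |>.trans (Category.assoc _ _ _))
  simp only [Category.assoc]
  rfl

theorem vertexwise_eq_of_path (hE : Evaluates O.ops α) (hZ : Z.gr.TwoEdges a b c d)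
    (hk : Graph.Hom.Contracts k.hom c d) (hk' : Graph.Hom.Contracts k'.hom a b)
    (hp : [Z.gr.ptV a, Z.gr.ptV b, Z.gr.ptV d].Perm (ordering Z.gr.Vert))
    (hc : Z.gr.ptV c = Z.gr.ptV b) :
    P.vertexwise α k.hom ≫ α W m Y = P.vertexwise α k'.hom ≫ α W m Y' := by
  have q : ∀ {v} {x y : Z.gr.fl.pt} (hx) (hy), x ≠ y → (⟨x, hx⟩ : (Z.gr.legAt v).pt) ≠
    ⟨y, hy⟩ := fun _ _ h e => h (congrArg Subtype.val e)
  obtain ⟨φ, e, A, B, C, H⟩ := hE.comp_comp_right (k := k) hp (𝟙 _) (𝟙 _) (𝟙 _) rfl rfl rfl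
    (a := ⟨a, rfl⟩) (b := ⟨b, rfl⟩) (c := ⟨c, hc⟩) (d := ⟨d, rfl⟩) (q _ _ hZ.bc) hZ hk
  obtain ⟨φ', e', A', B', C', H'⟩ := hE.comp_comp_left (k := k') hp (𝟙 _) (𝟙 _) (𝟙 _) rfl rfl rfl
    (a := ⟨a, rfl⟩) (b := ⟨b, rfl⟩) (c := ⟨c, hc⟩) (d := ⟨d, rfl⟩) (q _ _ hZ.bc) hZ hk'
  have h1 := O.comp_comp (S₁ := Z.gr.legAt (Z.gr.ptV a)) (S₂ := Z.gr.legAt (Z.gr.ptV b))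
    (S₃ := Z.gr.legAt (Z.gr.ptV d)) ⟨a, rfl⟩ ⟨b, rfl⟩ ⟨c, hc⟩ ⟨d, rfl⟩ (q _ _ hZ.bc)
    (Z.gr.genus (Z.gr.ptV a)) (Z.gr.genus (Z.gr.ptV b)) (Z.gr.genus (Z.gr.ptV d))
    (φ ≫ MultCyc.inv φ')
    (fun x => MultCyc.arcMap_comp_inv _ _ ((A x).trans (A' x).symm))
    (fun x => MultCyc.arcMap_comp_inv _ _ ((B x).trans (B' x).symm))
    (fun x => MultCyc.arcMap_comp_inv _ _ ((C x).trans (C' x).symm))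
  rw [← cancel_epi (P.in₃ Z.gr _ _ _ hp (𝟙 _) (𝟙 _) (𝟙 _) rfl rfl rfl), H, H',
    mp_eq_comp φ φ' e e']
  refine Eq.trans ?_ (congrArg (fun z => z ≫ P.mp φ' e') h1 |>.trans
    ((Category.assoc _ _ _).trans (congrArg (fun z => _ ≫ z) (Category.assoc _ _ _))))
  simp only [Category.assoc]
  rfl

end TwoEdges

end NsModule

theorem Graph.TwoEdges.flip_left {Γ : Graph} {a b c d : Γ.fl.pt} (h : Γ.TwoEdges a b c d) :
    Γ.TwoEdges b a c d :=
  ⟨h.ab.symm, h.cd, h.bc, h.bd, h.inv_b, h.inv_c, fun z hz => by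
    rcases h.all z hz with h | h | h | h <;> simp [h]⟩

theorem Graph.TwoEdges.vert {Γ : Graph} {a b c d : Γ.fl.pt} (h : Γ.TwoEdges a b c d)
    (q : Γ.Vert → Prop) (ha : q (Γ.ptV a) ↔ q (Γ.ptV b)) (hc : q (Γ.ptV c) ↔ q (Γ.ptV d))
    {v : Γ.Vert} (hv : q v) (w : Γ.Vert) : q w := by
  refine (eqvGen_iff (p := q) (fun x y ⟨z, h1, h2⟩ => ?_) (Γ.conn v w)).1 hv
  rw [← h1, ← h2]
  by_cases hz : Γ.inv z = z
  · rw [hz]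
  · rcases h.all z hz with rfl | rfl | rfl | rfl
    · rwa [h.inv_a]
    · rw [h.inv_b, ha]
    · rwa [h.inv_c]
    · rw [h.inv_d, hc]

namespace NsModule

variable {M : Type u} [Category.{v} M] [MonoidalCategory M] [SymmetricCategory M] {P : NsModule M}
  {α : P.ContractionFamily} {O : NsModularOperad P}

/-- The two ways of contracting the two edges of a graph in turn give the same result. -/
theorem vertexwise_eq_of_twoEdges (hE : Evaluates O.ops α) {W : MultCyc} {m : ℕ}
    {Z Y Y' : LGraph W m} {k : Z ⟶ Y} {k' : Z ⟶ Y'} {a b c d : Z.gr.fl.pt}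
    (hZ : Z.gr.TwoEdges a b c d)
    (hk : Graph.Hom.Contracts k.hom c d) (hk' : Graph.Hom.Contracts k'.hom a b) :
    P.vertexwise α k.hom ≫ α W m Y = P.vertexwise α k'.hom ≫ α W m Y' := by
  -- an edge between two vertices and a loop
  have loop : ∀ {Y Y' : LGraph W m} {k : Z ⟶ Y} {k' : Z ⟶ Y'} {a b c d : Z.gr.fl.pt}
      (_ : Z.gr.TwoEdges a b c d) (_ : Graph.Hom.Contracts k.hom c d)
      (_ : Graph.Hom.Contracts k'.hom a b), Z.gr.ptV a ≠ Z.gr.ptV b → Z.gr.ptV c = Z.gr.ptV d →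
      P.vertexwise α k.hom ≫ α W m Y = P.vertexwise α k'.hom ≫ α W m Y' := by
    intro Y Y' k k' a b c d hZ hk hk' hab hcd
    have key : ∀ {a b : Z.gr.fl.pt} (_ : Z.gr.TwoEdges a b c d)
        (_ : Graph.Hom.Contracts k'.hom a b), Z.gr.ptV a ≠ Z.gr.ptV b → Z.gr.ptV c = Z.gr.ptV a →
        P.vertexwise α k.hom ≫ α W m Y = P.vertexwise α k'.hom ≫ α W m Y' := by
      intro a b hZ hk' hab hca
      refine vertexwise_eq_of_loop hE hZ hk hk' (perm_pair hab fun w => ?_) hca (hcd ▸ hca)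
      exact hZ.vert (fun w => w = Z.gr.ptV a ∨ w = Z.gr.ptV b) (by simp) (by rw [hcd])
        (Or.inl rfl) w
    rcases hZ.vert (fun w => w = Z.gr.ptV a ∨ w = Z.gr.ptV b) (by simp) (by rw [hcd])
        (Or.inl rfl) (Z.gr.ptV c) with h | h
    · exact key hZ hk' hab h
    · exact key hZ.flip_left hk'.flip hab.symm h
  by_cases hab : Z.gr.ptV a = Z.gr.ptV b <;> by_cases hcd : Z.gr.ptV c = Z.gr.ptV d
  · exact vertexwise_eq_of_loops hE hZ hk hk' fun w =>
      hZ.vert (fun w => w = Z.gr.ptV a) (by simp [hab]) (by rw [hcd]) rfl w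
  · exact (loop hZ.swap hk' hk hcd hab).symm
  · exact loop hZ hk hk' hab hcd
  · -- two edges between different vertices
    have key : ∀ {a b c d : Z.gr.fl.pt} (_ : Z.gr.TwoEdges a b c d)
        (_ : Graph.Hom.Contracts k.hom c d) (_ : Graph.Hom.Contracts k'.hom a b),
        Z.gr.ptV a ≠ Z.gr.ptV b → Z.gr.ptV c ≠ Z.gr.ptV d → Z.gr.ptV c = Z.gr.ptV b →
        P.vertexwise α k.hom ≫ α W m Y = P.vertexwise α k'.hom ≫ α W m Y' := by
      intro a b c d hZ hk hk' hab hcd h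
      by_cases hda : Z.gr.ptV d = Z.gr.ptV a
      · refine vertexwise_eq_of_double hE hZ.flip_left hk hk'.flip
          (perm_pair hab.symm fun w => ?_) h hda
        exact hZ.vert (fun w => w = Z.gr.ptV b ∨ w = Z.gr.ptV a) (by simp) (by simp [h, hda])
          (Or.inl rfl) w
      · refine vertexwise_eq_of_path hE hZ hk hk'
          (perm_triple hab (Ne.symm hda) (h ▸ hcd) fun w => ?_) h
        exact hZ.vert (fun w => w = Z.gr.ptV a ∨ w = Z.gr.ptV b ∨ w = Z.gr.ptV d) (by simp)
          (by simp [h]) (Or.inl rfl) w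
    have hZ' := hZ.flip
    by_cases h1 : Z.gr.ptV c = Z.gr.ptV b
    · exact key hZ hk hk' hab hcd h1
    · by_cases h2 : Z.gr.ptV c = Z.gr.ptV a
      · exact key hZ.flip_left hk hk'.flip (Ne.symm hab) hcd h2
      · by_cases h3 : Z.gr.ptV d = Z.gr.ptV b
        · exact key hZ'.flip_left hk.flip hk' hab (Ne.symm hcd) h3
        · by_cases h4 : Z.gr.ptV d = Z.gr.ptV a
          · exact key hZ' hk.flip hk'.flip (Ne.symm hab) (Ne.symm hcd) h4
          · exfalso
            have := hZ.vert (fun w => w = Z.gr.ptV a ∨ w = Z.gr.ptV b) (by simp)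
              (by simp [h1, h2, h3, h4]) (Or.inl rfl) (Z.gr.ptV c)
            exact this.elim h2 h1

end NsModule

theorem hom_ext_cutArc {S W : MultCyc} {u t : S.pt} {φ ψ : cut S u t ⟶ W}
    (h : ∀ a, arcMap φ (cutArc u t a) = arcMap ψ (cutArc u t a)) : φ = ψ :=
  MultCyc.hom_ext_arc fun a => by
    obtain ⟨a, rfl⟩ := (Gluing.canonical _ _).arc_surjective a
    exact h a

theorem hom_ext_mergeArc {S T W : MultCyc} {u : S.pt} {t : T.pt} {φ ψ : merge S T u t ⟶ W}
    (h : ∀ a, arcMap φ (mergeArcLeft u t a) = arcMap ψ (mergeArcLeft u t a))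
    (h' : ∀ a, arcMap φ (mergeArcRight u t a) = arcMap ψ (mergeArcRight u t a)) : φ = ψ :=
  MultCyc.hom_ext_arc fun a => by
    obtain ⟨a, rfl⟩ := (Gluing.canonical _ _).arc_surjective a
    rcases a with (a | a) | (a | a)
    exacts [h (Sum.inl a), h' (Sum.inl a), h (Sum.inr a), h' (Sum.inr a)]

namespace NsModule

variable {M : Type u} [Category.{v} M] [MonoidalCategory M] [SymmetricCategory M] {P : NsModule M}
  {α β : P.ContractionFamily} {R : Ops P}

theorem Evaluates.starUnit (hE : Evaluates R α) : P.StarUnit α := by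
  intro S g
  have h0 : (NsMod.star S g).gr.numEdges = 0 := (Graph.numEdges_eq_zero_iff _).2 fun _ => rfl
  obtain ⟨φ, e, h1, h2⟩ := hE.star (NsMod.star S g) h0 () (fun _ => rfl) (corollaLeg S g) rfl
  have h3 : φ = 𝟙 S := MultCyc.hom_ext_arc fun a => by
    refine (h1 a).trans ((star_arc S g _).trans (Eq.trans ?_ (MultCyc.arcMap_id a).symm))
    rcases a with a | a <;> rfl
  subst h3
  exact h2.trans (P.mp_id _ _ _)

theorem Evaluates.unique (hE : Evaluates R α) (hE' : Evaluates R β) {S : MultCyc} {g : ℕ}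
    (X : LGraph S g) (hX : X.gr.numEdges ≤ 1) : α S g X = β S g X := by
  rcases Nat.le_one_iff_eq_zero_or_eq_one.1 hX with h0 | h1
  · obtain ⟨v⟩ : Nonempty X.gr.Vert := X.gr.fl.nonempty.map X.gr.arcV
    have hv : ∀ w, w = v := fun w => Graph.eq_of_numEdges_eq_zero h0 w v
    obtain ⟨φ₁, e₁, A, H⟩ := hE.star X h0 v hv (𝟙 _) rfl
    obtain ⟨φ₂, e₂, A', H'⟩ := hE'.star X h0 v hv (𝟙 _) rfl
    have h2 : φ₁ = φ₂ := MultCyc.hom_ext_arc fun a => by rw [A, A']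
    subst h2
    rw [← cancel_epi (P.in₁ X.gr v hv (𝟙 _) rfl), H, H']
  · obtain ⟨x, y, hxy⟩ := Graph.exists_onlyEdge h1
    by_cases hv : X.gr.ptV x = X.gr.ptV y
    · have hv1 := hxy.eq_vert hv
      have hne : (⟨x, rfl⟩ : (X.gr.legAt (X.gr.ptV x)).pt) ≠ ⟨y, hv.symm⟩ :=
        fun e => hxy.1 (congrArg Subtype.val e)
      obtain ⟨φ₁, e₁, A, H⟩ := hE.loop X _ hv1 (𝟙 _) rfl ⟨x, rfl⟩ ⟨y, hv.symm⟩ hne hxy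
      obtain ⟨φ₂, e₂, A', H'⟩ := hE'.loop X _ hv1 (𝟙 _) rfl ⟨x, rfl⟩ ⟨y, hv.symm⟩ hne hxy
      obtain rfl : φ₁ = φ₂ := hom_ext_cutArc fun a => by rw [A, A']
      rw [← cancel_epi (P.in₁ X.gr _ hv1 (𝟙 _) rfl), H, H']
    · have hp := hxy.perm hv
      obtain ⟨φ₁, e₁, A, B, H⟩ := hE.edge X _ _ hp (𝟙 _) (𝟙 _) rfl rfl ⟨x, rfl⟩ ⟨y, rfl⟩ hxy
      obtain ⟨φ₂, e₂, A', B', H'⟩ := hE'.edge X _ _ hp (𝟙 _) (𝟙 _) rfl rfl ⟨x, rfl⟩ ⟨y, rfl⟩ hxy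
      obtain rfl : φ₁ = φ₂ := hom_ext_mergeArc (fun a => by rw [A, A']) fun a => by rw [B, B']
      rw [← cancel_epi (P.in₂ X.gr _ _ hp (𝟙 _) (𝟙 _) rfl rfl), H, H']

section Labels

variable {S T W : MultCyc} {g h k : ℕ} (X : LGraph W k) (v w : X.gr.Vert)

theorem exists_starLabel (h0 : X.gr.numEdges = 0) (hv : ∀ w, w = v) (ρ : S ⟶ X.gr.legAt v)
    (e : g = X.gr.genus v) :
    ∃ (φ : S ⟶ W) (_ : g = k), ∀ a, arcMap φ a = X.gl.arc (X.gr.incl v (arcMap ρ a)) := by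
  let E : Unit ≃ X.gr.Vert :=
    { toFun := fun _ => v
      invFun := fun _ => ()
      left_inv := fun _ => rfl
      right_inv := fun w => (hv w).symm }
  let F : (star S g).gr ≅ X.gr := Graph.mkIso (Γ := corolla S g) (X.gr.flagsOne v hv ρ) E
    (fun a => hv _) (fun _ => e.symm)
    (fun x => X.gr.numEdges_eq_zero_iff.1 h0 _)
  obtain ⟨e', φ, hφ⟩ := (star S g).exists_label X F
  refine ⟨φ, e', fun a => ?_⟩
  exact (congrArg (arcMap φ) (star_arc S g a).symm).trans ((hφ a).trans (congrArg X.gl.arc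
    ((Graph.mkIso_arc (Γ := corolla S g) _ _ _ _ _ a).trans (X.gr.flagsOne_arc v hv ρ a))))

theorem exists_loopLabel (P : NsModule M) (hv : ∀ w, w = v) (ρ : S ⟶ X.gr.legAt v)
    (e : g = X.gr.genus v) (u t : S.pt) (hut : u ≠ t)
    (hX : X.gr.OnlyEdge (ρ.pt u).1 (ρ.pt t).1) :
    ∃ (φ : cut S u t ⟶ W) (_ : g + 1 = k),
      ∀ a, arcMap φ (cutArc u t a) = X.gl.arc (X.gr.incl v (arcMap ρ a)) := by
  obtain ⟨F, h2, -⟩ := exists_loopIso (P := P) X.gr v hv ρ e u t hut hX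
  obtain ⟨e'', φ, hφ⟩ := (loopGraph u t hut g).exists_label X F
  refine ⟨φ, e'', fun a => ?_⟩
  rw [← loopGraph_arc u t hut g]
  exact (hφ a).trans (congrArg _ (h2 a))

theorem exists_edgeLabel (P : NsModule M) (hp : [v, w].Perm (ordering X.gr.Vert))
    (ρ : S ⟶ X.gr.legAt v) (σ : T ⟶ X.gr.legAt w)
    (e : g = X.gr.genus v) (e' : h = X.gr.genus w) (u : S.pt) (t : T.pt)
    (hX : X.gr.OnlyEdge (ρ.pt u).1 (σ.pt t).1) :
    ∃ (φ : merge S T u t ⟶ W) (_ : g + h = k),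
      (∀ a, arcMap φ (mergeArcLeft u t a) = X.gl.arc (X.gr.incl v (arcMap ρ a))) ∧
      (∀ a, arcMap φ (mergeArcRight u t a) = X.gl.arc (X.gr.incl w (arcMap σ a))) := by
  obtain ⟨F, h2, h3, -⟩ := exists_edgeIso (P := P) X.gr v w hp ρ σ e e' u t hX
  obtain ⟨e'', φ, hφ⟩ := (edgeGraph u t g h).exists_label X F
  refine ⟨φ, e'', fun a => ?_, fun a => ?_⟩
  · rw [← edgeGraph_arc_left u t g h, hφ, h2]
  · rw [← edgeGraph_arc_right u t g h, hφ, h3]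

end Labels

/-- The value `m` on the graph `X` is the one given by the operations `R`, if `X` has at most one
edge. -/
structure Presents (R : Ops P) {W : MultCyc} {k : ℕ} (X : LGraph W k)
    (m : P.onGraph X.gr ⟶ P.ob W k) : Prop where
  star : ∀ {S : MultCyc} {g : ℕ} (_ : X.gr.numEdges = 0) (v : X.gr.Vert)
    (hv : ∀ w, w = v) (ρ : S ⟶ X.gr.legAt v) (e : g = X.gr.genus v),
    ∃ (φ : S ⟶ W) (e' : g = k),
      (∀ a, arcMap φ a = X.gl.arc (X.gr.incl v (arcMap ρ a))) ∧
      P.in₁ X.gr v hv ρ e ≫ m = P.mp φ e'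
  edge : ∀ {S T : MultCyc} {g h : ℕ} (v w : X.gr.Vert)
    (hp : [v, w].Perm (ordering X.gr.Vert)) (ρ : S ⟶ X.gr.legAt v) (σ : T ⟶ X.gr.legAt w)
    (e : g = X.gr.genus v) (e' : h = X.gr.genus w) (u : S.pt) (t : T.pt)
    (_ : X.gr.OnlyEdge (ρ.pt u).1 (σ.pt t).1),
    ∃ (φ : merge S T u t ⟶ W) (e'' : g + h = k),
      (∀ a, arcMap φ (mergeArcLeft u t a) = X.gl.arc (X.gr.incl v (arcMap ρ a))) ∧
      (∀ a, arcMap φ (mergeArcRight u t a) = X.gl.arc (X.gr.incl w (arcMap σ a))) ∧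
      P.in₂ X.gr v w hp ρ σ e e' ≫ m = R.comp u t g h ≫ P.mp φ e''
  loop : ∀ {S : MultCyc} {g : ℕ} (v : X.gr.Vert) (hv : ∀ w, w = v)
    (ρ : S ⟶ X.gr.legAt v) (e : g = X.gr.genus v) (u t : S.pt) (hut : u ≠ t)
    (_ : X.gr.OnlyEdge (ρ.pt u).1 (ρ.pt t).1),
    ∃ (φ : cut S u t ⟶ W) (e' : g + 1 = k),
      (∀ a, arcMap φ (cutArc u t a) = X.gl.arc (X.gr.incl v (arcMap ρ a))) ∧
      P.in₁ X.gr v hv ρ e ≫ m = R.contr u t hut g ≫ P.mp φ e'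

theorem evaluates_iff : Evaluates R α ↔ ∀ (S : MultCyc) (g : ℕ) (X : LGraph S g),
    Presents R X (α S g X) :=
  ⟨fun h _ _ X => ⟨h.star X, h.edge X, h.loop X⟩,
    fun h => ⟨fun X => (h _ _ X).star, fun X => (h _ _ X).edge, fun X => (h _ _ X).loop⟩⟩

theorem exists_presents_star {W : MultCyc} {k : ℕ} (X : LGraph W k) (h0 : X.gr.numEdges = 0) :
    ∃ m, Presents R X m := by
  obtain ⟨v⟩ : Nonempty X.gr.Vert := X.gr.fl.nonempty.map X.gr.arcV
  have hv : ∀ w, w = v := fun w => Graph.eq_of_numEdges_eq_zero h0 w v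
  obtain ⟨φ, e, hφ⟩ := exists_starLabel X v h0 hv (𝟙 _) rfl
  refine ⟨inv (P.in₁ X.gr v hv (𝟙 _) rfl) ≫ P.mp φ e, ?_, ?_, ?_⟩
  · rintro S g - v' hv' ρ rfl
    obtain rfl := hv v'
    refine ⟨ρ ≫ φ, e, fun a => ?_, ?_⟩
    · rw [MultCyc.arcMap_comp, hφ, MultCyc.arcMap_id]
    · have h1 := P.in₁_comp hv ρ (𝟙 _) rfl rfl
      rw [Category.comp_id] at h1
      rw [h1, Category.assoc, IsIso.hom_inv_id_assoc, mp_comp]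
  · intro S T g h v w hp ρ σ e e' u t hX
    rw [hX.numEdges] at h0
    cases h0
  · intro S g v hv ρ e u t hut hX
    rw [hX.numEdges] at h0
    cases h0

variable (O : NsModularOperad P)

theorem exists_presents_loop {W : MultCyc} {k : ℕ} (X : LGraph W k) {x y : X.gr.fl.pt}
    (hxy : X.gr.OnlyEdge x y) (hv : X.gr.ptV x = X.gr.ptV y) : ∃ m, Presents O.ops X m := by
  have hv1 := hxy.eq_vert hv
  have hne : (⟨x, rfl⟩ : (X.gr.legAt (X.gr.ptV x)).pt) ≠ ⟨y, hv.symm⟩ :=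
    fun e => hxy.1 (congrArg Subtype.val e)
  obtain ⟨φ, e, hφ⟩ := exists_loopLabel X _ P hv1 (𝟙 _) rfl ⟨x, rfl⟩ ⟨y, hv.symm⟩ hne hxy
  have key : ∀ (u t : (X.gr.legAt (X.gr.ptV x)).pt) (hut : u ≠ t) (_ : X.gr.OnlyEdge u.1 t.1)
      (φ' : cut _ u t ⟶ W) (_ : ∀ a, arcMap φ' (cutArc u t a) = X.gl.arc (X.gr.incl _ a)),
      O.contr u t hut _ ≫ P.mp φ' e = O.contr (S := X.gr.legAt (X.gr.ptV x)) ⟨x, rfl⟩ ⟨y, hv.symm⟩ hne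
        _ ≫ P.mp φ e := by
    intro u t hut h φ' hφ'
    rcases hxy.eq_or h with ⟨h1, h2⟩ | ⟨h1, h2⟩
    · obtain rfl : u = ⟨x, rfl⟩ := Subtype.ext h1
      obtain rfl : t = ⟨y, hv.symm⟩ := Subtype.ext h2
      obtain rfl : φ' = φ := hom_ext_cutArc fun a => by rw [hφ, hφ', MultCyc.arcMap_id]
      rfl
    · obtain rfl : t = ⟨x, rfl⟩ := Subtype.ext h2
      obtain rfl : u = ⟨y, hv.symm⟩ := Subtype.ext h1
      rw [mp_eq_comp φ φ' e e, ← Category.assoc, O.contr_symm]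
      intro a
      exact MultCyc.arcMap_comp_inv _ _ (by rw [hφ, hφ', MultCyc.arcMap_id])
  refine ⟨inv (P.in₁ X.gr _ hv1 (𝟙 _) rfl) ≫ O.contr (S := X.gr.legAt (X.gr.ptV x)) ⟨x, rfl⟩
    ⟨y, hv.symm⟩ hne _ ≫ P.mp φ e,
    ?_, ?_, ?_⟩
  · intro S g h0
    rw [hxy.numEdges] at h0
    cases h0
  · intro S T g h v w hp
    exact absurd ((hv1 v).trans (hv1 w).symm) (Graph.ne_of_perm hp)
  · rintro S g v' hv' ρ rfl u t hut hX
    obtain rfl := hv1 v'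
    obtain ⟨φ₁, e₁, h₁⟩ := exists_loopLabel X _ P hv1 ρ rfl u t hut hX
    obtain ⟨φ₂, e₂, h₂⟩ := exists_loopLabel X _ P hv1 (𝟙 _) rfl (ρ.pt u) (ρ.pt t)
      (ρ.pt.injective.ne hut) hX
    refine ⟨φ₁, e₁, h₁, ?_⟩
    have h1 := P.in₁_comp hv1 ρ (𝟙 _) rfl rfl
    rw [Category.comp_id] at h1
    rw [h1, Category.assoc, IsIso.hom_inv_id_assoc, ← key _ _ (ρ.pt.injective.ne hut) hX φ₂ (fun a => by
      rw [h₂, MultCyc.arcMap_id]), ← Category.assoc, ← O.contr_natural ρ u t hut _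
      (φ₁ ≫ MultCyc.inv φ₂) (fun a => MultCyc.arcMap_comp_inv _ _ (by
        rw [h₁, h₂, MultCyc.arcMap_id])), Category.assoc, mp_comp, Category.assoc,
      MultCyc.inv_comp, Category.comp_id]
    rfl

theorem exists_presents_edge {W : MultCyc} {k : ℕ} (X : LGraph W k) {x y : X.gr.fl.pt}
    (hxy : X.gr.OnlyEdge x y) (hv : X.gr.ptV x ≠ X.gr.ptV y) : ∃ m, Presents O.ops X m := by
  have hp := hxy.perm hv
  obtain ⟨φ, e, hφ, hφ'⟩ := exists_edgeLabel X _ _ P hp (𝟙 _) (𝟙 _) rfl rfl ⟨x, rfl⟩ ⟨y, rfl⟩ hxy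
  have key : ∀ (v w : X.gr.Vert) (hp' : [v, w].Perm (ordering X.gr.Vert)) (u : (X.gr.legAt v).pt)
      (t : (X.gr.legAt w).pt) (_ : X.gr.OnlyEdge u.1 t.1) (ψ : merge _ _ u t ⟶ W)
      (e' : X.gr.genus v + X.gr.genus w = k)
      (_ : ∀ a, arcMap ψ (mergeArcLeft u t a) = X.gl.arc (X.gr.incl _ a))
      (_ : ∀ a, arcMap ψ (mergeArcRight u t a) = X.gl.arc (X.gr.incl _ a)),
      P.in₂ X.gr v w hp' (𝟙 _) (𝟙 _) rfl rfl ≫ inv (P.in₂ X.gr _ _ hp (𝟙 _) (𝟙 _) rfl rfl) ≫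
        O.comp (S := X.gr.legAt (X.gr.ptV x)) (T := X.gr.legAt (X.gr.ptV y)) ⟨x, rfl⟩ ⟨y, rfl⟩
          _ _ ≫ P.mp φ e = O.comp u t _ _ ≫ P.mp ψ e' := by
    intro v w hp' u t h ψ e' hψ hψ'
    rcases hxy.eq_or h with ⟨h1, h2⟩ | ⟨h1, h2⟩
    · obtain rfl : X.gr.ptV x = v := by rw [← h1]; exact u.2
      obtain rfl : X.gr.ptV y = w := by rw [← h2]; exact t.2
      obtain rfl : u = ⟨x, rfl⟩ := Subtype.ext h1
      obtain rfl : t = ⟨y, rfl⟩ := Subtype.ext h2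
      obtain rfl : ψ = φ := hom_ext_mergeArc (fun a => by rw [hφ, hψ, MultCyc.arcMap_id])
        (fun a => by rw [hφ', hψ', MultCyc.arcMap_id])
      rw [IsIso.hom_inv_id_assoc]
    · obtain rfl : X.gr.ptV y = v := by rw [← h1]; exact u.2
      obtain rfl : X.gr.ptV x = w := by rw [← h2]; exact t.2
      obtain rfl : u = ⟨y, rfl⟩ := Subtype.ext h1
      obtain rfl : t = ⟨x, rfl⟩ := Subtype.ext h2
      rw [P.in₂_swap hp hp', Category.assoc, IsIso.hom_inv_id_assoc, ← Category.assoc,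
        ← O.comp_symm (S := X.gr.legAt (X.gr.ptV y)) (T := X.gr.legAt (X.gr.ptV x)) ⟨y, rfl⟩
          ⟨x, rfl⟩ _ _ (ψ ≫ MultCyc.inv φ)
        (fun a => MultCyc.arcMap_comp_inv _ _ (by rw [hφ', hψ, MultCyc.arcMap_id]))
        (fun a => MultCyc.arcMap_comp_inv _ _ (by rw [hφ, hψ', MultCyc.arcMap_id])),
        Category.assoc, mp_comp, Category.assoc, MultCyc.inv_comp, Category.comp_id]
  refine ⟨inv (P.in₂ X.gr _ _ hp (𝟙 _) (𝟙 _) rfl rfl) ≫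
    O.comp (S := X.gr.legAt (X.gr.ptV x)) (T := X.gr.legAt (X.gr.ptV y)) ⟨x, rfl⟩ ⟨y, rfl⟩ _ _ ≫
      P.mp φ e,
    ?_, ?_, ?_⟩
  · intro S g h0
    rw [hxy.numEdges] at h0
    cases h0
  · rintro S T g h v w hp' ρ σ rfl rfl u t hX
    obtain ⟨φ₁, e₁, h₁, h₁'⟩ := exists_edgeLabel X _ _ P hp' ρ σ rfl rfl u t hX
    obtain ⟨φ₂, e₂, h₂, h₂'⟩ := exists_edgeLabel X _ _ P hp' (𝟙 _) (𝟙 _) rfl rfl (ρ.pt u) (σ.pt t)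
      hX
    refine ⟨φ₁, e₁, h₁, h₁', ?_⟩
    have h1 := P.in₂_comp hp' ρ (𝟙 _) σ (𝟙 _) rfl rfl rfl rfl
    rw [Category.comp_id, Category.comp_id] at h1
    rw [h1, Category.assoc, key v w hp' _ _ hX φ₂ e₂ (fun a => by rw [h₂, MultCyc.arcMap_id])
      (fun a => by rw [h₂', MultCyc.arcMap_id]), ← Category.assoc,
      ← O.comp_natural ρ σ u t _ _ (φ₁ ≫ MultCyc.inv φ₂)
        (fun a => MultCyc.arcMap_comp_inv _ _ (by rw [h₁, h₂, MultCyc.arcMap_id]))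
        (fun a => MultCyc.arcMap_comp_inv _ _ (by rw [h₁', h₂', MultCyc.arcMap_id])),
      Category.assoc, mp_comp, Category.assoc, MultCyc.inv_comp, Category.comp_id]
    rfl
  · intro S g v hv'
    exact absurd ((hv' _).trans (hv' _).symm) hv

theorem exists_presents_of_le_one {W : MultCyc} {k : ℕ} (X : LGraph W k)
    (hX : X.gr.numEdges ≤ 1) : ∃ m, Presents O.ops X m := by
  rcases Nat.le_one_iff_eq_zero_or_eq_one.1 hX with h0 | h1
  · exact exists_presents_star X h0
  · obtain ⟨x, y, hxy⟩ := Graph.exists_onlyEdge h1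
    by_cases hv : X.gr.ptV x = X.gr.ptV y
    · exact exists_presents_loop O X hxy hv
    · exact exists_presents_edge O X hxy hv

theorem presents_of_two_le {W : MultCyc} {k : ℕ} (X : LGraph W k) (hX : 2 ≤ X.gr.numEdges)
    (m : P.onGraph X.gr ⟶ P.ob W k) : Presents R X m where
  star h0 := by omega
  edge v w hp ρ σ e e' u t h := by have := h.numEdges; omega
  loop v hv ρ e u t hut h := by have := h.numEdges; omega

end NsModule

namespace Graph

variable {Γ Δ : Graph}

/-- A contraction either is an isomorphism or lowers the number of edges. -/
theorem Hom.numEdges_lt_or_iso (f : Γ ⟶ Δ) :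
    Δ.numEdges < Γ.numEdges ∨ ∃ F : Γ ≅ Δ, F.hom = f := by
  by_cases hf : Function.Surjective f.gl.emb
  · right
    obtain ⟨k, hk⟩ := exists_factor f (𝟙 Γ) fun x _ => hf x
    refine ⟨⟨f, k, hk, hom_ext_arc (fun a => ?_) fun y => ?_⟩, rfl⟩
    · obtain ⟨a, rfl⟩ := f.gl.arc_surjective a
      rw [← comp_arc, ← Category.assoc, hk, Category.id_comp, id_arc]
    · refine f.gl.emb_injective ?_
      have h := congrArg (fun z : Γ ⟶ Γ => z.gl.emb (f.gl.emb y)) hk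
      exact h
  · left
    have h1 := Γ.two_mul_numEdges
    have h2 := Δ.two_mul_numEdges
    simp only [Function.Surjective, not_forall] at hf
    obtain ⟨x, hx⟩ := hf
    have hx' : Γ.inv x ≠ x := fun h => hx (f.mem_of_leg x h)
    have hinv : ∀ y, Γ.inv (f.gl.emb y) = f.gl.emb y ↔ Δ.inv y = y := fun y => by
      rw [f.inv_emb]
      exact f.gl.emb_injective.eq_iff
    have h3 : Nat.card {y // Δ.inv y ≠ y} < Nat.card {x // Γ.inv x ≠ x} := by
      let i : {y // Δ.inv y ≠ y} → {x // Γ.inv x ≠ x} :=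
        fun y => ⟨f.gl.emb y.1, fun h => y.2 ((hinv _).1 h)⟩
      have hi : Function.Injective i := fun y y' h =>
        Subtype.ext (f.gl.emb_injective (congrArg Subtype.val h))
      refine lt_of_le_of_ne (Nat.card_le_card_of_injective i hi) fun hc => ?_
      obtain ⟨y, hy⟩ := (Nat.bijective_iff_injective_and_card i).2 ⟨hi, hc⟩ |>.2 ⟨x, hx'⟩
      exact hx ⟨y.1, congrArg Subtype.val hy⟩
    omega

theorem Hom.numEdges_le (f : Γ ⟶ Δ) : Δ.numEdges ≤ Γ.numEdges := by
  obtain ⟨v⟩ : Nonempty Δ.Vert := Δ.fl.nonempty.map Δ.arcV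
  exact (Nat.le_add_left _ _).trans (numEdges_fiber_add_le f.toPreHom v)

theorem exists_edge (h : Γ.numEdges ≠ 0) : ∃ x, Γ.inv x ≠ x := by
  by_contra h'
  push Not at h'
  exact h ((numEdges_eq_zero_iff _).2 h')

end Graph

/-- The contraction of all edges except for one. -/
theorem LGraph.exists_oneEdge {S : MultCyc} {g : ℕ} (X : LGraph S g) {x : X.gr.fl.pt}
    (hx : X.gr.inv x ≠ x) : ∃ (Y : LGraph S g) (f : X ⟶ Y), Y.gr.numEdges = 1 ∧
      ∀ z, z ∈ Set.range f.hom.gl.emb ↔ X.gr.inv z = z ∨ z = x ∨ z = X.gr.inv x := by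
  obtain ⟨Y, f, hf⟩ := X.exists_contraction
    (fun z => X.gr.inv z ≠ z ∧ z ≠ x ∧ z ≠ X.gr.inv x)
    (fun z ⟨h1, h2, h3⟩ => ⟨fun h => h1 (X.gr.inv.injective h),
      fun h => h3 (by rw [← h, X.gr.inv_inv]), fun h => h2 (X.gr.inv.injective h)⟩)
    (fun z h => h.1)
  have hf' : ∀ z, z ∈ Set.range f.hom.gl.emb ↔ X.gr.inv z = z ∨ z = x ∨ z = X.gr.inv x :=
    fun z => (hf z).trans (by tauto)
  refine ⟨Y, f, ?_, hf'⟩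
  obtain ⟨y, hy⟩ := (hf' x).2 (Or.inr (Or.inl rfl))
  have hy' : f.hom.gl.emb (Y.gr.inv y) = X.gr.inv x := by rw [← f.hom.inv_emb, hy]
  refine Graph.OnlyEdge.numEdges (x := y) (y := Y.gr.inv y) ⟨fun h => hx ?_, rfl, fun z hz => ?_⟩
  · rw [← hy', ← h, hy]
  · rcases (hf' _).1 ⟨z, rfl⟩ with h | h | h
    · rw [f.hom.inv_emb] at h
      exact (hz (f.hom.gl.emb_injective h)).elim
    · exact Or.inl (f.hom.gl.emb_injective (h.trans hy.symm))
    · exact Or.inr (f.hom.gl.emb_injective (h.trans hy'.symm))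

/-- An isomorphism of graphs that is compatible with the labels. -/
def LGraph.isoOfGr {S : MultCyc} {g : ℕ} {X Y : LGraph S g} (F : X.gr ≅ Y.gr)
    (hl : ∀ a, Y.gl.arc (F.hom.gl.arc a) = X.gl.arc a) : X ≅ Y where
  hom := ⟨F.hom, hl⟩
  inv := ⟨F.inv, fun a => by
    obtain ⟨a, rfl⟩ := F.hom.gl.arc_surjective a
    rw [hl]
    refine congrArg X.gl.arc ?_
    exact (Graph.comp_arc F.hom F.inv a).symm.trans
      ((congrArg (fun k : X.gr ⟶ X.gr => k.gl.arc a) F.hom_inv_id).trans (Graph.id_arc a))⟩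
  hom_inv_id := LGraph.Hom.ext F.hom_inv_id
  inv_hom_id := LGraph.Hom.ext F.inv_hom_id

namespace NsModule

variable {M : Type u} [Category.{v} M] [MonoidalCategory M] [SymmetricCategory M] {P : NsModule M}
  {α β : P.ContractionFamily} {R : Ops P} {n : ℕ}

variable (P) in
theorem onIso_refl (Γ : Graph) : P.onIso (Iso.refl Γ) = 𝟙 (P.onGraph Γ) := by
  refine Eq.trans ?_ (uMap_id (P.factor Γ))
  refine congrArg (uMap (Y := P.factor Γ) (Equiv.refl Γ.Vert)) (funext fun w => ?_)
  exact P.mp_id _ _ _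

theorem vertexwise_congr {Γ Δ : Graph} (f : Γ ⟶ Δ)
    (h : ∀ v, α _ _ (LGraph.fiber f v) = β _ _ (LGraph.fiber f v)) :
    P.vertexwise α f = P.vertexwise β f := by
  rw [vertexwise_eq, vertexwise_eq]
  refine congrArg (uFib (X := P.factor Γ) (Y := P.factor Δ) f.vert) (funext fun v => ?_)
  unfold onFiber
  rw [h v]

/-- The value of `α` on a graph with at most `n` edges can be computed by first contracting all
edges but one. -/
def FactorsUpTo (α : P.ContractionFamily) (n : ℕ) : Prop :=
  ∀ {S : MultCyc} {g : ℕ} {X Y : LGraph S g} (h : X ⟶ Y), X.gr.numEdges ≤ n →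
    Y.gr.numEdges = 1 → α S g X = P.vertexwise α h.hom ≫ α S g Y

theorem FactorsUpTo.factor (h1 : FactorsUpTo α n) (hn : P.NaturalUpTo α n) (hs : P.StarUnit α)
    {S : MultCyc} {g : ℕ} {X Y : LGraph S g} (h : X ⟶ Y) (hX : X.gr.numEdges ≤ n) :
    α S g X = P.vertexwise α h.hom ≫ α S g Y := by
  generalize hl : Y.gr.numEdges = l
  induction l using Nat.strong_induction_on generalizing S g X Y with | _ l ih => ?_
  rcases Nat.eq_zero_or_pos l with rfl | hpos
  · exact factor_of_numEdges_eq_zero hn hs h hX hl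
  · obtain ⟨x, hx⟩ := Graph.exists_edge (Γ := Y.gr) (by omega)
    obtain ⟨Y₁, k, hY₁, -⟩ := Y.exists_oneEdge hx
    have hY : Y.gr.numEdges ≤ n := (Graph.Hom.numEdges_le h.hom).trans hX
    rw [h1 (h ≫ k) hX hY₁, h1 k hY hY₁, LGraph.comp_hom, ← Category.assoc]
    refine congrArg (fun z => z ≫ α S g Y₁) ?_
    refine vertexwise_comp hn h.hom k.hom (fun v => ?_) fun u => ?_
    · exact (Nat.le_add_right _ _).trans
        ((Graph.numEdges_fiber_add_le h.hom.toPreHom v).trans hX)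
    · have h2 := Graph.numEdges_fiber_add_le k.hom.toPreHom u
      have h3 := Graph.numEdges_fiber_add_le (h.hom ≫ k.hom).toPreHom u
      exact ih _ (by
        show (k.hom.toPreHom.fiber u).numEdges < l
        omega) (LGraph.restrict h.hom k.hom u)
        ((Nat.le_add_right _ _).trans (h3.trans hX)) rfl

/-- `α` satisfies all conditions on a family of contractions as far as they only concern graphs with
at most `n` edges. -/
structure Good (R : Ops P) (α : P.ContractionFamily) (n : ℕ) : Prop where
  eval : Evaluates R α
  nat : P.NaturalUpTo α n
  one : FactorsUpTo α n

namespace Good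

theorem factor (hG : Good R α n) {S : MultCyc} {g : ℕ} {X Y : LGraph S g} (h : X ⟶ Y)
    (hX : X.gr.numEdges ≤ n) : α S g X = P.vertexwise α h.hom ≫ α S g Y :=
  FactorsUpTo.factor hG.one hG.nat hG.eval.starUnit h hX

theorem comp (hG : Good R α n) {Γ Δ Λ : Graph} (f : Γ ⟶ Δ) (k : Δ ⟶ Λ)
    (h : Γ.numEdges ≤ n + Λ.numEdges) :
    P.vertexwise α (f ≫ k) = P.vertexwise α f ≫ P.vertexwise α k := by
  refine vertexwise_comp hG.nat f k (fun v => ?_) fun u => hG.factor _ ?_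
  · have h1 := Graph.numEdges_fiber_add_le f.toPreHom v
    have h2 := Graph.Hom.numEdges_le k
    show (f.toPreHom.fiber v).numEdges ≤ n
    omega
  · have h1 := Graph.numEdges_fiber_add_le (f ≫ k).toPreHom u
    show ((f ≫ k).toPreHom.fiber u).numEdges ≤ n
    omega

theorem iso (hG : Good R α n) {Γ Δ : Graph} (F : Γ ≅ Δ) :
    P.vertexwise α F.hom = P.onIso F := vertexwise_iso hG.nat hG.eval.starUnit F

theorem unique (hG : Good R α n) (hG' : Good R β n) {S : MultCyc} {g : ℕ} (X : LGraph S g)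
    (hX : X.gr.numEdges ≤ n) : α S g X = β S g X := by
  generalize hl : X.gr.numEdges = l
  induction l using Nat.strong_induction_on generalizing S g X with | _ l ih => ?_
  rcases Nat.lt_or_ge 1 l with h1 | h1
  · obtain ⟨x, hx⟩ := Graph.exists_edge (Γ := X.gr) (by omega)
    obtain ⟨Y, k, hY, -⟩ := X.exists_oneEdge hx
    rw [hG.one k hX hY, hG'.one k hX hY, hG.eval.unique hG'.eval Y (by omega)]
    refine congrArg (fun z => z ≫ β S g Y) (vertexwise_congr _ fun v => ?_)
    have h2 := Graph.numEdges_fiber_add_le k.hom.toPreHom v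
    refine ih (k.hom.toPreHom.fiber v).numEdges (by omega) _ ?_ rfl
    show (k.hom.toPreHom.fiber v).numEdges ≤ n
    omega
  · exact hG.eval.unique hG'.eval X (by omega)

theorem mono (hG : Good R α n) {m : ℕ} (h : m ≤ n) : Good R α m where
  eval := hG.eval
  nat X Y F φ e hX hφ := hG.nat X Y F φ e (hX.trans h) hφ
  one k hX hY := hG.one k (hX.trans h) hY

theorem congr (hG : Good R α n) (hn : 1 ≤ n)
    (h : ∀ {S : MultCyc} {g : ℕ} (X : LGraph S g), X.gr.numEdges ≤ n → β S g X = α S g X) :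
    Good R β n where
  eval := evaluates_iff.2 fun S g X => by
    rcases Nat.lt_or_ge n X.gr.numEdges with h1 | h1
    · exact presents_of_two_le X (by omega) _
    · rw [h X h1]
      exact evaluates_iff.1 hG.eval S g X
  nat X Y F φ e hX hφ := by
    rw [h X hX, h Y ((Graph.Hom.numEdges_le F.hom).trans hX)]
    exact hG.nat X Y F φ e hX hφ
  one {S g X Y} k hX hY := by
    rw [h X hX, h Y (by omega), hG.one k hX hY]
    refine congrArg (fun z => z ≫ α S g Y) (vertexwise_congr _ fun v => (h _ ?_).symm)
    have h2 := Graph.numEdges_fiber_add_le k.hom.toPreHom v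
    show (k.hom.toPreHom.fiber v).numEdges ≤ n
    omega

end Good

end NsModule

namespace NsModularOperad

open NsModule

variable {M : Type u} [Category.{v} M] [MonoidalCategory M] [SymmetricCategory M] {P : NsModule M}
  {O : NsModularOperad P} {α β : P.ContractionFamily}

namespace IsContraction

variable (h : O.IsContraction α)

include h

theorem natural (n : ℕ) : P.NaturalUpTo α n := by
  intro S T g h' X Y F φ e _ hφ
  subst e
  exact (h.iso (LGraph.isoOfGr (X := X.relabel φ) F fun a =>
    (hφ a).symm.trans (X.relabel_arc φ a).symm)).trans (h.relabel X φ)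

theorem evaluates : Evaluates O.ops α :=
  evaluates_of_natural (h.natural 1) le_rfl h.star O.ops h.edge h.loop

theorem factors (n : ℕ) : FactorsUpTo α n := by
  intro S g X Y k hX hY
  -- transport along an isomorphism with a standard graph with one edge
  have key : ∀ {T : MultCyc} {g' : ℕ} (E : LGraph T g') (F : E.gr ≅ Y.gr)
      (_ : ∀ (X' : LGraph T g') (f : X' ⟶ E), α T g' X' = P.vertexwise α f.hom ≫ α T g' E),
      α S g X = P.vertexwise α k.hom ≫ α S g Y := by
    intro T g' E F hE
    obtain ⟨e, φ, hφ⟩ := E.exists_label Y F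
    subst e
    have hinv : ∀ a, F.hom.gl.arc (F.inv.gl.arc a) = a := fun a =>
      (Graph.comp_arc F.inv F.hom a).symm.trans
        ((congrArg (fun k : Y.gr ⟶ Y.gr => k.gl.arc a) F.inv_hom_id).trans (Graph.id_arc a))
    let f : X.relabel (MultCyc.inv φ) ⟶ E := ⟨k.hom ≫ F.inv, fun a => by
      refine MultCyc.arcMap_injective φ ?_
      rw [hφ]
      refine (congrArg (fun z => Y.gl.arc (F.hom.gl.arc z)) (Graph.comp_arc k.hom F.inv a)).trans ?_
      refine (congrArg Y.gl.arc (hinv _)).trans ((k.label a).trans ?_)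
      refine Eq.trans ?_ (congrArg (arcMap φ) (X.relabel_arc (MultCyc.inv φ) a).symm)
      rw [← MultCyc.arcMap_comp, MultCyc.inv_comp, MultCyc.arcMap_id]⟩
    have h1 := hE _ f
    rw [h.relabel] at h1
    have h2 : P.vertexwise α (k.hom ≫ F.inv) = P.vertexwise α k.hom ≫ P.onIso F.symm := by
      rw [← vertexwise_iso (h.natural n) h.star F.symm]
      refine vertexwise_comp (h.natural n) k.hom F.inv (fun v => ?_) fun u => ?_
      · exact (Nat.le_add_right _ _).trans
          ((Graph.numEdges_fiber_add_le k.hom.toPreHom v).trans hX)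
      · refine factor_of_numEdges_eq_zero (h.natural n) h.star _ ?_ ?_
        · exact (Nat.le_add_right _ _).trans
            ((Graph.numEdges_fiber_add_le (k.hom ≫ F.inv).toPreHom u).trans hX)
        · refine (Graph.numEdges_eq_zero_iff _).2 fun x => Subtype.ext ?_
          exact F.inv.toPreHom.cutInv_of_mem ⟨_, inv_emb_hom_emb F x.1⟩
    have h3 := h.natural 1 E Y F φ rfl (by
      have := Graph.Hom.numEdges_le F.inv
      omega) hφ
    have h4 : P.onIso F.symm ≫ P.onIso F = 𝟙 _ := by
      rw [onIso_comp, Iso.symm_self_id, onIso_refl]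
    have h5 : α T g' E = P.onIso F ≫ α S g' Y ≫ P.mp (MultCyc.inv φ) rfl := by
      rw [← Category.assoc, h3, Category.assoc, mp_comp, MultCyc.comp_inv, mp_id, Category.comp_id]
    rw [h5, ← Category.assoc (P.onIso F)] at h1
    have h6 : α S g' X ≫ P.mp (MultCyc.inv φ) rfl =
        (P.vertexwise α k.hom ≫ α S g' Y) ≫ P.mp (MultCyc.inv φ) rfl := by
      refine h1.trans ((congrArg (fun z => z ≫ (P.onIso F ≫ α S g' Y) ≫
        P.mp (MultCyc.inv φ) rfl) h2).trans ?_)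
      have h7 : ∀ {A B C D : M} (p : A ⟶ B) (q : B ⟶ C) (r : C ⟶ B) (s : B ⟶ D) {E : M}
          (t : D ⟶ E), q ≫ r = 𝟙 B → (p ≫ q) ≫ (r ≫ s) ≫ t = (p ≫ s) ≫ t := by
        intro A B C D p q r s E t hqr
        rw [Category.assoc, Category.assoc, ← Category.assoc q, hqr, Category.id_comp,
          Category.assoc]
      exact h7 _ _ _ _ _ h4
    exact (cancel_mono _).1 h6
  obtain ⟨x, y, hxy⟩ := Graph.exists_onlyEdge hY
  by_cases hv : Y.gr.ptV x = Y.gr.ptV y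
  · have hv1 := hxy.eq_vert hv
    have hne : (⟨x, rfl⟩ : (Y.gr.legAt (Y.gr.ptV x)).pt) ≠ ⟨y, hv.symm⟩ :=
      fun e => hxy.1 (congrArg Subtype.val e)
    obtain ⟨F, -⟩ := exists_loopIso (P := P) Y.gr _ hv1 (𝟙 _) rfl ⟨x, rfl⟩ ⟨y, hv.symm⟩ hne hxy
    exact key _ F (h.selfGraft _ _ _ _)
  · have hp := hxy.perm hv
    obtain ⟨F, -⟩ := exists_edgeIso (P := P) Y.gr _ _ hp (𝟙 _) (𝟙 _) rfl rfl ⟨x, rfl⟩ ⟨y, rfl⟩ hxy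
    exact key _ F (h.graft _ _ _ _)

theorem good (n : ℕ) : Good O.ops α n := ⟨h.evaluates, h.natural n, h.factors n⟩

end IsContraction

theorem IsContraction.unique (h : O.IsContraction α) (h' : O.IsContraction β) : α = β :=
  funext fun S => funext fun g => funext fun X =>
    (h.good X.gr.numEdges).unique (h'.good X.gr.numEdges) X le_rfl

/-- A family that satisfies all conditions for graphs with a bounded number of edges is the family
of contractions. -/
theorem isContraction_of_good (h : ∀ n, 1 ≤ n → Good O.ops α n) : O.IsContraction α where
  iso {S g X Y} f := by
    have h1 := (h (X.gr.numEdges + 1) (by omega)).nat X Y (LGraph.isoGr f) (𝟙 S) rfl (by omega)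
      fun a => by rw [MultCyc.arcMap_id]; exact (f.hom.label a).symm
    rw [h1, mp_id, Category.comp_id]
  relabel {_ T g} X f := by
    have h1 := (h (X.gr.numEdges + 1) (by omega)).nat X (X.relabel f) (Iso.refl _) f rfl (by omega)
      fun a => (X.relabel_arc f a).symm.trans
        (congrArg (X.relabel f).gl.arc (Graph.id_arc a).symm)
    refine Eq.trans (Category.id_comp _).symm (Eq.trans ?_ h1)
    exact congrArg (fun z => z ≫ α T g (X.relabel f)) (P.onIso_refl X.gr).symm
  star S g := (h 1 le_rfl).eval.starUnit S g
  edge {S T} u v g h' := by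
    obtain ⟨φ, e, h1, h2, h3⟩ := (h 1 le_rfl).eval.edge (edgeGraph u v g h') _ _ perm_ordering_bool
      (edgeLegLeft u v g h') (edgeLegRight u v g h') rfl rfl u v (edgeGraph_onlyEdge u v g h')
    have h4 : φ = 𝟙 _ := by
      refine hom_ext_mergeArc (fun a => ?_) fun a => ?_
      · rw [MultCyc.arcMap_id, h1, ← edgeGraph_arc_left u v g h']
        rcases a with a | a <;> rfl
      · rw [MultCyc.arcMap_id, h2, ← edgeGraph_arc_right u v g h']
        rcases a with a | a <;> rfl
    subst h4
    rw [toEdge_eq]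
    refine h3.trans (Eq.trans ?_ (Category.comp_id _))
    exact congrArg (fun z => _ ≫ z) (P.mp_id _ _ _)
  loop {S} u v huv g := by
    obtain ⟨φ, e, h1, h3⟩ := (h 1 le_rfl).eval.loop (loopGraph u v huv g) () (fun _ => rfl)
      (corollaLeg S g) rfl u v huv (loopGraph_onlyEdge u v huv g)
    have h4 : φ = 𝟙 _ := by
      refine hom_ext_cutArc fun a => ?_
      rw [MultCyc.arcMap_id, h1, ← loopGraph_arc u v huv g]
      rcases a with a | a <;> rfl
    subst h4
    rw [toLoop_eq]
    refine h3.trans (Eq.trans ?_ (Category.comp_id _))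
    exact congrArg (fun z => _ ≫ z) (P.mp_id _ _ _)
  graft u v g h' X f := (h (X.gr.numEdges + 1) (by omega)).factor f (by omega)
  selfGraft u v huv g X f := (h (X.gr.numEdges + 1) (by omega)).factor f (by omega)

end NsModularOperad

theorem Graph.Hom.mem_range_iff {Γ Δ : Graph} (f : Γ ⟶ Δ) {x y : Δ.fl.pt} (h : Δ.OnlyEdge x y)
    (z : Γ.fl.pt) :
    z ∈ Set.range f.gl.emb ↔ Γ.inv z = z ∨ z = f.gl.emb x ∨ z = f.gl.emb y := by
  constructor
  · rintro ⟨z, rfl⟩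
    by_cases hz : Δ.inv z = z
    · exact Or.inl (by rw [f.inv_emb, hz])
    · exact Or.inr ((h.2.2 z hz).imp (congrArg _) (congrArg _))
  · rintro (hz | rfl | rfl)
    exacts [f.mem_of_leg _ hz, ⟨_, rfl⟩, ⟨_, rfl⟩]

namespace NsModule

variable {M : Type u} [Category.{v} M] [MonoidalCategory M] [SymmetricCategory M] {P : NsModule M}
  {O : NsModularOperad P} {α : P.ContractionFamily} {n : ℕ}

theorem nonempty_hom (O : NsModularOperad P) {S : MultCyc} {g : ℕ} (X : LGraph S g) :
    Nonempty (P.onGraph X.gr ⟶ P.ob S g) := by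
  generalize hl : X.gr.numEdges = l
  induction l using Nat.strong_induction_on generalizing S g X with | _ l ih => ?_
  rcases Nat.lt_or_ge 1 l with h1 | h1
  · obtain ⟨x, hx⟩ := Graph.exists_edge (Γ := X.gr) (by omega)
    obtain ⟨Y, q, hY, -⟩ := X.exists_oneEdge hx
    obtain ⟨m, -⟩ := exists_presents_of_le_one O Y (by omega)
    have h2 : ∀ v, Nonempty (P.onGraph (LGraph.fiber q.hom v).gr ⟶ P.factor Y.gr v) := fun v => by
      have h3 := Graph.numEdges_fiber_add_le q.hom.toPreHom v
      exact ih (q.hom.toPreHom.fiber v).numEdges (by omega) (LGraph.fiber q.hom v) rfl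
    exact ⟨uFib (X := P.factor X.gr) (Y := P.factor Y.gr) q.hom.vert (fun v =>
      uMap (Y := P.factor (LGraph.fiber q.hom v).gr) (Equiv.refl _)
        (fun w => P.mp (fiberLeg q.hom v w) rfl) ≫ (h2 v).some) ≫ m⟩
  · exact (exists_presents_of_le_one O X (by omega)).nonempty

theorem exists_evaluates (O : NsModularOperad P) : ∃ α, Evaluates O.ops α := by
  have h : ∀ (S : MultCyc) (g : ℕ) (X : LGraph S g), ∃ m, Presents O.ops X m := fun S g X => by
    rcases Nat.lt_or_ge 1 X.gr.numEdges with h1 | h1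
    · exact ⟨(nonempty_hom O X).some, presents_of_two_le X h1 _⟩
    · exact exists_presents_of_le_one O X h1
  choose α hα using h
  exact ⟨α, evaluates_iff.2 hα⟩

theorem Evaluates.good_one (h : Evaluates O.ops α) : Good O.ops α 1 := by
  refine ⟨h, h.natural, fun {S g X Y} k hX hY => ?_⟩
  rcases Graph.Hom.numEdges_lt_or_iso k.hom with h1 | ⟨F, hF⟩
  · omega
  · rw [← hF, vertexwise_iso h.natural h.starUnit, h.natural X Y F (𝟙 S) rfl hX, mp_id,
      Category.comp_id]
    intro a
    rw [hF, MultCyc.arcMap_id]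
    exact (k.label a).symm

theorem Good.value_eq (hG : Good O.ops α n) (hn : 1 ≤ n) {S : MultCyc} {g : ℕ}
    {X Y Y' : LGraph S g} (hX : X.gr.numEdges ≤ n + 1) (q : X ⟶ Y) (q' : X ⟶ Y')
    (hY : Y.gr.numEdges = 1) (hY' : Y'.gr.numEdges = 1) :
    P.vertexwise α q.hom ≫ α S g Y = P.vertexwise α q'.hom ≫ α S g Y' := by
  obtain ⟨y₁, y₂, hy⟩ := Graph.exists_onlyEdge hY
  obtain ⟨z₁, z₂, hz⟩ := Graph.exists_onlyEdge hY'
  have hr := q.hom.mem_range_iff hy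
  have hr' := q'.hom.mem_range_iff hz
  have hinv : X.gr.inv (q.hom.gl.emb y₁) = q.hom.gl.emb y₂ := by rw [q.hom.inv_emb, hy.2.1]
  have hinv' : X.gr.inv (q'.hom.gl.emb z₁) = q'.hom.gl.emb z₂ := by rw [q'.hom.inv_emb, hz.2.1]
  have hne : q.hom.gl.emb y₁ ≠ q.hom.gl.emb y₂ := q.hom.gl.emb_injective.ne hy.1
  have hne' : q'.hom.gl.emb z₁ ≠ q'.hom.gl.emb z₂ := q'.hom.gl.emb_injective.ne hz.1
  generalize q.hom.gl.emb y₁ = a at hr hinv hne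
  generalize q.hom.gl.emb y₂ = b at hr hinv hne
  generalize q'.hom.gl.emb z₁ = c at hr' hinv' hne'
  generalize q'.hom.gl.emb z₂ = d at hr' hinv' hne'
  have hinv₂ : X.gr.inv b = a := by rw [← hinv, X.gr.inv_inv]
  have hinv₂' : X.gr.inv d = c := by rw [← hinv', X.gr.inv_inv]
  by_cases hc : c = a ∨ c = b
  · obtain ⟨k, rfl⟩ := LGraph.exists_factor q q' (fun z h => by
      refine (hr z).2 (((hr' z).1 h).imp_right ?_)
      rcases hc with rfl | rfl
      · rw [hinv] at hinv'
        rw [hinv']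
        exact id
      · rw [hinv₂] at hinv'
        rw [hinv']
        exact Or.symm)
    rw [LGraph.comp_hom, hG.comp _ _ (by omega), Category.assoc, ← hG.one k (by omega) hY']
  · rw [not_or] at hc
    have hda : d ≠ a := fun h => hc.2 (by rw [← hinv₂', h, hinv])
    have hdb : d ≠ b := fun h => hc.1 (by rw [← hinv₂', h, hinv₂])
    obtain ⟨Z, p, hp⟩ := X.exists_contraction
      (fun z => X.gr.inv z ≠ z ∧ z ≠ a ∧ z ≠ b ∧ z ≠ c ∧ z ≠ d)
      (fun z ⟨h1, h2, h3, h4, h5⟩ => ⟨fun h => h1 (X.gr.inv.injective h),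
        fun h => h3 (by rw [← hinv, ← h, X.gr.inv_inv]),
        fun h => h2 (by rw [← hinv₂, ← h, X.gr.inv_inv]),
        fun h => h5 (by rw [← hinv', ← h, X.gr.inv_inv]),
        fun h => h4 (by rw [← hinv₂', ← h, X.gr.inv_inv])⟩)
      (fun z h => h.1)
    obtain ⟨k, hk⟩ := LGraph.exists_factor p q (fun z h => (hp z).2 (by
      have := (hr z).1 h
      tauto))
    obtain ⟨k', hk'⟩ := LGraph.exists_factor p q' (fun z h => (hp z).2 (by
      have := (hr' z).1 h
      tauto))
    obtain ⟨a', ha⟩ := (hp a).2 (by tauto)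
    obtain ⟨b', hb⟩ := (hp b).2 (by tauto)
    obtain ⟨c', hc'⟩ := (hp c).2 (by tauto)
    obtain ⟨d', hd⟩ := (hp d).2 (by tauto)
    have hpi := p.hom.gl.emb_injective
    have hmem : ∀ {W : LGraph S g} (f : X ⟶ W) (r : Z ⟶ W) (_ : p ≫ r = f) (z : Z.gr.fl.pt),
        z ∈ Set.range r.hom.gl.emb ↔ p.hom.gl.emb z ∈ Set.range f.hom.gl.emb := by
      rintro W _ r rfl z
      constructor
      · rintro ⟨w, rfl⟩
        exact ⟨w, rfl⟩
      · rintro ⟨w, hw⟩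
        exact ⟨w, hpi hw⟩
    have hlegs : ∀ z, Z.gr.inv z = z ∨ z = a' ∨ z = b' ∨ z = c' ∨ z = d' := fun z => by
      have h1 := (hp _).1 ⟨z, rfl⟩
      rw [p.hom.inv_emb, ← ha, ← hb, ← hc', ← hd, hpi.eq_iff.ne, hpi.eq_iff.ne, hpi.eq_iff.ne,
        hpi.eq_iff.ne, hpi.eq_iff.ne] at h1
      tauto
    subst ha hb hc' hd
    rw [p.hom.inv_emb] at hinv hinv₂ hinv' hinv₂'
    have i1 := hpi hinv
    have i2 := hpi hinv₂
    have i3 := hpi hinv'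
    have i4 := hpi hinv₂'
    have e1 : a' ≠ b' := fun h => hne (h ▸ rfl)
    have e2 : c' ≠ d' := fun h => hne' (h ▸ rfl)
    have e3 : a' ≠ c' := fun h => hc.1 (h ▸ rfl)
    have e4 : b' ≠ c' := fun h => hc.2 (h ▸ rfl)
    have e5 : a' ≠ d' := fun h => hda (h ▸ rfl)
    have e6 : b' ≠ d' := fun h => hdb (h ▸ rfl)
    have hZ : Z.gr.TwoEdges a' b' c' d' :=
      { ab := e1, cd := e2, ac := e3, ad := e5, inv_a := i1, inv_c := i3,
        all := fun z hz => (hlegs z).resolve_left hz }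
    have hkc : Graph.Hom.Contracts k.hom c' d' := fun z => by
      rw [hmem q k hk z, hr, p.hom.inv_emb, hpi.eq_iff, hpi.eq_iff, hpi.eq_iff]
      refine ⟨fun h => ?_, ?_⟩
      · rcases hlegs z with h1 | h1 | h1 | h1
        exacts [absurd (Or.inl h1) h, absurd (Or.inr (Or.inl h1)) h, absurd (Or.inr (Or.inr h1)) h,
          h1]
      · rintro (rfl | rfl) (h | h | h)
        exacts [e2 (h.symm.trans i3), e3 h.symm, e4 h.symm, e2 (i4.symm.trans h), e5 h.symm,
          e6 h.symm]
    have hkc' : Graph.Hom.Contracts k'.hom a' b' := fun z => by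
      rw [hmem q' k' hk' z, hr', p.hom.inv_emb, hpi.eq_iff, hpi.eq_iff, hpi.eq_iff]
      refine ⟨fun h => ?_, ?_⟩
      · rcases hlegs z with h1 | h1 | h1 | h1 | h1
        exacts [absurd (Or.inl h1) h, Or.inl h1, Or.inr h1, absurd (Or.inr (Or.inl h1)) h,
          absurd (Or.inr (Or.inr h1)) h]
      · rintro (rfl | rfl) (h | h | h)
        exacts [e1 (h.symm.trans i1), e3 h, e5 h, e1 (i2.symm.trans h), e4 h, e6 h]
    rw [← hk, ← hk', LGraph.comp_hom, LGraph.comp_hom, hG.comp _ _ (by omega),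
      hG.comp _ _ (by omega), Category.assoc, Category.assoc,
      vertexwise_eq_of_twoEdges hG.eval hZ hkc hkc']

theorem Good.exists_succ (hG : Good O.ops α n) (hn : 1 ≤ n) : ∃ β, Good O.ops β (n + 1) := by
  have hq : ∀ (S : MultCyc) (g : ℕ) (X : LGraph S g), ∃ m : P.onGraph X.gr ⟶ P.ob S g,
      (X.gr.numEdges ≤ n → m = α S g X) ∧ (X.gr.numEdges = n + 1 → ∀ {Y : LGraph S g} (q : X ⟶ Y),
        Y.gr.numEdges = 1 → m = P.vertexwise α q.hom ≫ α S g Y) := fun S g X => by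
    by_cases h : X.gr.numEdges = n + 1
    · obtain ⟨x, hx⟩ := Graph.exists_edge (Γ := X.gr) (by omega)
      obtain ⟨Y, q, hY, -⟩ := X.exists_oneEdge hx
      exact ⟨P.vertexwise α q.hom ≫ α S g Y, fun h' => by omega, fun _ Y' q' hY' =>
        hG.value_eq hn h.le q q' hY hY'⟩
    · exact ⟨α S g X, fun _ => rfl, fun h' => absurd h' h⟩
  choose β hβ hβ' using hq
  refine ⟨β, evaluates_iff.2 fun S g X => ?_, fun {S T g h} X Y F φ e hX hφ => ?_,
    fun {S g X Y} k hX hY => ?_⟩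
  · rcases Nat.lt_or_ge n X.gr.numEdges with h1 | h1
    · exact presents_of_two_le X (by omega) _
    · rw [hβ _ _ _ h1]
      exact evaluates_iff.1 hG.eval S g X
  · subst e
    have h1 := Graph.Hom.numEdges_le F.hom
    have h2 := Graph.Hom.numEdges_le F.inv
    rcases Nat.lt_or_ge n X.gr.numEdges with h3 | h3
    · obtain ⟨y, hy⟩ := Graph.exists_edge (Γ := Y.gr) (by omega)
      obtain ⟨Z, q, hZ, -⟩ := Y.exists_oneEdge hy
      have hZ' : (Z.relabel (MultCyc.inv φ)).gr.numEdges = 1 := hZ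
      let q' : X ⟶ Z.relabel (MultCyc.inv φ) := ⟨F.hom ≫ q.hom, fun a => by
        refine (Z.relabel_arc _ _).trans ?_
        refine MultCyc.arcMap_injective φ ?_
        rw [hφ, ← MultCyc.arcMap_comp, MultCyc.inv_comp, MultCyc.arcMap_id]
        exact (congrArg Z.gl.arc (Graph.comp_arc F.hom q.hom a)).trans (q.label _)⟩
      have h4 := hG.nat (Z.relabel (MultCyc.inv φ)) Z (Iso.refl _) φ rfl (by omega) (fun a => by
        refine (congrArg (arcMap φ) (Z.relabel_arc (MultCyc.inv φ) a)).trans ?_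
        rw [← MultCyc.arcMap_comp, MultCyc.inv_comp, MultCyc.arcMap_id]
        exact congrArg Z.gl.arc (Graph.id_arc a).symm)
      rw [hβ' _ _ Y (by omega) q hZ, hβ' _ _ X (by omega) q' hZ']
      have h5 := hG.comp F.hom q.hom (by omega)
      rw [hG.iso] at h5
      refine (Category.assoc _ _ _).symm.trans ((congrArg (fun z => z ≫ α T g Z) h5.symm).trans ?_)
      refine Eq.trans ?_ (Category.assoc _ _ _).symm
      refine congrArg (fun z => P.vertexwise α (F.hom ≫ q.hom) ≫ z) (Eq.trans ?_ h4)
      refine (Category.id_comp _).symm.trans ?_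
      exact congrArg (fun z => z ≫ α T g Z) (P.onIso_refl Z.gr).symm
    · rw [hβ _ _ _ h3, hβ _ _ _ (by omega)]
      exact hG.nat X Y F φ rfl h3 hφ
  · have h1 : P.vertexwise β k.hom = P.vertexwise α k.hom := vertexwise_congr _ fun v => by
      have h2 := Graph.numEdges_fiber_add_le k.hom.toPreHom v
      refine hβ _ _ _ ?_
      show (k.hom.toPreHom.fiber v).numEdges ≤ n
      omega
    rw [h1, hβ _ _ Y (by omega)]
    rcases Nat.lt_or_ge n X.gr.numEdges with h3 | h3
    · exact hβ' _ _ X (by omega) k hY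
    · rw [hβ _ _ X h3]
      exact hG.one k h3 hY

end NsModule

namespace NsModularOperad

open NsModule

variable {M : Type u} [Category.{v} M] [MonoidalCategory M] [SymmetricCategory M] {P : NsModule M}

theorem exists_good (O : NsModularOperad P) (n : ℕ) : ∃ α, Good O.ops α (n + 1) := by
  induction n with
  | zero =>
    obtain ⟨α, h⟩ := exists_evaluates O
    exact ⟨α, h.good_one⟩
  | succ n ih =>
    obtain ⟨α, h⟩ := ih
    exact h.exists_succ (by omega)

theorem exists_isContraction (O : NsModularOperad P) : ∃ α, O.IsContraction α := by
  choose α hα using exists_good O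
  refine ⟨fun S g X => α X.gr.numEdges S g X, isContraction_of_good fun n hn => ?_⟩
  refine (hα n).mono (Nat.le_succ n) |>.congr hn fun {S g} X hX => ?_
  exact ((hα X.gr.numEdges).mono (Nat.le_succ _)).unique ((hα n).mono (by omega)) X le_rfl

end NsModularOperad

namespace NsModule

variable {M : Type u} [Category.{v} M] [MonoidalCategory M] [SymmetricCategory M] {P : NsModule M}
  {α : P.ContractionFamily}

instance (P : NsModule M) (S : MultCyc) (g : ℕ) : IsIso (P.toCorolla S g) :=
  inferInstanceAs (IsIso (P.in₁ (corolla S g) () (fun _ => rfl) (corollaLeg S g) rfl))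

theorem StarUnit.comp_toCorolla (h : P.StarUnit α) (S : MultCyc) (g : ℕ) :
    α S g (star S g) ≫ P.toCorolla S g = 𝟙 _ := by
  rw [← cancel_epi (P.toCorolla S g), ← Category.assoc, h S g, Category.id_comp, Category.comp_id]

end NsModule

open NsModule

variable {M : Type u} [Category.{v} M] [MonoidalCategory M] [SymmetricCategory M] {P : NsModule M}
  {O : NsModularOperad P} {α : P.ContractionFamily}

/-- The functor on graphs given by the contractions of an operad. -/
theorem NsModularOperad.IsContraction.exists_extends (h : O.IsContraction α) (S : MultCyc) (g : ℕ) :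
    ∃ F : LGraph S g ⥤ M, P.Extends α F := by
  let F : LGraph S g ⥤ M :=
    { obj := fun X => P.onGraph X.gr
      map := fun f => P.vertexwise α f.hom
      map_id := fun X => ((h.good 0).iso (Iso.refl X.gr)).trans (P.onIso_refl X.gr)
      map_comp := fun {X Y Z} f k => (h.good X.gr.numEdges).comp f.hom k.hom (by omega) }
  refine ⟨F, fun _ => rfl, fun {X Y} f => ?_, fun {X Y} f => ?_, fun X => ?_⟩
  · rw [eqToHom_refl, eqToHom_refl, Category.id_comp, Category.comp_id]
    exact (h.good 0).iso (LGraph.isoGr f)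
  · rw [eqToHom_refl, eqToHom_refl, Category.id_comp, Category.comp_id]
  · rw [eqToHom_refl, eqToHom_refl, Category.id_comp, Category.comp_id]
    have h1 := (h.good X.gr.numEdges).factor ((isTerminalStar S g).from X) le_rfl
    rw [h1, Category.assoc]
    refine (Category.comp_id _).symm.trans (congrArg (fun z => _ ≫ z) ?_)
    exact (StarUnit.comp_toCorolla h.star S g).symm

namespace Graph

/-- The graph with vertices `ι`, with flags `S i` at the vertex `i`. -/
def ofFamily {ι : Type} [Finite ι] (S : ι → MultCyc) (g : ι → ℕ)
    (inv : Equiv.Perm (Σ i, (S i).pt)) (inv_inv : ∀ x, inv (inv x) = x)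
    (conn : ∀ i j, Relation.EqvGen (fun i j => ∃ x, x.1 = i ∧ (inv x).1 = j) i j) [Nonempty ι] :
    Graph where
  fl :=
    { pt := Σ i, (S i).pt
      emp := Σ i, (S i).emp
      succ := Equiv.sigmaCongrRight fun i => (S i).succ
      nonempty := by
        obtain ⟨i⟩ := ‹Nonempty ι›
        exact (S i).nonempty.map (Sum.map (Sigma.mk i) (Sigma.mk i)) }
  Vert := ι
  ptV := Sigma.fst
  empV := Sigma.fst
  ptV_succ _ := rfl
  surj i := by
    obtain ⟨x | x⟩ := (S i).nonempty
    exacts [⟨Sum.inl ⟨i, x⟩, rfl⟩, ⟨Sum.inr ⟨i, x⟩, rfl⟩]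
  genus := g
  inv := inv
  inv_inv := inv_inv
  conn := conn

/-- The flags at a vertex of `ofFamily`. -/
def ofFamilyLeg {ι : Type} [Finite ι] (S : ι → MultCyc) (g : ι → ℕ)
    (inv : Equiv.Perm (Σ i, (S i).pt)) (inv_inv conn) [Nonempty ι] (i : ι) :
    S i ⟶ (ofFamily S g inv inv_inv conn).legAt i where
  pt := (Equiv.sigmaSubtype (β := fun i => (S i).pt) i).symm
  emp := (Equiv.sigmaSubtype (β := fun i => (S i).emp) i).symm
  map_succ _ := rfl

theorem exists_twoEdges {ι : Type} [Finite ι] (S : ι → MultCyc) (g : ι → ℕ) {a b c d : Σ i, (S i).pt}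
    (hab : a ≠ b) (hac : a ≠ c) (had : a ≠ d) (hbc : b ≠ c) (hbd : b ≠ d) (hcd : c ≠ d)
    (conn : ∀ i, Relation.EqvGen (fun i j => (i = a.1 ∧ j = b.1) ∨ (i = c.1 ∧ j = d.1)) a.1 i) :
    ∃ (Γ : Graph) (v : ι → Γ.Vert) (ρ : ∀ i, S i ⟶ Γ.legAt (v i)), Function.Bijective v ∧
      (∀ i, g i = Γ.genus (v i)) ∧ Γ.TwoEdges ((ρ a.1).pt a.2).1 ((ρ b.1).pt b.2).1
        ((ρ c.1).pt c.2).1 ((ρ d.1).pt d.2).1 := by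
  classical
  have inv_a : (Equiv.swap a b * Equiv.swap c d) a = b := by
    rw [Equiv.Perm.mul_apply, Equiv.swap_apply_of_ne_of_ne hac had, Equiv.swap_apply_left]
  have inv_b : (Equiv.swap a b * Equiv.swap c d) b = a := by
    rw [Equiv.Perm.mul_apply, Equiv.swap_apply_of_ne_of_ne hbc hbd, Equiv.swap_apply_right]
  have inv_c : (Equiv.swap a b * Equiv.swap c d) c = d := by
    rw [Equiv.Perm.mul_apply, Equiv.swap_apply_left, Equiv.swap_apply_of_ne_of_ne had.symm hbd.symm]
  have inv_d : (Equiv.swap a b * Equiv.swap c d) d = c := by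
    rw [Equiv.Perm.mul_apply, Equiv.swap_apply_right,
      Equiv.swap_apply_of_ne_of_ne hac.symm hbc.symm]
  have inv_ne : ∀ z, z ≠ a → z ≠ b → z ≠ c → z ≠ d → (Equiv.swap a b * Equiv.swap c d) z = z :=
    fun z h1 h2 h3 h4 => by
      rw [Equiv.Perm.mul_apply, Equiv.swap_apply_of_ne_of_ne h3 h4,
        Equiv.swap_apply_of_ne_of_ne h1 h2]
  have conn' : ∀ i, Relation.EqvGen
      (fun i j => ∃ x, x.1 = i ∧ ((Equiv.swap a b * Equiv.swap c d) x).1 = j) a.1 i := fun i =>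
    Relation.EqvGen.mono (fun i j h => by
      rcases h with ⟨rfl, rfl⟩ | ⟨rfl, rfl⟩
      exacts [⟨a, rfl, by rw [inv_a]⟩, ⟨c, rfl, by rw [inv_c]⟩]) _ _ (conn i)
  have : Nonempty ι := ⟨a.1⟩
  refine ⟨ofFamily S g (Equiv.swap a b * Equiv.swap c d) (fun z => ?_) fun i j =>
    (conn' i).symm.trans _ _ _ (conn' j), id, fun i => ofFamilyLeg S g _ _ _ i,
    Function.bijective_id, fun _ => rfl, hab, hcd, hac, had, inv_a, inv_c, fun z hz => ?_⟩
  · by_cases h1 : z = a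
    · rw [h1, inv_a, inv_b]
    by_cases h2 : z = b
    · rw [h2, inv_b, inv_a]
    by_cases h3 : z = c
    · rw [h3, inv_c, inv_d]
    by_cases h4 : z = d
    · rw [h4, inv_d, inv_c]
    rw [inv_ne z h1 h2 h3 h4, inv_ne z h1 h2 h3 h4]
  · by_contra h
    simp only [not_or] at h
    exact hz (inv_ne z h.1 h.2.1 h.2.2.1 h.2.2.2)

end Graph

theorem LGraph.exists_contracts {S : MultCyc} {g : ℕ} (X : LGraph S g) {a b c d : X.gr.fl.pt}
    (h : X.gr.TwoEdges a b c d) : ∃ (Y : LGraph S g) (k : X ⟶ Y), Graph.Hom.Contracts k.hom c d := by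
  obtain ⟨Y, k, hk⟩ := X.exists_contraction (fun x => x = c ∨ x = d)
    (by
      rintro _ (rfl | rfl)
      exacts [Or.inr h.inv_c, Or.inl h.inv_d])
    (by
      rintro _ (rfl | rfl)
      exacts [fun e => h.cd (e.symm.trans h.inv_c), fun e => h.cd (h.inv_d.symm.trans e)])
  exact ⟨Y, k, fun x => by rw [hk, not_not]⟩

namespace NsModule

variable {M : Type u} [Category.{v} M] [MonoidalCategory M] [SymmetricCategory M] {P : NsModule M}

/-- The compatibility of `α` with all contractions. -/
def Factors (α : P.ContractionFamily) : Prop :=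
  ∀ {S : MultCyc} {g : ℕ} {X Y : LGraph S g} (f : X ⟶ Y),
    α S g X = P.vertexwise α f.hom ≫ α S g Y

variable {α : P.ContractionFamily} {R : Ops P}

theorem comp_mp_inv_eq {A B W : MultCyc} {g h m : ℕ} {Q : M} {p : Q ⟶ P.ob A g} {q : Q ⟶ P.ob B h}
    {φ : A ⟶ W} {ψ : B ⟶ W} {e : g = m} {e' : h = m} (H : p ≫ P.mp φ e = q ≫ P.mp ψ e') :
    p ≫ P.mp (φ ≫ MultCyc.inv ψ) (e.trans e'.symm) = q := by
  rw [← cancel_mono (P.mp ψ e'), Category.assoc, mp_comp, Category.assoc, MultCyc.inv_comp,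
    Category.comp_id, H]

theorem contr_contr_of_factors (hE : Evaluates R α) (hF : Factors α) {S : MultCyc} {a b c d : S.pt}
    (hab : a ≠ b) (hac : a ≠ c) (had : a ≠ d) (hbc : b ≠ c) (hbd : b ≠ d) (hcd : c ≠ d) (g : ℕ)
    (φ : cut (cut S c d) (cutPt a hac had) (cutPt b hbc hbd) ⟶
      cut (cut S a b) (cutPt c hac.symm hbc.symm) (cutPt d had.symm hbd.symm))
    (hφ : ∀ x, arcMap φ (cutArc _ _ (cutArc c d x)) = cutArc _ _ (cutArc a b x)) :
    R.contr c d hcd g ≫ R.contr _ _ (cutPt_ne hac had hbc hbd hab) (g + 1) ≫ P.mp φ rfl =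
      R.contr a b hab g ≫
        R.contr _ _ (cutPt_ne hac.symm hbc.symm had.symm hbd.symm hcd) (g + 1) := by
  have q : ∀ {x y : S.pt}, x ≠ y → (⟨(), x⟩ : Σ _ : Unit, S.pt) ≠ ⟨(), y⟩ := fun h e =>
    h (eq_of_heq (Sigma.mk.inj e).2)
  obtain ⟨Γ, v, ρ, hv, hg, hΓ⟩ := Graph.exists_twoEdges (fun _ : Unit => S) (fun _ => g)
    (q hab) (q hac) (q had) (q hbc) (q hbd) (q hcd) fun _ => .refl _
  obtain ⟨Y, k, hk⟩ := (LGraph.ofGraph Γ).exists_contracts hΓ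
  obtain ⟨Y', k', hk'⟩ := (LGraph.ofGraph Γ).exists_contracts hΓ.swap
  have hv' : ∀ w, w = v () := fun w => by
    obtain ⟨_, rfl⟩ := hv.2 w
    rfl
  obtain ⟨φ₁, e, A, H⟩ := hE.contr_contr (k := k) hv' (ρ ()) (hg ()) hab hac had hbc hbd hcd hΓ hk
  obtain ⟨φ₂, e', A', H'⟩ := hE.contr_contr (k := k') hv' (ρ ()) (hg ()) hcd hac.symm hbc.symm
    had.symm hbd.symm hab hΓ.swap hk'
  rw [← hF] at H H'
  have H₂ := H.symm.trans H'
  simp only [← Category.assoc] at H₂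
  have h1 := comp_mp_inv_eq H₂
  obtain rfl : φ = φ₁ ≫ MultCyc.inv φ₂ := hom_ext_cutArc fun x => by
    obtain ⟨x, rfl⟩ := (Gluing.canonical _ _).arc_surjective x
    exact (hφ x).trans (MultCyc.arcMap_comp_inv _ _ ((A x).trans (A' x).symm)).symm
  exact (Category.assoc _ _ _).symm.trans h1

section

variable {S T : MultCyc}

/-- The family consisting of `S` and `T`. -/
abbrev boolFamily (S T : MultCyc) : Bool → MultCyc := fun i => cond i T S

theorem boolFamily_ne {x : S.pt} {y : T.pt} :
    (⟨false, x⟩ : Σ i, (boolFamily S T i).pt) ≠ ⟨true, y⟩ := fun e => by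
  cases congrArg Sigma.fst e

theorem perm_of_bijective {ι : Type} [Finite ι] {v : Bool → ι} (hv : Function.Bijective v) :
    [v false, v true].Perm (ordering ι) :=
  perm_pair (hv.1.ne (by decide)) fun w => by
    obtain ⟨_ | _, rfl⟩ := hv.2 w
    exacts [Or.inl rfl, Or.inr rfl]

theorem contr_comp_of_factors (hE : Evaluates R α) (hF : Factors α) (a c : S.pt) (b d : T.pt)
    (hac : a ≠ c) (hbd : b ≠ d) (g h : ℕ)
    (φ : cut (merge S T c d) (mergeLeft a hac) (mergeRight b hbd) ⟶
      cut (merge S T a b) (mergeLeft c hac.symm) (mergeRight d hbd.symm))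
    (hφ : ∀ x, arcMap φ (cutArc _ _ (mergeArcLeft c d x)) = cutArc _ _ (mergeArcLeft a b x))
    (hφ' : ∀ x, arcMap φ (cutArc _ _ (mergeArcRight c d x)) = cutArc _ _ (mergeArcRight a b x)) :
    R.comp c d g h ≫ R.contr _ _ (mergeLeft_ne_mergeRight hac hbd) (g + h) ≫ P.mp φ rfl =
      R.comp a b g h ≫ R.contr _ _ (mergeLeft_ne_mergeRight hac.symm hbd.symm) (g + h) := by
  obtain ⟨Γ, v, ρ, hv, hg, hΓ⟩ := Graph.exists_twoEdges (boolFamily S T) (fun i => cond i h g)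
    (a := ⟨false, a⟩) (b := ⟨true, b⟩) (c := ⟨false, c⟩) (d := ⟨true, d⟩) boolFamily_ne
    (sigma_mk_injective.ne hac) boolFamily_ne boolFamily_ne.symm (sigma_mk_injective.ne hbd)
    boolFamily_ne (by
      rintro (_ | _)
      exacts [.refl _, .rel _ _ (Or.inl ⟨rfl, rfl⟩)])
  obtain ⟨Y, k, hk⟩ := (LGraph.ofGraph Γ).exists_contracts hΓ
  obtain ⟨Y', k', hk'⟩ := (LGraph.ofGraph Γ).exists_contracts hΓ.swap
  obtain ⟨φ₁, e, A, B, H⟩ := hE.contr_comp (S := S) (T := T) (k := k) (perm_of_bijective hv)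
    (ρ false) (ρ true) (hg false) (hg true) hac hbd hΓ hk
  obtain ⟨φ₂, e', A', B', H'⟩ := hE.contr_comp (S := S) (T := T) (k := k') (perm_of_bijective hv)
    (ρ false) (ρ true) (hg false) (hg true) hac.symm hbd.symm hΓ.swap hk'
  rw [← hF] at H H'
  have H₂ := H.symm.trans H'
  simp only [← Category.assoc] at H₂
  have h1 := comp_mp_inv_eq H₂
  obtain rfl : φ = φ₁ ≫ MultCyc.inv φ₂ := hom_ext_cutArc fun x => by
    obtain ⟨x, rfl⟩ := (Gluing.canonical _ _).arc_surjective x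
    rcases x with (x | x) | (x | x)
    · exact (hφ (Sum.inl x)).trans (MultCyc.arcMap_comp_inv _ _ ((A _).trans (A' _).symm)).symm
    · exact (hφ' (Sum.inl x)).trans (MultCyc.arcMap_comp_inv _ _ ((B _).trans (B' _).symm)).symm
    · exact (hφ (Sum.inr x)).trans (MultCyc.arcMap_comp_inv _ _ ((A _).trans (A' _).symm)).symm
    · exact (hφ' (Sum.inr x)).trans (MultCyc.arcMap_comp_inv _ _ ((B _).trans (B' _).symm)).symm
  exact (Category.assoc _ _ _).symm.trans h1

theorem comp_contr_of_factors (hE : Evaluates R α) (hF : Factors α) (a c d : S.pt) (b : T.pt)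
    (hac : a ≠ c) (had : a ≠ d) (hcd : c ≠ d) (g h : ℕ)
    (φ : merge (cut S c d) T (cutPt a hac had) b ⟶
      cut (merge S T a b) (mergeLeft c hac.symm) (mergeLeft d had.symm))
    (hφ : ∀ x, arcMap φ (mergeArcLeft _ _ (cutArc c d x)) = cutArc _ _ (mergeArcLeft a b x))
    (hφ' : ∀ x, arcMap φ (mergeArcRight _ _ x) = cutArc _ _ (mergeArcRight a b x)) :
    (R.contr c d hcd g ▷ P.ob T h) ≫ R.comp (cutPt a hac had) b (g + 1) h ≫
        P.mp φ (add_right_comm g 1 h) =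
      R.comp a b g h ≫ R.contr _ _ (mergeLeft_ne hac.symm had.symm hcd) (g + h) := by
  obtain ⟨Γ, v, ρ, hv, hg, hΓ⟩ := Graph.exists_twoEdges (boolFamily S T) (fun i => cond i h g)
    (a := ⟨false, a⟩) (b := ⟨true, b⟩) (c := ⟨false, c⟩) (d := ⟨false, d⟩) boolFamily_ne
    (sigma_mk_injective.ne hac) (sigma_mk_injective.ne had) boolFamily_ne.symm boolFamily_ne.symm
    (sigma_mk_injective.ne hcd) (by
      rintro (_ | _)
      exacts [.refl _, .rel _ _ (Or.inl ⟨rfl, rfl⟩)])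
  obtain ⟨Y, k, hk⟩ := (LGraph.ofGraph Γ).exists_contracts hΓ
  obtain ⟨Y', k', hk'⟩ := (LGraph.ofGraph Γ).exists_contracts hΓ.swap
  obtain ⟨φ₁, e, A, B, H⟩ := hE.comp_contr (S := S) (T := T) (k := k) (perm_of_bijective hv)
    (ρ false) (ρ true) (hg false) (hg true) hac had hcd hΓ hk
  obtain ⟨φ₂, e', A', B', H'⟩ := hE.contr_comp_loop (S := S) (T := T) (k := k')
    (perm_of_bijective hv) (ρ false) (ρ true) (hg false) (hg true) hac had hcd hΓ hk'
  rw [← hF] at H H'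
  have H₂ := H.symm.trans H'
  simp only [← Category.assoc] at H₂
  have h1 := comp_mp_inv_eq H₂
  obtain rfl : φ = φ₁ ≫ MultCyc.inv φ₂ := hom_ext_mergeArc (fun x => by
      obtain ⟨x, rfl⟩ := (Gluing.canonical _ _).arc_surjective x
      exact (hφ x).trans (MultCyc.arcMap_comp_inv _ _ ((A _).trans (A' _).symm)).symm) fun x =>
    (hφ' x).trans (MultCyc.arcMap_comp_inv _ _ ((B _).trans (B' _).symm)).symm
  exact (Category.assoc _ _ _).symm.trans h1

end

section

variable {S₁ S₂ S₃ : MultCyc}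

/-- The family consisting of `S₁`, `S₂` and `S₃`. -/
abbrev optionFamily (S₁ S₂ S₃ : MultCyc) : Option Bool → MultCyc
  | none => S₁
  | some false => S₂
  | some true => S₃

theorem comp_comp_of_factors (hE : Evaluates R α) (hF : Factors α) (a : S₁.pt) (b c : S₂.pt)
    (d : S₃.pt) (hbc : b ≠ c) (g₁ g₂ g₃ : ℕ)
    (φ : merge S₁ (merge S₂ S₃ c d) a (mergeLeft b hbc) ⟶
      merge (merge S₁ S₂ a b) S₃ (mergeRight c hbc.symm) d)
    (h₁ : ∀ x, arcMap φ (mergeArcLeft _ _ x) = mergeArcLeft _ _ (mergeArcLeft a b x))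
    (h₂ : ∀ x, arcMap φ (mergeArcRight _ _ (mergeArcLeft c d x)) =
      mergeArcLeft _ _ (mergeArcRight a b x))
    (h₃ : ∀ x, arcMap φ (mergeArcRight _ _ (mergeArcRight c d x)) = mergeArcRight _ _ x) :
    (P.ob S₁ g₁ ◁ R.comp c d g₂ g₃) ≫ R.comp a (mergeLeft b hbc) g₁ (g₂ + g₃) ≫
        P.mp φ (add_assoc g₁ g₂ g₃).symm =
      (α_ (P.ob S₁ g₁) (P.ob S₂ g₂) (P.ob S₃ g₃)).inv ≫ (R.comp a b g₁ g₂ ▷ P.ob S₃ g₃) ≫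
        R.comp (mergeRight c hbc.symm) d (g₁ + g₂) g₃ := by
  have ne : ∀ {i j} {x : (optionFamily S₁ S₂ S₃ i).pt} {y : (optionFamily S₁ S₂ S₃ j).pt}, i ≠ j →
      (⟨i, x⟩ : Σ i, (optionFamily S₁ S₂ S₃ i).pt) ≠ ⟨j, y⟩ := fun h e => h (congrArg Sigma.fst e)
  obtain ⟨Γ, v, ρ, hv, hg, hΓ⟩ := Graph.exists_twoEdges (optionFamily S₁ S₂ S₃)
    (fun | none => g₁ | some false => g₂ | some true => g₃)
    (a := ⟨none, a⟩) (b := ⟨some false, b⟩) (c := ⟨some false, c⟩) (d := ⟨some true, d⟩)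
    (ne (by decide)) (ne (by decide)) (ne (by decide)) (sigma_mk_injective.ne hbc)
    (ne (by decide)) (ne (by decide)) (by
      rintro (_ | _ | _)
      exacts [.refl _, .rel _ _ (Or.inl ⟨rfl, rfl⟩),
        .trans _ (some false) _ (.rel _ _ (Or.inl ⟨rfl, rfl⟩)) (.rel _ _ (Or.inr ⟨rfl, rfl⟩))])
  obtain ⟨Y, k, hk⟩ := (LGraph.ofGraph Γ).exists_contracts hΓ
  obtain ⟨Y', k', hk'⟩ := (LGraph.ofGraph Γ).exists_contracts hΓ.swap
  have hp : [v none, v (some false), v (some true)].Perm (ordering Γ.Vert) :=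
    perm_triple (hv.1.ne (by decide)) (hv.1.ne (by decide)) (hv.1.ne (by decide)) fun w => by
      obtain ⟨_ | _ | _, rfl⟩ := hv.2 w
      exacts [Or.inl rfl, Or.inr (Or.inl rfl), Or.inr (Or.inr rfl)]
  obtain ⟨φ₁, e, A, B, C, H⟩ := hE.comp_comp_right (S₁ := S₁) (S₂ := S₂) (S₃ := S₃) (k := k) hp
    (ρ none) (ρ (some false)) (ρ (some true)) (hg none) (hg (some false)) (hg (some true)) hbc hΓ hk
  obtain ⟨φ₂, e', A', B', C', H'⟩ := hE.comp_comp_left (S₁ := S₁) (S₂ := S₂) (S₃ := S₃) (k := k') hp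
    (ρ none) (ρ (some false)) (ρ (some true)) (hg none) (hg (some false)) (hg (some true)) hbc hΓ hk'
  rw [← hF] at H H'
  have H₂ := H.symm.trans H'
  simp only [← Category.assoc] at H₂
  have h1 := comp_mp_inv_eq H₂
  obtain rfl : φ = φ₁ ≫ MultCyc.inv φ₂ := hom_ext_mergeArc (fun x =>
      (h₁ x).trans (MultCyc.arcMap_comp_inv _ _ ((A _).trans (A' _).symm)).symm) fun x => by
    obtain ⟨x, rfl⟩ := (Gluing.canonical _ _).arc_surjective x
    rcases x with (x | x) | (x | x)
    · exact (h₂ (Sum.inl x)).trans (MultCyc.arcMap_comp_inv _ _ ((B _).trans (B' _).symm)).symm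
    · exact (h₃ (Sum.inl x)).trans (MultCyc.arcMap_comp_inv _ _ ((C _).trans (C' _).symm)).symm
    · exact (h₂ (Sum.inr x)).trans (MultCyc.arcMap_comp_inv _ _ ((B _).trans (B' _).symm)).symm
    · exact (h₃ (Sum.inr x)).trans (MultCyc.arcMap_comp_inv _ _ ((C _).trans (C' _).symm)).symm
  refine (Category.assoc _ _ _).symm.trans (h1.trans ?_)
  exact Category.assoc _ _ _

end

end NsModule

variable {M : Type u} [Category.{v} M] [MonoidalCategory M] [SymmetricCategory M] {P : NsModule M}
  {α : P.ContractionFamily}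

namespace NsModule

variable {R : Ops P}

namespace Evaluates

variable (hE : Evaluates R α) {S T S' T' : MultCyc}
include hE

theorem contr_natural (ρ : S ⟶ S') (u v : S.pt) (huv : u ≠ v) (g : ℕ)
    (φ : cut S u v ⟶ cut S' (ρ.pt u) (ρ.pt v))
    (hφ : ∀ x, arcMap φ (cutArc u v x) = cutArc _ _ (arcMap ρ x)) :
    R.contr u v huv g ≫ P.mp φ rfl =
      P.mp ρ rfl ≫ R.contr (ρ.pt u) (ρ.pt v) (ρ.pt.injective.ne huv) g := by
  have hne := ρ.pt.injective.ne huv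
  obtain ⟨φ₁, e, A, H⟩ := hE.loop (loopGraph _ _ hne g) () (fun _ => rfl) (corollaLeg S' g) rfl
    (ρ.pt u) (ρ.pt v) hne (loopGraph_onlyEdge _ _ hne g)
  obtain ⟨φ₂, e', A', H'⟩ := hE.loop (loopGraph _ _ hne g) () (fun _ => rfl)
    (ρ ≫ corollaLeg S' g) rfl u v huv (loopGraph_onlyEdge _ _ hne g)
  have h2 := P.in₁_comp (Γ := (loopGraph _ _ hne g).gr) (v := ()) (fun _ => rfl) ρ (corollaLeg S' g)
    rfl rfl
  have h3 : R.contr u v huv g ≫ P.mp φ₂ e' =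
      (P.mp ρ rfl ≫ R.contr (ρ.pt u) (ρ.pt v) hne g) ≫ P.mp φ₁ e := by
    refine H'.symm.trans ((congrArg (fun z => z ≫ α _ _ (loopGraph _ _ hne g)) h2).trans ?_)
    refine (Category.assoc _ _ _).trans (Eq.trans ?_ (Category.assoc _ _ _).symm)
    exact congrArg (fun z => P.mp ρ rfl ≫ z) H
  obtain rfl : φ = φ₂ ≫ MultCyc.inv φ₁ := hom_ext_cutArc fun x =>
    (hφ x).trans (MultCyc.arcMap_comp_inv _ _ ((A' _).trans (Eq.trans (congrArg _ (congrArg _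
      (MultCyc.arcMap_comp _ _ _))) (A _).symm))).symm
  exact comp_mp_inv_eq h3

theorem contr_symm (u v : S.pt) (huv : u ≠ v) (g : ℕ) (φ : cut S u v ⟶ cut S v u)
    (hφ : ∀ x, arcMap φ (cutArc u v x) = cutArc v u x) :
    R.contr u v huv g ≫ P.mp φ rfl = R.contr v u huv.symm g := by
  obtain ⟨φ₁, e, A, H⟩ := hE.loop (loopGraph u v huv g) () (fun _ => rfl) (corollaLeg S g) rfl
    u v huv (loopGraph_onlyEdge u v huv g)
  obtain ⟨φ₂, e', A', H'⟩ := hE.loop (loopGraph u v huv g) () (fun _ => rfl) (corollaLeg S g) rfl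
    v u huv.symm (loopGraph_onlyEdge u v huv g).symm
  obtain rfl : φ = φ₁ ≫ MultCyc.inv φ₂ := hom_ext_cutArc fun x =>
    (hφ x).trans (MultCyc.arcMap_comp_inv _ _ ((A _).trans (A' _).symm)).symm
  exact comp_mp_inv_eq (H.symm.trans H')

theorem comp_natural (ρ : S ⟶ S') (σ : T ⟶ T') (u : S.pt) (v : T.pt) (g h : ℕ)
    (φ : merge S T u v ⟶ merge S' T' (ρ.pt u) (σ.pt v))
    (hφ : ∀ x, arcMap φ (mergeArcLeft u v x) = mergeArcLeft _ _ (arcMap ρ x))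
    (hφ' : ∀ x, arcMap φ (mergeArcRight u v x) = mergeArcRight _ _ (arcMap σ x)) :
    R.comp u v g h ≫ P.mp φ rfl =
      (P.mp ρ rfl ⊗ₘ P.mp σ rfl) ≫ R.comp (ρ.pt u) (σ.pt v) g h := by
  obtain ⟨φ₁, e, A, B, H⟩ := hE.edge (edgeGraph (ρ.pt u) (σ.pt v) g h) _ _ perm_ordering_bool
    (edgeLegLeft _ _ g h) (edgeLegRight _ _ g h) rfl rfl _ _ (edgeGraph_onlyEdge _ _ g h)
  obtain ⟨φ₂, e', A', B', H'⟩ := hE.edge (edgeGraph (ρ.pt u) (σ.pt v) g h) _ _ perm_ordering_bool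
    (ρ ≫ edgeLegLeft _ _ g h) (σ ≫ edgeLegRight _ _ g h) rfl rfl u v (edgeGraph_onlyEdge _ _ g h)
  have h2 := P.in₂_comp (Γ := (edgeGraph (ρ.pt u) (σ.pt v) g h).gr) perm_ordering_bool ρ
    (edgeLegLeft _ _ g h) σ (edgeLegRight _ _ g h) rfl rfl rfl rfl
  have h3 : R.comp u v g h ≫ P.mp φ₂ e' =
      ((P.mp ρ rfl ⊗ₘ P.mp σ rfl) ≫ R.comp (ρ.pt u) (σ.pt v) g h) ≫ P.mp φ₁ e := by
    refine H'.symm.trans ((congrArg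
      (fun z => z ≫ α _ _ (edgeGraph (ρ.pt u) (σ.pt v) g h)) h2).trans ?_)
    refine (Category.assoc _ _ _).trans (Eq.trans ?_ (Category.assoc _ _ _).symm)
    exact congrArg (fun z => (P.mp ρ rfl ⊗ₘ P.mp σ rfl) ≫ z) H
  obtain rfl : φ = φ₂ ≫ MultCyc.inv φ₁ := hom_ext_mergeArc
    (fun x => (hφ x).trans (MultCyc.arcMap_comp_inv _ _ ((A' _).trans (Eq.trans (congrArg _
      (congrArg _ (MultCyc.arcMap_comp _ _ _))) (A _).symm))).symm)
    (fun x => (hφ' x).trans (MultCyc.arcMap_comp_inv _ _ ((B' _).trans (Eq.trans (congrArg _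
      (congrArg _ (MultCyc.arcMap_comp _ _ _))) (B _).symm))).symm)
  exact comp_mp_inv_eq h3

theorem comp_symm (u : S.pt) (v : T.pt) (g h : ℕ) (φ : merge S T u v ⟶ merge T S v u)
    (hφ : ∀ x, arcMap φ (mergeArcLeft u v x) = mergeArcRight v u x)
    (hφ' : ∀ x, arcMap φ (mergeArcRight u v x) = mergeArcLeft v u x) :
    R.comp u v g h ≫ P.mp φ (add_comm g h) =
      (β_ (P.ob S g) (P.ob T h)).hom ≫ R.comp v u h g := by
  have hp : [true, false].Perm (ordering (edgeGraph v u h g).gr.Vert) :=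
    (List.Perm.swap _ _ _).trans perm_ordering_bool
  obtain ⟨φ₁, e, A, B, H⟩ := hE.edge (edgeGraph v u h g) _ _ perm_ordering_bool
    (edgeLegLeft v u h g) (edgeLegRight v u h g) rfl rfl v u (edgeGraph_onlyEdge v u h g)
  obtain ⟨φ₂, e', A', B', H'⟩ := hE.edge (edgeGraph v u h g) _ _ hp
    (edgeLegRight v u h g) (edgeLegLeft v u h g) rfl rfl u v (edgeGraph_onlyEdge v u h g).symm
  have h2 := P.in₂_swap (Γ := (edgeGraph v u h g).gr) perm_ordering_bool hp
    (edgeLegLeft v u h g) (edgeLegRight v u h g) rfl rfl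
  have h3 : R.comp u v g h ≫ P.mp φ₂ e' =
      ((β_ (P.ob S g) (P.ob T h)).hom ≫ R.comp v u h g) ≫ P.mp φ₁ e := by
    refine H'.symm.trans ((congrArg (fun z => z ≫ α _ _ (edgeGraph v u h g)) h2).trans ?_)
    refine (Category.assoc _ _ _).trans (Eq.trans ?_ (Category.assoc _ _ _).symm)
    exact congrArg (fun z => (β_ (P.ob S g) (P.ob T h)).hom ≫ z) H
  obtain rfl : φ = φ₂ ≫ MultCyc.inv φ₁ := hom_ext_mergeArc
    (fun x => (hφ x).trans (MultCyc.arcMap_comp_inv _ _ ((A' _).trans (B _).symm)).symm)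
    (fun x => (hφ' x).trans (MultCyc.arcMap_comp_inv _ _ ((B' _).trans (A _).symm)).symm)
  exact comp_mp_inv_eq h3

end Evaluates

/-- The operad whose operations are given by the values of `α` on graphs with one edge. -/
def Evaluates.operad (hE : Evaluates R α) (hF : Factors α) : NsModularOperad P where
  comp := R.comp
  contr := R.contr
  contr_symm := hE.contr_symm
  comp_symm := hE.comp_symm
  comp_comp := comp_comp_of_factors hE hF
  contr_contr _ _ _ _ := contr_contr_of_factors hE hF
  contr_comp := contr_comp_of_factors hE hF
  comp_contr := comp_contr_of_factors hE hF
  comp_natural := hE.comp_natural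
  contr_natural := hE.contr_natural

theorem exists_operad (hs : P.StarUnit α) (hn : ∀ n, P.NaturalUpTo α n) (hF : Factors α) :
    ∃ O : NsModularOperad P, O.IsContraction α := by
  let R : Ops P :=
    { comp := fun {S T} u v g h => P.toEdge u v g h ≫ α (merge S T u v) (g + h) (edgeGraph u v g h)
      contr := fun {S} u v huv g =>
        P.toLoop u v huv g ≫ α (cut S u v) (g + 1) (loopGraph u v huv g) }
  have hE : Evaluates R α := evaluates_of_natural (hn 1) le_rfl hs R (fun _ _ _ _ => rfl)
    fun _ _ _ _ => rfl
  exact ⟨hE.operad hF, NsModularOperad.isContraction_of_good fun n _ =>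
    ⟨hE, hn n, fun f _ _ => hF f⟩⟩

/-- The properties of `α` that the functors on graphs of type `(S; g)` give. -/
structure Functorial (α : P.ContractionFamily) : Prop where
  iso : ∀ {S : MultCyc} {g : ℕ} {X Y : LGraph S g} (f : X ≅ Y),
    P.vertexwise α f.hom.hom = P.onIso (LGraph.isoGr f)
  comp : ∀ {S : MultCyc} {g : ℕ} {X Y Z : LGraph S g} (f : X ⟶ Y) (k : Y ⟶ Z),
    P.vertexwise α (f ≫ k).hom = P.vertexwise α f.hom ≫ P.vertexwise α k.hom
  star : ∀ {S : MultCyc} {g : ℕ} (X : LGraph S g),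
    P.vertexwise α ((isTerminalStar S g).from X).hom = α S g X ≫ P.toCorolla S g

namespace Functorial

variable (h : Functorial α)
include h

theorem starUnit : P.StarUnit α := fun S g => by
  have h1 := h.star (NsMod.star S g)
  rw [(isTerminalStar S g).hom_ext ((isTerminalStar S g).from (NsMod.star S g)) (𝟙 _)] at h1
  have h2 := h.iso (Iso.refl (NsMod.star S g))
  have h3 : α S g (NsMod.star S g) ≫ P.toCorolla S g = 𝟙 _ :=
    h1.symm.trans (h2.trans (P.onIso_refl _))
  rw [← cancel_mono (P.toCorolla S g), Category.assoc, h3, Category.id_comp, Category.comp_id]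

theorem factors : Factors α := fun {S g X Y} f => by
  rw [← cancel_mono (P.toCorolla S g), ← h.star, Category.assoc, ← h.star, ← h.comp]
  exact congrArg (fun k : X ⟶ NsMod.star S g => P.vertexwise α k.hom)
    ((isTerminalStar S g).hom_ext _ _)

theorem onIso_comp_eq {S : MultCyc} {g : ℕ} {X Y : LGraph S g} (F : X ≅ Y) :
    P.onIso (LGraph.isoGr F) ≫ α S g Y = α S g X := by
  rw [h.factors F.hom, h.iso]

theorem relabel {S T : MultCyc} {g : ℕ} (X : LGraph S g) (φ : S ⟶ T) :
    α T g (X.relabel φ) = α S g X ≫ P.mp φ rfl := by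
  have hl : ∀ {Y : LGraph S g} (k : X ⟶ Y) (a : X.gr.fl.Arc),
      (Y.relabel φ).gl.arc (k.hom.gl.arc a) = (X.relabel φ).gl.arc a := fun {Y} k a =>
    (Y.relabel_arc φ _).trans ((congrArg (arcMap φ) (k.label a)).trans (X.relabel_arc φ a).symm)
  let t : X.relabel φ ⟶ (NsMod.star S g).relabel φ :=
    ⟨((isTerminalStar S g).from X).hom, hl ((isTerminalStar S g).from X)⟩
  let K : corolla S g ≅ corolla T g := Graph.mkIso (Γ := corolla S g) (Δ := corolla T g) φ
    (Equiv.refl Unit) (fun _ => rfl) (fun _ => rfl) (fun _ => rfl)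
  have hK : ∀ a : S.Arc, K.hom.gl.arc a = arcMap φ a := fun a =>
    Graph.mkIso_arc (Γ := corolla S g) (Δ := corolla T g) _ _ _ _ _ a
  let k : (NsMod.star S g).relabel φ ≅ NsMod.star T g := LGraph.isoOfGr K fun a => by
    refine (star_arc T g _).trans ((hK a).trans (Eq.trans ?_
      ((NsMod.star S g).relabel_arc φ a).symm))
    exact congrArg (arcMap φ) (star_arc S g a).symm
  have h1 : P.toCorolla S g ≫ P.onIso K = P.mp φ rfl ≫ P.toCorolla T g := by
    refine (P.in₁_onIso K () (fun _ => rfl) (corollaLeg S g) rfl fun _ => rfl).trans ?_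
    have h2 : corollaLeg S g ≫ legAtIso K () = φ ≫ corollaLeg T g :=
      MultCyc.hom_ext_arc fun a => Graph.incl_injective _ _
        ((congrArg _ (MultCyc.arcMap_comp _ _ _)).trans
        ((incl_legAtIso K () _).trans (Eq.trans (by rcases a with a | a <;> rfl) (hK a)) |>.trans
          (by rcases a with a | a <;> rfl)))
    refine Eq.trans ?_ (P.in₁_comp (Γ := corolla T g) (v := ()) (fun _ => rfl) φ (corollaLeg T g)
      rfl rfl)
    exact congrArg (fun z => P.in₁ (corolla T g) () (fun _ => rfl) z rfl) h2
  have h3 := h.factors t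
  have h4 := h.onIso_comp_eq k
  have h5 : P.toCorolla S g ≫ α T g ((NsMod.star S g).relabel φ) = P.mp φ rfl := by
    refine (congrArg (fun z => P.toCorolla S g ≫ z) h4.symm).trans ?_
    refine (Category.assoc _ _ _).symm.trans ?_
    refine (congrArg (fun z => z ≫ α T g (NsMod.star T g)) h1).trans ?_
    rw [Category.assoc, h.starUnit, Category.comp_id]
  refine h3.trans ((congrArg (fun z => z ≫ α T g ((NsMod.star S g).relabel φ)) (h.star X)).trans ?_)
  exact (Category.assoc _ _ _).trans (congrArg (fun z => α S g X ≫ z) h5)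

theorem natural (n : ℕ) : P.NaturalUpTo α n := by
  intro S T g h' X Y F φ e _ hφ
  subst e
  exact (h.onIso_comp_eq (LGraph.isoOfGr (X := X.relabel φ) F fun a =>
    (hφ a).symm.trans (X.relabel_arc φ a).symm)).trans (h.relabel X φ)

theorem exists_operad : ∃ O : NsModularOperad P, O.IsContraction α :=
  NsModule.exists_operad h.starUnit h.natural h.factors

end Functorial

theorem functorial_of_extends
    (hF : ∀ (S : MultCyc) (g : ℕ), Geometric S g → ∃ F : LGraph S g ⥤ M, P.Extends α F)
    (h0 : ∀ {S : MultCyc} {g : ℕ} (_ : ¬ Geometric S g) (X : LGraph S g) {Z : M}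
      (f f' : P.onGraph X.gr ⟶ Z), f = f') : Functorial α where
  iso {S g X Y} f := by
    by_cases hS : Geometric S g
    · obtain ⟨F, hF⟩ := hF S g hS
      have h1 := (hF.map f.hom).symm.trans (hF.map_iso f)
      rwa [cancel_epi, cancel_mono] at h1
    · exact h0 hS X _ _
  comp {S g X Y Z} f k := by
    by_cases hS : Geometric S g
    · obtain ⟨F, hF⟩ := hF S g hS
      have h1 := F.map_comp f k
      rw [hF.map, hF.map, hF.map] at h1
      simp only [Category.assoc, eqToHom_trans_assoc, eqToHom_refl, Category.id_comp] at h1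
      rw [cancel_epi, ← Category.assoc, cancel_mono] at h1
      exact h1
    · exact h0 hS X _ _
  star {S g} X := by
    by_cases hS : Geometric S g
    · obtain ⟨F, hF⟩ := hF S g hS
      have h1 := (hF.map _).symm.trans (hF.map_star X)
      rw [cancel_epi, ← Category.assoc, cancel_mono] at h1
      exact h1
    · exact h0 hS X _ _

end NsModule

/-! ### The number of components -/

section Cycles

open Equiv.Perm

variable {α β : Type} [Finite α] [Finite β]

/-- The cycles of a permutation, including the fixed points. -/
abbrev Cycles (σ : Equiv.Perm α) : Type := Quotient (SameCycle.setoid σ)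

theorem eq_of_sameCycle {γ : Type} {σ : Equiv.Perm α} (F : α → γ) (h : ∀ x, F (σ x) = F x)
    {x y : α} (hxy : σ.SameCycle x y) : F x = F y := by
  obtain ⟨n, rfl⟩ := hxy.exists_nat_pow_eq
  clear hxy
  induction n with
  | zero => rfl
  | succ n ih => rw [ih, pow_succ', mul_apply, h]

theorem sameCycle_of_map {σ : Equiv.Perm α} {τ : Equiv.Perm β} (f : α → β)
    (h : ∀ x, τ.SameCycle (f x) (f (σ x))) {x y : α} (hxy : σ.SameCycle x y) :
    τ.SameCycle (f x) (f y) :=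
  Quotient.exact (eq_of_sameCycle (fun x => (Quotient.mk (SameCycle.setoid τ) (f x)))
    (fun x => (Quotient.sound (h x)).symm) hxy)

theorem sameCycle_apply_self (σ : Equiv.Perm α) (x : α) : σ.SameCycle x (σ x) := ⟨1, rfl⟩

section Swap

variable [DecidableEq α] {σ : Equiv.Perm α} {u v : α}

theorem mul_swap_of_ne {x : α} (hu : x ≠ u) (hv : x ≠ v) : (σ * Equiv.swap u v) x = σ x := by
  rw [mul_apply, Equiv.swap_apply_of_ne_of_ne hu hv]

theorem mul_swap_left : (σ * Equiv.swap u v) u = σ v := by rw [mul_apply, Equiv.swap_apply_left]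

theorem mul_swap_right : (σ * Equiv.swap u v) v = σ u := by rw [mul_apply, Equiv.swap_apply_right]

theorem sameCycle_mul_swap (h : ¬ σ.SameCycle u v) : (σ * Equiv.swap u v).SameCycle u v := by
  classical
  have hex : ∃ n, 0 < n ∧ (σ ^ n) u = u :=
    ⟨orderOf σ, orderOf_pos σ, by rw [pow_orderOf_eq_one]; rfl⟩
  obtain ⟨hpos, hn⟩ := Nat.find_spec hex
  have key : ∀ j, 0 < j → j ≤ Nat.find hex → (σ * Equiv.swap u v).SameCycle v ((σ ^ j) u) := by
    intro j
    induction j with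
    | zero => exact fun h => absurd h (lt_irrefl _)
    | succ j ih =>
      intro _ hj
      rw [pow_succ', mul_apply]
      rcases Nat.eq_zero_or_pos j with rfl | hj0
      · exact ⟨1, mul_swap_right⟩
      · refine (ih hj0 (by omega)).trans ?_
        refine ⟨1, ?_⟩
        rw [zpow_one, mul_swap_of_ne (fun e => Nat.find_min hex hj ⟨hj0, e⟩)
          fun e => h ⟨j, by rw [zpow_natCast, e]⟩]
  have h1 := key _ hpos le_rfl
  rw [hn] at h1
  exact h1.symm

theorem not_sameCycle_mul_swap (huv : u ≠ v) (h : σ.SameCycle u v) :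
    ¬ (σ * Equiv.swap u v).SameCycle u v := by
  classical
  have hex := h.exists_nat_pow_eq
  have hk := Nat.find_spec hex
  have hmin : ∀ j < Nat.find hex, (σ ^ j) u ≠ v := fun j hj => Nat.find_min hex hj
  have hne : ∀ j, 0 < j → j ≤ Nat.find hex → (σ ^ j) u ≠ u := fun j h0 hj e => by
    refine hmin (Nat.find hex - j) (by omega) ?_
    have h1 := congrArg (σ ^ (Nat.find hex - j)) e
    rw [← mul_apply, ← pow_add, Nat.sub_add_cancel hj, hk] at h1
    exact h1.symm
  have hpos : 0 < Nat.find hex := by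
    rcases Nat.eq_zero_or_pos (Nat.find hex) with h0 | h0
    · rw [h0] at hk
      exact (huv hk).elim
    · exact h0
  intro h'
  let C : α → Prop := fun x => ∃ j, 0 < j ∧ j ≤ Nat.find hex ∧ (σ ^ j) u = x
  obtain ⟨n, hn⟩ := h'.symm.exists_nat_pow_eq
  have hC : ∀ n, C (((σ * Equiv.swap u v) ^ n) v) := by
    intro n
    induction n with
    | zero => exact ⟨_, hpos, le_rfl, hk⟩
    | succ n ih =>
      obtain ⟨j, h0, hj, e⟩ := ih
      rw [pow_succ', mul_apply, ← e]
      rcases hj.lt_or_eq with hlt | heq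
      · refine ⟨j + 1, by omega, hlt, ?_⟩
        rw [mul_swap_of_ne (hne j h0 hj) (hmin j hlt), pow_succ', mul_apply]
      · refine ⟨1, one_pos, hpos, ?_⟩
        rw [heq, hk, mul_swap_right, pow_one]
  obtain ⟨j, h0, hj, e⟩ := hC n
  exact hne j h0 hj (e.trans hn)

theorem card_cycles_mul_swap (h : ¬ σ.SameCycle u v) :
    Nat.card (Cycles (σ * Equiv.swap u v)) + 1 = Nat.card (Cycles σ) := by
  classical
  have huv := sameCycle_mul_swap h
  have hle : ∀ {x y}, σ.SameCycle x y → (σ * Equiv.swap u v).SameCycle x y := by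
    refine sameCycle_of_map id fun x => ?_
    by_cases hu : x = u
    · subst hu
      exact huv.trans ⟨1, mul_swap_right⟩
    · by_cases hv : x = v
      · subst hv
        exact huv.symm.trans ⟨1, mul_swap_left⟩
      · exact ⟨1, mul_swap_of_ne hu hv⟩
  let F : α → Cycles σ := fun x => if σ.SameCycle x v then Quotient.mk _ u else Quotient.mk _ x
  have hFu : F u = Quotient.mk _ u := if_neg h
  have hFv : F v = Quotient.mk _ u := if_pos (SameCycle.refl σ v)
  have hFσ : ∀ x, F (σ x) = F x := fun x => by
    show ite _ _ _ = ite _ _ _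
    rw [sameCycle_apply_left]
    congr 1
    exact Quotient.sound (sameCycle_apply_self σ x).symm
  have hF : ∀ x, F ((σ * Equiv.swap u v) x) = F x := fun x => by
    by_cases hu : x = u
    · rw [hu, mul_swap_left, hFσ, hFu, hFv]
    · by_cases hv : x = v
      · rw [hv, mul_swap_right, hFσ, hFu, hFv]
      · rw [mul_swap_of_ne hu hv, hFσ]
  let i : {q : Cycles σ // q ≠ Quotient.mk _ v} → Cycles (σ * Equiv.swap u v) :=
    fun q => Quotient.map' (s₁ := SameCycle.setoid σ) (s₂ := SameCycle.setoid _) id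
      (fun _ _ => hle) q.1
  have hi : Function.Bijective i := by
    constructor
    · rintro ⟨⟨x⟩, hx⟩ ⟨⟨y⟩, hy⟩ hxy
      have h1 := eq_of_sameCycle F hF (Quotient.exact hxy)
      have hx' : F x = Quotient.mk _ x := if_neg fun h => hx (Quotient.sound h)
      have hy' : F y = Quotient.mk _ y := if_neg fun h => hy (Quotient.sound h)
      exact Subtype.ext (hx'.symm.trans (h1.trans hy'))
    · rintro ⟨x⟩
      by_cases hx : σ.SameCycle x v
      · exact ⟨⟨Quotient.mk _ u, fun e => h (Quotient.exact e)⟩,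
          Quotient.sound (huv.trans (hle hx.symm))⟩
      · exact ⟨⟨Quotient.mk _ x, fun e => hx (Quotient.exact e)⟩, rfl⟩
  rw [← Nat.card_congr (Equiv.ofBijective i hi)]
  have h2 := Nat.card_congr (Equiv.optionSubtypeNe (Quotient.mk (SameCycle.setoid σ) v))
  rw [← h2, Finite.card_option]

theorem card_cycles_mul_swap_of_sameCycle (huv : u ≠ v) (h : σ.SameCycle u v) :
    Nat.card (Cycles (σ * Equiv.swap u v)) = Nat.card (Cycles σ) + 1 := by
  have h1 := card_cycles_mul_swap (not_sameCycle_mul_swap huv h)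
  rw [mul_assoc, Equiv.swap_mul_self, mul_one] at h1
  exact h1.symm

end Swap

theorem card_cycles_sumCongr (σ : Equiv.Perm α) (τ : Equiv.Perm β) :
    Nat.card (Cycles (Equiv.sumCongr σ τ)) = Nat.card (Cycles σ) + Nat.card (Cycles τ) := by
  rw [← Nat.card_sum]
  let F : α ⊕ β → Cycles σ ⊕ Cycles τ := Sum.map (Quotient.mk _) (Quotient.mk _)
  have hF : ∀ x, F (Equiv.sumCongr σ τ x) = F x := by
    rintro (x | x)
    · exact congrArg Sum.inl (Quotient.sound (sameCycle_apply_self σ x).symm)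
    · exact congrArg Sum.inr (Quotient.sound (sameCycle_apply_self τ x).symm)
  refine Nat.card_congr
    { toFun := Quotient.lift F fun x y h => eq_of_sameCycle F hF h
      invFun := Sum.elim
        (Quotient.map' (s₁ := SameCycle.setoid σ) (s₂ := SameCycle.setoid _) Sum.inl
          fun _ _ => sameCycle_of_map Sum.inl fun x =>
            sameCycle_apply_self (Equiv.sumCongr σ τ) (Sum.inl x))
        (Quotient.map' (s₁ := SameCycle.setoid τ) (s₂ := SameCycle.setoid _) Sum.inr
          fun _ _ => sameCycle_of_map Sum.inr fun x =>
            sameCycle_apply_self (Equiv.sumCongr σ τ) (Sum.inr x))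
      left_inv := by rintro ⟨x | x⟩ <;> rfl
      right_inv := by rintro (⟨⟨x⟩⟩ | ⟨⟨x⟩⟩) <;> rfl }

theorem sameCycle_firstReturn_iff (φ : Equiv.Perm α) (p : α → Prop) (x y : {x // p x}) :
    (firstReturn φ p).SameCycle x y ↔ φ.SameCycle x.1 y.1 := by
  classical
  have hr : ∀ x : {x // p x}, ((firstReturn φ p x).1 : α) =
      (φ ^ (Nat.find (exists_return φ p x) + 1)) x.1 := fun x => by
    rw [pow_succ, mul_apply]
    rfl
  constructor
  · refine sameCycle_of_map Subtype.val fun x => ?_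
    rw [hr]
    exact ⟨((Nat.find (exists_return φ p x) + 1 : ℕ) : ℤ), rfl⟩
  · intro h
    obtain ⟨n, hn⟩ := h.exists_nat_pow_eq
    clear h
    induction n using Nat.strong_induction_on generalizing x with | _ n ih => ?_
    rcases n with _ | n
    · exact (show x = y from Subtype.ext hn) ▸ SameCycle.refl _ _
    · rw [pow_succ, mul_apply] at hn
      have hle := Nat.find_min' (exists_return φ p x) (m := n) (by rw [hn]; exact y.2)
      refine (sameCycle_apply_self (firstReturn φ p) x).trans
        (ih (n - Nat.find (exists_return φ p x)) (by omega) _ ?_)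
      rw [hr, ← mul_apply, ← pow_add, ← hn, ← mul_apply, ← pow_succ]
      congr 2
      omega

theorem card_cycles_firstReturn (φ : Equiv.Perm α) (p : α → Prop) :
    Nat.card (Cycles (firstReturn φ p)) +
      Nat.card {c : Cycles φ // ∀ x, Quotient.mk _ x = c → ¬ p x} = Nat.card (Cycles φ) := by
  rw [← Nat.card_sum]
  refine Nat.card_congr (Equiv.ofBijective (Sum.elim
    (Quotient.map' (s₁ := SameCycle.setoid (firstReturn φ p)) (s₂ := SameCycle.setoid φ)
      Subtype.val fun x y => (sameCycle_firstReturn_iff φ p x y).1) Subtype.val) ⟨?_, ?_⟩)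
  · rintro (⟨⟨x⟩⟩ | c) (⟨⟨y⟩⟩ | c') h
    · exact congrArg Sum.inl (Quotient.sound ((sameCycle_firstReturn_iff φ p x y).2
        (Quotient.exact h)))
    · exact absurd x.2 (c'.2 _ h)
    · exact absurd y.2 (c.2 _ h.symm)
    · exact congrArg Sum.inr (Subtype.ext h)
  · rintro c
    by_cases h : ∀ x, Quotient.mk _ x = c → ¬ p x
    · exact ⟨Sum.inr ⟨c, h⟩, rfl⟩
    · push Not at h
      obtain ⟨x, rfl, hx⟩ := h
      exact ⟨Sum.inl (Quotient.mk _ ⟨x, hx⟩), rfl⟩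

end Cycles

theorem MultCyc.b_eq {S T : MultCyc} (f : S ⟶ T) : S.b = T.b := by
  have hf : ∀ x, f.pt (S.succ x) = T.succ (f.pt x) := f.map_succ
  have hf' : ∀ y, f.pt.symm (T.succ y) = S.succ (f.pt.symm y) := fun y => by
    rw [Equiv.symm_apply_eq, hf, Equiv.apply_symm_apply]
  refine congrArg₂ (· + ·) (Nat.card_congr ?_) (Nat.card_congr f.emp)
  exact
    { toFun := Quotient.map' (s₁ := Equiv.Perm.SameCycle.setoid _)
        (s₂ := Equiv.Perm.SameCycle.setoid _) f.pt fun _ _ => sameCycle_of_map f.pt fun x => by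
          rw [hf]; exact sameCycle_apply_self _ _
      invFun := Quotient.map' (s₁ := Equiv.Perm.SameCycle.setoid _)
        (s₂ := Equiv.Perm.SameCycle.setoid _) f.pt.symm fun _ _ =>
          sameCycle_of_map f.pt.symm fun x => by
            rw [hf']; exact sameCycle_apply_self _ _
      left_inv := by
        rintro ⟨x⟩
        exact congrArg (Quotient.mk _) (f.pt.symm_apply_apply x)
      right_inv := by
        rintro ⟨x⟩
        exact congrArg (Quotient.mk _) (f.pt.apply_symm_apply x) }

theorem glue_b (S : MultCyc) (τ : Equiv.Perm S.pt) :
    (glue S τ).b = Nat.card (Cycles (S.succ * τ)) + Nat.card S.emp := by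
  have h := card_cycles_firstReturn (S.succ * τ) fun x => τ x = x
  show Nat.card (Cycles (firstReturn (S.succ * τ) fun x => τ x = x)) + Nat.card (S.emp ⊕
    {c : Cycles (S.succ * τ) // ∀ x, Quotient.mk _ x = c → ¬ τ x = x}) = _
  rw [Nat.card_sum]
  omega

theorem merge_b {S T : MultCyc} (u : S.pt) (v : T.pt) : (merge S T u v).b + 1 = S.b + T.b := by
  classical
  let σ : Equiv.Perm (S.pt ⊕ T.pt) := Equiv.sumCongr S.succ T.succ
  have h : ¬ σ.SameCycle (Sum.inl u) (Sum.inr v) := fun h => by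
    have h1 := eq_of_sameCycle Sum.isLeft (by rintro (x | x) <;> rfl) h
    cases h1
  have h1 := card_cycles_mul_swap h
  have h2 : (merge S T u v).b = Nat.card (Cycles (σ * Equiv.swap (Sum.inl u) (Sum.inr v))) +
      Nat.card (S.emp ⊕ T.emp) := by
    convert glue_b (S.sum T) (Equiv.swap (Sum.inl u) (Sum.inr v))
  have h3 : Nat.card (Cycles σ) = _ := card_cycles_sumCongr S.succ T.succ
  rw [h2, Nat.card_sum]
  show _ = Nat.card (Cycles S.succ) + _ + (Nat.card (Cycles T.succ) + _)
  omega

theorem cut_b {S : MultCyc} {u v : S.pt} (huv : u ≠ v) :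
    (cut S u v).b + 1 = S.b ∨ (cut S u v).b = S.b + 1 := by
  classical
  have h2 : (cut S u v).b = Nat.card (Cycles (S.succ * Equiv.swap u v)) + Nat.card S.emp := by
    convert glue_b S (Equiv.swap u v)
  have h3 : S.b = Nat.card (Cycles S.succ) + Nat.card S.emp := rfl
  by_cases h : S.succ.SameCycle u v
  · have := card_cycles_mul_swap_of_sameCycle huv h
    omega
  · have := card_cycles_mul_swap h
    omega

namespace Geometric

theorem of_hom {S T : MultCyc} {g : ℕ} (hS : Geometric S g) (f : S ⟶ T) : Geometric T g := by
  obtain ⟨G, h⟩ := hS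
  exact ⟨G, by rw [h, MultCyc.b_eq f]⟩

theorem merge {S T : MultCyc} {g h : ℕ} (hS : Geometric S g) (hT : Geometric T h) (u : S.pt)
    (v : T.pt) : Geometric (merge S T u v) (g + h) := by
  obtain ⟨G, hG⟩ := hS
  obtain ⟨H, hH⟩ := hT
  have := merge_b u v
  exact ⟨G + H, by omega⟩

theorem cut {S : MultCyc} {g : ℕ} (hS : Geometric S g) {u v : S.pt} (huv : u ≠ v) :
    Geometric (cut S u v) (g + 1) := by
  obtain ⟨G, hG⟩ := hS
  rcases cut_b huv with h | h
  exacts [⟨G + 1, by omega⟩, ⟨G, by omega⟩]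

end Geometric

variable {M : Type u} [Category.{v} M] [MonoidalCategory M] [SymmetricCategory M]

theorem LGraph.geometric (P : NsModule M) {S : MultCyc} {g : ℕ} (X : LGraph S g)
    (h : ∀ v, Geometric (X.gr.legAt v) (X.gr.genus v)) : Geometric S g := by
  generalize hl : X.gr.numEdges = l
  induction l using Nat.strong_induction_on generalizing S g X with | _ l ih => ?_
  rcases Nat.lt_or_ge 1 l with h1 | h1
  · obtain ⟨x, hx⟩ := Graph.exists_edge (Γ := X.gr) (by omega)
    obtain ⟨Y, q, hY, -⟩ := X.exists_oneEdge hx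
    refine ih 1 h1 Y (fun v => ?_) hY
    have h3 := Graph.numEdges_fiber_add_le q.hom.toPreHom v
    exact ih (q.hom.toPreHom.fiber v).numEdges (by omega) (LGraph.fiber q.hom v)
      (fun w => (h w.1).of_hom (fiberLeg q.hom v w)) rfl
  · rcases Nat.le_one_iff_eq_zero_or_eq_one.1 h1 with rfl | rfl
    · obtain ⟨v⟩ : Nonempty X.gr.Vert := X.gr.fl.nonempty.map X.gr.arcV
      obtain ⟨φ, e, -⟩ := NsModule.exists_starLabel X v hl
        (fun w => Graph.eq_of_numEdges_eq_zero hl w v) (𝟙 _) rfl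
      exact e ▸ (h v).of_hom φ
    · obtain ⟨x, y, hxy⟩ := Graph.exists_onlyEdge hl
      by_cases hv : X.gr.ptV x = X.gr.ptV y
      · have hne : (⟨x, rfl⟩ : (X.gr.legAt (X.gr.ptV x)).pt) ≠ ⟨y, hv.symm⟩ :=
          fun e => hxy.1 (congrArg Subtype.val e)
        obtain ⟨φ, e, -⟩ := NsModule.exists_loopLabel X _ P (hxy.eq_vert hv) (𝟙 _) rfl ⟨x, rfl⟩
          ⟨y, hv.symm⟩ hne hxy
        exact e ▸ ((h _).cut hne).of_hom φ
      · obtain ⟨φ, e, -⟩ := NsModule.exists_edgeLabel X _ _ P (hxy.perm hv) (𝟙 _) (𝟙 _) rfl rfl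
          ⟨x, rfl⟩ ⟨y, rfl⟩ hxy
        exact e ▸ ((h _).merge (h _) (⟨x, rfl⟩ : (X.gr.legAt (X.gr.ptV x)).pt)
          (⟨y, rfl⟩ : (X.gr.legAt (X.gr.ptV y)).pt)).of_hom φ

variable [∀ X : M, PreservesColimit (Functor.empty.{0} M) (tensorLeft X)]

/-- A tensor product is initial if one of its factors is. -/
theorem isInitial_listTensor {ι : Type} {X : ι → M} {i : ι} (hi : Nonempty (IsInitial (X i)))
    {l : List ι} (h : i ∈ l) : Nonempty (IsInitial (listTensor X l)) := by
  induction l with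
  | nil => cases h
  | cons j l ih =>
    rcases List.mem_cons.1 h with rfl | h
    · obtain ⟨hi⟩ := hi
      have h1 : IsInitial (listTensor X l ⊗ X i) :=
        hi.isInitialObj (tensorLeft (listTensor X l)) (X i)
      exact ⟨h1.ofIso (β_ (listTensor X l) (X i))⟩
    · obtain ⟨h1⟩ := ih h
      exact ⟨h1.isInitialObj (tensorLeft (X j)) (listTensor X l)⟩

theorem NsModule.isInitial_onGraph [HasInitial M] {P : NsModule M} (hP : P.IsGeometric)
    {S : MultCyc} {g : ℕ} (hS : ¬ Geometric S g) (X : LGraph S g) :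
    Nonempty (IsInitial (P.onGraph X.gr)) := by
  by_contra h
  refine hS (X.geometric P fun v => ?_)
  by_contra hv
  obtain ⟨e⟩ := hP _ _ hv
  exact h (isInitial_listTensor (X := P.factor X.gr) ⟨initialIsInitial.ofIso e.symm⟩
    (mem_ordering v))

end NsMod

/-- Let `P` be a geometric non-Σ modular module. Every structure of a non-Σ modular operad on `P`
has exactly one family of contractions `α_Γ : P(Γ) ⟶ P((S; g))` along non-Σ modular graphs, and a
family `α` is the family of contractions of a structure of a non-Σ modular operad on `P` if and only
if, for each geometric `(S, g)`, the assignment `Γ ↦ P(Γ)` extends, by means of `α`, to a functor on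
the category of non-Σ modular graphs of type `(S; g)`. -/
theorem mainTheorem5 {M : Type u} [CategoryTheory.Category.{v} M]
    [CategoryTheory.MonoidalCategory M] [CategoryTheory.SymmetricCategory M]
    [CategoryTheory.Limits.HasInitial M]
    [∀ X : M, CategoryTheory.Limits.PreservesColimit (CategoryTheory.Functor.empty.{0} M)
      (CategoryTheory.MonoidalCategory.tensorLeft X)]
    (P : NsMod.NsModule M) (hP : P.IsGeometric) :
    (∀ O : NsMod.NsModularOperad P, ∃! α : P.ContractionFamily, O.IsContraction α) ∧
    (∀ α : P.ContractionFamily, (∃ O : NsMod.NsModularOperad P, O.IsContraction α) ↔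
      ∀ (S : NsMod.MultCyc) (g : ℕ), NsMod.Geometric S g →
        ∃ F : CategoryTheory.Functor (NsMod.LGraph S g) M, P.Extends α F) := by
  refine ⟨fun O => ?_, fun α => ⟨fun ⟨_, hO⟩ S g _ => hO.exists_extends S g, fun h => ?_⟩⟩
  · obtain ⟨α, hα⟩ := O.exists_isContraction
    exact ⟨α, hα, fun _ hβ => hβ.unique hα⟩
  · exact (NsMod.NsModule.functorial_of_extends h fun hS X _ f f' =>
      (NsMod.NsModule.isInitial_onGraph hP hS X).some.hom_ext f f').exists_operad
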